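/- Let $\epsilon\in\{\pm1\}$ and $e(x)=e^{2\pi i x}$. **Setting.** Let $\widetilde{SL}_2(\mathbb R)=SL_2(\mathbb R)\times\{\pm1\}$ with product $(g_1,\kappa_1)(g_2,\kappa_2)=(g_1g_2,\alpha(g_1,g_2)\kappa_1\kappa_2)$, where $\alpha(g_1,g_2)=\left(\frac{X(g_1g_2)}{X(g_1)},\frac{X(g_1g_2)}{X(g_2)}\right)_H$, $X\begin{pmatrix}a&b\\c&d\end{pmatrix}=c$ if $c\ne0$ and $=d$ if $c=0$, and $(x,y)_H=-1$ if $x,y<0$, $=1$ otherwise. Put $\tilde n_x=(\begin{pmatrix}1&x\\0&1\end{pmatrix},1)$, $\tilde n_{-,x}=(\begin{pmatrix}1&0\\x&1\end{pmatrix},1)$, $\tilde a_u=(\begin{pmatrix}u&0\\0&u^{-1}\end{pmatrix},1)$ for $u>0$, $\tilde m_{\epsilon_1,\epsilon_2}=(\epsilon_1 I,\epsilon_2)$ and $\tilde s=(\begin{pmatrix}0&-1\\1&0\end{pmatrix},1)$. Let $\sigma_\epsilon(I,\pm1)=\pm1$, $\sigma_\epsilon(-I,\pm1)=\mp\epsilon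 i$ and $\omega_{\epsilon,\nu}(\tilde m\tilde a_u\tilde n_{-,y})=\sigma_\epsilon(\tilde m)u^{\nu-1}$. For $\nu\in\mathbb C$, $V^\infty_{\epsilon,\nu}$ is the space of smooth functions $f$ on $\widetilde{SL}_2(\mathbb R)$ with $f(\tilde g\tilde b)=\omega_{\epsilon,\nu}(\tilde b)^{-1}f(\tilde g)$ for all $\tilde b=\tilde m\tilde a_u\tilde n_{-,y}$, with its $C^\infty$ topology, and $V^{-\infty}_{\epsilon,\nu}$ is the strong dual of $V^\infty_{-\epsilon,-\nu}$. The group acts by left inverse translation $\pi$. For $\varphi\in V^\infty_{-\epsilon,-\nu}$ write $\varphi_0(x)=\varphi(\tilde n_x)$ and $\varphi_\infty(x)=\varphi(\tilde s^{-1}\tilde n_x)$. For $F\in V^{-\infty}_{\epsilon,\nu}$, $F_0$ and $F_\infty$ are the distributions on $\mathbb R$ with $F(\varphi)=\int F_0\varphi_0$, resp. $F(\varphi)=\int F_\infty\varphi_\infty$, whenever $\varphi_0$, resp. $\varphi_\infty$, has compact support in $\mathbb R$ (and $\varphi$ is supported in the corresponding chart). Put $\delta_{\epsilon,\nu,\infty}=\pi(\tilde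 s)\delta_{\epsilon,\nu,0}$, where $\delta_{\epsilon,\nu,0}(\varphi)=\varphi(1)$. A family $F_\nu\in V^{-\infty}_{\epsilon,\nu}$ is called holomorphic on an open set if $\nu\mapsto F_\nu(\varphi_\nu)$ is holomorphic there for every family $\varphi_\nu\in V^\infty_{-\epsilon,-\nu}$ whose restriction to the preimage $\tilde K$ of $SO(2)$ does not depend on $\nu$; poles and residues are understood in the same way. **Eisenstein distribution.** Let $\tilde\Gamma_1(4)$ be the group of all $(\begin{pmatrix}a&b\\c&d\end{pmatrix},(\frac cd))$ with $a,b,c,d\in\mathbb Z$, $ad-bc=1$, $a\equiv d\equiv1$, $c\equiv0\pmod4$ (Kronecker symbol), and $\tilde\Gamma_\infty=\{\tilde n_m:m\in\mathbb Z\}$. Put $\zeta_2(s)=(1-2^{-s})\zeta(s)$. For $\operatorname{Re}\nu>1$ let $$\tilde E^{(\infty)}_{\epsilon,\nu}=\zeta_2(2\nu+1)\sum_{\tilde\gamma\in\tilde\Gamma_1(4)/\tilde\Gamma_\infty}\pi(\tilde\gamma)\,\delta_{\epsilon,\nu,\infty}\in V^{-\infty}_{\epsilon,\nu},\qquad a_{\epsilon,\nu}(n)=\int_0^1(\tilde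 E^{(\infty)}_{\epsilon,\nu})_0(x)\,e(-nx)\,dx .$$ (The distribution $(\tilde E^{(\infty)}_{\epsilon,\nu})_0$ has period $1$, and the integral is its value at $\chi(x)e(-nx)$ for any $\chi\in C_c^\infty(\mathbb R)$ whose integer translates sum to $1$.) For $n\in\mathbb Z\setminus\{0\}$ and $\nu\in\mathbb C$ let $\mathbb e_{\epsilon,\nu,n}\in V^{-\infty}_{\epsilon,\nu}$ be the canonical extension of $e(nx)$, that is, $$\mathbb e_{\epsilon,\nu,n}(\varphi)=\left(\frac{-1}{2\pi i n}\right)^{k}\int_{\mathbb R}e(nx)\,\varphi_0^{(k)}(x)\,dx$$ for any integer $k\ge0$ with $\operatorname{Re}\nu+k>0$. For $\nu\in\mathbb C\setminus\mathbb Z_{\le0}$ let $\mathbb e_{\epsilon,\nu,0}=\mathbb 1_{\epsilon,\nu}$ be the distribution with $(\mathbb 1_{\epsilon,\nu})_0(x)=1$ and $(\mathbb 1_{\epsilon,\nu})_\infty(x)=\operatorname{sgn}(-x)^{\epsilon/2}|x|^{\nu-1}$, where $\operatorname{sgn}(-x)^{\epsilon/2}$ is $1$ for $x<0$ and $\epsilon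 i$ for $x>0$; for $\operatorname{Re}\nu\le0$ the latter is the usual meromorphic continuation in $\nu$ (finite part), which has simple poles at the integers $\nu\le0$. **Proposition.** For $\operatorname{Re}\nu>1$ the series that defines $\tilde E^{(\infty)}_{\epsilon,\nu}$ converges (unconditionally, in the strong topology). The family $\tilde E^{(\infty)}_{\epsilon,\nu}$ continues to a holomorphic family on $\mathbb C\setminus\{0,\tfrac12\}$, with at most a simple pole at $\nu=0$ and a simple pole, with nonzero residue, at $\nu=\tfrac12$. Each $a_{\epsilon,\nu}(n)$ continues to a holomorphic function of $\nu\in\mathbb C\setminus\{\tfrac12\}$ that is meromorphic at $\tfrac12$; the family $a_{\epsilon,\nu}(0)\,\mathbb 1_{\epsilon,\nu}$, defined for $\nu\notin\{\tfrac12\}\cup\mathbb Z_{\le0}$, extends to a holomorphic family on $\mathbb C\setminus\{0,\tfrac12\}$; and for every $\nu\in\mathbb C\setminus\{0,\tfrac12\}$ the continuation is given by $$\tilde E^{(\infty)}_{\epsilon,\nu}=\sum_{n\in\mathbb Z}a_{\epsilon,\nu}(n)\,\mathbb e_{\epsilon,\nu,n}+\zeta_2(2\nu+1)\,\delta_{\epsilon,\nu,\infty},\qquad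 \zeta_2(2\nu+1)=(1-2^{-2\nu-1})\,\zeta(2\nu+1),$$ where the series converges (unconditionally, in the strong topology), and at a negative integer $\nu$ the term with $n=0$ is the value of the extended family. -/

import Mathlib

noncomputable section

open scoped ContDiff Topology

namespace Metaplectic

/-- The Hilbert symbol of `ℝ` (on nonzero reals). -/
def hilb (x y : ℝ) : ℤˣ := if x < 0 ∧ y < 0 then -1 else 1

/-- The lower left entry of a matrix if it is nonzero, the lower right entry otherwise. -/
def X (g : Matrix.SpecialLinearGroup (Fin 2) ℝ) : ℝ := if g 1 0 = 0 then g 1 1 else g 1 0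

/-- Kubota's cocycle on `SL₂(ℝ)`. -/
def cocycle (g₁ g₂ : Matrix.SpecialLinearGroup (Fin 2) ℝ) : ℤˣ :=
  hilb (X (g₁ * g₂) / X g₁) (X (g₁ * g₂) / X g₂)

/-- The set underlying the metaplectic group: `SL₂(ℝ) × {±1}`. -/
@[ext] structure Mp where
  mat : Matrix.SpecialLinearGroup (Fin 2) ℝ
  sgn : ℤˣ

lemma X_ne_zero (g : Matrix.SpecialLinearGroup (Fin 2) ℝ) : X g ≠ 0 := by
  have h := g.det_coe
  rw [Matrix.det_fin_two] at h
  unfold X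
  split_ifs with h0
  · intro h1
    simp [h0, h1] at h
  · exact h0

lemma X_one : X 1 = 1 := by simp [X]

lemma hilb_comm (x y : ℝ) : hilb x y = hilb y x := by simp [hilb, and_comm]

lemma div_neg_iff_mul (x y : ℝ) : x / y < 0 ↔ x * y < 0 := by
  rw [div_neg_iff, mul_neg_iff]

lemma X_key_aux (a₁ b₁ c₁ d₁ a₂ b₂ c₂ d₂ a₃ b₃ c₃ d₃ : ℝ)
    (h1 : a₁ * d₁ - b₁ * c₁ = 1) (h2 : a₂ * d₂ - b₂ * c₂ = 1) (h3 : a₃ * d₃ - b₃ * c₃ = 1)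
    (X1 X2 X3 X12 X23 X123 : ℝ)
    (e1 : X1 = if c₁ = 0 then d₁ else c₁) (e2 : X2 = if c₂ = 0 then d₂ else c₂)
    (e3 : X3 = if c₃ = 0 then d₃ else c₃)
    (e12 : X12 = if c₁ * a₂ + d₁ * c₂ = 0 then c₁ * b₂ + d₁ * d₂ else c₁ * a₂ + d₁ * c₂)
    (e23 : X23 = if c₂ * a₃ + d₂ * c₃ = 0 then c₂ * b₃ + d₂ * d₃ else c₂ * a₃ + d₂ * c₃)
    (e123 : X123 = if (c₁ * a₂ + d₁ * c₂) * a₃ + (c₁ * b₂ + d₁ * d₂) * c₃ = 0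
      then (c₁ * a₂ + d₁ * c₂) * b₃ + (c₁ * b₂ + d₁ * d₂) * d₃
      else (c₁ * a₂ + d₁ * c₂) * a₃ + (c₁ * b₂ + d₁ * d₂) * c₃)
    (n1 : X1 ≠ 0) (n3 : X3 ≠ 0) (n12 : X12 ≠ 0)
    (h : 0 < X123 * X1 * X2 * X3) : 0 < X12 * X23 * X1 * X3 := by
  by_cases z2 : c₂ = 0
  · subst z2
    have hd2 : d₂ ≠ 0 := by rintro rfl; simp at h2
    have ha2 : a₂ = 1 / d₂ := by field_simp; linarith
    have P : 0 < X12 * X1 * d₂ := by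
      by_cases z1 : c₁ = 0
      · subst z1
        simp at e1 e12; rw [e1] at n1; rw [e1, e12]
        have : d₁ * d₂ * d₁ * d₂ = (d₁ * d₂) ^ 2 := by ring
        rw [this]; positivity
      · have : ¬ (c₁ * a₂ + d₁ * 0 = 0) := by simp [z1, ha2, hd2]
        rw [if_neg this] at e12; rw [if_neg z1] at e1
        rw [e1, e12]
        have : (c₁ * a₂ + d₁ * 0) * c₁ * d₂ = c₁ ^ 2 := by rw [ha2]; field_simp; ring
        rw [this]; positivity
    have Q : 0 < X23 * X3 * d₂ := by
      by_cases z3 : c₃ = 0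
      · subst z3
        simp at e3 e23; rw [e3] at n3; rw [e3, e23]
        have : d₂ * d₃ * d₃ * d₂ = (d₂ * d₃) ^ 2 := by ring
        rw [this]; positivity
      · have : ¬ (0 * a₃ + d₂ * c₃ = 0) := by simp [z3, hd2]
        rw [if_neg this] at e23; rw [if_neg z3] at e3
        rw [e3, e23]
        have : (0 * a₃ + d₂ * c₃) * c₃ * d₂ = (d₂ * c₃) ^ 2 := by ring
        rw [this]; positivity
    have := mul_pos P Q
    have e : X12 * X1 * d₂ * (X23 * X3 * d₂) = d₂ ^ 2 * (X12 * X23 * X1 * X3) := by ring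
    rw [e] at this
    exact pos_of_mul_pos_right this (by positivity)
  rw [if_neg z2] at e2
  by_cases z1 : c₁ = 0
  · subst z1
    have hd1 : d₁ ≠ 0 := by rintro rfl; simp at h1
    simp only [if_true, zero_mul, zero_add, mul_eq_zero, hd1, z2, or_self, if_false] at e1 e12
    have : X123 = d₁ * X23 := by
      rw [e123, e23]
      have e : (0 * a₂ + d₁ * c₂) * a₃ + (0 * b₂ + d₁ * d₂) * c₃ = d₁ * (c₂ * a₃ + d₂ * c₃) := by
        ring
      simp only [e, mul_eq_zero, hd1, false_or]
      split_ifs <;> ring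
    subst e1 e12 e2 this
    convert h using 1
    ring
  rw [if_neg z1] at e1
  by_cases z3 : c₃ = 0
  · subst z3
    have hd3 : d₃ ≠ 0 := by rintro rfl; simp at h3
    have ha3 : a₃ = 1 / d₃ := by field_simp; linarith
    have ha3' : a₃ ≠ 0 := by rw [ha3]; positivity
    simp only [if_true, mul_zero, add_zero, mul_eq_zero, ha3', z2, or_self, or_false, if_false]
      at e3 e23 e123
    have h4 : 0 < X123 * X1 * X2 * X3 * (a₃ ^ 2) := by positivity
    rw [e1, e2, e3] at h4 h
    rw [e1, e3, e23]
    by_cases w : c₁ * a₂ + d₁ * c₂ = 0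
    · rw [if_pos w] at e12 e123
      rw [w] at e123
      rw [e123] at h4
      rw [e12]
      have hh : (0 * b₃ + (c₁ * b₂ + d₁ * d₂) * d₃) * c₁ * c₂ * d₃ * a₃ ^ 2 =
        (c₁ * b₂ + d₁ * d₂) * (c₂ * a₃) * c₁ * d₃ * (d₃ * a₃) := by ring
      rw [hh] at h4
      have : d₃ * a₃ = 1 := by linarith
      rwa [this, mul_one] at h4
    · rw [if_neg w] at e12 e123
      rw [e123] at h
      rw [e12]
      convert h using 1
      ring
  rw [if_neg z3] at e3
  by_cases w12 : c₁ * a₂ + d₁ * c₂ = 0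
  · rw [if_pos w12] at e12
    rw [w12] at e123
    simp only [← e12, zero_mul, zero_add, mul_eq_zero, n12, z3, or_self, if_false] at e123
    -- `X12 c₂ = - c₁`
    have k : X12 * c₂ = - c₁ := by
      rw [e12]; linear_combination (-c₁) * h2 + d₂ * w12
    subst e1 e2 e3 e123
    exfalso
    have : X12 * X3 * X1 * X2 * X3 = - (X1 * X3) ^ 2 := by
      linear_combination (X3 * X1 * X3) * k
    rw [this] at h
    nlinarith [sq_nonneg (X1 * X3)]
  rw [if_neg w12] at e12
  by_cases w23 : c₂ * a₃ + d₂ * c₃ = 0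
  · rw [if_pos w23] at e23
    have k3 : (c₁ * a₂ + d₁ * c₂) * a₃ + (c₁ * b₂ + d₁ * d₂) * c₃ = c₁ * (a₂ * a₃ + b₂ * c₃) := by
      linear_combination d₁ * w23
    have k4 : (a₂ * a₃ + b₂ * c₃) * c₂ = - c₃ := by
      linear_combination a₂ * w23 - c₃ * h2
    have k5 : a₂ * a₃ + b₂ * c₃ ≠ 0 := by
      intro h0; rw [h0] at k4; simp at k4; exact z3 k4
    rw [k3, if_neg (mul_ne_zero z1 k5)] at e123
    subst e1 e2 e3 e123
    exfalso
    have : X1 * (a₂ * a₃ + b₂ * X3) * X1 * X2 * X3 = - (X1 * X3) ^ 2 := by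
      linear_combination (X1 * X1 * X3) * k4
    rw [this] at h
    nlinarith [sq_nonneg (X1 * X3)]
  rw [if_neg w23] at e23
  have id : ((c₁ * a₂ + d₁ * c₂) * a₃ + (c₁ * b₂ + d₁ * d₂) * c₃) * c₂ =
      X12 * X23 - c₁ * c₃ := by
    rw [e12, e23]
    linear_combination (-c₁ * c₃) * h2
  have hp : 0 < (c₁ * c₃) ^ 2 := by positivity
  rw [e1, e2, e3] at h
  rw [e1, e3]
  have hh : X12 * X23 * c₁ * c₃ =
      ((c₁ * a₂ + d₁ * c₂) * a₃ + (c₁ * b₂ + d₁ * d₂) * c₃) * c₁ * c₂ * c₃ + (c₁ * c₃) ^ 2 := by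
    linear_combination (-c₁ * c₃) * id
  rw [hh]
  by_cases w : (c₁ * a₂ + d₁ * c₂) * a₃ + (c₁ * b₂ + d₁ * d₂) * c₃ = 0
  · rw [w]; linarith
  · rw [if_neg w] at e123
    rw [e123] at h
    linarith

lemma X_key (g₁ g₂ g₃ : Matrix.SpecialLinearGroup (Fin 2) ℝ)
    (h : 0 < X (g₁ * g₂ * g₃) * X g₁ * X g₂ * X g₃) :
    0 < X (g₁ * g₂) * X (g₂ * g₃) * X g₁ * X g₃ := by
  have d1 := g₁.det_coe
  have d2 := g₂.det_coe
  have d3 := g₃.det_coe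
  rw [Matrix.det_fin_two] at d1 d2 d3
  refine X_key_aux (g₁ 0 0) (g₁ 0 1) (g₁ 1 0) (g₁ 1 1) (g₂ 0 0) (g₂ 0 1) (g₂ 1 0) (g₂ 1 1)
    (g₃ 0 0) (g₃ 0 1) (g₃ 1 0) (g₃ 1 1) d1 d2 d3 _ _ _ _ _ _ rfl rfl rfl ?_ ?_ ?_
    (X_ne_zero g₁) (X_ne_zero g₃) (X_ne_zero _) h <;>
  simp [X, Matrix.mul_apply, Fin.sum_univ_two]

/-- The cocycle identity. -/
lemma cocycle_assoc (g₁ g₂ g₃ : Matrix.SpecialLinearGroup (Fin 2) ℝ) :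
    cocycle g₁ g₂ * cocycle (g₁ * g₂) g₃ = cocycle g₁ (g₂ * g₃) * cocycle g₂ g₃ := by
  have hk := X_key g₁ g₂ g₃
  have n1 := X_ne_zero g₁
  have n2 := X_ne_zero g₂
  have n3 := X_ne_zero g₃
  have n12 := X_ne_zero (g₁ * g₂)
  have n23 := X_ne_zero (g₂ * g₃)
  have n123 := X_ne_zero (g₁ * g₂ * g₃)
  unfold cocycle hilb
  simp only [div_neg_iff_mul, ← mul_assoc]
  generalize X (g₁ * g₂ * g₃) = r at *
  generalize X (g₁ * g₂) = p at *
  generalize X (g₂ * g₃) = q at *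
  generalize X g₁ = x at *
  generalize X g₂ = y at *
  generalize X g₃ = z at *
  rcases lt_or_gt_of_ne n1 with h1 | h1 <;> rcases lt_or_gt_of_ne n2 with h2 | h2 <;>
  rcases lt_or_gt_of_ne n3 with h3 | h3 <;> rcases lt_or_gt_of_ne n12 with h4 | h4 <;>
  rcases lt_or_gt_of_ne n23 with h5 | h5 <;> rcases lt_or_gt_of_ne n123 with h6 | h6 <;>
  simp only [mul_pos_iff, mul_neg_iff, h1, h2, h3, h4, h5, h6, h1.not_gt, h2.not_gt,
    h3.not_gt, h4.not_gt, h5.not_gt, h6.not_gt] at hk ⊢ <;>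
  simp at hk ⊢

instance : One Mp := ⟨⟨1, 1⟩⟩

instance : Mul Mp := ⟨fun g h => ⟨g.mat * h.mat, cocycle g.mat h.mat * (g.sgn * h.sgn)⟩⟩

instance : Inv Mp := ⟨fun g => ⟨g.mat⁻¹, cocycle g.mat⁻¹ g.mat * g.sgn⟩⟩

@[simp] lemma one_mat : (1 : Mp).mat = 1 := rfl
@[simp] lemma one_sgn : (1 : Mp).sgn = 1 := rfl
@[simp] lemma mul_mat (g h : Mp) : (g * h).mat = g.mat * h.mat := rfl
@[simp] lemma mul_sgn (g h : Mp) :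
    (g * h).sgn = cocycle g.mat h.mat * (g.sgn * h.sgn) := rfl
@[simp] lemma inv_mat (g : Mp) : g⁻¹.mat = g.mat⁻¹ := rfl
@[simp] lemma inv_sgn (g : Mp) : g⁻¹.sgn = cocycle g.mat⁻¹ g.mat * g.sgn := rfl

/-- The metaplectic group: `(g₁, ε₁) (g₂, ε₂) = (g₁ g₂, α(g₁, g₂) ε₁ ε₂)`. -/
instance : Group Mp := Group.ofLeftAxioms
  (by
    intro a b c
    ext1
    · simp [mul_assoc]
    · have := cocycle_assoc a.mat b.mat c.mat
      simp only [mul_sgn, mul_mat]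
      calc _ = (cocycle a.mat b.mat * cocycle (a.mat * b.mat) c.mat) *
            (a.sgn * b.sgn * c.sgn) := by ac_rfl
        _ = _ := by rw [this]; ac_rfl)
  (by
    intro a
    ext1
    · simp
    · simp [cocycle, X_one, hilb, div_self (X_ne_zero _)])
  (by
    intro a
    ext1
    · simp
    · simp only [mul_sgn, inv_sgn, inv_mat, one_sgn]
      rcases Int.units_eq_one_or (cocycle a.mat⁻¹ a.mat) with h | h <;>
      rcases Int.units_eq_one_or a.sgn with h' | h' <;> simp [h, h'])

/-- `m̃_{ε₁,ε₂} = (ε₁ I, ε₂)`. -/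
def mElt (e₁ e₂ : ℤˣ) : Mp :=
  ⟨⟨!![((e₁ : ℤ) : ℝ), 0; 0, ((e₁ : ℤ) : ℝ)], by
    rcases Int.units_eq_one_or e₁ with h | h <;> simp [h, Matrix.det_fin_two]⟩, e₂⟩

/-- `ã_u = (diag(u, u⁻¹), 1)` with `u = e^t`. -/
def aElt (t : ℝ) : Mp :=
  ⟨⟨!![Real.exp t, 0; 0, Real.exp (-t)], by simp [Matrix.det_fin_two, ← Real.exp_add]⟩, 1⟩

/-- `ñ_x`, upper triangular unipotent. -/
def nElt (x : ℝ) : Mp := ⟨⟨!![1, x; 0, 1], by simp [Matrix.det_fin_two]⟩, 1⟩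

/-- `ñ_{-,x}`, lower triangular unipotent. -/
def nbarElt (x : ℝ) : Mp := ⟨⟨!![1, 0; x, 1], by simp [Matrix.det_fin_two]⟩, 1⟩

/-- `s̃ = ((0, -1; 1, 0), 1)`. -/
def sElt : Mp := ⟨⟨!![0, -1; 1, 0], by simp [Matrix.det_fin_two]⟩, 1⟩

/-- The character `σ_ε` of `M̃`, at `m̃_{e₁,e₂}`. -/
def sigma (ε e₁ e₂ : ℤˣ) : ℂ :=
  ((e₂ : ℤ) : ℂ) * if e₁ = 1 then 1 else -((ε : ℤ) : ℂ) * Complex.I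

/-- The quasi-character `ω_{ε,ν}` of `B̃ = M̃ Ã Ñ₋`, at `m̃_{e₁,e₂} ã_u ñ₋` with `u = e^t`:
`σ_ε(m̃) u^{ν-1}`. -/
def omega (ε : ℤˣ) (ν : ℂ) (e₁ e₂ : ℤˣ) (t : ℝ) : ℂ :=
  sigma ε e₁ e₂ * Complex.exp (t * (ν - 1))

/-- Smoothness on the Lie group: the translates of the big cell
`(x, t, y) ↦ ñ_x ã_{e^t} ñ_{-,y}` are an atlas. -/
def IsSmooth (f : Mp → ℂ) : Prop :=
  ∀ g : Mp, ContDiff ℝ ∞ fun p : ℝ × ℝ × ℝ => f (g * (nElt p.1 * aElt p.2.1 * nbarElt p.2.2))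

/-- The functions that make up the smooth principal series `V^∞_{ε,ν}`. -/
def smoothPSFun (ε : ℤˣ) (ν : ℂ) : Submodule ℂ (Mp → ℂ) where
  carrier := {f | IsSmooth f ∧ ∀ (g : Mp) (e₁ e₂ : ℤˣ) (t y : ℝ),
    f (g * (mElt e₁ e₂ * aElt t * nbarElt y)) = (omega ε ν e₁ e₂ t)⁻¹ * f g}
  zero_mem' := ⟨fun _ => contDiff_const, by simp⟩
  add_mem' := fun {f h} hf hh => ⟨fun g => (hf.1 g).add (hh.1 g), fun g e₁ e₂ t y => by
    simp only [Pi.add_apply, hf.2 g e₁ e₂ t y, hh.2 g e₁ e₂ t y]; ring⟩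
  smul_mem' := fun c f hf => ⟨fun g => contDiff_const.mul (hf.1 g), fun g e₁ e₂ t y => by
    simp only [Pi.smul_apply, hf.2 g e₁ e₂ t y, smul_eq_mul]; ring⟩

/-- The smooth principal series `V^∞_{ε,ν}`. -/
def SmoothPS (ε : ℤˣ) (ν : ℂ) : Type := smoothPSFun ε ν

instance (ε : ℤˣ) (ν : ℂ) : AddCommGroup (SmoothPS ε ν) :=
  inferInstanceAs (AddCommGroup (smoothPSFun ε ν))

instance (ε : ℤˣ) (ν : ℂ) : Module ℂ (SmoothPS ε ν) :=
  inferInstanceAs (Module ℂ (smoothPSFun ε ν))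

instance (ε : ℤˣ) (ν : ℂ) : CoeFun (SmoothPS ε ν) fun _ => Mp → ℂ := ⟨Subtype.val⟩

variable {ε : ℤˣ} {ν : ℂ}

lemma aElt_zero : aElt 0 = 1 := by
  ext1
  · ext i j; fin_cases i <;> fin_cases j <;> simp [aElt]
  · rfl

lemma nbarElt_zero : nbarElt 0 = 1 := by
  ext1
  · ext i j; fin_cases i <;> fin_cases j <;> simp [nbarElt]
  · rfl

lemma nElt_zero : nElt 0 = 1 := by
  ext1
  · ext i j; fin_cases i <;> fin_cases j <;> simp [nElt]
  · rfl

lemma contDiff_slice (f : SmoothPS ε ν) (g : Mp) :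
    ContDiff ℝ ∞ fun x : ℝ => f (g * nElt x) := by
  have h := (f.2.1 g).comp
    (show ContDiff ℝ ∞ (fun x : ℝ => ((x, 0, 0) : ℝ × ℝ × ℝ)) by fun_prop)
  simpa [Function.comp_def, aElt_zero, nbarElt_zero] using h

/-- All derivatives of all the functions `x ↦ f(g ñ_x)`. -/
def jets (ε : ℤˣ) (ν : ℂ) : SmoothPS ε ν →ₗ[ℂ] (Mp → ℕ → C(ℝ, ℂ)) where
  toFun f := fun g k => ⟨iteratedDeriv k fun x : ℝ => f (g * nElt x),
    (contDiff_slice f g).continuous_iteratedDeriv k (by exact_mod_cast le_top)⟩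
  map_add' f h := by
    funext g k
    ext x
    have := iteratedDeriv_fun_add (n := k) (x := x)
      (((contDiff_slice f g).of_le (by exact_mod_cast le_top)).contDiffAt)
      (((contDiff_slice h g).of_le (by exact_mod_cast le_top)).contDiffAt)
    exact this
  map_smul' c f := by
    funext g k
    ext x
    have := iteratedDeriv_fun_const_smul (n := k) (x := x) (f := fun x => f (g * nElt x))
       (((contDiff_slice f g).of_le (by exact_mod_cast le_top)).contDiffAt) c
    exact this

/-- The `C^∞` topology on `V^∞_{ε,ν}`: locally uniform convergence of all derivatives. -/
instance : TopologicalSpace (SmoothPS ε ν) := TopologicalSpace.induced (jets ε ν) inferInstance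


instance : IsTopologicalAddGroup (SmoothPS ε ν) := topologicalAddGroup_induced (jets ε ν)

instance : ContinuousSMul ℂ (SmoothPS ε ν) := continuousSMul_induced (jets ε ν)

lemma continuous_jets (g : Mp) (k : ℕ) :
    Continuous fun f : SmoothPS ε ν => jets ε ν f g k :=
  (continuous_apply k).comp ((continuous_apply g).comp continuous_induced_dom)

/-- The distributional principal series `V^{-∞}_{ε,ν}`: the strong dual of `V^∞_{-ε,-ν}`. -/
abbrev DistPS (ε : ℤˣ) (ν : ℂ) : Type := SmoothPS (-ε) (-ν) →L[ℂ] ℂ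


/-- Left inverse translation on the smooth principal series: `(π(h) f)(g) = f(h⁻¹ g)`. -/
def piSmooth (ε : ℤˣ) (ν : ℂ) (h : Mp) : SmoothPS ε ν →L[ℂ] SmoothPS ε ν where
  toFun f := ⟨fun g => f (h⁻¹ * g), by
    refine ⟨fun g => ?_, fun g e₁ e₂ t y => ?_⟩
    · simpa only [mul_assoc] using f.2.1 (h⁻¹ * g)
    · simpa only [mul_assoc] using f.2.2 (h⁻¹ * g) e₁ e₂ t y⟩
  map_add' _ _ := rfl
  map_smul' _ _ := rfl
  cont := by
    refine continuous_induced_rng.2 (continuous_pi fun g => continuous_pi fun k => ?_)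
    refine (continuous_jets (ε := ε) (ν := ν) (h⁻¹ * g) k).congr fun f => ?_
    ext x
    change iteratedDeriv k (fun x => f (h⁻¹ * g * nElt x)) x =
      iteratedDeriv k (fun x => f (h⁻¹ * (g * nElt x))) x
    simp only [mul_assoc]

/-- The action on the distributional principal series, dual to `piSmooth`. -/
def piDist (ε : ℤˣ) (ν : ℂ) (h : Mp) (F : DistPS ε ν) : DistPS ε ν :=
  F.comp (piSmooth (-ε) (-ν) h⁻¹)

/-- `δ_{ε,ν,0}`. -/
def deltaZero (ε : ℤˣ) (ν : ℂ) : DistPS ε ν where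
  toFun φ := φ 1
  map_add' _ _ := rfl
  map_smul' _ _ := rfl
  cont := by
    have h := (continuous_eval_const (F := C(ℝ, ℂ)) (0 : ℝ)).comp
      (continuous_jets (ε := -ε) (ν := -ν) 1 0)
    refine h.congr fun φ => ?_
    simp [jets, nElt_zero]

/-- `δ_{ε,ν,∞} = π(s̃) δ_{ε,ν,0}`. -/
def deltaInf (ε : ℤˣ) (ν : ℂ) : DistPS ε ν := piDist ε ν sElt (deltaZero ε ν)

lemma coe_s : (sElt.mat : Matrix (Fin 2) (Fin 2) ℝ) = !![0, -1; 1, 0] := rfl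
lemma coe_n (x : ℝ) : ((nElt x).mat : Matrix (Fin 2) (Fin 2) ℝ) = !![1, x; 0, 1] := rfl
lemma coe_nbar (x : ℝ) : ((nbarElt x).mat : Matrix (Fin 2) (Fin 2) ℝ) = !![1, 0; x, 1] := rfl
lemma coe_a (t : ℝ) : ((aElt t).mat : Matrix (Fin 2) (Fin 2) ℝ) =
    !![Real.exp t, 0; 0, Real.exp (-t)] := rfl
lemma coe_m (e₁ e₂ : ℤˣ) : ((mElt e₁ e₂).mat : Matrix (Fin 2) (Fin 2) ℝ) =
    !![((e₁ : ℤ) : ℝ), 0; 0, ((e₁ : ℤ) : ℝ)] := rfl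

lemma X_of {g : Matrix.SpecialLinearGroup (Fin 2) ℝ} {a b c d : ℝ}
    (h : (g : Matrix (Fin 2) (Fin 2) ℝ) = !![a, b; c, d]) : X g = if c = 0 then d else c := by
  simp [X, h]

lemma mul_sgn_of {g h : Mp} {a b c d a' b' c' d' : ℝ}
    (hg : (g.mat : Matrix (Fin 2) (Fin 2) ℝ) = !![a, b; c, d])
    (hh : (h.mat : Matrix (Fin 2) (Fin 2) ℝ) = !![a', b'; c', d']) :
    (((g * h).mat : Matrix.SpecialLinearGroup (Fin 2) ℝ) : Matrix (Fin 2) (Fin 2) ℝ) =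
      !![a * a' + b * c', a * b' + b * d'; c * a' + d * c', c * b' + d * d'] ∧
    (g * h).sgn = hilb
      ((if c * a' + d * c' = 0 then c * b' + d * d' else c * a' + d * c') /
        if c = 0 then d else c)
      ((if c * a' + d * c' = 0 then c * b' + d * d' else c * a' + d * c') /
        if c' = 0 then d' else c') * (g.sgn * h.sgn) := by
  have e : (((g * h).mat : Matrix.SpecialLinearGroup (Fin 2) ℝ) : Matrix (Fin 2) (Fin 2) ℝ) =
      !![a * a' + b * c', a * b' + b * d'; c * a' + d * c', c * b' + d * d'] := by
    rw [mul_mat, Matrix.SpecialLinearGroup.coe_mul, hg, hh, Matrix.mul_fin_two]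
  refine ⟨e, ?_⟩
  rw [mul_mat] at e
  rw [mul_sgn, cocycle, X_of e, X_of hg, X_of hh]

lemma inv_sElt : ((sElt⁻¹).mat : Matrix (Fin 2) (Fin 2) ℝ) = !![0, 1; -1, 0] ∧
    (sElt⁻¹).sgn = 1 := by
  have e : ((sElt⁻¹).mat : Matrix (Fin 2) (Fin 2) ℝ) = !![0, 1; -1, 0] := by
    rw [inv_mat, Matrix.SpecialLinearGroup.coe_inv, coe_s, Matrix.adjugate_fin_two]
    simp
  refine ⟨e, ?_⟩
  rw [inv_mat] at e
  rw [inv_sgn, cocycle, inv_mul_cancel, X_one, X_of e, X_of coe_s]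
  simp [hilb, sElt]

lemma chart_neg {y : ℝ} (hy : y < 0) : nElt (-y⁻¹) =
    sElt⁻¹ * nElt y * (mElt 1 1 * aElt (Real.log (-y)) * nbarElt (-y)) := by
  have hy' : 0 < -y := by linarith
  have hne : y ≠ 0 := hy.ne
  obtain ⟨e1, s1⟩ := mul_sgn_of inv_sElt.1 (coe_n y)
  obtain ⟨e2, s2⟩ := mul_sgn_of e1 (coe_m 1 1)
  obtain ⟨e3, s3⟩ := mul_sgn_of e2 (coe_a (Real.log (-y)))
  obtain ⟨e4, s4⟩ := mul_sgn_of e3 (coe_nbar (-y))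
  rw [← mul_assoc, ← mul_assoc]
  ext1
  · refine Subtype.ext ?_
    rw [e4, coe_n, Real.exp_neg, Real.exp_log hy']
    ext i j
    fin_cases i <;> fin_cases j <;> simp <;> field_simp
  · rw [s4, s3, s2, s1, inv_sElt.2, Real.exp_neg, Real.exp_log hy']
    simp [nElt, mElt, aElt, nbarElt, hilb, hne]
    have h1 : ¬ 0 < y := hy.not_gt
    have h2 : ¬ y / -1 < 0 := by rw [div_neg, div_one]; linarith
    simp [h1, h2, (zero_lt_one (α := ℝ)).not_gt]

lemma chart_pos {y : ℝ} (hy : 0 < y) : nElt (-y⁻¹) =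
    sElt⁻¹ * nElt y * (mElt (-1) (-1) * aElt (Real.log y) * nbarElt (-y)) := by
  have hne : y ≠ 0 := hy.ne'
  obtain ⟨e1, s1⟩ := mul_sgn_of inv_sElt.1 (coe_n y)
  obtain ⟨e2, s2⟩ := mul_sgn_of e1 (coe_m (-1) (-1))
  obtain ⟨e3, s3⟩ := mul_sgn_of e2 (coe_a (Real.log y))
  obtain ⟨e4, s4⟩ := mul_sgn_of e3 (coe_nbar (-y))
  rw [← mul_assoc, ← mul_assoc]
  ext1
  · refine Subtype.ext ?_
    rw [e4, coe_n, Real.exp_neg, Real.exp_log hy]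
    ext i j
    fin_cases i <;> fin_cases j <;> simp <;> field_simp
  · rw [s4, s3, s2, s1, inv_sElt.2, Real.exp_neg, Real.exp_log hy]
    simp [nElt, mElt, aElt, nbarElt, hilb, hne]
    have h1 : ¬ y < 0 := hy.not_gt
    simp [h1, (zero_lt_one (α := ℝ)).not_gt]


/-- On the two half-lines the two charts are related by a power of `|x|`. -/
lemma apply_chart (ε : ℤˣ) (ν : ℂ) {σ : ℝ} (hσ : σ = 1 ∨ σ = -1) :
    ∃ c : ℂ, ∀ (f : SmoothPS ε ν) (x : ℝ), 0 < x → f (nElt (σ * x)) =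
      c * Complex.exp ((ν - 1) * Real.log x) * f (sElt⁻¹ * nElt (-σ * x⁻¹)) := by
  rcases hσ with rfl | rfl
  · refine ⟨(sigma ε 1 1)⁻¹, fun f x hx => ?_⟩
    have hx' : (-x⁻¹) < 0 := by simpa using hx
    have h := chart_neg hx'
    rw [inv_neg, inv_inv, neg_neg, neg_neg] at h
    rw [one_mul, neg_one_mul, h, f.2.2, omega, mul_inv, ← Complex.exp_neg, Real.log_inv]
    push_cast
    congr 3
    ring
  · refine ⟨(sigma ε (-1) (-1))⁻¹, fun f x hx => ?_⟩
    have h := chart_pos (inv_pos.2 hx)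
    rw [inv_inv] at h
    rw [neg_neg, one_mul, neg_one_mul, h, f.2.2, omega, mul_inv, ← Complex.exp_neg, Real.log_inv]
    push_cast
    congr 3
    ring

lemma iteratedDeriv_tail (s : ℂ) (k : ℕ) : ∃ a : ℕ → ℂ, ∀ (c : ℂ) (g h : ℝ → ℂ),
    ContDiff ℝ ∞ g → (∀ x, 0 < x → h x = c * Complex.exp (-s * Real.log x) * g x⁻¹) →
    ∀ x : ℝ, 0 < x → iteratedDeriv k h x = c * ∑ j ∈ Finset.range (k + 1),
      a j * (Complex.exp (-(s + k + j) * Real.log x) * iteratedDeriv j g x⁻¹) := by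
  induction k with
  | zero =>
    refine ⟨fun _ => 1, fun c g h _ hh x hx => ?_⟩
    simp [hh x hx]
    ring
  | succ k ih =>
    obtain ⟨a, ha⟩ := ih
    refine ⟨fun j => (if j < k + 1 then -(s + k + j) * a j else 0) -
      (if j = 0 then 0 else a (j - 1)), fun c g h hg hh x hx => ?_⟩
    have hne : (x : ℂ) ≠ 0 := by exact_mod_cast hx.ne'
    have hd : ∀ j : ℕ, HasDerivAt
        (fun x : ℝ => Complex.exp (-(s + k + j) * Real.log x) * iteratedDeriv j g x⁻¹)
        (-(s + k + j) * (Complex.exp (-(s + (k + 1 : ℕ) + j) * Real.log x) *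
            iteratedDeriv j g x⁻¹) -
          Complex.exp (-(s + (k + 1 : ℕ) + (j + 1 : ℕ)) * Real.log x) *
            iteratedDeriv (j + 1) g x⁻¹) x := by
      intro j
      have h1 : HasDerivAt (fun x : ℝ => Complex.exp (-(s + k + j) * Real.log x))
          (Complex.exp (-(s + k + j) * Real.log x) * (-(s + k + j) * ((x⁻¹ : ℝ) : ℂ))) x :=
        ((Real.hasDerivAt_log hx.ne').ofReal_comp.const_mul _).cexp
      have h2 : HasDerivAt (iteratedDeriv j g) (iteratedDeriv (j + 1) g x⁻¹) x⁻¹ := by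
        rw [iteratedDeriv_succ]
        exact ((hg.differentiable_iteratedDeriv j (by exact_mod_cast ENat.natCast_lt_top j))
          x⁻¹).hasDerivAt
      have h3 := h2.scomp x (hasDerivAt_inv hx.ne')
      have h4 := h1.mul h3
      have hx1 : Complex.exp (Real.log x) = x := by
        rw [← Complex.ofReal_exp, Real.exp_log hx]
      refine h4.congr_deriv ?_
      have e1 : Complex.exp (-(s + (k + 1 : ℕ) + j) * Real.log x) =
          Complex.exp (-(s + k + j) * Real.log x) * (x : ℂ)⁻¹ := by
        rw [← hx1, ← Complex.exp_neg, ← Complex.exp_add]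
        congr 1
        push_cast
        ring
      have e2 : Complex.exp (-(s + (k + 1 : ℕ) + (j + 1 : ℕ)) * Real.log x) =
          Complex.exp (-(s + k + j) * Real.log x) * ((x : ℂ)⁻¹ * (x : ℂ)⁻¹) := by
        rw [← hx1, ← Complex.exp_neg, ← Complex.exp_add, ← Complex.exp_add]
        congr 1
        push_cast
        ring
      have e1' := e1
      have e2' := e2
      push_cast at e1' e2' ⊢
      rw [e1', e2']
      simp only [Function.comp_apply, Complex.real_smul]
      push_cast
      field_simp
      ring
    have hd' : HasDerivAt (iteratedDeriv k h) (c * ∑ j ∈ Finset.range (k + 1), a j *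
        (-(s + k + j) * (Complex.exp (-(s + (k + 1 : ℕ) + j) * Real.log x) *
            iteratedDeriv j g x⁻¹) -
          Complex.exp (-(s + (k + 1 : ℕ) + (j + 1 : ℕ)) * Real.log x) *
            iteratedDeriv (j + 1) g x⁻¹)) x := by
      have h1 := (HasDerivAt.fun_sum (u := Finset.range (k + 1))
        fun j _ => (hd j).const_mul (a j)).const_mul c
      refine h1.congr_of_eventuallyEq ?_
      filter_upwards [lt_mem_nhds hx] with y hy
      exact ha c g h hg hh y hy
    rw [iteratedDeriv_succ, hd'.deriv]
    congr 1
    simp only [sub_mul, Finset.sum_sub_distrib, mul_sub]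
    congr 1
    · rw [Finset.sum_range_succ _ (k + 1)]
      simp only [lt_irrefl, if_false, zero_mul, add_zero]
      refine Finset.sum_congr rfl fun j hj => ?_
      rw [if_pos (Finset.mem_range.1 hj)]
      ring
    · rw [Finset.sum_range_succ' _ (k + 1)]
      simp

/-- The function `x ↦ f(g ñ_x)`. -/
def slice (f : SmoothPS ε ν) (g : Mp) (x : ℝ) : ℂ := f (g * nElt x)

lemma slice_smooth (f : SmoothPS ε ν) (g : Mp) : ContDiff ℝ ∞ (slice f g) := contDiff_slice f g

/-- The sup norm over `[-1, 1]` of the `k`-th derivative of `x ↦ f(g ñ_x)`. -/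
def snorm (g : Mp) (k : ℕ) (f : SmoothPS ε ν) : ℝ :=
  ‖(jets ε ν f g k).restrict (Set.Icc (-1) 1)‖

lemma snorm_nonneg (g : Mp) (k : ℕ) (f : SmoothPS ε ν) : 0 ≤ snorm g k f := norm_nonneg _

lemma continuous_snorm (g : Mp) (k : ℕ) : Continuous (snorm (ε := ε) (ν := ν) g k) :=
  continuous_norm.comp ((ContinuousMap.continuous_restrict _).comp (continuous_jets g k))

lemma le_snorm (g : Mp) (k : ℕ) (f : SmoothPS ε ν) {x : ℝ} (hx : x ∈ Set.Icc (-1 : ℝ) 1) :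
    ‖iteratedDeriv k (slice f g) x‖ ≤ snorm g k f :=
  ContinuousMap.norm_coe_le_norm ((jets ε ν f g k).restrict (Set.Icc (-1) 1)) ⟨x, hx⟩

/-- A finite sum of seminorms. -/
def qnorm (k : ℕ) (f : SmoothPS ε ν) : ℝ :=
  ∑ j ∈ Finset.range (k + 1), (snorm 1 j f + snorm sElt⁻¹ j f)

lemma qnorm_nonneg (k : ℕ) (f : SmoothPS ε ν) : 0 ≤ qnorm k f :=
  Finset.sum_nonneg fun _ _ => add_nonneg (snorm_nonneg _ _ _) (snorm_nonneg _ _ _)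

lemma snorm_le_qnorm {k j : ℕ} (h : j ≤ k) (f : SmoothPS ε ν) :
    snorm 1 j f + snorm sElt⁻¹ j f ≤ qnorm k f :=
  Finset.single_le_sum (f := fun j => snorm 1 j f + snorm sElt⁻¹ j f)
    (fun _ _ => add_nonneg (snorm_nonneg _ _ _) (snorm_nonneg _ _ _))
    (Finset.mem_range.2 (Nat.lt_succ_of_le h))

lemma le_qnorm_one {k j : ℕ} (h : j ≤ k) (f : SmoothPS ε ν) {x : ℝ}
    (hx : x ∈ Set.Icc (-1 : ℝ) 1) : ‖iteratedDeriv j (slice f 1) x‖ ≤ qnorm k f :=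
  (le_snorm 1 j f hx).trans <| (le_add_of_nonneg_right (snorm_nonneg _ _ _)).trans
    (snorm_le_qnorm h f)

lemma le_qnorm_s {k j : ℕ} (h : j ≤ k) (f : SmoothPS ε ν) {x : ℝ}
    (hx : x ∈ Set.Icc (-1 : ℝ) 1) : ‖iteratedDeriv j (slice f sElt⁻¹) x‖ ≤ qnorm k f :=
  (le_snorm _ j f hx).trans <| (le_add_of_nonneg_left (snorm_nonneg _ _ _)).trans
    (snorm_le_qnorm h f)

lemma continuous_qnorm (k : ℕ) : Continuous (qnorm (ε := ε) (ν := ν) k) :=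
  continuous_finsetSum _ fun _ _ => (continuous_snorm _ _).add (continuous_snorm _ _)

lemma qnorm_zero (k : ℕ) : qnorm k (0 : SmoothPS ε ν) = 0 := by
  refine Finset.sum_eq_zero fun j _ => ?_
  have h : ∀ g : Mp, snorm g j (0 : SmoothPS ε ν) = 0 := fun g => by
    have : (jets ε ν 0 g j).restrict (Set.Icc (-1 : ℝ) 1) = 0 := by
      rw [map_zero]; rfl
    rw [snorm, this, norm_zero]
  rw [h, h, add_zero]

lemma continuous_of_bound (F : SmoothPS ε ν →ₗ[ℂ] ℂ) (C : ℝ) (k : ℕ)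
    (h : ∀ f, ‖F f‖ ≤ C * qnorm k f) : Continuous F := by
  refine continuous_of_continuousAt_zero F ?_
  rw [ContinuousAt, map_zero]
  refine squeeze_zero_norm h ?_
  have := ((continuous_qnorm (ε := ε) (ν := ν) k).const_mul C).tendsto 0
  simpa [qnorm_zero] using this

/-- Decay of the derivatives of `x ↦ f(ñ_x)`. -/
lemma tail_bound (ε : ℤˣ) (ν : ℂ) (k : ℕ) (hk : 1 ≤ -ν.re + k) : ∃ C : ℝ, 0 ≤ C ∧
    ∀ (f : SmoothPS ε ν) (x : ℝ), ‖iteratedDeriv k (slice f 1) x‖ ≤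
      C * qnorm k f * (1 + x ^ 2)⁻¹ := by
  have key : ∀ σ : ℝ, (σ = 1 ∨ σ = -1) → ∃ C : ℝ, 0 ≤ C ∧ ∀ (f : SmoothPS ε ν) (x : ℝ), 1 ≤ x →
      ‖iteratedDeriv k (slice f 1) (σ * x)‖ ≤ C * qnorm k f * (1 + x ^ 2)⁻¹ := by
    intro σ hσ
    have hσ1 : ‖σ‖ = 1 := by rcases hσ with rfl | rfl <;> simp
    obtain ⟨c, hc⟩ := apply_chart ε ν hσ
    obtain ⟨a, ha⟩ := iteratedDeriv_tail (1 - ν) k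
    refine ⟨‖c‖ * (∑ j ∈ Finset.range (k + 1), ‖a j‖) * 2, by positivity, fun f x hx => ?_⟩
    have hx0 : 0 < x := by linarith
    have hs : ContDiff ℝ ∞ fun y : ℝ => slice f sElt⁻¹ (-σ * y) :=
      (slice_smooth f _).comp (contDiff_const.mul contDiff_id)
    have h1 := ha c (fun y => slice f sElt⁻¹ (-σ * y)) (fun x => slice f 1 (σ * x)) hs
      (fun x hx => by simpa [slice] using hc f x hx) x hx0
    have h2 := iteratedDeriv_comp_const_smul (n := k) (f := slice f 1)
      (show ContDiff ℝ k (slice f 1) from (slice_smooth f 1).of_le (by exact_mod_cast le_top)) σ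
    rw [h2] at h1
    have h3 : ‖iteratedDeriv k (slice f 1) (σ * x)‖ =
        ‖σ ^ k • iteratedDeriv k (slice f 1) (σ * x)‖ := by
      rw [norm_smul, norm_pow, hσ1, one_pow, one_mul]
    have h3' := congrArg norm h1
    rw [h3, h3', norm_mul]
    have hx2 : (x ^ 2)⁻¹ ≤ 2 * (1 + x ^ 2)⁻¹ := by
      rw [← div_eq_mul_inv, inv_eq_one_div, div_le_div_iff₀ (by positivity) (by positivity)]
      nlinarith
    have h4 : ‖∑ j ∈ Finset.range (k + 1), a j * (Complex.exp (-(1 - ν + k + j) * Real.log x) *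
        iteratedDeriv j (fun y => slice f sElt⁻¹ (-σ * y)) x⁻¹)‖ ≤
        ∑ j ∈ Finset.range (k + 1), ‖a j‖ * ((2 * (1 + x ^ 2)⁻¹) * qnorm k f) := by
      refine norm_sum_le_of_le _ fun j hj => ?_
      have hj' : j ≤ k := Nat.lt_succ_iff.1 (Finset.mem_range.1 hj)
      rw [norm_mul, norm_mul]
      refine mul_le_mul_of_nonneg_left ?_ (norm_nonneg _)
      refine mul_le_mul ?_ ?_ (norm_nonneg _) (by positivity)
      · refine le_trans ?_ hx2
        rw [Complex.norm_exp]
        have hl : 0 ≤ Real.log x := Real.log_nonneg hx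
        have e : (x ^ 2)⁻¹ = Real.exp (-2 * Real.log x) := by
          rw [neg_mul, Real.exp_neg, mul_comm, Real.exp_mul, Real.exp_log hx0]
          norm_num
        rw [e]
        refine Real.exp_le_exp.2 ?_
        have e2 : (-(1 - ν + k + j) * (Real.log x : ℂ)).re =
            -(1 - ν.re + k + j) * Real.log x := by simp
        rw [e2]
        refine mul_le_mul_of_nonneg_right ?_ hl
        have : (0 : ℝ) ≤ j := Nat.cast_nonneg j
        linarith
      · have h5 := iteratedDeriv_comp_const_smul (n := j) (f := slice f sElt⁻¹)
          (show ContDiff ℝ j (slice f sElt⁻¹) from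
            (slice_smooth f _).of_le (by exact_mod_cast le_top)) (-σ)
        rw [h5, norm_smul, norm_pow, norm_neg, hσ1, one_pow, one_mul]
        refine le_qnorm_s hj' f ?_
        rw [Set.mem_Icc, ← abs_le, abs_mul, abs_neg]
        have : |σ| = 1 := hσ1
        rw [this, one_mul, abs_of_pos (inv_pos.2 hx0)]
        exact inv_le_one_of_one_le₀ hx
    refine (mul_le_mul_of_nonneg_left h4 (norm_nonneg _)).trans (le_of_eq ?_)
    rw [← Finset.sum_mul]
    ring
  obtain ⟨C₁, hC₁, h₁⟩ := key 1 (Or.inl rfl)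
  obtain ⟨C₂, hC₂, h₂⟩ := key (-1) (Or.inr rfl)
  refine ⟨2 + C₁ + C₂, by positivity, fun f x => ?_⟩
  have hq := qnorm_nonneg k f
  have hp : 0 ≤ (1 + x ^ 2)⁻¹ := by positivity
  have hqp := mul_nonneg hq hp
  rcases le_or_gt 1 x with hx | hx
  · have := h₁ f x hx
    rw [one_mul] at this
    nlinarith [mul_nonneg hC₁ hqp, mul_nonneg hC₂ hqp]
  rcases le_or_gt x (-1) with hx' | hx'
  · have := h₂ f (-x) (by linarith)
    rw [neg_mul_neg, one_mul, neg_sq] at this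
    nlinarith [mul_nonneg hC₁ hqp, mul_nonneg hC₂ hqp]
  have h := le_qnorm_one (le_refl k) f (x := x) ⟨hx'.le, hx.le⟩
  have h2 : 1 ≤ 2 * (1 + x ^ 2)⁻¹ := by
    rw [← div_eq_mul_inv, le_div_iff₀ (by positivity)]
    nlinarith
  nlinarith [mul_nonneg hC₁ hqp, mul_nonneg hC₂ hqp, mul_nonneg hq (sub_nonneg.2 h2)]

/-- `e(x) = exp(2πix)`. -/
def eExp (x : ℝ) : ℂ := Complex.exp (2 * Real.pi * Complex.I * x)

lemma norm_eExp (x : ℝ) : ‖eExp x‖ = 1 := by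
  rw [eExp, Complex.norm_exp]
  simp

lemma continuous_eExp : Continuous eExp := by
  unfold eExp
  fun_prop

lemma norm_fourier_integrand {k : ℕ} {C : ℝ} {f : SmoothPS ε ν} (n : ℤ) (x : ℝ)
    (h : ‖iteratedDeriv k (slice f 1) x‖ ≤ C * qnorm k f * (1 + x ^ 2)⁻¹) :
    ‖eExp (n * x) * iteratedDeriv k (slice f 1) x‖ ≤ C * qnorm k f * (1 + x ^ 2)⁻¹ := by
  rwa [norm_mul, norm_eExp, one_mul]

lemma fourier_integrable (k : ℕ) (hk : 1 ≤ -ν.re + k) (n : ℤ) (f : SmoothPS ε ν) :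
    MeasureTheory.Integrable fun x : ℝ => eExp (n * x) * iteratedDeriv k (slice f 1) x := by
  obtain ⟨C, -, hC⟩ := tail_bound ε ν k hk
  refine (integrable_inv_one_add_sq.const_mul (C * qnorm k f)).mono' ?_
    (Filter.Eventually.of_forall fun x => norm_fourier_integrand n x (hC f x))
  have h1 : Continuous fun x : ℝ => eExp (n * x) := by
    unfold eExp
    fun_prop
  exact (h1.mul ((slice_smooth f 1).continuous_iteratedDeriv k
    (by exact_mod_cast le_top))).aestronglyMeasurable

lemma iteratedDeriv_slice_add (k : ℕ) (g : Mp) (f h : SmoothPS ε ν) (x : ℝ) :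
    iteratedDeriv k (slice (f + h) g) x =
      iteratedDeriv k (slice f g) x + iteratedDeriv k (slice h g) x :=
  DFunLike.congr_fun (congrFun (congrFun ((jets ε ν).map_add f h) g) k) x

lemma iteratedDeriv_slice_smul (k : ℕ) (g : Mp) (c : ℂ) (f : SmoothPS ε ν) (x : ℝ) :
    iteratedDeriv k (slice (c • f) g) x = c * iteratedDeriv k (slice f g) x :=
  DFunLike.congr_fun (congrFun (congrFun ((jets ε ν).map_smul c f) g) k) x

/-- A number of derivatives that makes the integrals below converge. -/
def regOrder (ν : ℂ) : ℕ := ⌈-ν.re⌉₊ + 1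

lemma regOrder_spec (ν : ℂ) : 1 ≤ ν.re + regOrder ν := by
  have := Nat.le_ceil (-ν.re)
  rw [regOrder]
  push_cast
  linarith

/-- For `n ≠ 0`: the canonical extension `𝕖_{ε,ν,n}` of the distribution `e(nx)` on the chart
`x ↦ ñ_x`. With `φ₀(x) = φ(ñ_x)`, its value at `φ` is the integral of `e(nx) φ₀(x)`, regularized
at infinity by integrating by parts `k` times. The value does not depend on `k`, as long as the
integral converges, and it is the integral of `e(nx) φ₀(x)` when that converges. -/
def fourierLin (ε : ℤˣ) (ν : ℂ) (n : ℤ) : SmoothPS (-ε) (-ν) →ₗ[ℂ] ℂ where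
  toFun φ := (-1 / (2 * Real.pi * Complex.I * n)) ^ regOrder ν *
    ∫ x : ℝ, eExp (n * x) * iteratedDeriv (regOrder ν) (slice φ 1) x
  map_add' φ ψ := by
    have hk : 1 ≤ -(-ν).re + regOrder ν := by simpa using regOrder_spec ν
    simp only [iteratedDeriv_slice_add, mul_add]
    rw [MeasureTheory.integral_add (fourier_integrable _ hk n φ) (fourier_integrable _ hk n ψ),
      mul_add]
  map_smul' c φ := by
    simp only [iteratedDeriv_slice_smul, mul_left_comm _ c, MeasureTheory.integral_const_mul,
      RingHom.id_apply, smul_eq_mul]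

/-- The continuous functional `fourierLin`. -/
def fourierPos (ε : ℤˣ) (ν : ℂ) (n : ℤ) : DistPS ε ν where
  toLinearMap := fourierLin ε ν n
  cont := by
    have hk : 1 ≤ -(-ν).re + regOrder ν := by simpa using regOrder_spec ν
    obtain ⟨C, -, hC⟩ := tail_bound (-ε) (-ν) (regOrder ν) hk
    have hI : ∀ φ : SmoothPS (-ε) (-ν),
        ‖∫ x : ℝ, eExp (n * x) * iteratedDeriv (regOrder ν) (slice φ 1) x‖ ≤
          (C * ∫ x : ℝ, (1 + x ^ 2)⁻¹) * qnorm (regOrder ν) φ := fun φ => by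
      refine (MeasureTheory.norm_integral_le_of_norm_le
        (integrable_inv_one_add_sq.const_mul (C * qnorm (regOrder ν) φ))
        (Filter.Eventually.of_forall fun x => norm_fourier_integrand n x (hC φ x))).trans
        (le_of_eq ?_)
      rw [MeasureTheory.integral_const_mul]
      ring
    refine continuous_of_bound (fourierLin ε ν n)
      (‖(-1 / (2 * Real.pi * Complex.I * n) : ℂ) ^ regOrder ν‖ *
        (C * ∫ x : ℝ, (1 + x ^ 2)⁻¹)) (regOrder ν) fun φ => ?_
    rw [mul_assoc]
    exact (norm_mul _ _).le.trans (mul_le_mul_of_nonneg_left (hI φ) (norm_nonneg _))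

/-- `h(y) - ∑_{j<k} h^{(j)}(0) y^j / j!`. -/
def taylorRem (k : ℕ) (h : ℝ → ℂ) (y : ℝ) : ℂ :=
  h y - ∑ j ∈ Finset.range k, iteratedDeriv j h 0 * (y : ℂ) ^ j / (j.factorial : ℂ)

lemma taylorRem_bound (k : ℕ) : ∀ (h : ℝ → ℂ) (M : ℝ), ContDiff ℝ ∞ h →
    (∀ y ∈ Set.Icc (-1 : ℝ) 1, ‖iteratedDeriv k h y‖ ≤ M) →
    ∀ y ∈ Set.Icc (-1 : ℝ) 1, ‖taylorRem k h y‖ ≤ M * |y| ^ k := by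
  induction k with
  | zero =>
    intro h M _ hM y hy
    simpa [taylorRem] using hM y hy
  | succ k ih =>
    intro h M hh hM y hy
    have hd : ∀ t : ℝ, HasDerivAt (taylorRem (k + 1) h) (taylorRem k (deriv h) t) t := by
      intro t
      have h1 : HasDerivAt h (deriv h t) t :=
        (hh.differentiable (by simp) t).hasDerivAt
      have h2 : HasDerivAt (fun y : ℝ => ∑ j ∈ Finset.range (k + 1),
          iteratedDeriv j h 0 * (y : ℂ) ^ j / (j.factorial : ℂ))
          (∑ j ∈ Finset.range (k + 1),
            iteratedDeriv j h 0 * (j * (t : ℂ) ^ (j - 1) * 1) / (j.factorial : ℂ)) t := by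
        refine HasDerivAt.fun_sum fun j _ => ?_
        exact ((((hasDerivAt_id t).ofReal_comp).fun_pow j).const_mul _).div_const _
      refine (h1.sub h2).congr_deriv ?_
      rw [taylorRem, Finset.sum_range_succ']
      simp only [CharP.cast_eq_zero, zero_mul, mul_zero, zero_div, add_zero]
      congr 1
      refine Finset.sum_congr rfl fun j _ => ?_
      rw [← iteratedDeriv_succ', Nat.factorial_succ, Nat.add_sub_cancel]
      have : (j.factorial : ℂ) ≠ 0 := by exact_mod_cast j.factorial_ne_zero
      push_cast
      have : (j : ℂ) + 1 ≠ 0 := by exact_mod_cast j.succ_ne_zero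
      field_simp
    have hb := ih (deriv h) M (contDiff_infty_iff_deriv.1 hh).2
      (fun t ht => by rw [← iteratedDeriv_succ']; exact hM t ht)
    have hM0 : 0 ≤ M := (norm_nonneg _).trans (hM 0 (by simp))
    have hy' : |y| ≤ 1 := abs_le.2 hy
    have hmv := (convex_Icc (-|y|) |y|).norm_image_sub_le_of_norm_hasDerivWithin_le
      (f := taylorRem (k + 1) h) (C := M * |y| ^ k) (x := 0) (y := y)
      (fun t _ => (hd t).hasDerivWithinAt)
      (fun t ht => by
        have ht' : |t| ≤ |y| := abs_le.2 ht
        refine (hb t (abs_le.1 (ht'.trans hy'))).trans ?_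
        gcongr)
      (by simp) (abs_le.1 le_rfl)
    have h0 : taylorRem (k + 1) h 0 = 0 := by
      rw [taylorRem, Finset.sum_range_succ']
      simp
    rw [h0, sub_zero, sub_zero, Real.norm_eq_abs] at hmv
    rw [pow_succ, ← mul_assoc]
    exact hmv

/-- `sgn(-y)^{ε/2}`. -/
def signHalf (ε : ℤˣ) (y : ℝ) : ℂ := if y < 0 then 1 else ((ε : ℤ) : ℂ) * Complex.I

lemma norm_signHalf (ε : ℤˣ) (y : ℝ) : ‖signHalf ε y‖ = 1 := by
  unfold signHalf
  split_ifs
  · simp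
  · rcases Int.units_eq_one_or ε with h | h <;> simp [h]

/-- The integrand of the regularized integral in the chart at infinity. -/
def oneIntegrand (ε : ℤˣ) (ν : ℂ) (φ : SmoothPS (-ε) (-ν)) (y : ℝ) : ℂ :=
  signHalf ε y * ((|y| : ℝ) : ℂ) ^ (ν - 1) * taylorRem (regOrder ν) (slice φ sElt⁻¹) y

lemma oneIntegrand_bound (φ : SmoothPS (-ε) (-ν)) {y : ℝ} (hy : y ∈ Set.Icc (-1 : ℝ) 1) :
    ‖oneIntegrand ε ν φ y‖ ≤ qnorm (regOrder ν) φ := by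
  have hb := taylorRem_bound (regOrder ν) _ _ (slice_smooth φ sElt⁻¹)
    (fun y hy => le_qnorm_s le_rfl φ hy) y hy
  rw [oneIntegrand, norm_mul, norm_mul, norm_signHalf, one_mul]
  rcases eq_or_ne y 0 with rfl | h0
  · have : regOrder ν ≠ 0 := by simp [regOrder]
    rw [abs_zero, zero_pow this, mul_zero] at hb
    rw [norm_le_zero_iff.1 hb, norm_zero, mul_zero]
    exact qnorm_nonneg _ _
  have hp : 0 < |y| := abs_pos.2 h0
  have hy1 : |y| ≤ 1 := abs_le.2 hy
  rw [Complex.norm_cpow_eq_rpow_re_of_pos hp]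
  calc _ ≤ |y| ^ (ν - 1).re * (qnorm (regOrder ν) φ * |y| ^ regOrder ν) := by gcongr
    _ = |y| ^ ((ν - 1).re + regOrder ν) * qnorm (regOrder ν) φ := by
      rw [Real.rpow_add hp, Real.rpow_natCast]
      ring
    _ ≤ 1 * qnorm (regOrder ν) φ := by
      refine mul_le_mul_of_nonneg_right ?_ (qnorm_nonneg _ _)
      refine Real.rpow_le_one hp.le hy1 ?_
      have := regOrder_spec ν
      simp only [Complex.sub_re, Complex.one_re]
      linarith
    _ = _ := one_mul _

lemma oneIntegrand_integrable (φ : SmoothPS (-ε) (-ν)) :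
    IntervalIntegrable (oneIntegrand ε ν φ) MeasureTheory.volume (-1) 1 := by
  rw [intervalIntegrable_iff_integrableOn_Ioc_of_le (by norm_num)]
  have hmeas : Measurable (oneIntegrand ε ν φ) := by
    refine Measurable.mul (Measurable.mul ?_ ?_) ?_
    · exact Measurable.ite measurableSet_Iio measurable_const measurable_const
    · fun_prop
    · refine Measurable.sub (slice_smooth φ _).continuous.measurable ?_
      fun_prop
  refine MeasureTheory.Measure.integrableOn_of_bounded (M := qnorm (regOrder ν) φ) (by simp)
    hmeas.aestronglyMeasurable ?_
  refine (MeasureTheory.ae_restrict_iff' measurableSet_Ioc).2 (Filter.Eventually.of_forall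
    fun y hy => oneIntegrand_bound φ (Set.Ioc_subset_Icc_self hy))

/-- `𝕖_{ε,ν,0} = 𝟙_{ε,ν}` for `ν ∉ {0, -1, -2, …}` (no meaning otherwise): the distribution given
by the function `1` on the chart `x ↦ ñ_x` and by `sgn(-y)^{ε/2} |y|^{ν-1}` on the chart
`y ↦ s̃⁻¹ ñ_y`. It is a convergent integral for `Re ν > 0`, and is continued meromorphically to
the other `ν` by subtracting a Taylor polynomial (the finite part). -/
def oneLin (ε : ℤˣ) (ν : ℂ) : SmoothPS (-ε) (-ν) →ₗ[ℂ] ℂ where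
  toFun φ := (∫ x : ℝ in (-1)..1, slice φ 1 x) +
    (∫ y : ℝ in (-1)..1, oneIntegrand ε ν φ y) +
    ∑ j ∈ Finset.range (regOrder ν), iteratedDeriv j (slice φ sElt⁻¹) 0 / (j.factorial : ℂ) *
      ((((ε : ℤ) : ℂ) * Complex.I + (-1) ^ j) / (ν + j))
  map_add' φ ψ := by
    have e0 : ∀ x, slice (φ + ψ) 1 x = slice φ 1 x + slice ψ 1 x :=
      fun x => iteratedDeriv_slice_add 0 1 φ ψ x
    have e1 : ∀ y, slice (φ + ψ) sElt⁻¹ y = slice φ sElt⁻¹ y + slice ψ sElt⁻¹ y :=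
      fun x => iteratedDeriv_slice_add 0 _ φ ψ x
    have e2 : ∀ y, oneIntegrand ε ν (φ + ψ) y = oneIntegrand ε ν φ y + oneIntegrand ε ν ψ y := by
      intro y
      simp only [oneIntegrand, taylorRem, e1, iteratedDeriv_slice_add, add_mul, add_div,
        Finset.sum_add_distrib]
      ring
    have hc : ∀ φ : SmoothPS (-ε) (-ν),
        IntervalIntegrable (slice φ 1) MeasureTheory.volume (-1) 1 := fun φ =>
      (slice_smooth φ 1).continuous.intervalIntegrable _ _
    simp only [e0, e2, iteratedDeriv_slice_add, add_div, add_mul, Finset.sum_add_distrib]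
    rw [intervalIntegral.integral_add (hc φ) (hc ψ),
      intervalIntegral.integral_add (oneIntegrand_integrable φ) (oneIntegrand_integrable ψ)]
    ring
  map_smul' c φ := by
    have e0 : ∀ x, slice (c • φ) 1 x = c * slice φ 1 x :=
      fun x => iteratedDeriv_slice_smul 0 1 c φ x
    have e1 : ∀ y, slice (c • φ) sElt⁻¹ y = c * slice φ sElt⁻¹ y :=
      fun x => iteratedDeriv_slice_smul 0 _ c φ x
    have e2 : ∀ y, oneIntegrand ε ν (c • φ) y = c * oneIntegrand ε ν φ y := by
      intro y
      simp only [oneIntegrand, taylorRem, e1, iteratedDeriv_slice_smul, mul_assoc, mul_div_assoc,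
        ← Finset.mul_sum, ← mul_sub]
      ring
    simp only [e0, e2, iteratedDeriv_slice_smul, mul_assoc, mul_div_assoc, ← Finset.mul_sum,
      intervalIntegral.integral_const_mul, RingHom.id_apply, smul_eq_mul, mul_add]

/-- The continuous functional `oneLin`. -/
def oneDist (ε : ℤˣ) (ν : ℂ) : DistPS ε ν where
  toLinearMap := oneLin ε ν
  cont := by
    refine continuous_of_bound (oneLin ε ν) (2 + 2 + ∑ j ∈ Finset.range (regOrder ν),
      ‖(((ε : ℤ) : ℂ) * Complex.I + (-1) ^ j) / (ν + j)‖) (regOrder ν) fun φ => ?_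
    rw [add_mul, add_mul]
    refine norm_add₃_le.trans (add_le_add_three ?_ ?_ ?_)
    · refine (intervalIntegral.norm_integral_le_of_norm_le_const (C := qnorm (regOrder ν) φ)
        fun x hx => ?_).trans (le_of_eq ?_)
      · rw [Set.uIoc_of_le (by norm_num)] at hx
        exact le_qnorm_one (Nat.zero_le _) φ (Set.Ioc_subset_Icc_self hx)
      · norm_num
        ring
    · refine (intervalIntegral.norm_integral_le_of_norm_le_const (C := qnorm (regOrder ν) φ)
        fun x hx => ?_).trans (le_of_eq ?_)
      · rw [Set.uIoc_of_le (by norm_num)] at hx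
        exact oneIntegrand_bound φ (Set.Ioc_subset_Icc_self hx)
      · norm_num
        ring
    · rw [Finset.sum_mul]
      refine norm_sum_le_of_le _ fun j hj => ?_
      rw [norm_mul, mul_comm]
      refine mul_le_mul_of_nonneg_left ?_ (norm_nonneg _)
      rw [norm_div, Complex.norm_natCast]
      refine (div_le_self (norm_nonneg _) ?_).trans
        (le_qnorm_s (Finset.mem_range.1 hj).le φ (by simp))
      exact_mod_cast j.factorial_pos

/-- The distributions `𝕖_{ε,ν,n}`. -/
def fourierDist (ε : ℤˣ) (ν : ℂ) (n : ℤ) : DistPS ε ν :=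
  if n = 0 then oneDist ε ν else fourierPos ε ν n

/-- The Kronecker symbol `(a/n)`. -/
def kronecker (a n : ℤ) : ℤ :=
  if n = 0 then (if a = 1 ∨ a = -1 then 1 else 0)
  else (if n < 0 ∧ a < 0 then -1 else 1) * ZMod.χ₈ (a : ZMod 8) ^ n.natAbs.factorization 2 *
    jacobiSym a (n.natAbs / 2 ^ n.natAbs.factorization 2)

/-- The set `Γ̃₁(4)` of all `((a, b; c, d), (c/d))` with integers `a, b, c, d`, where
`a ≡ d ≡ 1` and `c ≡ 0` modulo `4`. -/
def gamma1Four : Set Mp :=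
  {γ | ∃ a b c d : ℤ, (γ.mat : Matrix (Fin 2) (Fin 2) ℝ) = !![(a : ℝ), (b : ℝ); (c : ℝ), (d : ℝ)] ∧
    a ≡ 1 [ZMOD 4] ∧ d ≡ 1 [ZMOD 4] ∧ c ≡ 0 [ZMOD 4] ∧ (γ.sgn : ℤ) = kronecker c d}

lemma nElt_mul (x y : ℝ) : nElt x * nElt y = nElt (x + y) := by
  obtain ⟨e, s⟩ := mul_sgn_of (coe_n x) (coe_n y)
  ext1
  · refine Subtype.ext ?_
    rw [e, coe_n]
    simp [add_comm]
  · rw [s]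
    simp [nElt, hilb, (zero_lt_one (α := ℝ)).not_gt]

/-- The group `Γ̃_∞ = {ñ_n : n ∈ ℤ}`. -/
def gammaInf : Subgroup Mp where
  carrier := {γ | ∃ n : ℤ, γ = nElt n}
  one_mem' := ⟨0, by rw [Int.cast_zero, nElt_zero]⟩
  mul_mem' := by
    rintro _ _ ⟨m, rfl⟩ ⟨n, rfl⟩
    exact ⟨m + n, by rw [nElt_mul, Int.cast_add]⟩
  inv_mem' := by
    rintro _ ⟨n, rfl⟩
    refine ⟨-n, inv_eq_of_mul_eq_one_right ?_⟩
    rw [nElt_mul, ← Int.cast_add, add_neg_cancel, Int.cast_zero, nElt_zero]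

/-- The cosets `γ Γ̃_∞` with `γ ∈ Γ̃₁(4)`, that is, `Γ̃₁(4) / Γ̃_∞`. -/
def EisCosets : Type := {q : Mp ⧸ gammaInf // ∃ γ ∈ gamma1Four, (QuotientGroup.mk γ) = q}

/-- `ζ₂(s) = (1 - 2^{-s}) ζ(s)`. -/
def zeta2 (s : ℂ) : ℂ := (1 - 2 ^ (-s)) * riemannZeta s

/-- The term `π(γ) δ_{ε,ν,∞}` of the Eisenstein series; it only depends on the coset of `γ`,
since `δ_{ε,ν,∞}` is invariant under `Γ̃_∞`. -/
def eisTerm (ε : ℤˣ) (ν : ℂ) (q : EisCosets) : DistPS ε ν := piDist ε ν q.1.out (deltaInf ε ν)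

/-- The metaplectic Eisenstein distribution at `∞`, for `Re ν > 1`:
`ζ₂(2ν+1) ∑ π(γ) δ_{ε,ν,∞}` over `γ ∈ Γ̃₁(4) / Γ̃_∞`. -/
def eisensteinInf (ε : ℤˣ) (ν : ℂ) : DistPS ε ν :=
  zeta2 (2 * ν + 1) • ∑' q : EisCosets, eisTerm ε ν q

/-- `c = ∫₀¹ F₀(x) e(-nx) dx` for a distribution `F` whose restriction `F₀` to the chart
`x ↦ ñ_x` has period `1`: the integral over a period is the value of `F₀` at `χ(x) e(-nx)`, for
any test function `χ` whose integer translates sum to `1`. -/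
def IsFourierCoeff (F : DistPS ε ν) (n : ℤ) (c : ℂ) : Prop :=
  ∀ χ : ℝ → ℂ, ContDiff ℝ ∞ χ → HasCompactSupport χ →
    (∀ x : ℝ, HasSum (fun k : ℤ => χ (x + k)) 1) →
    ∀ φ : SmoothPS (-ε) (-ν), (∀ x : ℝ, φ (nElt x) = χ x * eExp (-n * x)) → F φ = c

/-- The elements of `K̃`, the preimage of `SO(2)`. -/
def IsCompactElt (g : Mp) : Prop :=
  (g.mat : Matrix (Fin 2) (Fin 2) ℝ) * (g.mat : Matrix (Fin 2) (Fin 2) ℝ).transpose = 1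

/-- Flat sections: families of elements of the spaces `V^∞_{ε,ν}`, one for each `ν`, whose
restriction to `K̃` does not depend on `ν`. Restriction to `K̃` identifies each `V^∞_{ε,ν}` with
one and the same space of functions on `K̃`. -/
def FlatSection (ε : ℤˣ) : Type :=
  {Φ : ∀ ν : ℂ, SmoothPS ε ν // ∀ g : Mp, IsCompactElt g → ∀ ν ν' : ℂ, Φ ν g = Φ ν' g}

/-- The pairing of `F_ν` with a flat section, as a function of `ν`. -/
def pairFlat (F : ∀ ν : ℂ, DistPS ε ν) (Φ : FlatSection (-ε)) (ν : ℂ) : ℂ := F ν (Φ.1 (-ν))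

/-- The family `F_ν` of distributions depends holomorphically on `ν ∈ U` (`U` open). -/
def HolomorphicFamily (F : ∀ ν : ℂ, DistPS ε ν) (U : Set ℂ) : Prop :=
  ∀ Φ : FlatSection (-ε), DifferentiableOn ℂ (pairFlat F Φ) U

/-- `(ν - z) F_ν` tends to `R` as `ν → z`. For a family that is holomorphic in a punctured
neighbourhood of `z` this says that `z` is at most a simple pole, and that `R` is the residue. -/
def HasSimpleResidue (F : ∀ ν : ℂ, DistPS ε ν) (z : ℂ) (R : DistPS ε z) : Prop :=
  ∀ Φ : FlatSection (-ε),
    Filter.Tendsto (fun ν : ℂ => (ν - z) * pairFlat F Φ ν) (𝓝[≠] z) (𝓝 (R (Φ.1 (-z))))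

end Metaplectic

end

open Metaplectic

open scoped ContDiff Topology

/-! Unfold the Eisenstein series into a sum over rational numbers, turn that sum into a Fourier
series by Poisson summation, and continue the coefficients, which are Dirichlet series of Gauss
sums.

Unfolding. A coset in Γ̃₁(4)/Γ̃_∞ is determined by its first column (a, c), with 4 ∣ c, a ≡ 1 (4)
and gcd(a, c) = 1 (`exists_colIndex`). For c ≠ 0 the translate of δ_∞ takes at φ the value (c/d)
|c|^{-ν-1} φ₀(a/c), times εi if c > 0. Since ad ≡ 1 (mod c), quadratic reciprocity makes (c/d) a
function of a that is periodic modulo |c|, does not depend on the sign of c, and vanishes unless a ≡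
1 (4) is prime to c (`kronecker_eq_kron`, `kron_mul_kron`). So a may run over all integers, and
Poisson summation in a gives `tsum_eisVal`: the coefficient of 𝕖_n, before multiplication by
ζ₂(2ν+1), is εi K(n, ν) + K(-n, ν), where K (`kronSeries`) is the sum of c^{-ν-1} times a Gauss sum
over the positive multiples c of 4.

Continuation of the coefficients. The Gauss sums split into a 2-adic and an odd factor that interact
only through the class of the odd part modulo 4 (`kronGauss_eq`). For n ≠ 0 the 2-adic factor is a
finite sum. In the odd factor, multiplication by ζ₂(2ν+1) replaces the irregular Gauss sums of
moduli with square factors by Jacobi symbols (`zeta2_mul_gauss_series`). What remains is a finite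
sum of Dirichlet series in s = ν + 1/2 with periodic coefficients. These continue through Hurwitz
zeta functions, with at most a simple pole at s = 1 and with bounds polynomial in the period
(`exists_entire_periodic`). Hence the coefficients times ν - 1/2 are entire and, locally uniformly
in ν, of polynomial growth in n (`exists_entire_kronSeries`). For n = 0 everything is explicit: K(0,
ν) ζ₂(2ν+1) = 2^{-2ν-2} ζ(2ν).

Convergence. Integration by parts k times bounds 𝕖_n by |n|^{-k} times a continuous seminorm,
locally uniformly in ν (`norm_fourierDist_le`), so the Fourier series converges strongly and is a
holomorphic family (`exists_fourierSeries`).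

The term n = 0 and the poles. The poles of 𝟙_ν at ν = -1, -2, … are cancelled by the trivial zeros
of ζ(2ν). At ν = 0 there is no such zero, and ζ₂(2ν+1) has its pole there as well. At ν = 1/2 the
residue is nonzero because a test function on the chart whose integer translates sum to 1
annihilates all frequencies n ≠ 0 and takes the value (1 + εi)/16 on the constant term
(`residue_half_ne_zero`). -/

namespace Metaplectic

/-! ### Holomorphic parameter integrals, Hurwitz zeta functions, periodic Dirichlet series. -/

section

open MeasureTheory Set Filter

/-- Integrals of dominated holomorphic families are holomorphic. -/
theorem differentiableOn_integral_of_dominated {α : Type*} [MeasurableSpace α] {μ : Measure α}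
    {F : ℂ → α → ℂ} {U : Set ℂ} (hU : IsOpen U)
    (hm : ∀ z ∈ U, AEStronglyMeasurable (F z) μ)
    (hd : ∀ᵐ x ∂μ, DifferentiableOn ℂ (fun z => F z x) U)
    (hb : ∀ z ∈ U, ∃ V ∈ 𝓝 z, ∃ g : α → ℝ, Integrable g μ ∧ ∀ᵐ x ∂μ, ∀ w ∈ V, ‖F w x‖ ≤ g x) :
    DifferentiableOn ℂ (fun z => ∫ x, F z x ∂μ) U := by
  intro z hz
  obtain ⟨V, hV, g, hg, hgb⟩ := hb z hz
  obtain ⟨r, hr, hrs⟩ := Metric.mem_nhds_iff.1 (inter_mem hV (hU.mem_nhds hz))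
  have hd' : ∀ᵐ x ∂μ, ∀ w ∈ Metric.ball z (r / 2),
      HasDerivAt (fun z => F z x) (deriv (fun z => F z x) w) w := by
    filter_upwards [hd] with x hx w hw
    have hwU : w ∈ U := (hrs (Metric.ball_subset_ball (by linarith) hw)).2
    exact ((hx w hwU).differentiableAt (hU.mem_nhds hwU)).hasDerivAt
  -- Cauchy's estimate: circles of radius r/4 about points of the ball of radius r/2 stay inside the
  -- ball of radius r, where g dominates.
  have hbd : ∀ᵐ x ∂μ, ∀ w ∈ Metric.ball z (r / 2),
      ‖deriv (fun z => F z x) w‖ ≤ g x / (r / 4) := by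
    filter_upwards [hd, hgb] with x hx hgx w hw
    have hsub : Metric.closedBall w (r / 4) ⊆ Metric.ball z r := by
      intro v hv
      rw [Metric.mem_ball] at hw ⊢
      rw [Metric.mem_closedBall] at hv
      linarith [dist_triangle v w z]
    refine Complex.norm_deriv_le_of_forall_mem_sphere_norm_le (by positivity) ?_ ?_
    · refine DifferentiableOn.diffContOnCl_ball (U := Metric.ball z r) ?_ hsub
      exact hx.mono fun v hv => (hrs hv).2
    · intro v hv
      exact hgx v (hrs (hsub (Metric.sphere_subset_closedBall hv))).1
  have hzb : z ∈ Metric.ball z (r / 2) := Metric.mem_ball_self (by positivity)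
  have hF' : AEStronglyMeasurable (fun x => deriv (fun z => F z x) z) μ := by
    -- The derivative at z is measurable in x as an almost everywhere limit of difference quotients;
    -- the increments r/(n+2) keep z + u n inside the ball.
    obtain ⟨u, hu⟩ : ∃ u : ℕ → ℂ, (∀ n, z + u n ∈ U ∧ u n ≠ 0) ∧ Tendsto u atTop (𝓝 0) := by
      refine ⟨fun n => ((r / (n + 2) : ℝ) : ℂ), fun n => ⟨(hrs ?_).2, ?_⟩, ?_⟩
      · rw [Metric.mem_ball, dist_eq_norm, add_sub_cancel_left, Complex.norm_real,
          Real.norm_of_nonneg (by positivity), div_lt_iff₀ (by positivity)]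
        nlinarith [Nat.cast_nonneg (α := ℝ) n]
      · exact Complex.ofReal_ne_zero.2 (by positivity)
      · have : Tendsto (fun n : ℕ => r / ((n : ℝ) + 2)) atTop (𝓝 0) :=
          tendsto_const_nhds.div_atTop
            (tendsto_atTop_add_const_right _ _ tendsto_natCast_atTop_atTop)
        exact_mod_cast (Complex.continuous_ofReal.tendsto 0).comp this
    refine aestronglyMeasurable_of_tendsto_ae atTop
      (f := fun n x => (u n)⁻¹ * (F (z + u n) x - F z x)) (fun n => ?_) ?_
    · exact ((hm _ (hu.1 n).1).sub (hm _ hz)).const_mul _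
    · filter_upwards [hd'] with x hx
      have h1 := (hasDerivAt_iff_tendsto_slope_zero.1 (hx z hzb))
      refine h1.comp (tendsto_nhdsWithin_iff.2 ⟨hu.2, Eventually.of_forall fun n => (hu.1 n).2⟩)
  have := hasDerivAt_integral_of_dominated_loc_of_deriv_le (μ := μ) (F := F) (x₀ := z)
    (F' := fun w x => deriv (fun z => F z x) w) (bound := fun x => g x / (r / 4))
    (Metric.ball_mem_nhds z (by positivity : 0 < r / 2)) ?_ ?_ hF' hbd (hg.div_const _) hd'
  · exact this.2.differentiableAt.differentiableWithinAt
  · filter_upwards [hU.mem_nhds hz] with w hw using hm w hw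
  · refine hg.mono' (hm z hz) ?_
    filter_upwards [hgb] with x hx using hx z (mem_of_mem_nhds hV)

lemma isOpen_re_gt (a : ℝ) : IsOpen {s : ℂ | a < s.re} :=
  isOpen_lt continuous_const Complex.continuous_re

/-- The entire function `(s - 1) ζ(s)`. -/
lemma exists_entire_sub_one_mul_zeta : ∃ f : ℂ → ℂ, Differentiable ℂ f ∧
    (∀ s, s ≠ 1 → f s = (s - 1) * riemannZeta s) ∧ f 1 = 1 := by
  refine ⟨Function.update (fun s => (s - 1) * riemannZeta s) 1 1, ?_, fun s hs => ?_, by simp⟩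
  · have hc : ContinuousAt (Function.update (fun s => (s - 1) * riemannZeta s) 1 1) 1 := by
      rw [continuousAt_update_same]
      exact riemannZeta_residue_one
    intro s
    have := (Complex.differentiableOn_compl_singleton_and_continuousAt_iff
      (s := univ) (c := (1 : ℂ)) (f := Function.update (fun s => (s - 1) * riemannZeta s) 1 1)
      univ_mem).1 ⟨?_, hc⟩
    · exact (this s (mem_univ _)).differentiableAt univ_mem
    · intro s hs
      have hs1 : s ≠ 1 := by simpa using hs.2
      have h1 : DifferentiableAt ℂ (fun s => (s - 1) * riemannZeta s) s :=
        (differentiableAt_id.sub_const 1).mul (differentiableAt_riemannZeta hs1)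
      refine (h1.congr_of_eventuallyEq ?_).differentiableWithinAt
      filter_upwards [isOpen_ne.mem_nhds hs1] with t ht
      rw [Function.update_of_ne ht]
  · rw [Function.update_of_ne hs]

/-- Holomorphic functions on an exhausting sequence of half-planes that agree on the first one
come from one entire function. -/
lemma exists_entire_of_halfPlanes {f : ℂ → ℂ} {g : ℕ → ℂ → ℂ}
    (hd : ∀ k : ℕ, DifferentiableOn ℂ (g k) {s | 1 - (k : ℝ) < s.re})
    (hf : ∀ k s, 1 < s.re → g k s = f s) :
    ∃ h : ℂ → ℂ, Differentiable ℂ h ∧ ∀ (k : ℕ) s, 1 - (k : ℝ) < s.re → h s = g k s := by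
  have key : ∀ (k l : ℕ) (s : ℂ), 1 - (k : ℝ) < s.re → 1 - (l : ℝ) < s.re → g k s = g l s := by
    -- The identity theorem on the half-plane of the smaller index: both functions agree with f near
    -- the point 2, which lies in every one of the half-planes.
    have key' : ∀ (k l : ℕ) (s : ℂ), k ≤ l → 1 - (k : ℝ) < s.re → g k s = g l s := by
      intro k l s hkl hs
      have hkl' : (k : ℝ) ≤ l := by exact_mod_cast hkl
      have ho := isOpen_re_gt (1 - k)
      have h1 : AnalyticOnNhd ℂ (g k) {s | 1 - (k : ℝ) < s.re} := (hd k).analyticOnNhd ho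
      have h2 : AnalyticOnNhd ℂ (g l) {s | 1 - (k : ℝ) < s.re} :=
        ((hd l).mono fun s hs => by
          simp only [mem_ofPred_eq] at hs ⊢; linarith).analyticOnNhd ho
      have hk0 : (0 : ℝ) ≤ k := Nat.cast_nonneg k
      refine h1.eqOn_of_preconnected_of_eventuallyEq h2
        (convex_halfSpace_re_gt _).isPreconnected (z₀ := 2) ?_ ?_ hs
      · simp only [mem_ofPred_eq, Complex.re_ofNat]; linarith
      · filter_upwards [(isOpen_re_gt 1).mem_nhds (show (2 : ℂ) ∈ {s : ℂ | 1 < s.re} by simp)]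
          with s hs
        rw [hf k s hs, hf l s hs]
    intro k l s hk hl
    rcases le_total k l with h | h
    · exact key' k l s h hk
    · exact (key' l k s h hl).symm
  have hK : ∀ s : ℂ, 1 - ((⌈1 - s.re⌉₊ + 1 : ℕ) : ℝ) < s.re := fun s => by
    have := Nat.le_ceil (1 - s.re)
    push_cast
    linarith
  have heq : ∀ (k : ℕ) s, 1 - (k : ℝ) < s.re → g (⌈1 - s.re⌉₊ + 1) s = g k s :=
    fun k s hs => key _ _ s (hK s) hs
  refine ⟨fun s => g (⌈1 - s.re⌉₊ + 1) s, fun s => ?_, heq⟩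
  have ho := (isOpen_re_gt (1 - ((⌈1 - s.re⌉₊ + 1 : ℕ) : ℝ))).mem_nhds (hK s)
  refine ((hd (⌈1 - s.re⌉₊ + 1)).differentiableAt ho).congr_of_eventuallyEq ?_
  filter_upwards [ho] with t ht
  exact heq _ t ht

lemma norm_natCast_add_cpow_le {x : ℝ} (hx : 0 ≤ x) {σ : ℝ} {s : ℂ} (hσ : 0 ≤ σ) (hs : σ ≤ s.re)
    (m : ℕ) : ‖((m + 1 + x : ℝ) : ℂ) ^ (-s)‖ ≤ ((m + 1 : ℝ)) ^ (-σ) := by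
  have hm : (0 : ℝ) < m + 1 := by positivity
  rw [Complex.norm_cpow_eq_rpow_re_of_pos (by linarith), Complex.neg_re]
  calc (m + 1 + x) ^ (-s.re) ≤ (m + 1 + x) ^ (-σ) :=
        Real.rpow_le_rpow_of_exponent_le (by linarith [Nat.cast_nonneg (α := ℝ) m]) (by linarith)
    _ ≤ _ := Real.rpow_le_rpow_of_nonpos hm (by linarith) (by linarith)

lemma summable_natCast_add_one_rpow {σ : ℝ} (hσ : 1 < σ) :
    Summable fun m : ℕ => ((m + 1 : ℝ)) ^ (-σ) := by
  have := (summable_nat_add_iff 1).2 (Real.summable_nat_rpow.2 (by linarith : -σ < -1))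
  simpa using this

/-- Termwise differentiation on y > -1/2, an open interval containing the endpoint 0, on which m + 1
+ y ≥ (m + 1)/2 dominates the differentiated series. -/
lemma hurwitz_hasDerivAt {s : ℂ} (hs : 1 < s.re) {x : ℝ} (hx : 0 ≤ x) :
    HasDerivAt (fun y : ℝ => ∑' m : ℕ, ((m + 1 + y : ℝ) : ℂ) ^ (-s))
      (-s * ∑' m : ℕ, ((m + 1 + x : ℝ) : ℂ) ^ (-(s + 1))) x := by
  have hpos : ∀ (m : ℕ) (y : ℝ), y ∈ Ioi (-(1 / 2) : ℝ) → ((m : ℝ) + 1) / 2 ≤ m + 1 + y :=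
    fun m y hy => by
      have : -(1 / 2) < y := hy
      linarith [Nat.cast_nonneg (α := ℝ) m]
  have hsum : Summable fun m : ℕ => ‖s‖ * (((m : ℝ) + 1) / 2) ^ (-(s.re + 1)) := by
    refine Summable.mul_left _ ?_
    have h := (summable_natCast_add_one_rpow (σ := s.re + 1) (by linarith)).mul_right
      (((2 : ℝ)⁻¹) ^ (-(s.re + 1)))
    refine h.congr fun m => ?_
    rw [← Real.mul_rpow (by positivity) (by positivity), div_eq_mul_inv]
  rw [← tsum_mul_left]
  refine hasDerivAt_tsum_of_isPreconnected (t := Ioi (-(1 / 2) : ℝ)) (y₀ := x) hsum isOpen_Ioi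
    isPreconnected_Ioi (g := fun (m : ℕ) (y : ℝ) => ((m + 1 + y : ℝ) : ℂ) ^ (-s))
    (g' := fun (m : ℕ) (y : ℝ) => -s * ((m + 1 + y : ℝ) : ℂ) ^ (-(s + 1)))
    (fun m y hy => ?_) (fun m y hy => ?_) ?_ ?_ ?_
  · have h0 : (0 : ℝ) < m + 1 + y := lt_of_lt_of_le (by positivity) (hpos m y hy)
    have h1 : HasDerivAt (fun y : ℝ => ((m + 1 + y : ℝ) : ℂ)) 1 y := by
      have := ((hasDerivAt_id y).const_add ((m : ℝ) + 1)).ofReal_comp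
      simpa using this
    have h2 := HasDerivAt.comp_ofReal (e := fun z : ℂ => z ^ (-s)) (z := m + 1 + y)
      (hasDerivAt_id _ |>.cpow_const (c := -s) (Or.inl (by simpa using h0)))
    have h3 := h2.scomp y ((hasDerivAt_id y).const_add ((m : ℝ) + 1))
    simp only [Function.comp_def, one_smul, mul_one, id] at h3
    rwa [show -s - 1 = -(s + 1) by ring] at h3
  · have h0 : (0 : ℝ) < m + 1 + y := lt_of_lt_of_le (by positivity) (hpos m y hy)
    rw [norm_mul, norm_neg, Complex.norm_cpow_eq_rpow_re_of_pos h0]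
    refine mul_le_mul_of_nonneg_left ?_ (norm_nonneg _)
    exact Real.rpow_le_rpow_of_nonpos (by positivity) (hpos m y hy) (by simp; linarith)
  · exact mem_Ioi.2 (by linarith)
  · exact Summable.of_norm_bounded (summable_natCast_add_one_rpow hs)
      fun m => norm_natCast_add_cpow_le hx (by linarith) le_rfl m
  · exact mem_Ioi.2 (by linarith)

/-- One step of the continuation of `∑ (m + 1 + x) ^ (-s)`. -/
lemma hurwitz_halfPlane (k : ℕ) : ∃ Z : ℝ → ℂ → ℂ,
    (∀ x ∈ Icc (0 : ℝ) 1, DifferentiableOn ℂ (Z x) {s | 1 - (k : ℝ) < s.re}) ∧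
    (∀ x ∈ Icc (0 : ℝ) 1, ∀ s : ℂ, 1 < s.re →
      Z x s = (s - 1) * ∑' m : ℕ, ((m + 1 + x : ℝ) : ℂ) ^ (-s)) ∧
    (∀ s : ℂ, 1 - (k : ℝ) < s.re → ContinuousOn (fun x => Z x s) (Icc 0 1)) ∧
    (∀ s : ℂ, 1 - (k : ℝ) < s.re → ∃ V ∈ 𝓝 s, ∃ C, ∀ w ∈ V, ∀ x ∈ Icc (0 : ℝ) 1,
      ‖Z x w‖ ≤ C) := by
  induction k with
  | zero =>
    simp only [CharP.cast_eq_zero, sub_zero]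
    refine ⟨fun x s => (s - 1) * ∑' m : ℕ, ((m + 1 + x : ℝ) : ℂ) ^ (-s), fun x hx => ?_,
      fun _ _ _ _ => rfl, fun s hs => ?_, fun s hs => ?_⟩
    · intro s hs
      have hs' : 1 < s.re := hs
      obtain ⟨σ, h1, h2⟩ := exists_between hs'
      have ho := isOpen_re_gt σ
      have := Complex.differentiableOn_tsum_of_summable_norm (summable_natCast_add_one_rpow h1)
        (F := fun (m : ℕ) (s : ℂ) => ((m + 1 + x : ℝ) : ℂ) ^ (-s)) (U := {s : ℂ | σ < s.re})
        (fun m => ?_) ho (fun m w hw => norm_natCast_add_cpow_le hx.1 (by linarith) (le_of_lt hw) m)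
      · have h3 := (this.differentiableAt (ho.mem_nhds h2))
        exact ((differentiableAt_id.sub_const 1).mul h3).differentiableWithinAt
      · have : ((m + 1 + x : ℝ) : ℂ) ≠ 0 := by
          have := hx.1
          exact Complex.ofReal_ne_zero.2 (by positivity)
        exact fun w _ => (differentiableAt_id.neg.const_cpow (Or.inl this)).differentiableWithinAt
    · intro x hx
      exact (continuousAt_const.mul (hurwitz_hasDerivAt hs hx.1).continuousAt).continuousWithinAt
    · obtain ⟨σ, h1, h2⟩ := exists_between hs
      refine ⟨{w | σ < w.re} ∩ Metric.ball s 1,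
        inter_mem ((isOpen_re_gt σ).mem_nhds h2) (Metric.ball_mem_nhds s one_pos),
        (‖s‖ + 2) * ∑' m : ℕ, ((m + 1 : ℝ)) ^ (-σ), fun w hw x hx => ?_⟩
      rw [norm_mul]
      have hw1 : ‖w - 1‖ ≤ ‖s‖ + 2 := by
        have h3 : ‖w - s‖ < 1 := by simpa [dist_eq_norm] using hw.2
        calc ‖w - 1‖ = ‖(w - s) + s - 1‖ := by ring_nf
          _ ≤ ‖w - s‖ + ‖s‖ + ‖(1 : ℂ)‖ := (norm_sub_le _ _).trans (by gcongr; exact norm_add_le _ _)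
          _ ≤ _ := by rw [norm_one]; linarith
      refine mul_le_mul hw1 ?_ (norm_nonneg _) (by positivity)
      exact tsum_of_norm_bounded (summable_natCast_add_one_rpow h1).hasSum
        fun m => norm_natCast_add_cpow_le hx.1 (by linarith) (le_of_lt hw.1) m
  | succ k ih =>
    obtain ⟨Z, hd, hZ, hc, hb⟩ := ih
    obtain ⟨ξ, hξ, hξ1, -⟩ := exists_entire_sub_one_mul_zeta
    have hsh : ∀ s : ℂ, 1 - ((k + 1 : ℕ) : ℝ) < s.re → 1 - (k : ℝ) < (s + 1).re := by
      intro s hs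
      push_cast at hs
      rw [Complex.add_re, Complex.one_re]
      linarith
    have hsub : ∀ x ∈ Icc (0 : ℝ) 1, uIoc 0 x ⊆ Icc (0 : ℝ) 1 := fun x hx => by
      rw [uIoc_of_le hx.1]
      exact fun y hy => ⟨hy.1.le, hy.2.trans hx.2⟩
    have hbd : ∀ s : ℂ, 1 - ((k + 1 : ℕ) : ℝ) < s.re → ∃ V ∈ 𝓝 s, ∃ C, ∀ w ∈ V,
        ∀ x ∈ Icc (0 : ℝ) 1, ‖Z x (w + 1)‖ ≤ C := fun s hs => by
      obtain ⟨V, hV, C, hC⟩ := hb (s + 1) (hsh s hs)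
      exact ⟨(fun w => w + 1) ⁻¹' V, (continuous_add_const 1).continuousAt hV, C,
        fun w hw => hC _ hw⟩
    have hcont : ∀ s : ℂ, 1 - ((k + 1 : ℕ) : ℝ) < s.re →
      IntegrableOn (fun y => Z y (s + 1)) (Icc 0 1) := fun s hs =>
        (hc _ (hsh s hs)).integrableOn_Icc
    -- The x-derivative of the series at s is -s times the series at s + 1, that is -Z x (s + 1):
    -- the factor (s + 1) - 1 built into Z absorbs s. Integrating from 0, where the series is ζ(s),
    -- expresses Z x s by values at s + 1, which are available one unit further to the left.
    refine ⟨fun x s => ξ s - (s - 1) * ∫ y in (0 : ℝ)..x, Z y (s + 1), fun x hx => ?_,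
      fun x hx s hs => ?_, fun s hs => ?_, fun s hs => ?_⟩
    · refine hξ.differentiableOn.sub ((differentiableOn_id.sub_const 1).mul ?_)
      simp only [intervalIntegral.integral_of_le hx.1]
      refine differentiableOn_integral_of_dominated (isOpen_re_gt _) (fun s hs => ?_) ?_
        (fun s hs => ?_)
      · exact ((hcont s hs).mono_set fun y hy =>
          ⟨hy.1.le, hy.2.trans hx.2⟩).aestronglyMeasurable
      · refine (ae_restrict_iff' measurableSet_Ioc).2 (Eventually.of_forall fun y hy => ?_)
        exact (hd y ⟨hy.1.le, hy.2.trans hx.2⟩).comp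
          (differentiableOn_id.add_const 1) fun s hs => hsh s hs
      · obtain ⟨V, hV, C, hC⟩ := hbd s hs
        refine ⟨V, hV, fun _ => C, integrable_const _, ?_⟩
        exact (ae_restrict_iff' measurableSet_Ioc).2 (Eventually.of_forall fun y hy w hw =>
          hC w hw y ⟨hy.1.le, hy.2.trans hx.2⟩)
    · have hs0 : s ≠ 0 := by rintro rfl; simp at hs; linarith
      have hs1 : s ≠ 1 := by rintro rfl; simp at hs
      have h1 : ∀ y ∈ uIcc 0 x, HasDerivAt
          (fun y : ℝ => ∑' m : ℕ, ((m + 1 + y : ℝ) : ℂ) ^ (-s)) (-Z y (s + 1)) y := by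
        intro y hy
        rw [uIcc_of_le hx.1] at hy
        rw [hZ y ⟨hy.1, hy.2.trans hx.2⟩ (s + 1) (by simp; linarith), add_sub_cancel_right,
          ← neg_mul]
        exact hurwitz_hasDerivAt hs hy.1
      have hint : IntervalIntegrable (fun y => -Z y (s + 1)) volume 0 x := by
        have hk : 1 - ((k + 1 : ℕ) : ℝ) < s.re := by
          push_cast
          linarith [Nat.cast_nonneg (α := ℝ) k]
        rw [intervalIntegrable_iff_integrableOn_Ioc_of_le hx.1]
        exact ((hcont s hk).mono_set fun y hy => ⟨hy.1.le, hy.2.trans hx.2⟩).neg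
      have h2 := intervalIntegral.integral_eq_sub_of_hasDerivAt h1 hint
      rw [intervalIntegral.integral_neg] at h2
      have h3 : riemannZeta s = ∑' m : ℕ, ((m + 1 + (0 : ℝ) : ℝ) : ℂ) ^ (-s) := by
        rw [zeta_eq_tsum_one_div_nat_add_one_cpow hs]
        refine tsum_congr fun m => ?_
        rw [Complex.cpow_neg, one_div]
        push_cast
        simp
      change ξ s - (s - 1) * (∫ y in (0 : ℝ)..x, Z y (s + 1)) = _
      linear_combination hξ1 s hs1 + (s - 1) * h3 + (s - 1) * h2
    · refine continuousOn_const.sub (continuousOn_const.mul ?_)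
      have := intervalIntegral.continuousOn_primitive_interval (μ := volume) (a := (0 : ℝ)) (b := 1)
        (f := fun y => Z y (s + 1)) (by rw [uIcc_of_le zero_le_one]; exact hcont s hs)
      rwa [uIcc_of_le zero_le_one] at this
    · obtain ⟨V, hV, C, hC⟩ := hbd s hs
      obtain ⟨M, hM⟩ := (isCompact_closedBall s 1).exists_bound_of_continuousOn
        hξ.continuous.continuousOn
      refine ⟨V ∩ Metric.closedBall s 1, inter_mem hV (Metric.closedBall_mem_nhds s one_pos),
        M + (‖s‖ + 2) * C, fun w hw x hx => ?_⟩
      have hC0 : 0 ≤ C := (norm_nonneg _).trans (hC w hw.1 0 (by simp))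
      refine (norm_sub_le _ _).trans (add_le_add (hM w hw.2) ?_)
      rw [norm_mul]
      have hw1 : ‖w - 1‖ ≤ ‖s‖ + 2 := by
        have h3 : ‖w - s‖ ≤ 1 := by simpa [dist_eq_norm] using hw.2
        calc ‖w - 1‖ = ‖(w - s) + s - 1‖ := by ring_nf
          _ ≤ ‖w - s‖ + ‖s‖ + ‖(1 : ℂ)‖ := (norm_sub_le _ _).trans (by gcongr; exact norm_add_le _ _)
          _ ≤ _ := by rw [norm_one]; linarith
      refine mul_le_mul hw1 ?_ (norm_nonneg _) (by positivity)
      refine (intervalIntegral.norm_integral_le_of_norm_le_const (C := C)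
        fun y hy => hC w hw.1 y (hsub x hx hy)).trans ?_
      rw [sub_zero, abs_of_nonneg hx.1]
      exact mul_le_of_le_one_right hC0 hx.2

/-- The entire functions `(s - 1) ∑ (m + 1 + x) ^ (-s)`, for `0 ≤ x ≤ 1`, are bounded on bounded
sets, uniformly in `x`. -/
theorem exists_entire_hurwitz : ∃ Z : ℝ → ℂ → ℂ,
    (∀ x ∈ Icc (0 : ℝ) 1, Differentiable ℂ (Z x)) ∧
    (∀ x ∈ Icc (0 : ℝ) 1, ∀ s : ℂ, 1 < s.re →
      Z x s = (s - 1) * ∑' m : ℕ, ((m + 1 + x : ℝ) : ℂ) ^ (-s)) ∧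
    ∀ R : ℝ, ∃ C, ∀ s : ℂ, ‖s‖ ≤ R → ∀ x ∈ Icc (0 : ℝ) 1, ‖Z x s‖ ≤ C := by
  choose Z hd hZ hc hb using hurwitz_halfPlane
  have hex : ∀ x : ℝ, ∃ h : ℂ → ℂ, x ∈ Icc (0 : ℝ) 1 → Differentiable ℂ h ∧
      ∀ (k : ℕ) s, 1 - (k : ℝ) < s.re → h s = Z k x s := fun x => by
    by_cases hx : x ∈ Icc (0 : ℝ) 1
    · obtain ⟨h, h1, h2⟩ := exists_entire_of_halfPlanes (fun k => hd k x hx)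
        (fun k s hs => hZ k x hx s hs)
      exact ⟨h, fun _ => ⟨h1, h2⟩⟩
    · exact ⟨0, fun h => absurd h hx⟩
  choose W hW using hex
  refine ⟨W, fun x hx => (hW x hx).1, fun x hx s hs => ?_, fun R => ?_⟩
  · rw [(hW x hx).2 0 s (by simpa using hs), hZ 0 x hx s hs]
  -- Near each s there is a bound uniform in x, but it comes from a number of continuation steps
  -- that depends on s; compactness of the disc produces a single bound.
  · have key : ∃ C, ∀ s ∈ Metric.closedBall (0 : ℂ) R, ∀ x ∈ Icc (0 : ℝ) 1, ‖W x s‖ ≤ C := by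
      refine (isCompact_closedBall (0 : ℂ) R).induction_on (p := fun S =>
        ∃ C, ∀ s ∈ S, ∀ x ∈ Icc (0 : ℝ) 1, ‖W x s‖ ≤ C) ⟨0, by simp⟩ ?_ ?_ ?_
      · rintro S T hST ⟨C, hC⟩
        exact ⟨C, fun s hs => hC s (hST hs)⟩
      · rintro S T ⟨C, hC⟩ ⟨D, hD⟩
        refine ⟨max C D, fun s hs x hx => ?_⟩
        rcases hs with hs | hs
        · exact (hC s hs x hx).trans (le_max_left _ _)
        · exact (hD s hs x hx).trans (le_max_right _ _)
      · intro s _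
        obtain ⟨k, hk⟩ := exists_nat_gt (1 - s.re)
        have hk' : 1 - (k : ℝ) < s.re := by linarith
        obtain ⟨V, hV, C, hC⟩ := hb k s hk'
        refine ⟨V ∩ {s | 1 - (k : ℝ) < s.re}, mem_nhdsWithin_of_mem_nhds
          (inter_mem hV ((isOpen_re_gt _).mem_nhds hk')), C, fun w hw x hx => ?_⟩
        rw [(hW x hx).2 k w hw.2]
        exact hC w hw.1 x hx
    obtain ⟨C, hC⟩ := key
    exact ⟨C, fun s hs => hC s (by simpa using hs)⟩

lemma sum_zmod_val {M : Type*} [AddCommMonoid M] (N : ℕ) [NeZero N] (f : ℕ → M) :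
    ∑ j : ZMod N, f j.val = ∑ j ∈ Finset.range N, f j := by
  obtain _ | n := N
  · exact absurd rfl (NeZero.ne 0)
  · exact (Finset.sum_range f).symm

lemma norm_natCast_cpow_le {R : ℝ} {s : ℂ} (hs : ‖s‖ ≤ R) {m N : ℕ} (hm : 0 < m) (hmN : m ≤ N) :
    ‖(m : ℂ) ^ (-s)‖ ≤ (N : ℝ) ^ ⌈R⌉₊ := by
  rw [Complex.norm_natCast_cpow_of_pos hm, Complex.neg_re, ← Real.rpow_natCast]
  have h1 : (1 : ℝ) ≤ m := by exact_mod_cast hm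
  have h2 : (m : ℝ) ≤ N := by exact_mod_cast hmN
  have h3 : -s.re ≤ ⌈R⌉₊ :=
    ((neg_le_abs _).trans (Complex.abs_re_le_norm s)).trans (hs.trans (Nat.le_ceil R))
  exact (Real.rpow_le_rpow_of_exponent_le h1 h3).trans
    (Real.rpow_le_rpow (by linarith) h2 (Nat.cast_nonneg _))

/-- Continuation of Dirichlet series with periodic coefficients, with a bound that is polynomial in
the period. -/
theorem exists_entire_periodic : ∃ Λ : (N : ℕ) → (ℕ → ℂ) → ℂ → ℂ,
    (∀ (N : ℕ) (Φ : ℕ → ℂ), 0 < N → (∀ m, Φ (m + N) = Φ m) → (∀ m, ‖Φ m‖ ≤ 1) →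
      Differentiable ℂ (Λ N Φ) ∧
      ∀ s : ℂ, 1 < s.re → Λ N Φ s = (s - 1) * ∑' m : ℕ, Φ (m + 1) * ((m + 1 : ℕ) : ℂ) ^ (-s)) ∧
    ∀ R : ℝ, ∃ (C : ℝ) (A : ℕ), ∀ (N : ℕ) (Φ : ℕ → ℂ), 0 < N → (∀ m, ‖Φ m‖ ≤ 1) →
      ∀ s : ℂ, ‖s‖ ≤ R → ‖Λ N Φ s‖ ≤ C * N ^ A := by
  obtain ⟨Z, hZd, hZ, hZb⟩ := exists_entire_hurwitz
  -- Sort the series by residues modulo N. From each class the first term (j + 1)^{-s} is taken out;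
  -- the others are N^{-s} (m + 1 + (j + 1)/N)^{-s}, a Hurwitz series whose shift (j + 1)/N lies in
  -- [0, 1]. The N classes and the powers of integers up to N account for the polynomial bound.
  refine ⟨fun N Φ s => ∑ j ∈ Finset.range N, Φ (j + 1) * ((s - 1) * ((j + 1 : ℕ) : ℂ) ^ (-s) +
    (N : ℂ) ^ (-s) * Z ((j + 1 : ℕ) / N) s), fun N Φ hN hper hΦ => ⟨?_, fun s hs => ?_⟩,
    fun R => ?_⟩
  · have hN' : (N : ℂ) ≠ 0 := by exact_mod_cast hN.ne'
    refine Differentiable.fun_sum fun j hj => ?_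
    have hj : j < N := Finset.mem_range.1 hj
    have hx : (((j + 1 : ℕ) : ℝ) / N) ∈ Icc (0 : ℝ) 1 := by
      refine ⟨by positivity, div_le_one_of_le₀ ?_ (by positivity)⟩
      exact_mod_cast hj
    have hj' : ((j + 1 : ℕ) : ℂ) ≠ 0 := by exact_mod_cast j.succ_ne_zero
    refine Differentiable.const_mul (Differentiable.add ?_ ?_) _
    · exact (differentiable_id.sub_const 1).mul (differentiable_id.neg.const_cpow (Or.inl hj'))
    · exact (differentiable_id.neg.const_cpow (Or.inl hN')).mul (hZd _ hx)
  · have : NeZero N := ⟨hN.ne'⟩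
    have hN0 : (N : ℂ) ≠ 0 := by exact_mod_cast hN.ne'
    have hN1 : (N : ℝ) ≠ 0 := by exact_mod_cast hN.ne'
    have hsum : Summable fun m : ℕ => Φ (m + 1) * ((m + 1 : ℕ) : ℂ) ^ (-s) := by
      refine Summable.of_norm_bounded (summable_natCast_add_one_rpow hs) fun m => ?_
      have := norm_natCast_add_cpow_le (le_refl (0 : ℝ)) (by linarith) (le_refl s.re) m
      rw [norm_mul]
      refine (mul_le_of_le_one_left (norm_nonneg _) (hΦ _)).trans ?_
      simpa using this
    have hper' : ∀ j m, Φ (j + N * m) = Φ j := fun j m => by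
      induction m with
      | zero => simp
      | succ m ih => rw [mul_add, mul_one, ← add_assoc, hper, ih]
    rw [Nat.sumByResidueClasses hsum N, sum_zmod_val N (fun j => ∑' m : ℕ,
      Φ (j + N * m + 1) * ((j + N * m + 1 : ℕ) : ℂ) ^ (-s)), Finset.mul_sum]
    refine Finset.sum_congr rfl fun j hj => ?_
    have hj : j < N := Finset.mem_range.1 hj
    have hx : (((j + 1 : ℕ) : ℝ) / N) ∈ Icc (0 : ℝ) 1 := by
      refine ⟨by positivity, div_le_one_of_le₀ ?_ (by positivity)⟩
      exact_mod_cast hj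
    have hinj : Function.Injective fun m : ℕ => j + N * m := fun a b h => by
      have : N * a = N * b := by simpa using h
      exact Nat.eq_of_mul_eq_mul_left hN this
    have hs2 : Summable fun m : ℕ => Φ (j + N * m + 1) * ((j + N * m + 1 : ℕ) : ℂ) ^ (-s) :=
      hsum.comp_injective hinj
    have h1 : ∀ m : ℕ, Φ (j + N * m + 1) * ((j + N * m + 1 : ℕ) : ℂ) ^ (-s) =
        Φ (j + 1) * ((j + N * m + 1 : ℕ) : ℂ) ^ (-s) := fun m => by
      rw [show j + N * m + 1 = j + 1 + N * m by ring, hper']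
    have h2 : ∀ m : ℕ, ((j + N * (m + 1) + 1 : ℕ) : ℂ) ^ (-s) =
        (N : ℂ) ^ (-s) * ((m + 1 + ((j + 1 : ℕ) : ℝ) / N : ℝ) : ℂ) ^ (-s) := fun m => by
      rw [← Complex.ofReal_natCast N, ← Complex.mul_cpow_ofReal_nonneg (by positivity)
        (by positivity), ← Complex.ofReal_mul]
      congr 1
      push_cast
      field_simp
      ring
    simp only [h1] at hs2 ⊢
    rw [hs2.tsum_eq_zero_add]
    simp only [h2, tsum_mul_left, hZ _ hx s hs]
    simp only [mul_zero, add_zero]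
    ring
  · obtain ⟨C, hC⟩ := hZb R
    refine ⟨|R| + 1 + |C|, ⌈R⌉₊ + 1, fun N Φ hN hΦ s hs => ?_⟩
    have hterm : ∀ j ∈ Finset.range N, ‖Φ (j + 1) * ((s - 1) * ((j + 1 : ℕ) : ℂ) ^ (-s) +
        (N : ℂ) ^ (-s) * Z ((j + 1 : ℕ) / N) s)‖ ≤ (|R| + 1 + |C|) * (N : ℝ) ^ ⌈R⌉₊ := by
      intro j hj
      have hj : j < N := Finset.mem_range.1 hj
      have hx : (((j + 1 : ℕ) : ℝ) / N) ∈ Icc (0 : ℝ) 1 := by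
        refine ⟨by positivity, div_le_one_of_le₀ ?_ (by positivity)⟩
        exact_mod_cast hj
      rw [norm_mul]
      refine (mul_le_of_le_one_left (norm_nonneg _) (hΦ _)).trans ?_
      rw [add_mul]
      refine (norm_add_le _ _).trans (add_le_add ?_ ?_)
      · rw [norm_mul]
        refine mul_le_mul ?_ (norm_natCast_cpow_le hs j.succ_pos hj) (norm_nonneg _)
          (by positivity)
        refine (norm_sub_le _ _).trans ?_
        rw [norm_one]
        linarith [le_abs_self R]
      · rw [norm_mul, mul_comm]
        exact mul_le_mul ((hC s hs _ hx).trans (le_abs_self C))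
          (norm_natCast_cpow_le hs hN le_rfl) (norm_nonneg _) (abs_nonneg _)
    refine (norm_sum_le_of_le _ hterm).trans (le_of_eq ?_)
    rw [Finset.sum_const, Finset.card_range, nsmul_eq_mul]
    ring

/-! ### Theta series near a cusp and the value of the quadratic Gauss sum. -/

lemma tsum_int_residue {f : ℤ → ℂ} (hf : Summable f) (N : ℕ) [NeZero N] :
    ∑' n, f n = ∑ r ∈ Finset.range N, ∑' k : ℤ, f (k * N + r) := by
  have h1 : Summable fun p : Fin N × ℤ => f (p.2 * N + (p.1 : ℕ)) :=
    ((Equiv.prodComm _ _).trans (Int.divModEquiv N).symm).summable_iff.2 hf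
  have h2 := ((Equiv.prodComm _ _).trans (Int.divModEquiv N).symm).tsum_eq f
  rw [← h2, Finset.sum_range]
  exact h1.tsum_prod.trans (tsum_fintype _)

lemma summable_exp_neg_mul_sq {ρ : ℝ} (hρ : 0 < ρ) :
    Summable fun n : ℤ => Real.exp (-Real.pi * ρ * n ^ 2) := by
  refine (summable_pow_mul_jacobiTheta₂_term_bound 0 hρ 0).congr fun n => ?_
  simp
  ring

lemma norm_exp_neg_mul_sq (b : ℂ) (n : ℝ) :
    ‖Complex.exp (-Real.pi * b * n ^ 2)‖ = Real.exp (-Real.pi * b.re * n ^ 2) := by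
  rw [Complex.norm_exp]
  congr 1
  have : (-Real.pi * b * n ^ 2 : ℂ) = ((-Real.pi * n ^ 2 : ℝ) : ℂ) * b := by push_cast; ring
  rw [this, Complex.re_ofReal_mul]
  ring

/-- The behaviour of the theta series over a residue class near the cusp `0`. -/
lemma tendsto_theta_residue {ι : Type*} {l : Filter ι} {b : ι → ℂ}
    (hb : Tendsto (fun i => (1 / b i).re) l atTop) (N : ℕ) [NeZero N] (r : ℤ) :
    Tendsto (fun i => (b i * N ^ 2) ^ (1 / 2 : ℂ) *
      ∑' k : ℤ, Complex.exp (-Real.pi * b i * ((k * N + r : ℤ) : ℝ) ^ 2)) l (𝓝 1) := by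
  have hN : (0 : ℝ) < N := by exact_mod_cast NeZero.pos N
  have hN' : (N : ℂ) ≠ 0 := by exact_mod_cast NeZero.ne N
  have hpos : ∀ᶠ i in l, (N : ℝ) ^ 2 ≤ (1 / b i).re := hb.eventually_ge_atTop _
  have hre : ∀ {z : ℂ}, 0 < (1 / z).re → 0 < z.re ∧ z ≠ 0 := fun {z} hz => by
    have hz0 : z ≠ 0 := by rintro rfl; simp at hz
    rw [one_div, Complex.inv_re] at hz
    exact ⟨by simpa using (div_pos_iff_of_pos_right (Complex.normSq_pos.2 hz0)).1 hz, hz0⟩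
  -- This is the series after inversion. As Re(1/b) tends to infinity only n = 0 survives; once
  -- Re(1/b) ≥ N² the terms are dominated by exp(-π n²).
  have hlim : Tendsto (fun i => ∑' n : ℤ, Complex.exp (-Real.pi * (1 / (b i * N ^ 2)) * (n : ℝ) ^ 2 +
      2 * Real.pi * Complex.I * n * r / N)) l (𝓝 (∑' n : ℤ, if n = 0 then 1 else 0)) := by
    refine tendsto_tsum_of_dominated_convergence (summable_exp_neg_mul_sq one_pos) (fun n => ?_) ?_
    · split_ifs with hn
      · subst hn
        simp only [Int.cast_zero, Complex.ofReal_zero]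
        simp
        exact tendsto_const_nhds
      · rw [tendsto_zero_iff_norm_tendsto_zero]
        have h1 : ∀ i, ‖Complex.exp (-Real.pi * (1 / (b i * N ^ 2)) * (n : ℝ) ^ 2 +
            2 * Real.pi * Complex.I * n * r / N)‖ =
            Real.exp (-((Real.pi * n ^ 2 / N ^ 2) * (1 / b i).re)) := fun i => by
          rw [Complex.exp_add, norm_mul, norm_exp_neg_mul_sq, Complex.norm_exp]
          have e1 : (2 * Real.pi * Complex.I * n * r / N : ℂ) =
            ((2 * Real.pi * n * r / N : ℝ) : ℂ) * Complex.I := by push_cast; ring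
          have e2 : (1 / (b i * N ^ 2) : ℂ) = (((N : ℝ) ^ 2)⁻¹ : ℝ) * (1 / b i) := by
            push_cast
            field_simp
          rw [e1, e2, Complex.re_ofReal_mul, Complex.re_ofReal_mul]
          simp only [Complex.I_re, mul_zero, Real.exp_zero, mul_one]
          congr 1
          ring
        simp only [h1]
        refine Real.tendsto_exp_neg_atTop_nhds_zero.comp (hb.const_mul_atTop ?_)
        have : (n : ℝ) ≠ 0 := by exact_mod_cast hn
        positivity
    · filter_upwards [hpos] with i hi n
      rw [Complex.exp_add, norm_mul, norm_exp_neg_mul_sq, Complex.norm_exp]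
      have e1 : (2 * Real.pi * Complex.I * n * r / N : ℂ) =
        ((2 * Real.pi * n * r / N : ℝ) : ℂ) * Complex.I := by push_cast; ring
      have e2 : (1 / (b i * N ^ 2) : ℂ) = (((N : ℝ) ^ 2)⁻¹ : ℝ) * (1 / b i) := by
        push_cast
        field_simp
      rw [e1, e2, Complex.re_ofReal_mul, Complex.re_ofReal_mul]
      simp only [Complex.I_re, mul_zero, Real.exp_zero, mul_one]
      refine Real.exp_le_exp.2 ?_
      have h2 : 1 ≤ ((N : ℝ) ^ 2)⁻¹ * (1 / b i).re := by
        rw [inv_mul_eq_div, le_div_iff₀ (by positivity)]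
        linarith
      have h3 : 0 ≤ Real.pi * (n : ℝ) ^ 2 := by positivity
      nlinarith
  rw [tsum_ite_eq] at hlim
  refine hlim.congr' ?_
  filter_upwards [hpos] with i hi
  have hb0 := hre (lt_of_lt_of_le (by positivity) hi)
  have ha : 0 < (b i * N ^ 2).re := by
    have : (b i * N ^ 2 : ℂ) = ((N : ℝ) ^ 2 : ℝ) * b i := by push_cast; ring
    rw [this, Complex.re_ofReal_mul]
    exact mul_pos (by positivity) hb0.1
  have hne : (b i * N ^ 2 : ℂ) ^ (1 / 2 : ℂ) ≠ 0 := by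
    rw [Complex.cpow_ne_zero_iff]
    left
    rintro h
    rw [h] at ha
    simp at ha
  -- Inversion with linear coefficient -bNr: completing the square turns the shift by r into the
  -- phases e(nr/N), which have modulus one.
  have key := Complex.tsum_exp_neg_quadratic ha (-(b i * N * r))
  have e1 : ∀ k : ℤ, Complex.exp (-Real.pi * b i * ((k * N + r : ℤ) : ℝ) ^ 2) =
      Complex.exp (-Real.pi * b i * r ^ 2) *
      Complex.exp (-Real.pi * (b i * N ^ 2) * k ^ 2 + 2 * Real.pi * (-(b i * N * r)) * k) :=
    fun k => by
      rw [← Complex.exp_add]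
      congr 1
      push_cast
      ring
  simp only [e1, tsum_mul_left]
  rw [key, ← mul_assoc, ← mul_assoc, mul_comm _ (Complex.exp _), mul_assoc (Complex.exp _),
    mul_one_div_cancel hne, mul_one, ← tsum_mul_left]
  refine tsum_congr fun n => ?_
  rw [← Complex.exp_add]
  congr 1
  have := hb0.2
  push_cast
  field_simp
  ring_nf
  simp only [Complex.I_sq]
  ring

/-- Only the square modulo 4 matters in e(-cn²/4), and it is 0 or 1 according to the parity of n. -/
lemma neg_I_pow_mul_sq (c : ℕ) (k : ℤ) (r : ℕ) (hr : r < 2) :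
    Complex.exp (-Real.pi * (Complex.I * c / 2) * ((k * 2 + r : ℤ) : ℝ) ^ 2) =
      (-Complex.I) ^ (c * r) := by
  have h0 : (-Complex.I) = Complex.exp (-Real.pi * Complex.I / 2) := by
    rw [show (-Real.pi * Complex.I / 2 : ℂ) = -(Real.pi / 2 * Complex.I) by ring, Complex.exp_neg,
      Complex.exp_pi_div_two_mul_I, Complex.inv_I]
  rw [h0, ← Complex.exp_nat_mul, Complex.exp_eq_exp_iff_exists_int]
  interval_cases r
  · refine ⟨-(c * k ^ 2), ?_⟩
    push_cast
    ring
  · refine ⟨-(c * (k ^ 2 + k)), ?_⟩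
    push_cast
    ring

/-- The quadratic Gauss sum, in terms of `(-i)^c`. -/
theorem sum_eExp_sq_div (c : ℕ) (hc : 0 < c) :
    ∑ r ∈ Finset.range c, eExp ((r : ℝ) ^ 2 / c) =
      (1 + (-Complex.I) ^ c) / (-2 * Complex.I / c) ^ (1 / 2 : ℂ) := by
  have : NeZero c := ⟨hc.ne'⟩
  have hc0 : (c : ℂ) ≠ 0 := by exact_mod_cast hc.ne'
  have hcr : (0 : ℝ) < c := by exact_mod_cast hc
  set l : Filter ℝ := 𝓝[>] 0
  have hl : ∀ᶠ t in l, (0 : ℝ) < t := self_mem_nhdsWithin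
  have hl0 : Tendsto (fun t : ℝ => (t : ℂ)) l (𝓝 0) :=
    (Complex.continuous_ofReal.tendsto 0).mono_left nhdsWithin_le_nhds
  -- The theta series with parameter t - 2i/c is evaluated twice as t → 0+. Its phases e(n²/c)
  -- depend on n modulo c, which gives the Gauss sum; after inversion the phases depend on n modulo
  -- 2, which gives 1 + (-i)^c.
  set a : ℝ → ℂ := fun t => t + -2 * Complex.I / c with ha
  set w : ℝ → ℂ := fun t => 1 / (1 + Complex.I * c * t / 2) with hw
  have hwne : ∀ t : ℝ, 1 + Complex.I * c * t / 2 ≠ 0 := fun t h => by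
    have := congrArg Complex.re h
    simp at this
  have hwl : Tendsto w l (𝓝 1) := by
    have h1 : Tendsto (fun t : ℝ => 1 + Complex.I * c * t / 2) l (𝓝 (1 + Complex.I * c * 0 / 2)) :=
      ((hl0.const_mul _).div_const _).const_add _
    have h2 : Tendsto w l (𝓝 (1 / (1 + Complex.I * c * 0 / 2))) :=
      tendsto_const_nhds.div h1 (by simp)
    rwa [mul_zero, zero_div, add_zero, div_one] at h2
  have hal : Tendsto a l (𝓝 (-2 * Complex.I / c)) := by
    have h := hl0.add_const (-2 * Complex.I / (c : ℂ))
    rwa [zero_add] at h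
  have hslit : (-2 * Complex.I / c : ℂ) ∈ Complex.slitPlane := by
    refine Or.inr ?_
    rw [Complex.div_natCast_im]
    simp [hc.ne']
  -- Chosen so that 1/a = b + ic/2. The summand ic/2 carries the phases modulo 2, and Re(1/b) =
  -- 4/(c² t) tends to infinity.
  set b : ℝ → ℂ := fun t => t * c ^ 2 * w t / 4 with hb
  have hbinv : ∀ t : ℝ, 0 < t → 1 / b t = ((4 / (c ^ 2 * t) : ℝ) : ℂ) + 2 / c * Complex.I := by
    intro t ht
    have ht0 : (t : ℂ) ≠ 0 := by exact_mod_cast ht.ne'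
    have := hwne t
    simp only [hb, hw]
    push_cast
    field_simp
    ring
  have hainv : ∀ t : ℝ, 0 < t → 1 / a t = b t + Complex.I * c / 2 := by
    intro t ht
    have ht0 : a t ≠ 0 := fun h => by
      have := congrArg Complex.re h
      simp [ha, Complex.div_natCast_re] at this
      linarith
    have h1 := hwne t
    rw [div_eq_iff ht0]
    simp only [hb, hw, ha]
    generalize hq : 1 + Complex.I * c * t / 2 = q at h1
    have ht1 : (t : ℂ) = -2 * Complex.I * (q - 1) / c := by
      rw [← hq]
      field_simp
      ring_nf
      simp only [Complex.I_sq]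
      ring
    rw [ht1]
    field_simp
    ring_nf
    simp only [Complex.I_sq]
    ring
  have hbre : Tendsto (fun t => (1 / b t).re) l atTop := by
    have h1 : Tendsto (fun t : ℝ => 4 / c ^ 2 * t⁻¹) l atTop :=
      tendsto_inv_nhdsGT_zero.const_mul_atTop (by positivity)
    refine h1.congr' ?_
    filter_upwards [hl] with t ht
    rw [hbinv t ht, Complex.add_re, Complex.ofReal_re]
    have : (2 / (c : ℂ) * Complex.I).re = 0 := by
      rw [show (2 / (c : ℂ) * Complex.I) = ((2 / c : ℝ) : ℂ) * Complex.I by push_cast; ring]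
      simp
    rw [this, add_zero]
    field_simp
  have htre : Tendsto (fun t : ℝ => (1 / (t : ℂ)).re) l atTop := by
    refine tendsto_inv_nhdsGT_zero.congr fun t => ?_
    rw [one_div, ← Complex.ofReal_inv, Complex.ofReal_re]
  have hare : ∀ t : ℝ, 0 < t → 0 < (a t).re := fun t ht => by
    simp [ha, Complex.div_natCast_re, ht]
  -- first evaluation
  have e1 : ∀ t : ℝ, 0 < t → (∑' n : ℤ, Complex.exp (-Real.pi * a t * n ^ 2)) =
      ∑ r ∈ Finset.range c, eExp ((r : ℝ) ^ 2 / c) *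
        ∑' k : ℤ, Complex.exp (-Real.pi * t * ((k * c + (r : ℤ) : ℤ) : ℝ) ^ 2) := by
    intro t ht
    have hsum : Summable fun n : ℤ => Complex.exp (-Real.pi * a t * n ^ 2) := by
      refine Summable.of_norm ((summable_exp_neg_mul_sq (hare t ht)).congr fun n => ?_)
      exact_mod_cast (norm_exp_neg_mul_sq (a t) n).symm
    rw [tsum_int_residue hsum c]
    refine Finset.sum_congr rfl fun r _ => ?_
    rw [← tsum_mul_left]
    refine tsum_congr fun k => ?_
    rw [eExp, ← Complex.exp_add, Complex.exp_eq_exp_iff_exists_int]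
    refine ⟨k ^ 2 * c + 2 * k * r, ?_⟩
    simp only [ha]
    push_cast
    field_simp
    ring
  have e2 : ∀ t : ℝ, 0 < t → (∑' n : ℤ, Complex.exp (-Real.pi * a t * n ^ 2)) =
      1 / a t ^ (1 / 2 : ℂ) * ∑ r ∈ Finset.range 2, (-Complex.I) ^ (c * r) *
        ∑' k : ℤ, Complex.exp (-Real.pi * b t * ((k * (2 : ℕ) + (r : ℤ) : ℤ) : ℝ) ^ 2) := by
    intro t ht
    have h1 := Complex.tsum_exp_neg_quadratic (hare t ht) 0
    simp only [mul_zero, zero_mul, add_zero] at h1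
    rw [h1]
    congr 1
    have hsum : Summable fun n : ℤ => Complex.exp (-Real.pi / a t * n ^ 2) := by
      have hre : 0 < (1 / a t).re := by
        rw [one_div, Complex.inv_re]
        refine div_pos (hare t ht) (Complex.normSq_pos.2 fun h => ?_)
        have := hare t ht
        simp [h] at this
      refine Summable.of_norm ((summable_exp_neg_mul_sq hre).congr fun n => ?_)
      rw [div_eq_mul_one_div (-(Real.pi : ℂ))]
      exact_mod_cast (norm_exp_neg_mul_sq (1 / a t) n).symm
    rw [tsum_int_residue hsum 2]
    refine Finset.sum_congr rfl fun r hr => ?_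
    rw [← tsum_mul_left]
    refine tsum_congr fun k => ?_
    have h3 := neg_I_pow_mul_sq c k r (Finset.mem_range.1 hr)
    rw [← h3, ← Complex.exp_add, div_eq_mul_one_div (-(Real.pi : ℂ)), hainv t ht]
    congr 1
    push_cast
    ring
  have t1 : Tendsto (fun t : ℝ => ((t : ℂ) * c ^ 2) ^ (1 / 2 : ℂ) *
      ∑' n : ℤ, Complex.exp (-Real.pi * a t * n ^ 2)) l
      (𝓝 (∑ r ∈ Finset.range c, eExp ((r : ℝ) ^ 2 / c) * 1)) := by
    refine (tendsto_finsetSum (Finset.range c) fun r _ =>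
      (tendsto_theta_residue htre c r).const_mul (eExp ((r : ℝ) ^ 2 / c))).congr' ?_
    filter_upwards [hl] with t ht
    rw [e1 t ht, Finset.mul_sum]
    exact Finset.sum_congr rfl fun r _ => by ring
  have t2 : Tendsto (fun t : ℝ => ((t : ℂ) * c ^ 2) ^ (1 / 2 : ℂ) *
      ∑' n : ℤ, Complex.exp (-Real.pi * a t * n ^ 2)) l
      (𝓝 ((∑ r ∈ Finset.range 2, (-Complex.I) ^ (c * r) * 1) /
        ((-2 * Complex.I / c) ^ (1 / 2 : ℂ) * 1 ^ (1 / 2 : ℂ)))) := by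
    have h1 := (hal.cpow tendsto_const_nhds hslit (g := fun _ => (1 / 2 : ℂ))).mul
      (hwl.cpow tendsto_const_nhds Complex.one_mem_slitPlane (g := fun _ => (1 / 2 : ℂ)))
    have h2 := (tendsto_finsetSum (Finset.range 2) fun r _ =>
      (tendsto_theta_residue hbre 2 r).const_mul ((-Complex.I) ^ (c * r)))
    refine (h2.div h1 ?_).congr' ?_
    · rw [Complex.one_cpow, mul_one, Complex.cpow_ne_zero_iff]
      exact Or.inl (Complex.slitPlane_ne_zero hslit)
    filter_upwards [hl] with t ht
    have hw0 : w t ≠ 0 := one_div_ne_zero (hwne t)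
    -- The principal root of the product splits because t c² is a positive real number.
    have hp : (b t * (2 : ℕ) ^ 2) ^ (1 / 2 : ℂ) =
        ((t : ℂ) * c ^ 2) ^ (1 / 2 : ℂ) * w t ^ (1 / 2 : ℂ) := by
      have hr : 0 < t * (c : ℝ) ^ 2 := by positivity
      have hrc : ((t : ℂ) * c ^ 2) = ((t * (c : ℝ) ^ 2 : ℝ) : ℂ) := by push_cast; ring
      have hr0 : ((t * (c : ℝ) ^ 2 : ℝ) : ℂ) ≠ 0 := Complex.ofReal_ne_zero.2 hr.ne'
      have : b t * (2 : ℕ) ^ 2 = ((t * (c : ℝ) ^ 2 : ℝ) : ℂ) * w t := by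
        simp only [hb]
        push_cast
        ring
      rw [this, hrc, Complex.cpow_def_of_ne_zero (mul_ne_zero hr0 hw0),
        Complex.cpow_def_of_ne_zero hr0, Complex.cpow_def_of_ne_zero hw0,
        Complex.log_ofReal_mul hr hw0, ← Complex.exp_add, Complex.ofReal_log hr.le]
      ring_nf
    have ha0 : a t ^ (1 / 2 : ℂ) ≠ 0 := by
      rw [Complex.cpow_ne_zero_iff]
      left
      intro h
      have := hare t ht
      simp [h] at this
    have hw0' : w t ^ (1 / 2 : ℂ) ≠ 0 := by
      rw [Complex.cpow_ne_zero_iff]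
      exact Or.inl hw0
    rw [e2 t ht, Pi.div_apply, div_eq_iff (mul_ne_zero ha0 hw0')]
    simp only [hp]
    rw [Finset.mul_sum, Finset.mul_sum,
      Finset.sum_mul]
    refine Finset.sum_congr rfl fun r _ => ?_
    field_simp
  have := tendsto_nhds_unique t1 t2
  simpa [Finset.sum_range_succ] using this

/-- `1` or `i`, as `c` is `1` or `3` modulo `4`. -/
noncomputable def gaussSign (c : ℕ) : ℂ := if c % 4 = 1 then 1 else Complex.I

/-- The quadratic Gauss sum of odd modulus. -/
theorem sum_eExp_sq_div_of_odd {c : ℕ} (hc : Odd c) :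
    ∑ r ∈ Finset.range c, eExp ((r : ℝ) ^ 2 / c) = gaussSign c * (Real.sqrt c : ℂ) := by
  have hc0 : (0 : ℝ) < c := by exact_mod_cast hc.pos
  have hs : ((Real.sqrt c : ℝ) : ℂ) ≠ 0 := Complex.ofReal_ne_zero.2 (Real.sqrt_pos.2 hc0).ne'
  have hsq : ((Real.sqrt c : ℝ) : ℂ) ^ 2 = c := by
    rw [← Complex.ofReal_pow, Real.sq_sqrt hc0.le, Complex.ofReal_natCast]
  -- Since -2i = (1 - i)² and 1 - i has positive real part, this exhibits the principal root.
  have h1 : (-2 * Complex.I / c : ℂ) = ((1 - Complex.I) / (Real.sqrt c : ℝ)) ^ 2 := by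
    rw [div_pow, hsq, sub_sq, Complex.I_sq]
    ring
  have h2 : (-2 * Complex.I / c : ℂ) ^ (1 / 2 : ℂ) = (1 - Complex.I) / (Real.sqrt c : ℝ) := by
    rw [h1, one_div, Complex.sq_cpow_two_inv]
    rw [Complex.div_ofReal_re]
    simpa using hc0
  have h3 : (1 - Complex.I) ≠ 0 := fun h => by simpa using congrArg Complex.re h
  have h4 : (-Complex.I) ^ 4 = 1 := by rw [neg_pow, Complex.I_pow_four]; norm_num
  rw [sum_eExp_sq_div c hc.pos, h2, div_div_eq_mul_div, div_eq_iff h3, ← Nat.div_add_mod c 4,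
    pow_add, pow_mul, h4, one_pow, one_mul, Nat.div_add_mod, gaussSign]
  have : c % 4 = 1 ∨ c % 4 = 3 := by
    rcases hc with ⟨k, rfl⟩
    omega
  rcases this with h | h
  · rw [h]
    simp
    ring
  · rw [h]
    simp [pow_succ]
    ring_nf
    simp only [Complex.I_sq]
    ring

end

/-! ### Gauss sums of Jacobi symbols: squarefree odd moduli. -/

section

open scoped NumberTheorySymbols

/-- Sums over a complete residue system. -/
lemma sum_residues {ι : Type*} {s : Finset ι} {g : ι → ℤ} {N : ℕ} (hN : 0 < N)
    (hcard : s.card = N) (hinj : ∀ i ∈ s, ∀ j ∈ s, (N : ℤ) ∣ g i - g j → i = j) {f : ℤ → ℂ}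
    (hf : ∀ x k : ℤ, f (x + N * k) = f x) :
    ∑ i ∈ s, f (g i) = ∑ j ∈ Finset.range N, f (j : ℤ) := by
  have hN' : (N : ℤ) ≠ 0 := by exact_mod_cast hN.ne'
  have hval : ∀ x : ℤ, (((x % N).toNat : ℕ) : ℤ) = x % N := fun x =>
    Int.toNat_of_nonneg (Int.emod_nonneg _ hN')
  have hinj' : Set.InjOn (fun i => (g i % N).toNat) s := by
    intro i hi j hj h
    have h1 := congrArg (fun n : ℕ => (n : ℤ)) h
    simp only [hval] at h1
    exact hinj i hi j hj (Int.ModEq.dvd h1.symm)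
  have himg : s.image (fun i => (g i % N).toNat) = Finset.range N := by
    refine Finset.eq_of_subset_of_card_le ?_ ?_
    · intro n hn
      obtain ⟨i, -, rfl⟩ := Finset.mem_image.1 hn
      rw [Finset.mem_range, ← Int.ofNat_lt, hval]
      exact Int.emod_lt_of_pos _ (by exact_mod_cast hN)
    · rw [Finset.card_image_of_injOn hinj', hcard, Finset.card_range]
  rw [← himg, Finset.sum_image hinj']
  refine Finset.sum_congr rfl fun i _ => ?_
  rw [hval, ← hf (g i % N) (g i / N), Int.emod_add_mul_ediv]

lemma sum_range_mul {f : ℤ → ℂ} (M N : ℕ) (hM : 0 < M) (hN : 0 < N)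
    (hf : ∀ x k : ℤ, f (x + (M * N : ℕ) * k) = f x) :
    ∑ j ∈ Finset.range (M * N), f j =
      ∑ x ∈ Finset.range M, ∑ t ∈ Finset.range N, f (x + M * t) := by
  rw [← Finset.sum_product', ← sum_residues (s := Finset.range M ×ˢ Finset.range N) (g := fun p : ℕ × ℕ => (p.1 : ℤ) + M * p.2)
    (mul_pos hM hN) (by simp) ?_ hf]
  rintro ⟨x, t⟩ h ⟨x', t'⟩ h' hd
  simp only [Finset.mem_product, Finset.mem_range] at h h'
  simp only at hd
  have h1 : (M : ℤ) ∣ (x : ℤ) - x' := by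
    have h2 : (M : ℤ) ∣ ((x : ℤ) + M * t - (x' + M * t')) :=
      (Dvd.intro (N : ℤ) (by push_cast; ring)).trans hd
    have h3 : ((x : ℤ) - x') = ((x : ℤ) + M * t - (x' + M * t')) - M * ((t : ℤ) - t') := by ring
    rw [h3]
    exact dvd_sub h2 (Dvd.intro _ rfl)
  have hx : x = x' := by
    have := Int.eq_zero_of_abs_lt_dvd h1 (by rw [abs_lt]; constructor <;> omega)
    omega
  subst hx
  have h4 : (M : ℤ) * N ∣ M * ((t : ℤ) - t') := by
    have : (x : ℤ) + M * t - (x + M * t') = M * ((t : ℤ) - t') := by ring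
    rw [this] at hd
    exact_mod_cast hd
  have h5 := (mul_dvd_mul_iff_left (by exact_mod_cast hM.ne' : (M : ℤ) ≠ 0)).1 h4
  have := Int.eq_zero_of_abs_lt_dvd h5 (by rw [abs_lt]; constructor <;> omega)
  have : t = t' := by omega
  rw [this]

/-- The Chinese remainder theorem with representatives N x + M y, which split e(·/MN) into e(x/M)
e(y/N). -/
lemma sum_range_mul_coprime {f : ℤ → ℂ} (M N : ℕ) (hM : 0 < M) (hN : 0 < N) (hMN : M.Coprime N)
    (hf : ∀ x k : ℤ, f (x + (M * N : ℕ) * k) = f x) :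
    ∑ j ∈ Finset.range (M * N), f j =
      ∑ x ∈ Finset.range M, ∑ y ∈ Finset.range N, f (N * x + M * y) := by
  rw [← Finset.sum_product', ← sum_residues (s := Finset.range M ×ˢ Finset.range N) (g := fun p : ℕ × ℕ => (N : ℤ) * p.1 + M * p.2)
    (mul_pos hM hN) (by simp) ?_ hf]
  rintro ⟨x, t⟩ h ⟨x', t'⟩ h' hd
  simp only [Finset.mem_product, Finset.mem_range] at h h'
  simp only [Nat.cast_mul] at hd
  have hc : IsCoprime (M : ℤ) N := Nat.isCoprime_iff_coprime.2 hMN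
  have h1 : (M : ℤ) ∣ (x : ℤ) - x' := by
    refine hc.dvd_of_dvd_mul_left ?_
    have h3 : (N : ℤ) * ((x : ℤ) - x') =
      ((N : ℤ) * x + M * t - (N * x' + M * t')) - M * ((t : ℤ) - t') := by ring
    rw [h3]
    exact dvd_sub ((Dvd.intro _ rfl).trans hd) (Dvd.intro _ rfl)
  have h2 : (N : ℤ) ∣ (t : ℤ) - t' := by
    refine hc.symm.dvd_of_dvd_mul_left ?_
    have h3 : (M : ℤ) * ((t : ℤ) - t') =
      ((N : ℤ) * x + M * t - (N * x' + M * t')) - N * ((x : ℤ) - x') := by ring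
    rw [h3]
    exact dvd_sub ((Dvd.intro_left _ rfl).trans hd) (Dvd.intro _ rfl)
  have e1 := Int.eq_zero_of_abs_lt_dvd h1 (by rw [abs_lt]; constructor <;> omega)
  have e2 := Int.eq_zero_of_abs_lt_dvd h2 (by rw [abs_lt]; constructor <;> omega)
  rw [Prod.mk.injEq]
  omega

lemma sum_range_mul_unit {f : ℤ → ℂ} (N : ℕ) (hN : 0 < N) {u : ℤ} (hu : IsCoprime (N : ℤ) u)
    (hf : ∀ x k : ℤ, f (x + N * k) = f x) :
    ∑ j ∈ Finset.range N, f (u * j) = ∑ j ∈ Finset.range N, f j := by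
  refine sum_residues (g := fun j : ℕ => u * (j : ℤ)) hN (by simp) (fun i hi j hj h => ?_) hf
  rw [Finset.mem_range] at hi hj
  rw [← mul_sub] at h
  have := Int.eq_zero_of_abs_lt_dvd (hu.dvd_of_dvd_mul_left h) (by rw [abs_lt]; constructor <;> omega)
  omega

lemma eExp_add (x y : ℝ) : eExp (x + y) = eExp x * eExp y := by
  rw [eExp, eExp, eExp, ← Complex.exp_add]
  push_cast
  ring_nf

lemma eExp_int (n : ℤ) : eExp n = 1 := by
  rw [eExp, Complex.exp_eq_one_iff]
  exact ⟨n, by push_cast; ring⟩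

/-- `e(y / c)`. -/
noncomputable def eDiv (c : ℕ) (y : ℤ) : ℂ := eExp ((y : ℝ) / c)

lemma norm_eDiv (c : ℕ) (y : ℤ) : ‖eDiv c y‖ = 1 := norm_eExp _

lemma eDiv_add (c : ℕ) (x y : ℤ) : eDiv c (x + y) = eDiv c x * eDiv c y := by
  rw [eDiv, eDiv, eDiv, ← eExp_add]
  push_cast
  rw [add_div]

lemma eDiv_mul {c : ℕ} (hc : 0 < c) (k : ℤ) : eDiv c (c * k) = 1 := by
  have : (c : ℝ) ≠ 0 := by exact_mod_cast hc.ne'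
  rw [eDiv, ← eExp_int k]
  push_cast
  rw [mul_div_cancel_left₀ _ this]

lemma eDiv_mul_mul {c : ℕ} (hc : 0 < c) (d : ℕ) (y : ℤ) : eDiv (c * d) (c * y) = eDiv d y := by
  have : (c : ℝ) ≠ 0 := by exact_mod_cast hc.ne'
  rw [eDiv, eDiv]
  push_cast
  rw [mul_div_mul_left _ _ this]

lemma eDiv_mul_add {c : ℕ} (hc : 0 < c) (m x k : ℤ) : eDiv c (m * (x + c * k)) = eDiv c (m * x) := by
  rw [show m * (x + c * k) = m * x + c * (m * k) by ring, eDiv_add, eDiv_mul hc, mul_one]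

lemma eDiv_pow (c : ℕ) (m : ℤ) (t : ℕ) : eDiv c (m * t) = eDiv c m ^ t := by
  rw [eDiv, eDiv, eExp, eExp, ← Complex.exp_nat_mul]
  push_cast
  ring_nf

lemma eDiv_eq_one_iff {c : ℕ} (hc : 0 < c) (m : ℤ) : eDiv c m = 1 ↔ (c : ℤ) ∣ m := by
  refine ⟨fun h => ?_, ?_⟩
  · rw [eDiv, eExp, Complex.exp_eq_one_iff] at h
    obtain ⟨n, hn⟩ := h
    have hc' : (c : ℂ) ≠ 0 := by exact_mod_cast hc.ne'
    have h2 : (2 * Real.pi * Complex.I : ℂ) ≠ 0 := Complex.two_pi_I_ne_zero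
    push_cast at hn
    have h3 : ((m : ℂ) / c) = n := by
      refine mul_left_cancel₀ h2 ?_
      rw [hn]
      ring
    rw [div_eq_iff hc'] at h3
    exact ⟨n, by rw [mul_comm]; exact_mod_cast h3⟩
  · rintro ⟨k, rfl⟩
    exact eDiv_mul hc k

lemma sum_eDiv {k : ℕ} (hk : 0 < k) (m : ℤ) :
    ∑ t ∈ Finset.range k, eDiv k (m * t) = if (k : ℤ) ∣ m then (k : ℂ) else 0 := by
  simp only [eDiv_pow]
  split_ifs with h
  · rw [(eDiv_eq_one_iff hk m).2 h]
    simp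
  · have h1 : eDiv k m ≠ 1 := fun h1 => h ((eDiv_eq_one_iff hk m).1 h1)
    rw [geom_sum_eq h1, ← eDiv_pow, mul_comm, eDiv_mul hk, sub_self, zero_div]

lemma jacobi_add_mul (c : ℕ) (x k : ℤ) : J(x + c * k | c) = J(x | c) :=
  jacobiSym.mod_left' (by simp)

/-- The Gauss sum of the Jacobi symbol modulo `c`. -/
noncomputable def jacobiGauss (m : ℤ) (c : ℕ) : ℂ :=
  ∑ y ∈ Finset.range c, (J(y | c) : ℂ) * eDiv c (m * y)

/-- A residue y has 1 + (y/p) square roots, so the sum of e(x²/p) is the sum of (1 + (y/p)) e(y/p),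
and the part without the symbol vanishes. -/
lemma jacobiGauss_prime_one {p : ℕ} (hp : p.Prime) (hp2 : p ≠ 2) :
    jacobiGauss 1 p = gaussSign p * (Real.sqrt p : ℂ) := by
  have : Fact p.Prime := ⟨hp⟩
  have : NeZero p := ⟨hp.ne_zero⟩
  rw [← sum_eExp_sq_div_of_odd (hp.odd_of_ne_two hp2)]
  have hS : ∀ y : ℤ, eDiv p y = ZMod.stdAddChar (y : ZMod p) := fun y => by
    rw [ZMod.stdAddChar_coe, eDiv, eExp]
    push_cast
    ring_nf
  have h1 : ∑ r ∈ Finset.range p, eExp ((r : ℝ) ^ 2 / p) =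
      ∑ x : ZMod p, ZMod.stdAddChar (x ^ 2) := by
    rw [← sum_zmod_val p fun r => eExp ((r : ℝ) ^ 2 / p)]
    refine Finset.sum_congr rfl fun x _ => ?_
    have := hS ((x.val : ℤ) ^ 2)
    rw [eDiv] at this
    push_cast at this
    rw [this, ZMod.natCast_zmod_val]
  have h2 : jacobiGauss 1 p = ∑ y : ZMod p, (quadraticChar (ZMod p) y : ℂ) * ZMod.stdAddChar y := by
    rw [jacobiGauss, ← sum_zmod_val p fun y : ℕ => (J(y | p) : ℂ) * eDiv p (1 * y)]
    refine Finset.sum_congr rfl fun y _ => ?_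
    rw [one_mul, hS, ← jacobiSym.legendreSym.to_jacobiSym, legendreSym]
    push_cast
    rw [ZMod.natCast_zmod_val]
  have h3 : ∑ y : ZMod p, ZMod.stdAddChar y = (0 : ℂ) :=
    AddChar.sum_eq_zero_of_ne_one (by
      have := ZMod.isPrimitive_stdAddChar p one_ne_zero
      rwa [AddChar.mulShift_one] at this)
  have h4 : ∑ x : ZMod p, (ZMod.stdAddChar (x ^ 2) : ℂ) =
      ∑ y : ZMod p, ((quadraticChar (ZMod p) y + 1 : ℤ) : ℂ) * ZMod.stdAddChar y := by
    rw [← Finset.sum_fiberwise_of_maps_to (s := Finset.univ) (t := Finset.univ)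
      (g := fun x : ZMod p => x ^ 2) (fun _ _ => Finset.mem_univ _)]
    refine Finset.sum_congr rfl fun y _ => ?_
    rw [← quadraticChar_card_sqrts ((ZMod.ringChar_zmod_n p).substr hp2) y,
      Finset.sum_congr rfl (g := fun _ => ZMod.stdAddChar y) fun x hx => by
        rw [(Finset.mem_filter.1 hx).2], Finset.sum_const, nsmul_eq_mul]
    congr 2
    congr 1
    ext x
    simp
  rw [h1, h4, h2]
  push_cast
  simp only [add_mul, one_mul, Finset.sum_add_distrib]
  rw [h3, add_zero]

lemma jacobiGauss_term_periodic {c : ℕ} (hc : 0 < c) (m x k : ℤ) :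
    (J(x + c * k | c) : ℂ) * eDiv c (m * (x + c * k)) = (J(x | c) : ℂ) * eDiv c (m * x) := by
  rw [jacobi_add_mul, eDiv_mul_add hc]

/-- If p ∤ m, substitute y ↦ my and use that (m/p)² = 1. If p ∣ m, both sides vanish because the
quadratic character sums to zero. -/
lemma jacobiGauss_prime {p : ℕ} (hp : p.Prime) (hp2 : p ≠ 2) (m : ℤ) :
    jacobiGauss m p = (J(m | p) : ℂ) * (gaussSign p * (Real.sqrt p : ℂ)) := by
  have : Fact p.Prime := ⟨hp⟩
  have : NeZero p := ⟨hp.ne_zero⟩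
  by_cases hm : (p : ℤ) ∣ m
  · obtain ⟨k, rfl⟩ := hm
    have h0 : J(p * k | p) = 0 := by
      rw [jacobiSym.mod_left, Int.mul_emod_right, jacobiSym.zero_left hp.one_lt]
    rw [h0, jacobiGauss]
    simp only [mul_assoc, eDiv_mul hp.pos, mul_one]
    rw [← sum_zmod_val p fun y : ℕ => (J(y | p) : ℂ)]
    have h1 := quadraticChar_sum_zero (F := ZMod p) ((ZMod.ringChar_zmod_n p).substr hp2)
    have h2 : ∀ y : ZMod p, (J((y.val : ℕ) | p) : ℂ) = (quadraticChar (ZMod p) y : ℂ) := fun y => by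
      rw [← jacobiSym.legendreSym.to_jacobiSym, legendreSym]
      push_cast
      rw [ZMod.natCast_zmod_val]
    simp only [h2]
    rw [Int.cast_zero, zero_mul]
    exact_mod_cast h1
  · have hcop : IsCoprime (p : ℤ) m :=
      (Nat.prime_iff_prime_int.1 hp).coprime_iff_not_dvd.2 hm
    have hJ : J(m | p) * J(m | p) = 1 := by
      have := jacobiSym.sq_one (a := m) (b := p) (by
        rw [Int.gcd_comm]; exact Int.isCoprime_iff_gcd_eq_one.1 hcop)
      rwa [sq] at this
    rw [← jacobiGauss_prime_one hp hp2, jacobiGauss, jacobiGauss,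
      ← sum_range_mul_unit p hp.pos hcop (f := fun y => (J(y | p) : ℂ) * eDiv p (1 * y))
        (jacobiGauss_term_periodic hp.pos 1), Finset.mul_sum]
    refine Finset.sum_congr rfl fun y _ => ?_
    rw [jacobiSym.mul_left, one_mul]
    push_cast
    have : ((J(m | p) : ℤ) : ℂ) * (J(m | p) : ℤ) = 1 := by exact_mod_cast hJ
    linear_combination (-(J(y | p) : ℂ) * eDiv p (m * y)) * this

/-- Quadratic reciprocity: replacing the sign of ab by the product of the signs of a and b costs -1
exactly when both are 3 modulo 4, where i · i = -1. -/
lemma gaussSign_mul {a b : ℕ} (ha : Odd a) (hb : Odd b) (hab : a.Coprime b) :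
    ((J(a | b) * J(b | a) : ℤ) : ℂ) * (gaussSign a * gaussSign b) = gaussSign (a * b) := by
  have h1 := jacobiSym.quadratic_reciprocity_if (Nat.odd_iff.1 ha) (Nat.odd_iff.1 hb)
  have h2 : J(b | a) * J(b | a) = 1 := by
    have := jacobiSym.sq_one (a := b) (b := a) (by
      rw [Int.gcd_natCast_natCast]; exact hab.symm)
    rwa [sq] at this
  rw [← h1]
  rcases Nat.odd_mod_four_iff.1 (Nat.odd_iff.1 ha) with h | h <;>
  rcases Nat.odd_mod_four_iff.1 (Nat.odd_iff.1 hb) with h' | h' <;>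
  simp [gaussSign, h, h', Nat.mul_mod, h2]

/-- Induction on the primes dividing c. The Chinese remainder substitution produces the factor
(a/p)(p/a), which `gaussSign_mul` absorbs; squarefreeness makes p prime to a. -/
theorem jacobiGauss_of_squarefree (c : ℕ) : Odd c → Squarefree c → ∀ m : ℤ,
    jacobiGauss m c = (J(m | c) : ℂ) * (gaussSign c * (Real.sqrt c : ℂ)) := by
  induction c using induction_on_primes with
  | zero => intro h; simp at h
  | one => intro _ _ m; simp [jacobiGauss, gaussSign, eDiv, eExp]
  | prime_mul p a hp ih =>
    intro hodd hsq m
    obtain ⟨hpo, hao⟩ := Nat.odd_mul.1 hodd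
    have hcop := Nat.coprime_of_squarefree_mul hsq
    have hp2 : p ≠ 2 := by rintro rfl; revert hpo; decide
    have ha0 : 0 < a := hao.pos
    have : NeZero p := ⟨hp.ne_zero⟩
    have : NeZero a := ⟨ha0.ne'⟩
    have h1 := jacobiGauss_prime hp hp2 m
    have h2 := ih hao (hsq.squarefree_of_dvd (Dvd.intro_left _ rfl)) m
    have key : jacobiGauss m (p * a) =
        ((J(a | p) * J(p | a) : ℤ) : ℂ) * (jacobiGauss m p * jacobiGauss m a) := by
      rw [jacobiGauss, sum_range_mul_coprime p a hp.pos ha0 hcop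
        (f := fun y => (J(y | p * a) : ℂ) * eDiv (p * a) (m * y))
        (jacobiGauss_term_periodic (mul_pos hp.pos ha0) m), jacobiGauss, jacobiGauss,
        Finset.sum_mul_sum, Finset.mul_sum]
      refine Finset.sum_congr rfl fun x _ => ?_
      rw [Finset.mul_sum]
      refine Finset.sum_congr rfl fun y _ => ?_
      rw [jacobiSym.mul_right, jacobi_add_mul, add_comm ((a : ℤ) * x), jacobi_add_mul,
        jacobiSym.mul_left, jacobiSym.mul_left, mul_add, eDiv_add,
        show m * (p * y) = p * (m * y) by ring, eDiv_mul_mul hp.pos, mul_comm p a,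
        show m * (a * x) = a * (m * x) by ring, eDiv_mul_mul ha0]
      push_cast
      ring
    rw [key, h1, h2, ← gaussSign_mul hpo hao hcop, jacobiSym.mul_right]
    rw [Nat.cast_mul, Real.sqrt_mul (Nat.cast_nonneg p)]
    push_cast
    ring

end

/-! ### Gauss sums of Jacobi symbols: moduli with square factors. -/

section

open scoped NumberTheorySymbols ArithmeticFunction.Moebius

/-- The divisors of f that divide y are those of gcd(y, f), and the Möbius function sums to zero
over them unless the gcd is 1. -/
lemma sum_moebius_dvd {f : ℕ} (hf : 0 < f) (y : ℤ) :
    ∑ δ ∈ f.divisors, (if (δ : ℤ) ∣ y then μ δ else 0) = if y.gcd f = 1 then 1 else 0 := by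
  have h1 : f.divisors.filter (fun δ : ℕ => (δ : ℤ) ∣ y) = (y.gcd f).divisors := by
    ext δ
    rw [Finset.mem_filter, Nat.mem_divisors, Nat.mem_divisors, Int.gcd_eq_natAbs,
      Int.natAbs_natCast, Nat.dvd_gcd_iff, Int.natCast_dvd]
    have := Nat.gcd_ne_zero_right (m := y.natAbs) hf.ne'
    have := hf.ne'
    tauto
  rw [← Finset.sum_filter, h1, ← ArithmeticFunction.coe_mul_zeta_apply,
    ArithmeticFunction.moebius_mul_coe_zeta, ArithmeticFunction.one_apply]

lemma jacobi_mul_sq {c f : ℕ} (hc : 0 < c) (hf : 0 < f) (y : ℤ) :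
    J(y | c * f ^ 2) = if y.gcd f = 1 then J(y | c) else 0 := by
  have : NeZero c := ⟨hc.ne'⟩
  have : NeZero f := ⟨hf.ne'⟩
  rw [jacobiSym.mul_right' y hc.ne' (pow_pos hf 2).ne', jacobiSym.pow_right]
  split_ifs with h
  · rw [jacobiSym.sq_one h, mul_one]
  · rw [jacobiSym.eq_zero_iff_not_coprime.2 h]
    simp

/-- The symbol modulo c f² is the symbol modulo c restricted to y prime to f. Möbius inversion over
δ ∣ f removes this condition, and for each f = δ d orthogonality of additive characters collapses
the sum to a Gauss sum modulo the squarefree c. -/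
theorem jacobiGauss_mul_sq {c f : ℕ} (hc : Odd c) (hsq : Squarefree c) (hf : 0 < f) (m : ℤ) :
    jacobiGauss m (c * f ^ 2) = gaussSign c * (Real.sqrt c : ℂ) * f *
      ∑ x ∈ f.divisorsAntidiagonal,
        if ((x.2 : ℤ) ^ 2 * x.1) ∣ m then ((μ x.1 * x.2 * J(m / x.2 ^ 2 | c) : ℤ) : ℂ) else 0 := by
  have hc0 := hc.pos
  have hF : 0 < c * f ^ 2 := by positivity
  have h1 : jacobiGauss m (c * f ^ 2) = ∑ δ ∈ f.divisors, (μ δ : ℂ) *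
      ∑ y ∈ Finset.range (c * f ^ 2), (if (δ : ℤ) ∣ y then
        (J(y | c) : ℂ) * eDiv (c * f ^ 2) (m * y) else 0) := by
    simp only [Finset.mul_sum]
    rw [Finset.sum_comm, jacobiGauss]
    refine Finset.sum_congr rfl fun y _ => ?_
    have h2 := congrArg (fun z : ℤ => (z : ℂ)) (sum_moebius_dvd hf y)
    simp only [Int.cast_sum] at h2
    rw [jacobi_mul_sq hc0 hf]
    have h3 : ((if (y : ℤ).gcd f = 1 then J(y | c) else 0 : ℤ) : ℂ) =
        ((if (y : ℤ).gcd f = 1 then 1 else 0 : ℤ) : ℂ) * J(y | c) := by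
      split_ifs <;> simp
    rw [h3, ← h2, Finset.sum_mul, Finset.sum_mul]
    refine Finset.sum_congr rfl fun δ _ => ?_
    split_ifs <;> simp [mul_assoc]
  rw [h1, Finset.mul_sum, Nat.sum_divisorsAntidiagonal (f := fun δ d =>
    gaussSign c * (Real.sqrt c : ℂ) * f *
      if ((d : ℤ) ^ 2 * δ) ∣ m then ((μ δ * d * J(m / d ^ 2 | c) : ℤ) : ℂ) else 0)]
  refine Finset.sum_congr rfl fun δ hδ => ?_
  obtain ⟨d, rfl⟩ := (Nat.mem_divisors.1 hδ).1
  have hδ0 : 0 < δ := Nat.pos_of_mul_pos_right hf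
  have hd0 : 0 < d := Nat.pos_of_mul_pos_left hf
  rw [Nat.mul_div_cancel_left _ hδ0]
  -- With f = δ d the modulus is c (δ d)² = δ (c k), so that y = δ y' leaves a sum over y' modulo c
  -- k.
  set k : ℕ := d ^ 2 * δ with hk
  have hk0 : 0 < k := by positivity
  have hck : 0 < c * k := by positivity
  have e1 : c * (δ * d) ^ 2 = δ * (c * k) := by rw [hk]; ring
  have h4 : ∑ y ∈ Finset.range (c * (δ * d) ^ 2), (if (δ : ℤ) ∣ y then
        (J(y | c) : ℂ) * eDiv (c * (δ * d) ^ 2) (m * y) else 0) =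
      ∑ y ∈ Finset.range (c * k), (J(δ * y | c) : ℂ) * eDiv (c * k) (m * y) := by
    rw [e1, ← Finset.sum_filter]
    symm
    refine Finset.sum_nbij (fun y => δ * y) ?_ ?_ ?_ ?_
    · intro y hy
      rw [Finset.mem_filter, Finset.mem_range]
      exact ⟨Nat.mul_lt_mul_of_pos_left (Finset.mem_range.1 hy) hδ0, by simp⟩
    · intro a _ b _ h
      exact Nat.eq_of_mul_eq_mul_left hδ0 h
    · intro y hy
      rw [Finset.coe_filter] at hy
      obtain ⟨hy1, hy2⟩ := hy
      obtain ⟨z, rfl⟩ := Int.natCast_dvd_natCast.1 hy2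
      refine ⟨z, ?_, rfl⟩
      rw [Finset.mem_range] at hy1
      exact Finset.mem_coe.2 (Finset.mem_range.2 (Nat.lt_of_mul_lt_mul_left hy1))
    · intro y _
      push_cast
      rw [show m * (δ * y : ℤ) = δ * (m * y) by ring, eDiv_mul_mul hδ0]
  have h5 : ∑ y ∈ Finset.range (c * k), (J(δ * y | c) : ℂ) * eDiv (c * k) (m * y) =
      if (k : ℤ) ∣ m then (k : ℂ) * (J(δ | c) * jacobiGauss (m / k) c) else 0 := by
    -- Write y' = x + c t: the symbol sees only x, and the sum of e(mt/k) over t modulo k vanishes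
    -- unless k ∣ m.
    rw [sum_range_mul (f := fun y => (J(δ * y | c) : ℂ) * eDiv (c * k) (m * y)) c k hc0 hk0]
    · have h6 : ∀ x t : ℕ, (J(δ * ((x : ℤ) + c * t) | c) : ℂ) * eDiv (c * k) (m * (x + c * t)) =
          (J(δ | c) * J(x | c) : ℂ) * eDiv (c * k) (m * x) * eDiv k (m * t) := fun x t => by
        rw [jacobiSym.mul_left, jacobi_add_mul, mul_add, eDiv_add,
          show m * (c * t : ℤ) = c * (m * t) by ring, eDiv_mul_mul hc0]
        push_cast
        ring
      simp only [h6, ← Finset.mul_sum, sum_eDiv hk0]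
      split_ifs with h
      · obtain ⟨m', rfl⟩ := h
        rw [Int.mul_ediv_cancel_left _ (by exact_mod_cast hk0.ne'), jacobiGauss, Finset.mul_sum,
          Finset.mul_sum]
        refine Finset.sum_congr rfl fun x _ => ?_
        rw [mul_comm c k, show (k : ℤ) * m' * x = k * (m' * x) by ring, eDiv_mul_mul hk0]
        ring
      · simp
    · intro x j
      rw [eDiv_mul_add hck]
      rw [show (δ : ℤ) * (x + (c * k : ℕ) * j) = δ * x + c * (δ * (k * j)) by push_cast; ring,
        jacobi_add_mul]
  rw [h4, h5]
  have hk' : ((d : ℤ) ^ 2 * δ) = (k : ℤ) := by rw [hk]; push_cast; ring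
  rw [hk']
  split_ifs with h
  · obtain ⟨m', rfl⟩ := h
    rw [Int.mul_ediv_cancel_left _ (by exact_mod_cast hk0.ne'),
      jacobiGauss_of_squarefree c hc hsq]
    -- The symbol (δ/c) left by y = δ y' combines with (m'/c) to (δ m'/c), and δ m' = m/d².
    have e2 : (k : ℤ) * m' / d ^ 2 = δ * m' := by
      rw [hk]
      push_cast
      rw [mul_assoc, Int.mul_ediv_cancel_left _ (by positivity)]
    rw [e2, jacobiSym.mul_left, hk]
    push_cast
    ring
  · simp

/-- Summing over square divisors turns Gauss sums into Jacobi symbols. -/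
theorem sum_jacobiGauss_sq_divisors {c f : ℕ} (hc : Odd c) (hsq : Squarefree c) (hf : 0 < f)
    (m : ℤ) : ∑ e ∈ f.divisors, (e : ℂ) * jacobiGauss m (c * (f / e) ^ 2) =
      gaussSign c * (Real.sqrt c : ℂ) * f * ∑ d ∈ f.divisors,
        if (d : ℤ) ^ 2 ∣ m then ((d * J(m / d ^ 2 | c * (f / d) ^ 2) : ℤ) : ℂ) else 0 := by
  have h1 : ∀ e ∈ f.divisors, (e : ℂ) * jacobiGauss m (c * (f / e) ^ 2) =
      gaussSign c * (Real.sqrt c : ℂ) * f * ∑ x ∈ (f / e).divisorsAntidiagonal,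
        if ((x.2 : ℤ) ^ 2 * x.1) ∣ m then ((μ x.1 * x.2 * J(m / x.2 ^ 2 | c) : ℤ) : ℂ) else 0 := by
    intro e he
    obtain ⟨h, rfl⟩ := (Nat.mem_divisors.1 he).1
    have he0 : 0 < e := Nat.pos_of_mul_pos_right hf
    rw [Nat.mul_div_cancel_left _ he0, jacobiGauss_mul_sq hc hsq (Nat.pos_of_mul_pos_left hf)]
    push_cast
    ring
  rw [Finset.sum_congr rfl h1, ← Finset.mul_sum]
  congr 1
  -- The right-hand symbols modulo c (f/d)² get the same Möbius expansion, over δ ∣ f/d.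
  have h2 : ∀ d ∈ f.divisors, (if (d : ℤ) ^ 2 ∣ m then
      ((d * J(m / d ^ 2 | c * (f / d) ^ 2) : ℤ) : ℂ) else 0) =
      ∑ δ ∈ (f / d).divisors, if ((d : ℤ) ^ 2 * δ) ∣ m then
        ((μ δ * d * J(m / d ^ 2 | c) : ℤ) : ℂ) else 0 := by
    intro d hd
    have hd0 : (d : ℤ) ^ 2 ≠ 0 := by
      have := Nat.pos_of_mem_divisors hd
      positivity
    have hfd : 0 < f / d := Nat.div_pos (Nat.divisor_le hd) (Nat.pos_of_mem_divisors hd)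
    split_ifs with h
    · obtain ⟨m', rfl⟩ := h
      rw [Int.mul_ediv_cancel_left _ hd0, jacobi_mul_sq hc.pos hfd]
      have h3 : ((if m'.gcd (f / d : ℕ) = 1 then J(m' | c) else 0 : ℤ) : ℂ) =
        ((if m'.gcd (f / d : ℕ) = 1 then 1 else 0 : ℤ) : ℂ) * J(m' | c) := by
          split_ifs <;> simp
      rw [Int.cast_mul, h3, ← sum_moebius_dvd hfd, Int.cast_sum, Finset.sum_mul, Finset.mul_sum]
      refine Finset.sum_congr rfl fun δ _ => ?_
      simp only [mul_dvd_mul_iff_left hd0]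
      split_ifs
      · push_cast
        ring
      · simp
    · refine (Finset.sum_eq_zero fun δ _ => ?_).symm
      rw [if_neg fun h' => h ((Dvd.intro _ rfl).trans h')]
  -- Both sides are now sums of the same function over the triples with e δ d = f; on the left e is
  -- summed first, on the right d.
  rw [Finset.sum_congr rfl h2, Finset.sum_sigma', Finset.sum_sigma']
  refine Finset.sum_bij' (fun x _ => ⟨x.2.2, x.2.1⟩) (fun x _ => ⟨f / x.1 / x.2, (x.2, x.1)⟩)
    ?_ ?_ ?_ ?_ ?_
  · rintro ⟨e, δ, d⟩ h
    simp only [Finset.mem_sigma, Nat.mem_divisors, Nat.mem_divisorsAntidiagonal] at h ⊢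
    obtain ⟨⟨⟨h, rfl⟩, -⟩, h4, -⟩ := h
    have he0 : 0 < e := Nat.pos_of_mul_pos_right hf
    rw [Nat.mul_div_cancel_left _ he0] at h4
    subst h4
    have hd0 : 0 < d := Nat.pos_of_mul_pos_left (Nat.pos_of_mul_pos_left hf)
    rw [show e * (δ * d) = d * (e * δ) by ring] at hf ⊢
    rw [Nat.mul_div_cancel_left _ hd0]
    exact ⟨⟨Dvd.intro _ rfl, hf.ne'⟩, Dvd.intro_left _ rfl, (Nat.pos_of_mul_pos_left hf).ne'⟩
  · rintro ⟨d, δ⟩ h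
    simp only [Finset.mem_sigma, Nat.mem_divisors, Nat.mem_divisorsAntidiagonal] at h ⊢
    obtain ⟨⟨⟨h, rfl⟩, -⟩, h4, -⟩ := h
    have hd0 : 0 < d := Nat.pos_of_mul_pos_right hf
    rw [Nat.mul_div_cancel_left _ hd0] at h4 ⊢
    obtain ⟨e, rfl⟩ := h4
    have hδ0 : 0 < δ := Nat.pos_of_mul_pos_right (Nat.pos_of_mul_pos_left hf)
    have he0 : 0 < e := Nat.pos_of_mul_pos_left (Nat.pos_of_mul_pos_left hf)
    rw [Nat.mul_div_cancel_left _ hδ0]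
    have e1 : d * (δ * e) = e * (δ * d) := by ring
    refine ⟨⟨⟨δ * d, e1⟩, hf.ne'⟩, ?_, ?_⟩
    · rw [e1, Nat.mul_div_cancel_left _ he0]
    · rw [e1, Nat.mul_div_cancel_left _ he0]
      positivity
  · rintro ⟨e, δ, d⟩ h
    simp only [Finset.mem_sigma, Nat.mem_divisors, Nat.mem_divisorsAntidiagonal] at h ⊢
    obtain ⟨⟨⟨h, rfl⟩, -⟩, h4, -⟩ := h
    have he0 : 0 < e := Nat.pos_of_mul_pos_right hf
    rw [Nat.mul_div_cancel_left _ he0] at h4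
    subst h4
    have hδ0 : 0 < δ := Nat.pos_of_mul_pos_right (Nat.pos_of_mul_pos_left hf)
    have hd0 : 0 < d := Nat.pos_of_mul_pos_left (Nat.pos_of_mul_pos_left hf)
    rw [show e * (δ * d) = d * (δ * e) by ring, Nat.mul_div_cancel_left _ hd0,
      Nat.mul_div_cancel_left _ hδ0]
  · rintro ⟨d, δ⟩ h
    rfl
  · rintro ⟨e, δ, d⟩ h
    rfl

/-- After division by gcd(e, f), the square e'² is prime to f'² and so divides the squarefree c,
which forces e' = 1. -/
lemma dvd_of_sq_dvd_squarefree_mul_sq {c e f : ℕ} (hsq : Squarefree c) (hf : 0 < f)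
    (h : e ^ 2 ∣ c * f ^ 2) : e ∣ f := by
  obtain ⟨g, e', f', hg, hcop, rfl, rfl⟩ := Nat.exists_coprime' (m := e) (n := f)
    (Nat.gcd_pos_of_pos_right _ hf)
  have h1 : e' ^ 2 ∣ c * f' ^ 2 := by
    have : g ^ 2 * e' ^ 2 ∣ g ^ 2 * (c * f' ^ 2) := by
      convert h using 1 <;> ring
    exact (Nat.mul_dvd_mul_iff_left (by positivity)).1 this
  have h2 : e' ^ 2 ∣ c := (hcop.pow 2 2).dvd_of_dvd_mul_right h1
  have h3 : e' = 1 := by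
    have := hsq e' (by rwa [← sq])
    exact Nat.isUnit_iff.1 this
  rw [h3, one_mul]
  exact Dvd.intro_left _ rfl

end

/-! ### The Kronecker symbol as a periodic function; its Gauss sums and their 2-adic factor. -/

section

open scoped NumberTheorySymbols
open ZMod (χ₄ χ₈)

/-- For `c = 2^v c'` with `c'` odd and `v ≥ 2`, the Kronecker symbol `(c/a)` as a function of
`a ≡ 1` modulo `4`. -/
def kron (v c' : ℕ) (a : ℤ) : ℤ := if a % 4 = 1 then χ₈ a ^ v * J(a | c') else 0

lemma chi8_neg (x : ZMod 8) : χ₈ (-x) = χ₈ x := by revert x; decide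

/-- Reciprocity. For d > 0 with d ≡ 1 (4) no sign arises. For d < 0 one has |d| ≡ 3 (4), and the
signs from reciprocity, from (-1/c'), and from the convention for negative arguments cancel. In
particular the sign of c drops out, and the symbol becomes periodic in d. -/
lemma kronecker_eq_kron {v c' : ℕ} (hc' : Odd c') {c d : ℤ} (hc : c.natAbs = 2 ^ v * c')
    (hd : d % 4 = 1) : kronecker c d = kron v c' d := by
  have hd0 : d ≠ 0 := by rintro rfl; simp at hd
  have hdo : Odd d.natAbs := by
    rw [Int.natAbs_odd, Int.odd_iff]
    omega
  have hf : d.natAbs.factorization 2 = 0 :=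
    Nat.factorization_eq_zero_of_not_dvd (fun h => by
      rw [← Nat.not_even_iff_odd, even_iff_two_dvd] at hdo
      exact hdo h)
  have hpow : ∀ b : ℕ, Odd b → J((2 ^ v * c' : ℕ) | b) = χ₈ b ^ v * J(c' | b) := fun b hb => by
    push_cast
    rw [jacobiSym.mul_left, jacobiSym.pow_left, jacobiSym.at_two hb]
  rw [kronecker, if_neg hd0, hf, pow_zero, pow_zero, Nat.div_one, mul_one, kron, if_pos hd]
  have hc'4 := Nat.odd_mod_four_iff.1 (Nat.odd_iff.1 hc')
  rcases lt_or_gt_of_ne hd0 with hneg | hpos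
  · obtain ⟨D, hD⟩ : ∃ D : ℕ, d = -(D : ℤ) := ⟨d.natAbs, by omega⟩
    subst hD
    have hD3 : D % 4 = 3 := by omega
    have hDo : Odd D := by simpa using hdo
    rw [Int.natAbs_neg, Int.natAbs_natCast]
    have h1 : (if -(D : ℤ) < 0 ∧ c < 0 then -1 else 1) * J(c | D) = J((2 ^ v * c' : ℕ) | D) := by
      rcases Int.natAbs_eq c with h | h
      · rw [if_neg (by rintro ⟨-, h2⟩; omega), one_mul, ← hc, ← h]
      · rw [if_pos ⟨hneg, by have := hc'.pos; have : 0 < 2 ^ v * c' := by positivity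
                             omega⟩, ← hc]
        conv_lhs => rw [h]
        rw [jacobiSym.neg _ hDo, ZMod.χ₄_nat_three_mod_four hD3]
        ring
    rw [h1, hpow D hDo, jacobiSym.neg _ hc']
    push_cast
    rw [chi8_neg]
    congr 1
    rw [← jacobiSym.quadratic_reciprocity_if (Nat.odd_iff.1 hc') (Nat.odd_iff.1 hDo)]
    rcases hc'4 with h | h
    · rw [if_neg (by omega), ZMod.χ₄_nat_one_mod_four h, one_mul]
    · rw [if_pos ⟨h, hD3⟩, ZMod.χ₄_nat_three_mod_four h, neg_one_mul]
  · obtain ⟨D, hD⟩ : ∃ D : ℕ, d = (D : ℤ) := ⟨d.natAbs, by omega⟩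
    subst hD
    have hD1 : D % 4 = 1 := by omega
    have hDo : Odd D := by simpa using hdo
    rw [Int.natAbs_natCast, if_neg (by rintro ⟨h, -⟩; omega), one_mul]
    have h1 : J(c | D) = J((2 ^ v * c' : ℕ) | D) := by
      rw [← hc]
      rcases Int.natAbs_eq c with h | h
      · rw [← h]
      · conv_lhs => rw [h]
        rw [jacobiSym.neg _ hDo, ZMod.χ₄_nat_one_mod_four hD1, one_mul]
    rw [h1, hpow D hDo]
    push_cast
    rw [← jacobiSym.quadratic_reciprocity_if (Nat.odd_iff.1 hc') (Nat.odd_iff.1 hDo),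
      if_neg (by omega)]

lemma chi8_add_mul {v : ℕ} (hv : 3 ≤ v) (x k : ℤ) :
    χ₈ ((x + 2 ^ v * k : ℤ) : ZMod 8) = χ₈ (x : ZMod 8) := by
  obtain ⟨u, rfl⟩ := Nat.exists_eq_add_of_le hv
  congr 1
  push_cast
  rw [pow_add, show ((2 : ZMod 8) ^ 3) = 0 by decide]
  ring

lemma chi8_sq {x : ℤ} (hx : x % 2 = 1) : χ₈ (x : ZMod 8) ^ 2 = 1 := by
  have : (x : ZMod 8) = ((x % 8 : ℤ) : ZMod 8) := by
    exact_mod_cast (ZMod.intCast_mod x 8).symm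
  rw [this]
  have h8 : x % 8 = 1 ∨ x % 8 = 3 ∨ x % 8 = 5 ∨ x % 8 = 7 := by omega
  rcases h8 with h | h | h | h <;> rw [h] <;> decide

/-- The `2`-adic part of `kron`. -/
def kronTwo (v : ℕ) (r x : ℤ) : ℤ := if x % 4 = r then χ₈ x ^ v else 0

/-- The condition on x has period 4 and χ₈ has period 8. For v = 2 the factor χ₈(x)² is 1 at odd x,
so period 4 still suffices. -/
lemma kronTwo_add_mul {v : ℕ} (hv : 2 ≤ v) {r : ℤ} (hr : r % 2 = 1) (x k : ℤ) :
    kronTwo v r (x + 2 ^ v * k) = kronTwo v r x := by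
  obtain ⟨u, rfl⟩ := Nat.exists_eq_add_of_le hv
  have h4 : (x + 2 ^ (2 + u) * k) % 4 = x % 4 := by
    rw [pow_add, mul_assoc]
    norm_num
  rw [kronTwo, kronTwo, h4]
  split_ifs with h
  · obtain _ | u := u
    · rw [add_zero, chi8_sq (by omega), chi8_sq (by omega)]
    · rw [chi8_add_mul (by omega)]
  · rfl

lemma kron_eq (v c' : ℕ) (a : ℤ) : kron v c' a = kronTwo v 1 a * J(a | c') := by
  rw [kron, kronTwo]
  split_ifs <;> simp

lemma kron_add_mul {v c' : ℕ} (hv : 2 ≤ v) (a k : ℤ) :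
    kron v c' (a + (2 ^ v * c' : ℕ) * k) = kron v c' a := by
  rw [kron_eq, kron_eq]
  congr 1
  · rw [show a + (2 ^ v * c' : ℕ) * k = a + 2 ^ v * (c' * k) by push_cast; ring,
      kronTwo_add_mul hv (by norm_num)]
  · rw [show a + (2 ^ v * c' : ℕ) * k = a + c' * (2 ^ v * k) by push_cast; ring, jacobi_add_mul]

lemma abs_kronTwo_le (v : ℕ) (r x : ℤ) : |kronTwo v r x| ≤ 1 := by
  rw [kronTwo]
  split_ifs
  · rw [abs_pow]
    refine pow_le_one₀ (abs_nonneg _) ?_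
    generalize (x : ZMod 8) = y
    revert y
    decide
  · simp

lemma abs_jacobi_le (a : ℤ) (c : ℕ) : |J(a | c)| ≤ 1 := by
  rcases jacobiSym.trichotomy a c with h | h | h <;> rw [h] <;> simp

lemma abs_kron_le (v c' : ℕ) (a : ℤ) : |kron v c' a| ≤ 1 := by
  rw [kron_eq, abs_mul]
  exact mul_le_one₀ (abs_kronTwo_le _ _ _) (abs_nonneg _) (abs_jacobi_le _ _)

lemma norm_intCast_le_one {z : ℤ} (h : |z| ≤ 1) : ‖(z : ℂ)‖ ≤ 1 := by
  rw [Complex.norm_intCast]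
  exact_mod_cast h

lemma norm_jacobiGauss_le (m : ℤ) (c : ℕ) : ‖jacobiGauss m c‖ ≤ c := by
  refine (norm_sum_le_of_le _ (f := fun y : ℕ => (J(y | c) : ℂ) * eDiv c (m * y))
    (n := fun _ => 1) fun y _ => ?_).trans (by simp)
  rw [norm_mul, norm_eDiv, mul_one]
  exact norm_intCast_le_one (abs_jacobi_le _ _)

/-- `∑ (c/a) e(-na/c)` over `a ≡ 1` modulo `4`, `a` modulo `c = 2^v c'`. -/
noncomputable def kronGauss (v c' : ℕ) (n : ℤ) : ℂ :=
  ∑ a ∈ Finset.range (2 ^ v * c'), (kron v c' a : ℂ) * eDiv (2 ^ v * c') (-n * a)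

/-- The `2`-adic part of `kronGauss`. -/
noncomputable def kronGaussTwo (v r : ℕ) (n : ℤ) : ℂ :=
  ∑ x ∈ Finset.range (2 ^ v), (kronTwo v r x : ℂ) * eDiv (2 ^ v) (-n * x)

lemma norm_kronGauss_le (v c' : ℕ) (n : ℤ) : ‖kronGauss v c' n‖ ≤ (2 ^ v * c' : ℕ) := by
  refine (norm_sum_le_of_le _ (n := fun _ => 1) fun y _ => ?_).trans (by simp)
  rw [norm_mul, norm_eDiv, mul_one]
  exact norm_intCast_le_one (abs_kron_le _ _ _)

lemma norm_kronGaussTwo_le (v r : ℕ) (n : ℤ) : ‖kronGaussTwo v r n‖ ≤ 2 ^ v := by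
  refine (norm_sum_le_of_le _ (n := fun _ => 1) fun y _ => ?_).trans (by simp)
  rw [norm_mul, norm_eDiv, mul_one]
  exact norm_intCast_le_one (abs_kronTwo_le _ _ _)

/-- Put a = c' x + 2^v y. The condition a ≡ 1 (4) turns into x ≡ c' (4), which is how the odd part
enters the 2-adic factor. The factor χ₈(c')^v occurs twice, once from the 2-adic character and once
from (2/c')^v, and cancels. -/
theorem kronGauss_eq {v c' : ℕ} (hv : 2 ≤ v) (hc' : Odd c') (n : ℤ) :
    kronGauss v c' n = kronGaussTwo v (c' % 4) n * jacobiGauss (-n) c' := by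
  have hv0 : 0 < 2 ^ v := by positivity
  have hcop : (2 ^ v).Coprime c' := (Nat.coprime_two_left.2 hc').pow_left _
  rw [kronGauss, sum_range_mul_coprime (2 ^ v) c' hv0 hc'.pos hcop
    (f := fun a => (kron v c' a : ℂ) * eDiv (2 ^ v * c') (-n * a)), kronGaussTwo, jacobiGauss,
    Finset.sum_mul_sum]
  · refine Finset.sum_congr rfl fun x _ => Finset.sum_congr rfl fun y _ => ?_
    have h1 : (kron v c' (c' * x + (2 ^ v : ℕ) * y)) = kronTwo v (c' % 4 : ℕ) x * J(y | c') := by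
      rw [kron_eq, add_comm ((c' : ℤ) * x), jacobi_add_mul, add_comm _ ((c' : ℤ) * x)]
      push_cast
      rw [kronTwo_add_mul hv (by norm_num), jacobiSym.mul_left, jacobiSym.pow_left,
        jacobiSym.at_two hc', kronTwo, kronTwo]
      have hc4 := Nat.odd_mod_four_iff.1 (Nat.odd_iff.1 hc')
      have h2 : ((c' : ℤ) * x) % 4 = 1 ↔ (x : ℤ) % 4 = ((c' : ℤ) % 4) := by
        rw [Int.mul_emod]
        have : (x : ℤ) % 4 = 0 ∨ (x : ℤ) % 4 = 1 ∨ (x : ℤ) % 4 = 2 ∨ (x : ℤ) % 4 = 3 := by omega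
        have h3 : (c' : ℤ) % 4 = 1 ∨ (c' : ℤ) % 4 = 3 := by omega
        rcases h3 with h | h <;> rcases this with h' | h' | h' | h' <;> rw [h, h'] <;> decide
      simp only [h2]
      split_ifs
      · have h4 := chi8_sq (x := c') (by have := Nat.odd_iff.1 hc'; omega)
        push_cast
        rw [map_mul, mul_pow]
        have h5 : (χ₈ (c' : ZMod 8) ^ v) * (χ₈ (c' : ZMod 8) ^ v) = 1 := by
          rw [← mul_pow, ← sq]
          push_cast at h4
          rw [h4, one_pow]
        linear_combination (χ₈ (x : ZMod 8) ^ v * J(y | c')) * h5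
      · ring
    rw [h1, mul_add, eDiv_add, show -n * ((2 ^ v : ℕ) * y : ℤ) = (2 ^ v : ℕ) * (-n * y) by ring,
      eDiv_mul_mul hv0, mul_comm (2 ^ v) c', show -n * ((c' : ℤ) * x) = c' * (-n * x) by ring,
      eDiv_mul_mul hc'.pos]
    push_cast
    ring
  · intro x k
    rw [kron_add_mul hv, eDiv_mul_add (mul_pos hv0 hc'.pos)]

/-- The character has period 8, so in x + 8t the sum over t is a full sum of additive characters. -/
lemma kronGaussTwo_of_three_le (v r : ℕ) (hr : r % 2 = 1) (n : ℤ) :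
    kronGaussTwo (v + 3) r n = (∑ x ∈ Finset.range 8, (kronTwo (v + 3) r x : ℂ) *
      eDiv (2 ^ (v + 3)) (-n * x)) * if (2 ^ v : ℤ) ∣ n then 2 ^ v else 0 := by
  have h8 : 2 ^ (v + 3) = 8 * 2 ^ v := by rw [pow_add]; ring
  have hv0 : 0 < 2 ^ v := by positivity
  have hs := sum_eDiv hv0 (-n)
  simp only [dvd_neg] at hs
  push_cast at hs
  rw [kronGaussTwo]
  conv_lhs => rw [h8]
  rw [sum_range_mul (f := fun x => (kronTwo (v + 3) r x : ℂ) * eDiv (8 * 2 ^ v) (-n * x)) 8 (2 ^ v)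
    (by norm_num) hv0, Finset.sum_mul]
  · refine Finset.sum_congr rfl fun x _ => ?_
    rw [← hs, Finset.mul_sum]
    refine Finset.sum_congr rfl fun t _ => ?_
    have h1 : kronTwo (v + 3) r (x + (8 : ℕ) * t) = kronTwo (v + 3) r x := by
      rw [kronTwo, kronTwo]
      have h2 := chi8_add_mul (le_refl 3) x t
      norm_num at h2 ⊢
      rw [show ((8 : ZMod 8)) = 0 by decide]
      simp
      congr 1
      simp only [eq_iff_iff]
      omega
    rw [h1, mul_add, eDiv_add, show -n * ((8 : ℕ) * t : ℤ) = (8 : ℕ) * (-n * t) by ring,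
      eDiv_mul_mul (by norm_num), h8]
    ring
  · intro x k
    rw [eDiv_mul_add (by positivity)]
    congr 2
    rw [← h8]
    push_cast
    exact_mod_cast kronTwo_add_mul (v := v + 3) (by omega) (by omega : (r : ℤ) % 2 = 1) x k

/-- This makes the 2-adic factor finite for n ≠ 0. For v < 3 the hypothesis cannot hold, since 2^v
already divides 8. -/
lemma kronGaussTwo_eq_zero {v r : ℕ} (hr : r % 2 = 1) {n : ℤ} (h : ¬ (2 ^ v : ℤ) ∣ 8 * n) :
    kronGaussTwo v r n = 0 := by
  have hv : 3 ≤ v := by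
    by_contra hlt
    refine h (Dvd.dvd.mul_right ?_ n)
    have : v ≤ 2 := by omega
    interval_cases v <;> decide
  obtain ⟨u, rfl⟩ := Nat.exists_eq_add_of_le' hv
  rw [kronGaussTwo_of_three_le u r hr, if_neg, mul_zero]
  intro hd
  refine h ?_
  rw [pow_add, mul_comm]
  exact mul_dvd_mul (by norm_num) hd

/-- At frequency zero this counts residues: of 1 and 5 modulo 8 the second contributes χ₈(5)^v =
(-1)^v. -/
lemma kronGaussTwo_zero {v : ℕ} (hv : 2 ≤ v) :
    8 * kronGaussTwo v 1 0 = (1 + (-1) ^ v) * 2 ^ v := by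
  obtain ⟨u, rfl⟩ := Nat.exists_eq_add_of_le' hv
  obtain _ | u := u
  · simp [kronGaussTwo, Finset.sum_range_succ, kronTwo, eDiv, eExp]
    have : χ₈ (1 : ZMod 8) = 1 := by decide
    norm_num
  · rw [show u + 1 + 2 = u + 3 by ring, kronGaussTwo_of_three_le u 1 (by norm_num)]
    simp [Finset.sum_range_succ, kronTwo, eDiv, eExp]
    ring

end

/-! ### The Dirichlet series of Gauss sums: reduction to Jacobi symbols and continuation. -/

section

open scoped NumberTheorySymbols

lemma summable_natCast_cpow {s : ℂ} (hs : 1 < s.re) :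
    Summable fun n : ℕ => ‖(n : ℂ) ^ (-s)‖ := by
  refine (Real.summable_nat_rpow.2 (by linarith : -s.re < -1)).congr fun n => ?_
  rw [Complex.norm_natCast_cpow_of_re_ne_zero _ (by rw [Complex.neg_re]; linarith), Complex.neg_re]

lemma zeta2_eq_tsum {s : ℂ} (hs : 1 < s.re) :
    zeta2 s = ∑' e : ℕ, if Odd e then (e : ℂ) ^ (-s) else 0 := by
  have hs0 : s ≠ 0 := by rintro rfl; simp at hs; linarith
  have hsum := (summable_natCast_cpow hs).of_norm
  have he : Function.Injective fun k : ℕ => 2 * k := fun a b h => by simpa using h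
  have ho : Function.Injective fun k : ℕ => 2 * k + 1 := fun a b h => by simpa using h
  have hse : Summable fun k : ℕ => ((2 * k : ℕ) : ℂ) ^ (-s) := hsum.comp_injective he
  have hso : Summable fun k : ℕ => ((2 * k + 1 : ℕ) : ℂ) ^ (-s) := hsum.comp_injective ho
  have h1 := tsum_even_add_odd (f := fun n : ℕ => (n : ℂ) ^ (-s)) hse hso
  have h2 : riemannZeta s = ∑' n : ℕ, (n : ℂ) ^ (-s) := by
    rw [zeta_eq_tsum_one_div_nat_cpow hs]
    exact tsum_congr fun n => by rw [Complex.cpow_neg, one_div]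
  have h3 : ∑' k : ℕ, ((2 * k : ℕ) : ℂ) ^ (-s) = 2 ^ (-s) * riemannZeta s := by
    rw [h2, ← tsum_mul_left]
    refine tsum_congr fun k => ?_
    rw [Nat.cast_mul, Complex.natCast_mul_natCast_cpow, Nat.cast_ofNat]
  have h4 : ∑' e : ℕ, (if Odd e then (e : ℂ) ^ (-s) else 0) =
      ∑' k : ℕ, ((2 * k + 1 : ℕ) : ℂ) ^ (-s) := by
    rw [← ho.tsum_eq (f := fun e : ℕ => if Odd e then (e : ℂ) ^ (-s) else 0)]
    · refine tsum_congr fun k => ?_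
      rw [if_pos (odd_two_mul_add_one k)]
    · intro e he
      by_contra h
      refine he (if_neg fun ⟨k, hk⟩ => h ⟨k, hk.symm⟩)
  rw [h4, zeta2]
  rw [h3, ← h2] at h1
  linear_combination -h1

/-- The products of Dirichlet series below are compared coefficient by coefficient, by collecting
the pairs (e, c) with c e² = C. -/
lemma tsum_fiber_sq {F : ℕ × ℕ → ℂ} (hF : Summable F) :
    ∑' p, F p = ∑' C : ℕ, ∑' p : {p : ℕ × ℕ // p.2 * p.1 ^ 2 = C}, F p := by
  have h : Summable fun x : (Σ C : ℕ, {p : ℕ × ℕ // p.2 * p.1 ^ 2 = C}) =>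
      F (Equiv.sigmaFiberEquiv (fun p : ℕ × ℕ => p.2 * p.1 ^ 2) x) :=
    (Equiv.sigmaFiberEquiv fun p : ℕ × ℕ => p.2 * p.1 ^ 2).summable_iff.2 hF
  rw [← (Equiv.sigmaFiberEquiv fun p : ℕ × ℕ => p.2 * p.1 ^ 2).tsum_eq F]
  exact h.tsum_sigma

/-- For C = c f² with c squarefree, e² ∣ C is equivalent to e ∣ f by
`dvd_of_sq_dvd_squarefree_mul_sq`, so the fibre is indexed by the divisors of f. -/
lemma tsum_fiber_sq_eq_sum {c f : ℕ} (hsq : Squarefree c) (hf : 0 < f) (F : ℕ × ℕ → ℂ) :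
    ∑' p : {p : ℕ × ℕ // p.2 * p.1 ^ 2 = c * f ^ 2}, F p =
      ∑ e ∈ f.divisors, F (e, c * (f / e) ^ 2) := by
  have h1 : {p : ℕ × ℕ | p.2 * p.1 ^ 2 = c * f ^ 2} =
      ↑(f.divisors.image fun e => (e, c * (f / e) ^ 2)) := by
    ext ⟨e, c'⟩
    simp only [Set.mem_ofPred_eq, Finset.coe_image, Set.mem_image, Finset.mem_coe, Prod.mk.injEq]
    constructor
    · intro h
      have hd := dvd_of_sq_dvd_squarefree_mul_sq hsq hf (Dvd.intro_left _ h)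
      refine ⟨e, Nat.mem_divisors.2 ⟨hd, hf.ne'⟩, rfl, ?_⟩
      obtain ⟨g, rfl⟩ := hd
      have he : 0 < e := Nat.pos_of_mul_pos_right hf
      rw [Nat.mul_div_cancel_left _ he]
      refine Nat.eq_of_mul_eq_mul_right (pow_pos he 2) ?_
      rw [h]
      ring
    · rintro ⟨e', he', rfl, rfl⟩
      obtain ⟨g, rfl⟩ := (Nat.mem_divisors.1 he').1
      rw [Nat.mul_div_cancel_left _ (Nat.pos_of_mem_divisors he')]
      ring
  have h2 := Finset.tsum_subtype (f.divisors.image fun e => (e, c * (f / e) ^ 2)) F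
  rw [Finset.sum_image (fun a _ b _ h => (Prod.mk.inj h).1)] at h2
  rw [← h2]
  exact tsum_congr_set_coe F h1

lemma sq_odd_mod_four {e : ℕ} (he : Odd e) (c : ℕ) : (c * e ^ 2) % 4 = c % 4 := by
  obtain ⟨k, rfl⟩ := he
  have : c * (2 * k + 1) ^ 2 = c + 4 * (c * (k ^ 2 + k)) := by ring
  rw [this, Nat.add_mul_mod_self_left]

/-- Along a fibre C = c e² the powers on the Gauss sum side reduce to a common C^{-(s+1)} and the
weight e required by `sum_jacobiGauss_sq_divisors`. -/
lemma cpow_mul_sq_left {e c : ℕ} (he : 0 < e) (s : ℂ) :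
    (e : ℂ) ^ (-(2 * s + 1)) * (c : ℂ) ^ (-(s + 1)) = e * ((c * e ^ 2 : ℕ) : ℂ) ^ (-(s + 1)) := by
  have he0 : (e : ℂ) ≠ 0 := by exact_mod_cast he.ne'
  rw [Nat.cast_mul, Complex.natCast_mul_natCast_cpow, sq, Nat.cast_mul,
    Complex.natCast_mul_natCast_cpow, show -(2 * s + 1) = -(s + 1) + -(s + 1) + 1 by ring,
    Complex.cpow_add _ _ he0, Complex.cpow_add _ _ he0, Complex.cpow_one]
  ring

/-- On the Jacobi symbol side the exponent differs by 1/2, and C^{1/2} = √c₀ · f supplies the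
modulus of the Gauss sum. -/
lemma cpow_mul_sq_right {d c f : ℕ} {c₀ : ℕ} (hd : 0 < d) (hc : 0 < c₀) (hf : 0 < f)
    (h : c * d ^ 2 = c₀ * f ^ 2) (s : ℂ) :
    (d : ℂ) ^ (-(2 * s)) * (c : ℂ) ^ (-(s + 1 / 2)) =
      (Real.sqrt c₀ : ℂ) * f * d * ((c₀ * f ^ 2 : ℕ) : ℂ) ^ (-(s + 1)) := by
  have hd0 : (d : ℂ) ≠ 0 := by exact_mod_cast hd.ne'
  have hC0 : ((c₀ * f ^ 2 : ℕ) : ℂ) ≠ 0 := by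
    have : 0 < c₀ * f ^ 2 := by positivity
    exact_mod_cast this.ne'
  have h1 : (d : ℂ) ^ (-(2 * s)) * (c : ℂ) ^ (-(s + 1 / 2)) =
      d * ((c * d ^ 2 : ℕ) : ℂ) ^ (-(s + 1 / 2)) := by
    rw [Nat.cast_mul, Complex.natCast_mul_natCast_cpow, sq, Nat.cast_mul,
      Complex.natCast_mul_natCast_cpow, show -(2 * s) = -(s + 1 / 2) + -(s + 1 / 2) + 1 by ring,
      Complex.cpow_add _ _ hd0, Complex.cpow_add _ _ hd0, Complex.cpow_one]
    ring
  have h2 : ((c₀ * f ^ 2 : ℕ) : ℂ) ^ (1 / 2 : ℂ) = (Real.sqrt c₀ : ℂ) * f := by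
    have h3 : ((c₀ * f ^ 2 : ℕ) : ℂ) = ((Real.sqrt c₀ : ℂ) * f) ^ 2 := by
      rw [mul_pow, ← Complex.ofReal_pow, Real.sq_sqrt (Nat.cast_nonneg _)]
      push_cast
      rfl
    rw [h3, one_div, Complex.sq_cpow_two_inv]
    have : 0 < Real.sqrt c₀ * f := by
      have := Real.sqrt_pos.2 (by exact_mod_cast hc : (0 : ℝ) < c₀)
      positivity
    rw [← Complex.ofReal_natCast, ← Complex.ofReal_mul, Complex.ofReal_re]
    exact this
  rw [h1, h, show -(s + 1 / 2) = -(s + 1) + 1 / 2 by ring, Complex.cpow_add _ _ hC0, h2]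
  ring

lemma summable_gauss_series (r : ℕ) (m : ℤ) {ν : ℂ} (hν : 1 < ν.re) :
    Summable fun c : ℕ => ‖if c % 4 = r then jacobiGauss m c * (c : ℂ) ^ (-(ν + 1)) else 0‖ := by
  refine Summable.of_norm_bounded (summable_natCast_cpow hν) fun c => ?_
  rw [norm_norm]
  split_ifs
  · rcases Nat.eq_zero_or_pos c with rfl | hc
    · simp [jacobiGauss]
    have hc0 : (c : ℂ) ≠ 0 := by exact_mod_cast hc.ne'
    rw [show -ν = -(ν + 1) + 1 by ring, Complex.cpow_add _ _ hc0, Complex.cpow_one, norm_mul,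
      norm_mul, Complex.norm_natCast, mul_comm]
    exact mul_le_mul_of_nonneg_left (norm_jacobiGauss_le m c) (norm_nonneg _)
  · simp

lemma norm_jacobi_series_term_le (r : ℕ) (m : ℤ) (s : ℂ) (c : ℕ) :
    ‖if c % 4 = r then (J(m | c) : ℂ) * (c : ℂ) ^ (-s) else 0‖ ≤ ‖(c : ℂ) ^ (-s)‖ := by
  split_ifs
  · rw [norm_mul]
    exact mul_le_of_le_one_left (norm_nonneg _) (norm_intCast_le_one (abs_jacobi_le _ _))
  · simp

/-- The summands of `ζ₂(2ν+1) ∑_{c ≡ r (4)} g(m; c) c^{-ν-1}`. -/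
noncomputable def gaussTerm (r : ℕ) (m : ℤ) (ν : ℂ) (p : ℕ × ℕ) : ℂ :=
  (if Odd p.1 then (p.1 : ℂ) ^ (-(2 * ν + 1)) else 0) *
    (if p.2 % 4 = r then jacobiGauss m p.2 * (p.2 : ℂ) ^ (-(ν + 1)) else 0)

/-- The summands of `∑_{d odd, d² ∣ m} d^{-2ν} ∑_{c ≡ r (4)} (m/d² ∣ c) c^{-ν-1/2}`. -/
noncomputable def jacobiTerm (r : ℕ) (m : ℤ) (ν : ℂ) (p : ℕ × ℕ) : ℂ :=
  if Odd p.1 ∧ (p.1 : ℤ) ^ 2 ∣ m then (p.1 : ℂ) ^ (-(2 * ν)) *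
    (if p.2 % 4 = r then (J(m / p.1 ^ 2 | p.2) : ℂ) * (p.2 : ℂ) ^ (-(ν + 1 / 2)) else 0)
    else 0

/-- On the fibre of C = c f² this is C^{-(ν+1)} times `sum_jacobiGauss_sq_divisors`. Odd squares are
1 modulo 4, so all c on a fibre lie in the class of C modulo 4; fibres in other classes vanish on
both sides. -/
lemma tsum_fiber_gaussTerm {r : ℕ} (hr : r = 1 ∨ r = 3) (m : ℤ) (ν : ℂ) (C : ℕ) :
    ∑' p : {p : ℕ × ℕ // p.2 * p.1 ^ 2 = C}, gaussTerm r m ν p =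
      gaussSign r * ∑' p : {p : ℕ × ℕ // p.2 * p.1 ^ 2 = C}, jacobiTerm r m ν p := by
  by_cases hC : C % 4 = r
  · have hCodd : Odd C := by
      rw [Nat.odd_iff]
      omega
    obtain ⟨c, f, hcf, hsq⟩ := Nat.sq_mul_squarefree C
    rw [mul_comm] at hcf
    subst hcf
    obtain ⟨hco, hfo⟩ := Nat.odd_mul.1 hCodd
    have hf : 0 < f := (Nat.pos_of_ne_zero fun h => by simp [h] at hfo)
    have hfo' : Odd f := (Nat.odd_pow_iff two_ne_zero).1 hfo
    rw [tsum_fiber_sq_eq_sum hsq hf, tsum_fiber_sq_eq_sum hsq hf]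
    have hdiv : ∀ e ∈ f.divisors, Odd e ∧ 0 < e ∧ c * (f / e) ^ 2 * e ^ 2 = c * f ^ 2 ∧
        (c * (f / e) ^ 2) % 4 = r := by
      intro e he
      obtain ⟨g, rfl⟩ := (Nat.mem_divisors.1 he).1
      have he0 := Nat.pos_of_mem_divisors he
      have heo : Odd e := (Nat.odd_mul.1 hfo').1
      have h3 : c * (e * g / e) ^ 2 * e ^ 2 = c * (e * g) ^ 2 := by
        rw [Nat.mul_div_cancel_left _ he0]
        ring
      refine ⟨heo, he0, h3, ?_⟩
      rw [← sq_odd_mod_four heo, h3, hC]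
    have hsign : gaussSign c = gaussSign r := by
      rw [sq_odd_mod_four hfo'] at hC
      rw [gaussSign, gaussSign, hC]
      rcases hr with rfl | rfl <;> norm_num
    have h4 : ∀ e ∈ f.divisors, gaussTerm r m ν (e, c * (f / e) ^ 2) =
        ((c * f ^ 2 : ℕ) : ℂ) ^ (-(ν + 1)) * (e * jacobiGauss m (c * (f / e) ^ 2)) := by
      intro e he
      obtain ⟨h5, h6, h7, h8⟩ := hdiv e he
      simp only [gaussTerm]
      rw [if_pos h5, if_pos h8, ← h7]
      linear_combination (jacobiGauss m (c * (f / e) ^ 2)) *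
        cpow_mul_sq_left (c := c * (f / e) ^ 2) h6 ν
    have h5 : ∀ d ∈ f.divisors, jacobiTerm r m ν (d, c * (f / d) ^ 2) =
        ((c * f ^ 2 : ℕ) : ℂ) ^ (-(ν + 1)) * ((Real.sqrt c : ℂ) * f *
          if (d : ℤ) ^ 2 ∣ m then ((d * J(m / d ^ 2 | c * (f / d) ^ 2) : ℤ) : ℂ) else 0) := by
      intro d hd
      obtain ⟨h5, h6, h7, h8⟩ := hdiv d hd
      simp only [jacobiTerm]
      by_cases h9 : (d : ℤ) ^ 2 ∣ m
      · rw [if_pos ⟨h5, h9⟩, if_pos h8, if_pos h9]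
        have := cpow_mul_sq_right h6 hco.pos hf h7 ν
        push_cast at this ⊢
        linear_combination (J(m / d ^ 2 | c * (f / d) ^ 2) : ℂ) * this
      · rw [if_neg fun h => h9 h.2, if_neg h9]
        ring
    rw [Finset.sum_congr rfl h4, Finset.sum_congr rfl h5, ← Finset.mul_sum, ← Finset.mul_sum,
      ← Finset.mul_sum, sum_jacobiGauss_sq_divisors hco hsq hf, hsign]
    ring
  · have h1 : ∀ p : {p : ℕ × ℕ // p.2 * p.1 ^ 2 = C}, gaussTerm r m ν p = 0 := by
      rintro ⟨⟨e, c⟩, h⟩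
      simp only [gaussTerm]
      split_ifs with h1 h2
      · exact absurd (by rw [← h]; simpa [sq_odd_mod_four h1] using h2) hC
      · ring
      · ring
      · ring
    have h2 : ∀ p : {p : ℕ × ℕ // p.2 * p.1 ^ 2 = C}, jacobiTerm r m ν p = 0 := by
      rintro ⟨⟨e, c⟩, h⟩
      simp only [jacobiTerm]
      split_ifs with h1 h2
      · exact absurd (by rw [← h]; simpa [sq_odd_mod_four h1.1] using h2) hC
      · ring
      · ring
    simp only [h1, h2, tsum_zero, mul_zero]

/-- Expand ζ₂(2ν+1) over odd e and compare the two double series on the fibres c e² = C. The gain is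
that for m ≠ 0 the sum over d on the right is finite and its inner series have periodic
coefficients. -/
theorem zeta2_mul_gauss_series {r : ℕ} (hr : r = 1 ∨ r = 3) (m : ℤ) {ν : ℂ} (hν : 1 < ν.re) :
    zeta2 (2 * ν + 1) *
      ∑' c : ℕ, (if c % 4 = r then jacobiGauss m c * (c : ℂ) ^ (-(ν + 1)) else 0) =
    gaussSign r * ∑' d : ℕ, if Odd d ∧ (d : ℤ) ^ 2 ∣ m then (d : ℂ) ^ (-(2 * ν)) *
      ∑' c : ℕ, (if c % 4 = r then (J(m / d ^ 2 | c) : ℂ) * (c : ℂ) ^ (-(ν + 1 / 2)) else 0)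
      else 0 := by
  have hs1 : 1 < (2 * ν + 1).re := by simp; linarith
  have hs2 : 1 < (2 * ν).re := by simp; linarith
  have hs3 : 1 < (ν + 1 / 2).re := by simp; linarith
  set A : ℕ → ℂ := fun e => if Odd e then (e : ℂ) ^ (-(2 * ν + 1)) else 0 with hA
  set B : ℕ → ℂ := fun c =>
    if c % 4 = r then jacobiGauss m c * (c : ℂ) ^ (-(ν + 1)) else 0 with hB
  have hsumA : Summable fun e : ℕ => ‖A e‖ := by
    refine Summable.of_norm_bounded (summable_natCast_cpow hs1) fun e => ?_
    rw [norm_norm, hA]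
    dsimp only
    split_ifs <;> simp
  have hsumB : Summable fun c : ℕ => ‖B c‖ := summable_gauss_series r m hν
  have hAB : gaussTerm r m ν = fun p => A p.1 * B p.2 := rfl
  have hS₁ : Summable (gaussTerm r m ν) := by
    rw [hAB]
    exact summable_mul_of_summable_norm hsumA hsumB
  have hS₂ : Summable (jacobiTerm r m ν) := by
    have hbd : Summable fun p : ℕ × ℕ =>
        ‖(p.1 : ℂ) ^ (-(2 * ν))‖ * ‖(p.2 : ℂ) ^ (-(ν + 1 / 2))‖ :=
      Summable.mul_of_nonneg (f := fun n : ℕ => ‖(n : ℂ) ^ (-(2 * ν))‖)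
        (g := fun n : ℕ => ‖(n : ℂ) ^ (-(ν + 1 / 2))‖)
        (summable_natCast_cpow hs2) (summable_natCast_cpow hs3)
        (fun _ => norm_nonneg _) fun _ => norm_nonneg _
    refine Summable.of_norm_bounded hbd fun p => ?_
    simp only [jacobiTerm]
    split_ifs with h1 h2
    · rw [norm_mul]
      refine mul_le_mul_of_nonneg_left ?_ (norm_nonneg _)
      have := norm_jacobi_series_term_le r (m / p.1 ^ 2) (ν + 1 / 2) p.2
      rwa [if_pos h2] at this
    · simp
      positivity
    · simp
      positivity
  have e1 : zeta2 (2 * ν + 1) *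
      ∑' c : ℕ, (if c % 4 = r then jacobiGauss m c * (c : ℂ) ^ (-(ν + 1)) else 0) =
      ∑' p, (gaussTerm r m ν) p := by
    rw [zeta2_eq_tsum hs1, hAB]
    exact tsum_mul_tsum_of_summable_norm hsumA hsumB
  have e2 : (∑' d : ℕ, if Odd d ∧ (d : ℤ) ^ 2 ∣ m then (d : ℂ) ^ (-(2 * ν)) *
      ∑' c : ℕ, (if c % 4 = r then (J(m / d ^ 2 | c) : ℂ) * (c : ℂ) ^ (-(ν + 1 / 2)) else 0)
      else 0) = ∑' p, (jacobiTerm r m ν) p := by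
    rw [hS₂.tsum_prod]
    refine tsum_congr fun d => ?_
    split_ifs with h
    · simp only [jacobiTerm, if_pos h, tsum_mul_left]
    · simp only [jacobiTerm, if_neg h, tsum_zero]
  rw [e1, e2, tsum_fiber_sq hS₁, tsum_fiber_sq hS₂, ← tsum_mul_left]
  exact tsum_congr fun C => tsum_fiber_gaussTerm hr m ν C

/-- The Dirichlet series `∑ c^{-ν-1} kronGauss` over the positive multiples `c` of `4`. -/
noncomputable def kronSeries (n : ℤ) (ν : ℂ) : ℂ :=
  ∑' p : ℕ × ℕ, ((2 ^ (p.1 + 2) * (2 * p.2 + 1) : ℕ) : ℂ) ^ (-(ν + 1)) *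
    kronGauss (p.1 + 2) (2 * p.2 + 1) n

/-- The terms of the `2`-adic factor of `kronSeries`. -/
noncomputable def twoTerm (r : ℕ) (n : ℤ) (ν : ℂ) (v : ℕ) : ℂ :=
  ((2 ^ (v + 2) : ℕ) : ℂ) ^ (-(ν + 1)) * kronGaussTwo (v + 2) r n

/-- The terms of the odd factor of `kronSeries`. -/
noncomputable def oddTerm (r : ℕ) (n : ℤ) (ν : ℂ) (c : ℕ) : ℂ :=
  if c % 4 = r then jacobiGauss (-n) c * (c : ℂ) ^ (-(ν + 1)) else 0

lemma norm_natCast_mul_cpow_sub_one {c : ℕ} (hc : 0 < c) (ν : ℂ) :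
    ‖(c : ℂ) ^ (-(ν + 1))‖ * c = ‖(c : ℂ) ^ (-ν)‖ := by
  have hc0 : (c : ℂ) ≠ 0 := by exact_mod_cast hc.ne'
  rw [show -ν = -(ν + 1) + 1 by ring, Complex.cpow_add _ _ hc0, Complex.cpow_one, norm_mul,
    Complex.norm_natCast]

lemma summable_twoTerm (r : ℕ) (n : ℤ) {ν : ℂ} (hν : 1 < ν.re) :
    Summable fun v => ‖twoTerm r n ν v‖ := by
  have hi : Function.Injective fun v : ℕ => 2 ^ (v + 2) := fun a b h => by
    have := Nat.pow_right_injective le_rfl h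
    omega
  have hs : Summable fun v : ℕ => ‖((2 ^ (v + 2) : ℕ) : ℂ) ^ (-ν)‖ :=
    (summable_natCast_cpow hν).comp_injective hi
  refine Summable.of_norm_bounded hs fun v => ?_
  rw [norm_norm, twoTerm, norm_mul, ← norm_natCast_mul_cpow_sub_one (by positivity) ν]
  refine mul_le_mul le_rfl ((norm_kronGaussTwo_le (v + 2) r n).trans_eq ?_) (norm_nonneg _)
    (norm_nonneg _)
  push_cast
  rfl

lemma tsum_oddTerm {r : ℕ} (hr : r % 2 = 1) (n : ℤ) (ν : ℂ) :
    ∑' k : ℕ, oddTerm r n ν (2 * k + 1) = ∑' c, oddTerm r n ν c := by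
  have ho : Function.Injective fun k : ℕ => 2 * k + 1 := fun a b h => by simpa using h
  refine ho.tsum_eq (f := oddTerm r n ν) fun c hc => ?_
  by_contra h
  refine hc (if_neg fun hc4 => h ⟨c / 2, ?_⟩)
  simp only
  omega

/-- Since the two factors of `kronGauss_eq` communicate only through c' modulo 4, the double series
is a sum of two products, one for each odd class. -/
lemma kronSeries_eq (n : ℤ) {ν : ℂ} (hν : 1 < ν.re) :
    kronSeries n ν = (∑' v, twoTerm 1 n ν v) * (∑' c, oddTerm 1 n ν c) +
      (∑' v, twoTerm 3 n ν v) * ∑' c, oddTerm 3 n ν c := by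
  have ho : Function.Injective fun k : ℕ => 2 * k + 1 := fun a b h => by simpa using h
  have hs : ∀ r, Summable fun k : ℕ => ‖oddTerm r n ν (2 * k + 1)‖ := fun r =>
    (summable_gauss_series r (-n) hν).comp_injective ho
  have hterm : ∀ p : ℕ × ℕ, ((2 ^ (p.1 + 2) * (2 * p.2 + 1) : ℕ) : ℂ) ^ (-(ν + 1)) *
      kronGauss (p.1 + 2) (2 * p.2 + 1) n = twoTerm 1 n ν p.1 * oddTerm 1 n ν (2 * p.2 + 1) +
      twoTerm 3 n ν p.1 * oddTerm 3 n ν (2 * p.2 + 1) := by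
    intro p
    rw [kronGauss_eq (by omega) (odd_two_mul_add_one _), Nat.cast_mul,
      Complex.natCast_mul_natCast_cpow]
    have h4 : (2 * p.2 + 1) % 4 = 1 ∨ (2 * p.2 + 1) % 4 = 3 := by omega
    rcases h4 with h | h <;> simp only [twoTerm, oddTerm, h] <;> norm_num <;> ring
  rw [kronSeries, tsum_congr hterm, Summable.tsum_add
    (summable_mul_of_summable_norm (f := twoTerm 1 n ν)
      (g := fun k => oddTerm 1 n ν (2 * k + 1)) (summable_twoTerm 1 n hν) (hs 1))
    (summable_mul_of_summable_norm (f := twoTerm 3 n ν)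
      (g := fun k => oddTerm 3 n ν (2 * k + 1)) (summable_twoTerm 3 n hν) (hs 3)),
    ← tsum_mul_tsum_of_summable_norm (f := twoTerm 1 n ν)
      (g := fun k => oddTerm 1 n ν (2 * k + 1)) (summable_twoTerm 1 n hν) (hs 1),
    ← tsum_mul_tsum_of_summable_norm (f := twoTerm 3 n ν)
      (g := fun k => oddTerm 3 n ν (2 * k + 1)) (summable_twoTerm 3 n hν) (hs 3),
    tsum_oddTerm (by norm_num), tsum_oddTerm (by norm_num)]

lemma two_pow_le_of_kronGaussTwo_ne_zero {v r : ℕ} (hr : r % 2 = 1) {n : ℤ} (hn : n ≠ 0)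
    (h : kronGaussTwo v r n ≠ 0) : 2 ^ v ≤ 8 * n.natAbs := by
  have h1 : (2 ^ v : ℤ) ∣ 8 * n := by
    by_contra h1
    exact h (kronGaussTwo_eq_zero hr h1)
  have h2 := Int.natAbs_dvd_natAbs.2 h1
  rw [Int.natAbs_pow, Int.natAbs_mul] at h2
  exact Nat.le_of_dvd (by have := Int.natAbs_pos.2 hn; simpa) h2

/-- A nonzero term needs 2^{v+2} ≤ 8|n|, and v < 2^v gives the crude cutoff v < 8|n|. -/
lemma tsum_twoTerm {r : ℕ} (hr : r % 2 = 1) {n : ℤ} (hn : n ≠ 0) (ν : ℂ) :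
    ∑' v, twoTerm r n ν v = ∑ v ∈ Finset.range (8 * n.natAbs), twoTerm r n ν v := by
  refine tsum_eq_sum fun v hv => ?_
  rw [Finset.mem_range, not_lt] at hv
  rw [twoTerm]
  by_cases h : kronGaussTwo (v + 2) r n = 0
  · rw [h, mul_zero]
  have h1 := two_pow_le_of_kronGaussTwo_ne_zero hr hn h
  have h2 : v + 2 < 2 ^ (v + 2) := Nat.lt_two_pow_self
  omega

/-- The character `c ↦ (m/c)` restricted to a residue class modulo `4`. -/
def jacobiClass (r : ℕ) (m : ℤ) (c : ℕ) : ℂ := if c % 4 = r then ((J(m | c) : ℤ) : ℂ) else 0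

lemma norm_jacobiClass_le (r : ℕ) (m : ℤ) (c : ℕ) : ‖jacobiClass r m c‖ ≤ 1 := by
  rw [jacobiClass]
  split_ifs
  · exact norm_intCast_le_one (abs_jacobi_le _ _)
  · simp

/-- The period 4|m| is linear in m, so that bounds polynomial in the period become bounds polynomial
in the frequency. -/
lemma jacobiClass_add {r : ℕ} (hr : r % 2 = 1) (m : ℤ) (c : ℕ) :
    jacobiClass r m (c + 4 * m.natAbs) = jacobiClass r m c := by
  rw [jacobiClass, jacobiClass]
  simp only [Nat.add_mul_mod_self_left]
  split_ifs with h
  · have hc : Odd c := by rw [Nat.odd_iff]; omega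
    have hc' : Odd (c + 4 * m.natAbs) := by rw [Nat.odd_iff]; omega
    rw [jacobiSym.mod_right m hc, jacobiSym.mod_right m hc', Nat.add_mod_right]
  · rfl

lemma tsum_jacobiClass {r : ℕ} (hr : r % 2 = 1) (m : ℤ) (s : ℂ) :
    ∑' c : ℕ, (if c % 4 = r then (J(m | c) : ℂ) * (c : ℂ) ^ (-s) else 0) =
      ∑' c : ℕ, jacobiClass r m (c + 1) * ((c + 1 : ℕ) : ℂ) ^ (-s) := by
  rw [← (add_left_injective 1).tsum_eq
    (f := fun c : ℕ => if c % 4 = r then (J(m | c) : ℂ) * (c : ℂ) ^ (-s) else 0)]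
  · refine tsum_congr fun c => ?_
    rw [jacobiClass, ite_mul, zero_mul]
  · intro c hc
    rcases Nat.eq_zero_or_pos c with rfl | h
    · refine absurd (if_neg ?_) hc
      omega
    · exact ⟨c - 1, Nat.succ_pred_eq_of_pos h⟩

/-- The continuation of `kronSeries`, multiplied by `(ν - 1/2) ζ₂(2ν+1)`, in terms of the
continuations `Λ` of the Dirichlet series with periodic coefficients. -/
noncomputable def kronCoeff (Λ : ℕ → (ℕ → ℂ) → ℂ → ℂ) (n : ℤ) (ν : ℂ) : ℂ :=
  ∑ r ∈ ({1, 3} : Finset ℕ), (∑ v ∈ Finset.range (8 * n.natAbs), twoTerm r n ν v) * (gaussSign r *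
    ∑ d ∈ Finset.range (n.natAbs + 1), if Odd d ∧ (d : ℤ) ^ 2 ∣ -n then (d : ℂ) ^ (-(2 * ν)) *
      Λ (4 * (-n / d ^ 2).natAbs) (jacobiClass r (-n / d ^ 2)) (ν + 1 / 2) else 0)

lemma norm_gaussSign (c : ℕ) : ‖gaussSign c‖ = 1 := by
  rw [gaussSign]
  split_ifs <;> simp

lemma natAbs_div_sq {n : ℤ} (hn : n ≠ 0) {d : ℕ} (hd : (d : ℤ) ^ 2 ∣ -n) :
    0 < (-n / d ^ 2).natAbs ∧ (-n / d ^ 2).natAbs ≤ n.natAbs ∧ d ≤ n.natAbs ∧ 0 < d := by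
  obtain ⟨k, hk⟩ := hd
  have hd0 : (d : ℤ) ≠ 0 := by
    rintro h
    rw [h] at hk
    simp at hk
    exact hn hk
  have hk0 : k ≠ 0 := by
    rintro rfl
    simp at hk
    exact hn hk
  have hdpos : 0 < d := Nat.pos_of_ne_zero fun h => hd0 (by exact_mod_cast h)
  have hn' : n.natAbs = d ^ 2 * k.natAbs := by
    rw [← Int.natAbs_neg, hk, Int.natAbs_mul, Int.natAbs_pow, Int.natAbs_natCast]
  have hk1 : 0 < k.natAbs := Int.natAbs_pos.2 hk0
  rw [hk, Int.mul_ediv_cancel_left _ (pow_ne_zero 2 hd0), hn']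
  refine ⟨hk1, Nat.le_mul_of_pos_left _ (by positivity), ?_, hdpos⟩
  calc d ≤ d ^ 2 := Nat.le_self_pow two_ne_zero d
    _ ≤ _ := Nat.le_mul_of_pos_right _ hk1

/-- The factor ν - 1/2 is the s - 1 built into Λ, at s = ν + 1/2. -/
lemma kronCoeff_eq {Λ : ℕ → (ℕ → ℂ) → ℂ → ℂ}
    (hΛ : ∀ (N : ℕ) (Φ : ℕ → ℂ), 0 < N → (∀ m, Φ (m + N) = Φ m) → (∀ m, ‖Φ m‖ ≤ 1) →
      Differentiable ℂ (Λ N Φ) ∧ ∀ s : ℂ, 1 < s.re →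
        Λ N Φ s = (s - 1) * ∑' m : ℕ, Φ (m + 1) * ((m + 1 : ℕ) : ℂ) ^ (-s))
    {n : ℤ} (hn : n ≠ 0) {ν : ℂ} (hν : 1 < ν.re) :
    kronCoeff Λ n ν = (ν - 1 / 2) * (zeta2 (2 * ν + 1) * kronSeries n ν) := by
  have hs3 : 1 < (ν + 1 / 2).re := by simp; linarith
  have key : ∀ r : ℕ, r = 1 ∨ r = 3 → (ν - 1 / 2) * (zeta2 (2 * ν + 1) * ∑' c, oddTerm r n ν c) =
      gaussSign r * ∑ d ∈ Finset.range (n.natAbs + 1), if Odd d ∧ (d : ℤ) ^ 2 ∣ -n then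
        (d : ℂ) ^ (-(2 * ν)) * Λ (4 * (-n / d ^ 2).natAbs) (jacobiClass r (-n / d ^ 2)) (ν + 1 / 2)
        else 0 := by
    intro r hr
    have hr2 : r % 2 = 1 := by rcases hr with rfl | rfl <;> norm_num
    have h1 := zeta2_mul_gauss_series hr (-n) hν
    simp only [oddTerm]
    rw [h1, mul_left_comm, tsum_eq_sum (s := Finset.range (n.natAbs + 1)), Finset.mul_sum]
    · congr 1
      refine Finset.sum_congr rfl fun d _ => ?_
      split_ifs with h
      · obtain ⟨h2, -, -⟩ := natAbs_div_sq hn h.2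
        rw [(hΛ _ _ (by omega) (jacobiClass_add hr2 _) (norm_jacobiClass_le r _)).2 _ hs3,
          tsum_jacobiClass hr2]
        ring
      · ring
    · intro d hd
      refine if_neg fun h => hd ?_
      have := (natAbs_div_sq hn h.2).2.2.1
      rw [Finset.mem_range]
      omega
  rw [kronSeries_eq n hν, kronCoeff, Finset.sum_pair (by norm_num), ← key 1 (Or.inl rfl),
    ← key 3 (Or.inr rfl), tsum_twoTerm (by norm_num) hn, tsum_twoTerm (by norm_num) hn]
  ring

lemma differentiable_kronCoeff {Λ : ℕ → (ℕ → ℂ) → ℂ → ℂ}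
    (hΛ : ∀ (N : ℕ) (Φ : ℕ → ℂ), 0 < N → (∀ m, Φ (m + N) = Φ m) → (∀ m, ‖Φ m‖ ≤ 1) →
      Differentiable ℂ (Λ N Φ))
    {n : ℤ} (hn : n ≠ 0) : Differentiable ℂ (kronCoeff Λ n) := by
  refine Differentiable.fun_sum fun r hr => Differentiable.mul ?_ (Differentiable.const_mul ?_ _)
  · refine Differentiable.fun_sum fun v _ => ?_
    have h0 : ((2 ^ (v + 2) : ℕ) : ℂ) ≠ 0 := by
      have : 0 < 2 ^ (v + 2) := by positivity
      exact_mod_cast this.ne'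
    refine Differentiable.mul_const ?_ _
    exact Differentiable.const_cpow (by fun_prop) (Or.inl h0)
  · refine Differentiable.fun_sum fun d _ => ?_
    have hr2 : r % 2 = 1 := by
      simp only [Finset.mem_insert, Finset.mem_singleton] at hr
      rcases hr with rfl | rfl <;> norm_num
    split_ifs with h
    · obtain ⟨h2, -, -, hd0⟩ := natAbs_div_sq hn h.2
      have h0 : (d : ℂ) ≠ 0 := by exact_mod_cast hd0.ne'
      refine Differentiable.mul (Differentiable.const_cpow (by fun_prop) (Or.inl h0)) ?_
      exact (hΛ _ _ (by omega) (jacobiClass_add hr2 _) (norm_jacobiClass_le r _)).comp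
        (by fun_prop : Differentiable ℂ fun ν : ℂ => ν + 1 / 2)
    · exact differentiable_const _

/-- Each ingredient is polynomial in |n| on a disc: at most 8|n| terms v with 2^{v+2} ≤ 8|n|, at
most |n| + 1 values of d, all d ≤ |n|, and periods at most 4|n|. -/
lemma norm_kronCoeff_le {Λ : ℕ → (ℕ → ℂ) → ℂ → ℂ}
    (hΛ : ∀ R : ℝ, ∃ (C : ℝ) (A : ℕ), ∀ (N : ℕ) (Φ : ℕ → ℂ), 0 < N → (∀ m, ‖Φ m‖ ≤ 1) →
      ∀ s : ℂ, ‖s‖ ≤ R → ‖Λ N Φ s‖ ≤ C * N ^ A) (R : ℝ) :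
    ∃ (C : ℝ) (A : ℕ), ∀ n : ℤ, n ≠ 0 → ∀ ν : ℂ, ‖ν‖ ≤ R →
      ‖kronCoeff Λ n ν‖ ≤ C * (n.natAbs : ℝ) ^ A := by
  obtain ⟨C, A, hC⟩ := hΛ (|R| + 1)
  set K := ⌈R + 1⌉₊
  set L := ⌈2 * R⌉₊
  have hC0 : 0 ≤ C := by
    have := (norm_nonneg _).trans (hC 1 0 one_pos (by simp) 0 (by rw [norm_zero]; positivity))
    simpa using this
  refine ⟨2 * (8 ^ (K + 2) * (2 * (C * 4 ^ A))), (K + 2) + (1 + L + A), fun n hn ν hν => ?_⟩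
  have hn1 : (1 : ℝ) ≤ n.natAbs := by exact_mod_cast Int.natAbs_pos.2 hn
  have hR : ‖ν + 1‖ ≤ R + 1 := (norm_add_le _ _).trans (by simpa using hν)
  have hR2 : ‖2 * ν‖ ≤ 2 * R := by simpa using hν
  have hR3 : ‖ν + 1 / 2‖ ≤ |R| + 1 := by
    refine (norm_add_le _ _).trans ?_
    have := le_abs_self R
    norm_num
    linarith
  have h1 : ∀ r, r % 2 = 1 → ‖∑ v ∈ Finset.range (8 * n.natAbs), twoTerm r n ν v‖ ≤
      8 ^ (K + 2) * (n.natAbs : ℝ) ^ (K + 2) := by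
    intro r hr
    refine (norm_sum_le_of_le _ (n := fun _ => (8 * n.natAbs : ℝ) ^ (K + 1)) fun v _ => ?_).trans ?_
    · rw [twoTerm]
      by_cases h : kronGaussTwo (v + 2) r n = 0
      · rw [h, mul_zero, norm_zero]
        positivity
      have h1 := two_pow_le_of_kronGaussTwo_ne_zero hr hn h
      have h2 := norm_natCast_cpow_le (m := 2 ^ (v + 2)) hR (by positivity) h1
      have h3 : ‖kronGaussTwo (v + 2) r n‖ ≤ 8 * n.natAbs :=
        (norm_kronGaussTwo_le _ _ _).trans (by exact_mod_cast h1)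
      rw [norm_mul, pow_succ _ K]
      refine mul_le_mul (h2.trans_eq (by push_cast; rfl)) h3 (norm_nonneg _) (by positivity)
    · rw [Finset.sum_const, Finset.card_range, nsmul_eq_mul]
      refine le_of_eq ?_
      push_cast
      ring
  have h2 : ∀ r, ‖gaussSign r * ∑ d ∈ Finset.range (n.natAbs + 1),
      if Odd d ∧ (d : ℤ) ^ 2 ∣ -n then (d : ℂ) ^ (-(2 * ν)) *
        Λ (4 * (-n / d ^ 2).natAbs) (jacobiClass r (-n / d ^ 2)) (ν + 1 / 2) else 0‖ ≤
      2 * (C * 4 ^ A) * (n.natAbs : ℝ) ^ (1 + L + A) := by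
    intro r
    rw [norm_mul, norm_gaussSign, one_mul]
    refine (norm_sum_le_of_le _ (n := fun _ => (n.natAbs : ℝ) ^ L * (C * (4 * n.natAbs) ^ A))
      fun d _ => ?_).trans ?_
    · split_ifs with h
      · obtain ⟨h3, h4, h5, h6⟩ := natAbs_div_sq hn h.2
        rw [norm_mul]
        refine mul_le_mul (norm_natCast_cpow_le hR2 h6 h5) ?_ (norm_nonneg _) (by positivity)
        refine (hC _ _ (by omega) (norm_jacobiClass_le r _) _ hR3).trans ?_
        gcongr
        push_cast
        have : ((-n / d ^ 2).natAbs : ℝ) ≤ n.natAbs := by exact_mod_cast h4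
        linarith
      · rw [norm_zero]
        positivity
    · rw [Finset.sum_const, Finset.card_range, nsmul_eq_mul]
      have : ((n.natAbs + 1 : ℕ) : ℝ) ≤ 2 * n.natAbs := by push_cast; linarith
      calc _ ≤ (2 * n.natAbs : ℝ) * ((n.natAbs : ℝ) ^ L * (C * (4 * n.natAbs) ^ A)) := by gcongr
        _ = _ := by ring
  rw [kronCoeff, Finset.sum_pair (by norm_num)]
  refine (norm_add_le _ _).trans ?_
  rw [norm_mul (∑ v ∈ Finset.range (8 * n.natAbs), twoTerm 1 n ν v),
    norm_mul (∑ v ∈ Finset.range (8 * n.natAbs), twoTerm 3 n ν v)]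
  calc _ ≤ 8 ^ (K + 2) * (n.natAbs : ℝ) ^ (K + 2) *
        (2 * (C * 4 ^ A) * (n.natAbs : ℝ) ^ (1 + L + A)) +
        8 ^ (K + 2) * (n.natAbs : ℝ) ^ (K + 2) *
        (2 * (C * 4 ^ A) * (n.natAbs : ℝ) ^ (1 + L + A)) := by
        exact add_le_add
          (mul_le_mul (h1 1 (by norm_num)) (h2 1) (norm_nonneg _) (by positivity))
          (mul_le_mul (h1 3 (by norm_num)) (h2 3) (norm_nonneg _) (by positivity))
    _ = _ := by ring

/-- The non-zero Fourier coefficients: continuation and growth. -/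
theorem exists_entire_kronSeries : ∃ β : ℤ → ℂ → ℂ,
    (∀ n : ℤ, n ≠ 0 → Differentiable ℂ (β n) ∧ ∀ ν : ℂ, 1 < ν.re →
      β n ν = (ν - 1 / 2) * (zeta2 (2 * ν + 1) * kronSeries n ν)) ∧
    ∀ R : ℝ, ∃ (C : ℝ) (A : ℕ), ∀ n : ℤ, n ≠ 0 → ∀ ν : ℂ, ‖ν‖ ≤ R →
      ‖β n ν‖ ≤ C * (n.natAbs : ℝ) ^ A := by
  obtain ⟨Λ, h1, h2⟩ := exists_entire_periodic
  exact ⟨kronCoeff Λ, fun n hn => ⟨differentiable_kronCoeff (fun N Φ a b c => (h1 N Φ a b c).1) hn,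
    fun ν hν => kronCoeff_eq h1 hn hν⟩, norm_kronCoeff_le h2⟩

/-- The constant Fourier coefficient. -/
theorem zeta2_mul_kronSeries_zero {ν : ℂ} (hν : 1 < ν.re) :
    zeta2 (2 * ν + 1) * kronSeries 0 ν = 2 ^ (-(2 * ν) - 2) * riemannZeta (2 * ν) := by
  have hs2 : 1 < (2 * ν).re := by simp; linarith
  -- For m = 0 the symbol (0/c) vanishes except at c = 1. Only the class r = 1 contributes, and the
  -- sum over odd d is ζ₂(2ν).
  have hodd : ∀ r : ℕ, r = 1 ∨ r = 3 → zeta2 (2 * ν + 1) * ∑' c, oddTerm r 0 ν c =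
      if r = 1 then zeta2 (2 * ν) else 0 := by
    intro r hr
    have h1 := zeta2_mul_gauss_series hr (-0) hν
    simp only [oddTerm]
    rw [h1, zeta2_eq_tsum hs2]
    have h2 : ∀ c : ℕ, c ≠ 1 →
        (if c % 4 = r then (J(0 | c) : ℂ) * (c : ℂ) ^ (-(ν + 1 / 2)) else 0) = 0 := by
      intro c hc
      split_ifs with h
      · rw [jacobiSym.zero_left (by rcases hr with rfl | rfl <;> omega), Int.cast_zero, zero_mul]
      · rfl
    simp only [neg_zero, dvd_zero, and_true, Int.zero_ediv]
    rw [tsum_eq_single 1 h2]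
    rcases hr with rfl | rfl
    · simp [gaussSign]
    · simp
  -- With q = 2^{-ν} the 2-adic factor is a geometric series over even v with sum q²/(4(1 - q²));
  -- the denominator cancels the Euler factor of ζ₂(2ν).
  set q : ℂ := 2 ^ (-ν) with hq
  have hq1 : ‖q‖ < 1 := by
    rw [hq, show (2 : ℂ) = ((2 : ℕ) : ℂ) by norm_num, Complex.norm_natCast_cpow_of_pos two_pos,
      Complex.neg_re]
    exact Real.rpow_lt_one_of_one_lt_of_neg (by norm_num) (by linarith)
  have htwo : ∀ v, twoTerm 1 0 ν v = q ^ 2 / 8 * q ^ v + q ^ 2 / 8 * (-q) ^ v := by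
    intro v
    have h0 : ((2 ^ (v + 2) : ℕ) : ℂ) ≠ 0 := by
      have : 0 < 2 ^ (v + 2) := by positivity
      exact_mod_cast this.ne'
    have h1 : ((2 ^ (v + 2) : ℕ) : ℂ) ^ (-ν) = q ^ (v + 2) := by
      rw [hq, Nat.cast_pow, ← Complex.natCast_cpow_natCast_mul, Complex.cpow_nat_mul,
        Nat.cast_ofNat]
    have h2 := kronGaussTwo_zero (v := v + 2) (by omega)
    have h3 : kronGaussTwo (v + 2) 1 0 = (1 + (-1) ^ v) * ((2 ^ (v + 2) : ℕ) : ℂ) / 8 := by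
      rw [eq_div_iff (by norm_num), mul_comm, h2]
      push_cast
      ring
    have h4 : ((2 ^ (v + 2) : ℕ) : ℂ) ^ (-(ν + 1)) * ((2 ^ (v + 2) : ℕ) : ℂ) = q ^ (v + 2) := by
      rw [← h1, show -ν = -(ν + 1) + 1 by ring, Complex.cpow_add _ _ h0, Complex.cpow_one]
    rw [twoTerm, h3, neg_pow q v]
    linear_combination (1 + (-1) ^ v) / 8 * h4
  have hsum : ∑' v, twoTerm 1 0 ν v = q ^ 2 / 8 * (1 - q)⁻¹ + q ^ 2 / 8 * (1 - -q)⁻¹ := by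
    have h1 := (hasSum_geometric_of_norm_lt_one hq1).mul_left (q ^ 2 / 8)
    have h2 := (hasSum_geometric_of_norm_lt_one (ξ := -q) (by rwa [norm_neg])).mul_left (q ^ 2 / 8)
    rw [tsum_congr htwo]
    exact (h1.add h2).tsum_eq
  have hne : ∀ z : ℂ, ‖z‖ < 1 → 1 - z ≠ 0 := fun z hz h => by
    rw [← sub_eq_zero.1 h, norm_one] at hz
    exact lt_irrefl _ hz
  have n1 := hne q hq1
  have n2 := hne (-q) (by rwa [norm_neg])
  have hq2 : (2 : ℂ) ^ (-(2 * ν)) = q ^ 2 := by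
    rw [hq, ← Complex.cpow_nat_mul]
    congr 1
    push_cast
    ring
  rw [kronSeries_eq 0 hν, mul_add, mul_left_comm, hodd 1 (Or.inl rfl), mul_left_comm,
    hodd 3 (Or.inr rfl), hsum, Complex.cpow_sub _ _ two_ne_zero, zeta2, hq2]
  simp only [if_true]
  norm_num
  have n3 : 1 + q ≠ 0 := by rwa [sub_neg_eq_add] at n2
  field_simp
  ring

end

/-! ### Seminorms, strong convergence, and tail estimates uniform in the parameter. -/

section

variable {ε : ℤˣ} {ν : ℂ}

lemma snorm_smul (g : Mp) (k : ℕ) (c : ℂ) (f : SmoothPS ε ν) :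
    snorm g k (c • f) = ‖c‖ * snorm g k f := by
  have h : (jets ε ν (c • f) g k).restrict (Set.Icc (-1 : ℝ) 1) =
      c • (jets ε ν f g k).restrict (Set.Icc (-1 : ℝ) 1) := by
    rw [map_smul]
    rfl
  rw [snorm, h, norm_smul, snorm]

lemma qnorm_smul (k : ℕ) (c : ℂ) (f : SmoothPS ε ν) : qnorm k (c • f) = ‖c‖ * qnorm k f := by
  rw [qnorm, qnorm, Finset.mul_sum]
  exact Finset.sum_congr rfl fun j _ => by rw [snorm_smul, snorm_smul, mul_add]

/-- The strong topology on the dual is uniform convergence on bounded sets; a continuous seminorm is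
bounded on each of them. -/
lemma exists_qnorm_le_of_isVonNBounded {s : Set (SmoothPS ε ν)}
    (hs : Bornology.IsVonNBounded ℂ s) (k : ℕ) : ∃ M : ℝ, ∀ f ∈ s, qnorm k f ≤ M := by
  have hU : {f : SmoothPS ε ν | qnorm k f < 1} ∈ 𝓝 (0 : SmoothPS ε ν) :=
    (continuous_qnorm (ε := ε) (ν := ν) k).continuousAt.preimage_mem_nhds
      (by rw [qnorm_zero]; exact Iio_mem_nhds one_pos)
  obtain ⟨r, hr, h⟩ := (hs hU).exists_pos
  refine ⟨r, fun f hf => ?_⟩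
  obtain ⟨g, hg, rfl⟩ := h (r : ℂ) (by simp [abs_of_pos hr]) hf
  have hg' : qnorm k g < 1 := hg
  change qnorm k ((r : ℂ) • g) ≤ r
  rw [qnorm_smul, Complex.norm_real, Real.norm_of_nonneg hr.le]
  nlinarith

/-- Series of distributions that are dominated by a continuous seminorm converge strongly. -/
theorem hasSum_of_le_qnorm {ι : Type*} (F : ι → SmoothPS ε ν →L[ℂ] ℂ) (C : ι → ℝ) (k : ℕ)
    (hF : ∀ i f, ‖F i f‖ ≤ C i * qnorm k f) (hC : Summable C) :
    ∃ G : SmoothPS ε ν →L[ℂ] ℂ, HasSum F G ∧ ∀ f, HasSum (fun i => F i f) (G f) := by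
  have hs : ∀ f, Summable fun i => F i f := fun f =>
    Summable.of_norm_bounded (hC.mul_right (qnorm k f)) fun i => hF i f
  let L : SmoothPS ε ν →ₗ[ℂ] ℂ :=
    { toFun := fun f => ∑' i, F i f
      map_add' := fun f g => by
        simp only [map_add]
        exact (hs f).tsum_add (hs g)
      map_smul' := fun c f => by
        simp only [map_smul, RingHom.id_apply, smul_eq_mul]
        exact tsum_mul_left }
  let G : SmoothPS ε ν →L[ℂ] ℂ :=
    { toLinearMap := L
      cont := continuous_of_bound L (∑' i, C i) k fun f => by
        rw [← tsum_mul_right]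
        exact tsum_of_norm_bounded (hC.mul_right _).hasSum fun i => hF i f }
  refine ⟨G, ?_, fun f => (hs f).hasSum⟩
  rw [HasSum, SummationFilter.unconditional_filter]
  -- On a bounded set the seminorm is at most some M, and the Weierstrass M-test gives uniform
  -- convergence of the partial sums.
  refine (UniformConvergenceCLM.tendsto_iff_tendstoUniformlyOn _ _ _).2 fun s hs' => ?_
  obtain ⟨M, hM⟩ := exists_qnorm_le_of_isVonNBounded hs' k
  have h := tendstoUniformlyOn_tsum (f := fun i f => F i f) (u := fun i => |C i| * M)
    (hC.abs.mul_right M) (s := s) fun i f hf => (hF i f).trans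
      ((mul_le_mul_of_nonneg_right (le_abs_self _) (qnorm_nonneg _ _)).trans
        (mul_le_mul_of_nonneg_left (hM f hf) (abs_nonneg _)))
  refine h.congr (Filter.Eventually.of_forall fun t f _ => ?_)
  exact (sum_apply t F f).symm

/-- Here and in `apply_nElt_neg` the constant of `apply_chart` is explicit. It is 1 or -εi, hence of
modulus one and independent of ν, as uniform estimates and the sign pattern of 𝟙 require. -/
lemma apply_nElt_pos (f : SmoothPS ε ν) {x : ℝ} (hx : 0 < x) :
    f (nElt x) = Complex.exp ((ν - 1) * Real.log x) * f (sElt⁻¹ * nElt (-x⁻¹)) := by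
  have hx' : (-x⁻¹) < 0 := by simpa using hx
  have h := chart_neg hx'
  rw [inv_neg, inv_inv, neg_neg, neg_neg] at h
  rw [h, f.2.2, omega, sigma, mul_inv, ← Complex.exp_neg, Real.log_inv]
  simp only [Units.val_one, Int.cast_one, if_true, mul_one, inv_one, one_mul]
  congr 2
  push_cast
  ring

lemma apply_nElt_neg (f : SmoothPS ε ν) {x : ℝ} (hx : 0 < x) :
    f (nElt (-x)) = -((ε : ℤ) : ℂ) * Complex.I * Complex.exp ((ν - 1) * Real.log x) *
      f (sElt⁻¹ * nElt x⁻¹) := by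
  have h := chart_pos (inv_pos.2 hx)
  rw [inv_inv] at h
  have h1 : (sigma ε (-1) (-1))⁻¹ = -((ε : ℤ) : ℂ) * Complex.I := by
    rcases Int.units_eq_one_or ε with rfl | rfl <;> simp [sigma]
  rw [h, f.2.2, omega, mul_inv, h1, ← Complex.exp_neg, Real.log_inv]
  congr 3
  push_cast
  ring

lemma norm_units_mul_I (ε : ℤˣ) : ‖((ε : ℤ) : ℂ) * Complex.I‖ = 1 := by
  rcases Int.units_eq_one_or ε with rfl | rfl <;> simp

/-- `iteratedDeriv_tail` with coefficients that are continuous in the exponent. -/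
lemma iteratedDeriv_tail_continuous (k : ℕ) : ∃ a : ℕ → ℂ → ℂ, (∀ j, Continuous (a j)) ∧
    ∀ (s c : ℂ) (g h : ℝ → ℂ),
    ContDiff ℝ ∞ g → (∀ x, 0 < x → h x = c * Complex.exp (-s * Real.log x) * g x⁻¹) →
    ∀ x : ℝ, 0 < x → iteratedDeriv k h x = c * ∑ j ∈ Finset.range (k + 1),
      a j s * (Complex.exp (-(s + k + j) * Real.log x) * iteratedDeriv j g x⁻¹) := by
  induction k with
  | zero =>
    refine ⟨fun _ _ => 1, fun _ => continuous_const, fun s c g h _ hh x hx => ?_⟩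
    simp [hh x hx]
    ring
  | succ k ih =>
    obtain ⟨a, hac, ha⟩ := ih
    refine ⟨fun j s => (if j < k + 1 then -(s + k + j) * a j s else 0) -
      (if j = 0 then 0 else a (j - 1) s), fun j => ?_, fun s c g h hg hh x hx => ?_⟩
    · have := hac j
      have := hac (j - 1)
      dsimp only
      split_ifs <;> fun_prop
    have hd : ∀ j : ℕ, HasDerivAt
        (fun x : ℝ => Complex.exp (-(s + k + j) * Real.log x) * iteratedDeriv j g x⁻¹)
        (-(s + k + j) * (Complex.exp (-(s + (k + 1 : ℕ) + j) * Real.log x) *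
            iteratedDeriv j g x⁻¹) -
          Complex.exp (-(s + (k + 1 : ℕ) + (j + 1 : ℕ)) * Real.log x) *
            iteratedDeriv (j + 1) g x⁻¹) x := by
      intro j
      have h1 : HasDerivAt (fun x : ℝ => Complex.exp (-(s + k + j) * Real.log x))
          (Complex.exp (-(s + k + j) * Real.log x) * (-(s + k + j) * ((x⁻¹ : ℝ) : ℂ))) x :=
        ((Real.hasDerivAt_log hx.ne').ofReal_comp.const_mul _).cexp
      have h2 : HasDerivAt (iteratedDeriv j g) (iteratedDeriv (j + 1) g x⁻¹) x⁻¹ := by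
        rw [iteratedDeriv_succ]
        exact ((hg.differentiable_iteratedDeriv j (by exact_mod_cast ENat.natCast_lt_top j))
          x⁻¹).hasDerivAt
      have h3 := h2.scomp x (hasDerivAt_inv hx.ne')
      have hx1 : (x : ℂ)⁻¹ = Complex.exp (-Real.log x) := by
        rw [Complex.exp_neg, ← Complex.ofReal_exp, Real.exp_log hx]
      refine (h1.mul h3).congr_deriv ?_
      have e1 : Complex.exp (-(s + (k + 1 : ℕ) + j) * Real.log x) =
          Complex.exp (-(s + k + j) * Real.log x) * (x : ℂ)⁻¹ := by
        rw [hx1, ← Complex.exp_add]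
        congr 1
        push_cast
        ring
      have e2 : Complex.exp (-(s + (k + 1 : ℕ) + (j + 1 : ℕ)) * Real.log x) =
          Complex.exp (-(s + k + j) * Real.log x) * ((x : ℂ)⁻¹ * (x : ℂ)⁻¹) := by
        rw [hx1, ← Complex.exp_add, ← Complex.exp_add]
        congr 1
        push_cast
        ring
      rw [e1, e2]
      simp only [Function.comp_apply, Complex.real_smul]
      push_cast
      field_simp
      ring
    have hd' : HasDerivAt (iteratedDeriv k h) (c * ∑ j ∈ Finset.range (k + 1), a j s *
        (-(s + k + j) * (Complex.exp (-(s + (k + 1 : ℕ) + j) * Real.log x) *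
            iteratedDeriv j g x⁻¹) -
          Complex.exp (-(s + (k + 1 : ℕ) + (j + 1 : ℕ)) * Real.log x) *
            iteratedDeriv (j + 1) g x⁻¹)) x := by
      refine ((HasDerivAt.fun_sum (u := Finset.range (k + 1))
        fun j _ => (hd j).const_mul (a j s)).const_mul c).congr_of_eventuallyEq ?_
      filter_upwards [lt_mem_nhds hx] with y hy
      exact ha s c g h hg hh y hy
    rw [iteratedDeriv_succ, hd'.deriv]
    congr 1
    simp only [sub_mul, Finset.sum_sub_distrib, mul_sub]
    congr 1
    · rw [Finset.sum_range_succ _ (k + 1)]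
      simp only [lt_irrefl, if_false, zero_mul, add_zero]
      refine Finset.sum_congr rfl fun j hj => ?_
      rw [if_pos (Finset.mem_range.1 hj)]
      ring
    · rw [Finset.sum_range_succ' _ (k + 1)]
      simp

/-- `tail_bound`, locally uniformly in the parameter. -/
theorem tail_bound_uniform (k : ℕ) (R : ℝ) : ∃ C : ℝ, 0 ≤ C ∧
    ∀ (ε : ℤˣ) (ν : ℂ), ‖ν‖ ≤ R → 1 ≤ -ν.re + k → ∀ (f : SmoothPS ε ν) (x : ℝ),
      ‖iteratedDeriv k (slice f 1) x‖ ≤ C * qnorm k f * (1 + x ^ 2)⁻¹ := by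
  obtain ⟨a, hac, ha⟩ := iteratedDeriv_tail_continuous k
  -- Continuity of the coefficients in the exponent bounds them on the compact disc of parameters.
  obtain ⟨A, hA⟩ : ∃ A : ℝ, ∀ ν : ℂ, ‖ν‖ ≤ R →
      ∑ j ∈ Finset.range (k + 1), ‖a j (1 - ν)‖ ≤ A := by
    have hc : Continuous fun ν : ℂ => ∑ j ∈ Finset.range (k + 1), ‖a j (1 - ν)‖ :=
      continuous_finsetSum _ fun j _ =>
        ((hac j).comp (continuous_const.sub continuous_id)).norm
    obtain ⟨A, hA⟩ := (isCompact_closedBall (0 : ℂ) R).bddAbove_image hc.continuousOn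
    exact ⟨A, fun ν hν => hA ⟨ν, by simpa using hν, rfl⟩⟩
  have key : ∀ σ : ℝ, (σ = 1 ∨ σ = -1) → ∀ (ε : ℤˣ) (ν : ℂ), ‖ν‖ ≤ R → 1 ≤ -ν.re + k →
      ∀ (f : SmoothPS ε ν) (x : ℝ), 1 ≤ x →
      ‖iteratedDeriv k (slice f 1) (σ * x)‖ ≤ |A| * 2 * qnorm k f * (1 + x ^ 2)⁻¹ := by
    intro σ hσ ε ν hν hk f x hx
    have hσ1 : ‖σ‖ = 1 := by rcases hσ with rfl | rfl <;> simp
    obtain ⟨c, hc1, hc⟩ : ∃ c : ℂ, ‖c‖ = 1 ∧ ∀ x : ℝ, 0 < x → f (nElt (σ * x)) =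
        c * Complex.exp ((ν - 1) * Real.log x) * f (sElt⁻¹ * nElt (-σ * x⁻¹)) := by
      rcases hσ with rfl | rfl
      · exact ⟨1, norm_one, fun x hx => by
          rw [one_mul, one_mul, neg_one_mul, apply_nElt_pos f hx]⟩
      · exact ⟨-((ε : ℤ) : ℂ) * Complex.I, by rw [neg_mul, norm_neg, norm_units_mul_I],
          fun x hx => by rw [neg_one_mul, neg_neg, one_mul, apply_nElt_neg f hx]⟩
    have hx0 : 0 < x := by linarith
    have hs : ContDiff ℝ ∞ fun y : ℝ => slice f sElt⁻¹ (-σ * y) :=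
      (slice_smooth f _).comp (contDiff_const.mul contDiff_id)
    have h1 := ha (1 - ν) c (fun y => slice f sElt⁻¹ (-σ * y)) (fun x => slice f 1 (σ * x)) hs
      (fun x hx => by simpa [slice] using hc x hx) x hx0
    have h2 := iteratedDeriv_comp_const_smul (n := k) (f := slice f 1)
      (show ContDiff ℝ k (slice f 1) from (slice_smooth f 1).of_le (by exact_mod_cast le_top)) σ
    rw [h2] at h1
    have h3 : ‖iteratedDeriv k (slice f 1) (σ * x)‖ =
        ‖σ ^ k • iteratedDeriv k (slice f 1) (σ * x)‖ := by
      rw [norm_smul, norm_pow, hσ1, one_pow, one_mul]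
    rw [h3, congrArg norm h1, norm_mul, hc1, one_mul]
    have hx2 : (x ^ 2)⁻¹ ≤ 2 * (1 + x ^ 2)⁻¹ := by
      rw [← div_eq_mul_inv, inv_eq_one_div, div_le_div_iff₀ (by positivity) (by positivity)]
      nlinarith
    have h4 : ‖∑ j ∈ Finset.range (k + 1), a j (1 - ν) *
        (Complex.exp (-(1 - ν + k + j) * Real.log x) *
        iteratedDeriv j (fun y => slice f sElt⁻¹ (-σ * y)) x⁻¹)‖ ≤
        ∑ j ∈ Finset.range (k + 1), ‖a j (1 - ν)‖ * ((2 * (1 + x ^ 2)⁻¹) * qnorm k f) := by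
      refine norm_sum_le_of_le _ fun j hj => ?_
      have hj' : j ≤ k := Nat.lt_succ_iff.1 (Finset.mem_range.1 hj)
      rw [norm_mul, norm_mul]
      refine mul_le_mul_of_nonneg_left ?_ (norm_nonneg _)
      refine mul_le_mul ?_ ?_ (norm_nonneg _) (by positivity)
      · refine le_trans ?_ hx2
        rw [Complex.norm_exp]
        have e : (x ^ 2)⁻¹ = Real.exp (-2 * Real.log x) := by
          rw [neg_mul, Real.exp_neg, mul_comm, Real.exp_mul, Real.exp_log hx0]
          norm_num
        rw [e]
        refine Real.exp_le_exp.2 ?_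
        have e2 : (-(1 - ν + k + j) * (Real.log x : ℂ)).re =
            -(1 - ν.re + k + j) * Real.log x := by simp
        rw [e2]
        refine mul_le_mul_of_nonneg_right ?_ (Real.log_nonneg hx)
        have : (0 : ℝ) ≤ j := Nat.cast_nonneg j
        linarith
      · have h5 := iteratedDeriv_comp_const_smul (n := j) (f := slice f sElt⁻¹)
          (show ContDiff ℝ j (slice f sElt⁻¹) from
            (slice_smooth f _).of_le (by exact_mod_cast le_top)) (-σ)
        rw [h5, norm_smul, norm_pow, norm_neg, hσ1, one_pow, one_mul]
        refine le_qnorm_s hj' f ?_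
        rw [Set.mem_Icc, ← abs_le, abs_mul, abs_neg]
        have : |σ| = 1 := hσ1
        rw [this, one_mul, abs_of_pos (inv_pos.2 hx0)]
        exact inv_le_one_of_one_le₀ hx
    refine h4.trans ?_
    rw [← Finset.sum_mul, show |A| * 2 * qnorm k f * (1 + x ^ 2)⁻¹ =
      |A| * (2 * (1 + x ^ 2)⁻¹ * qnorm k f) by ring]
    refine mul_le_mul_of_nonneg_right ((hA ν hν).trans (le_abs_self A)) ?_
    exact mul_nonneg (by positivity) (qnorm_nonneg _ _)
  refine ⟨2 + |A| * 2, by positivity, fun ε ν hν hk f x => ?_⟩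
  have hq := qnorm_nonneg k f
  have hp : 0 ≤ (1 + x ^ 2)⁻¹ := by positivity
  have hqp := mul_nonneg hq hp
  have hA0 := abs_nonneg A
  rcases le_or_gt 1 x with hx | hx
  · have := key 1 (Or.inl rfl) ε ν hν hk f x hx
    rw [one_mul] at this
    nlinarith [mul_nonneg hA0 hqp]
  rcases le_or_gt x (-1) with hx' | hx'
  · have := key (-1) (Or.inr rfl) ε ν hν hk f (-x) (by linarith)
    rw [neg_mul_neg, one_mul, neg_sq] at this
    nlinarith [mul_nonneg hA0 hqp]
  have h := le_qnorm_one (le_refl k) f (x := x) ⟨hx'.le, hx.le⟩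
  have h2 : 1 ≤ 2 * (1 + x ^ 2)⁻¹ := by
    rw [← div_eq_mul_inv, le_div_iff₀ (by positivity)]
    nlinarith
  nlinarith [mul_nonneg hA0 hqp, mul_nonneg hq (sub_nonneg.2 h2)]

end

/-! ### The distributions 𝕖_n and 𝟙: independence of the regularization and the term of frequency
zero. -/

section

variable {ε : ℤˣ} {ν : ℂ}
open MeasureTheory

lemma hasDerivAt_eExp_mul (n : ℤ) (x : ℝ) :
    HasDerivAt (fun x : ℝ => eExp (n * x)) (2 * Real.pi * Complex.I * n * eExp (n * x)) x := by
  unfold eExp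
  have h : HasDerivAt (fun x : ℝ => 2 * Real.pi * Complex.I * ((n * x : ℝ) : ℂ))
      (2 * Real.pi * Complex.I * n) x := by
    have h1 := ((hasDerivAt_id x).ofReal_comp.const_mul (n : ℂ)).const_mul (2 * Real.pi * Complex.I)
    simpa using h1
  exact h.cexp.congr_deriv (mul_comm _ _)

lemma continuous_eExp_mul (n : ℤ) : Continuous fun x : ℝ => eExp (n * x) :=
  continuous_eExp.comp (continuous_const.mul continuous_id)

lemma integrable_eExp_mul {h : ℝ → ℂ} (hh : Integrable h) (n : ℤ) :
    Integrable fun x : ℝ => eExp (n * x) * h x :=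
  hh.bdd_mul (c := 1) (continuous_eExp_mul n).aestronglyMeasurable
    (Filter.Eventually.of_forall fun _ => (norm_eExp _).le)

lemma two_pi_I_mul_ne_zero {n : ℤ} (hn : n ≠ 0) : (2 * Real.pi * Complex.I * n : ℂ) ≠ 0 :=
  mul_ne_zero Complex.two_pi_I_ne_zero (by exact_mod_cast hn)

lemma integral_eExp_mul_iteratedDeriv {h : ℝ → ℂ} (hh : ContDiff ℝ ∞ h) {k : ℕ}
    (h0 : Integrable (iteratedDeriv k h)) (h1 : Integrable (iteratedDeriv (k + 1) h))
    {n : ℤ} (hn : n ≠ 0) :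
    ∫ x : ℝ, eExp (n * x) * iteratedDeriv k h x = (-1 / (2 * Real.pi * Complex.I * n)) *
      ∫ x : ℝ, eExp (n * x) * iteratedDeriv (k + 1) h x := by
  have hd : ∀ x, HasDerivAt (iteratedDeriv k h) (iteratedDeriv (k + 1) h x) x := fun x => by
    rw [iteratedDeriv_succ]
    exact ((hh.differentiable_iteratedDeriv k (by exact_mod_cast ENat.natCast_lt_top k))
      x).hasDerivAt
  have h2 := integral_mul_deriv_eq_deriv_mul_of_integrable
    (u := fun x : ℝ => eExp (n * x)) (v := iteratedDeriv k h)
    (u' := fun x : ℝ => 2 * Real.pi * Complex.I * n * eExp (n * x))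
    (v' := iteratedDeriv (k + 1) h) (fun x _ => hasDerivAt_eExp_mul n x) (fun x _ => hd x)
    (integrable_eExp_mul h1 n) ?_ (integrable_eExp_mul h0 n)
  · rw [h2]
    simp only [mul_assoc]
    rw [integral_const_mul, integral_const_mul, integral_const_mul, integral_const_mul]
    have := two_pi_I_mul_ne_zero hn
    field_simp
  · refine ((integrable_eExp_mul h0 n).const_mul (2 * Real.pi * Complex.I * n)).congr
      (Filter.Eventually.of_forall fun x => ?_)
    simp only [Pi.mul_apply]
    ring

/-- One integration by parts does not change the value as long as all derivatives involved are
integrable. The order l may lie below `regOrder ν`; this covers test functions with compact support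
as well as other orders valid for the given ν. -/
lemma fourierDist_eq_integral {n : ℤ} (hn : n ≠ 0) (φ : SmoothPS (-ε) (-ν)) {l : ℕ}
    (hl : l ≤ regOrder ν) (hi : ∀ j, l ≤ j → Integrable (iteratedDeriv j (slice φ 1))) {k : ℕ}
    (hk : l ≤ k) : fourierDist ε ν n φ = (-1 / (2 * Real.pi * Complex.I * n)) ^ k *
      ∫ x : ℝ, eExp (n * x) * iteratedDeriv k (slice φ 1) x := by
  set J : ℕ → ℂ := fun k => (-1 / (2 * Real.pi * Complex.I * n)) ^ k *
      ∫ x : ℝ, eExp (n * x) * iteratedDeriv k (slice φ 1) x with hJ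
  have hstep : ∀ m, J (l + m) = J l := by
    intro m
    induction m with
    | zero => rfl
    | succ m ih =>
      rw [← ih]
      simp only [hJ]
      rw [integral_eExp_mul_iteratedDeriv (k := l + m) (slice_smooth φ 1) (hi _ (by omega))
        (hi _ (by omega)) hn, ← mul_assoc, ← pow_succ, add_assoc]
  obtain ⟨a, ha⟩ := Nat.exists_eq_add_of_le hl
  obtain ⟨b, rfl⟩ := Nat.exists_eq_add_of_le hk
  have e : fourierDist ε ν n φ = J (regOrder ν) := by
    rw [fourierDist, if_neg hn]
    rfl
  rw [e, ha, hstep]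
  exact (hstep b).symm

lemma integrable_iteratedDeriv_slice {k : ℕ} (hk : 1 ≤ -ν.re + k) (φ : SmoothPS ε ν) :
    Integrable (iteratedDeriv k (slice φ 1)) := by
  simpa [eExp] using fourier_integrable k hk 0 φ

lemma fourierDist_eq {n : ℤ} (hn : n ≠ 0) (φ : SmoothPS (-ε) (-ν)) {k : ℕ}
    (hk : 1 ≤ ν.re + k) : fourierDist ε ν n φ = (-1 / (2 * Real.pi * Complex.I * n)) ^ k *
      ∫ x : ℝ, eExp (n * x) * iteratedDeriv k (slice φ 1) x := by
  refine fourierDist_eq_integral hn φ (min_le_left (regOrder ν) k) (fun j hj => ?_)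
    (min_le_right (regOrder ν) k)
  refine integrable_iteratedDeriv_slice ?_ φ
  have h := regOrder_spec ν
  rw [Complex.neg_re, neg_neg]
  rcases min_le_iff.1 hj with hj | hj
  · have : (regOrder ν : ℝ) ≤ j := by exact_mod_cast hj
    linarith
  · have : (k : ℝ) ≤ j := by exact_mod_cast hj
    linarith

/-- The bound on `e_{ε,ν,n}` by the seminorms, locally uniform in `ν`. -/
theorem norm_fourierDist_le (k : ℕ) (R : ℝ) : ∃ C : ℝ, 0 ≤ C ∧ ∀ (ε : ℤˣ) (ν : ℂ), ‖ν‖ ≤ R →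
    1 ≤ ν.re + k → ∀ (n : ℤ), n ≠ 0 → ∀ φ : SmoothPS (-ε) (-ν),
      ‖fourierDist ε ν n φ‖ ≤ C * ((n.natAbs : ℝ) ^ k)⁻¹ * qnorm k φ := by
  obtain ⟨C, hC0, hC⟩ := tail_bound_uniform k R
  have hI : 0 ≤ ∫ x : ℝ, (1 + x ^ 2)⁻¹ := integral_nonneg fun x => by positivity
  refine ⟨C * ∫ x : ℝ, (1 + x ^ 2)⁻¹, mul_nonneg hC0 hI, fun ε ν hν hk n hn φ => ?_⟩
  have hn1 : (1 : ℝ) ≤ n.natAbs := by exact_mod_cast Int.natAbs_pos.2 hn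
  have h1 : ‖(-1 / (2 * Real.pi * Complex.I * n) : ℂ) ^ k‖ ≤ ((n.natAbs : ℝ) ^ k)⁻¹ := by
    rw [norm_pow, ← inv_pow]
    refine pow_le_pow_left₀ (norm_nonneg _) ?_ k
    have h2 : ‖(n : ℂ)‖ = n.natAbs := by
      rw [Complex.norm_intCast, Nat.cast_natAbs, Int.cast_abs]
    simp only [norm_div, norm_neg, norm_one, norm_mul, Complex.norm_real, Complex.norm_I, h2,
      Complex.norm_ofNat, Real.norm_of_nonneg Real.pi_pos.le, mul_one, one_div]
    refine inv_anti₀ (by linarith) ?_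
    nlinarith [Real.pi_gt_three]
  have h2 : ‖∫ x : ℝ, eExp (n * x) * iteratedDeriv k (slice φ 1) x‖ ≤
      C * (∫ x : ℝ, (1 + x ^ 2)⁻¹) * qnorm k φ := by
    refine (norm_integral_le_of_norm_le (integrable_inv_one_add_sq.const_mul (C * qnorm k φ))
      (Filter.Eventually.of_forall fun x => norm_fourier_integrand n x
        (hC (-ε) (-ν) (by rwa [norm_neg]) (by simpa using hk) φ x))).trans (le_of_eq ?_)
    rw [integral_const_mul]
    ring
  rw [fourierDist_eq hn φ hk, norm_mul]
  calc _ ≤ ((n.natAbs : ℝ) ^ k)⁻¹ * (C * (∫ x : ℝ, (1 + x ^ 2)⁻¹) * qnorm k φ) :=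
        mul_le_mul h1 h2 (norm_nonneg _) (by positivity)
    _ = _ := by ring

/-- The weight of the functional `oneLin` at infinity. -/
lemma intervalIntegrable_signHalf {u : ℝ → ℂ} (hu : Measurable u) {k : ℕ} {M : ℝ}
    (hb : ∀ y ∈ Set.Icc (-1 : ℝ) 1, ‖u y‖ ≤ M * |y| ^ k) (hk : 0 < ν.re + k) :
    IntervalIntegrable (fun y => signHalf ε y * ((|y| : ℝ) : ℂ) ^ (ν - 1) * u y) volume (-1) 1 := by
  have h1 : IntervalIntegrable (fun y : ℝ => M * |y| ^ (ν.re - 1 + k)) volume (-1) 1 := by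
    refine IntervalIntegrable.const_mul ?_ M
    have h2 : IntervalIntegrable (fun y : ℝ => |y| ^ (ν.re - 1 + k)) volume 0 1 := by
      refine (intervalIntegral.intervalIntegrable_rpow' (r := ν.re - 1 + k)
        (by linarith)).congr fun y hy => ?_
      rw [Set.uIoc_of_le zero_le_one] at hy
      rw [abs_of_pos hy.1]
    have h3 : IntervalIntegrable (fun y : ℝ => |y| ^ (ν.re - 1 + k)) volume (-1) 0 := by
      rw [IntervalIntegrable.iff_comp_neg]
      simpa using h2.symm
    exact h3.trans h2
  refine h1.mono_fun ?_ ?_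
  · refine Measurable.aestronglyMeasurable (Measurable.mul (Measurable.mul ?_ ?_) hu)
    · exact Measurable.ite measurableSet_Iio measurable_const measurable_const
    · fun_prop
  · refine (ae_restrict_iff' measurableSet_uIoc).2 ?_
    have h0 : ∀ᵐ y : ℝ, y ≠ 0 := by simp [ae_iff]
    filter_upwards [h0] with y hy0 hy
    rw [Set.uIoc_of_le (by norm_num)] at hy
    have hp := abs_pos.2 hy0
    have h4 := hb y (Set.Ioc_subset_Icc_self hy)
    rw [norm_mul, norm_mul, norm_signHalf, one_mul, Complex.norm_cpow_eq_rpow_re_of_pos hp,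
      Real.rpow_add hp, Real.rpow_natCast]
    refine le_trans ?_ (le_abs_self _)
    calc _ ≤ |y| ^ (ν - 1).re * (M * |y| ^ k) := by gcongr
      _ = _ := by rw [Complex.sub_re, Complex.one_re]; ring

lemma integral_signHalf_mul {u : ℝ → ℂ} (hi : IntervalIntegrable
    (fun y => signHalf ε y * ((|y| : ℝ) : ℂ) ^ (ν - 1) * u y) volume (-1) 1) :
    ∫ y in (-1 : ℝ)..1, signHalf ε y * ((|y| : ℝ) : ℂ) ^ (ν - 1) * u y =
      ((ε : ℤ) : ℂ) * Complex.I * (∫ y in (0 : ℝ)..1, (y : ℂ) ^ (ν - 1) * u y) +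
      ∫ y in (0 : ℝ)..1, (y : ℂ) ^ (ν - 1) * u (-y) := by
  have hi1 := hi.mono_set (c := 0) (d := 1) (Set.uIcc_subset_uIcc (by simp) (by simp))
  have hi2 := hi.mono_set (c := -1) (d := 0) (Set.uIcc_subset_uIcc (by simp) (by simp))
  rw [← intervalIntegral.integral_add_adjacent_intervals hi2 hi1, add_comm]
  congr 1
  · rw [← intervalIntegral.integral_const_mul]
    refine intervalIntegral.integral_congr_ae (Filter.Eventually.of_forall fun y hy => ?_)
    rw [Set.uIoc_of_le zero_le_one] at hy
    rw [signHalf, if_neg hy.1.not_gt, abs_of_pos hy.1]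
    ring
  · have h := intervalIntegral.integral_comp_neg (a := 0) (b := 1)
      (fun y : ℝ => signHalf ε y * ((|y| : ℝ) : ℂ) ^ (ν - 1) * u y)
    rw [neg_zero] at h
    rw [← h]
    refine intervalIntegral.integral_congr_ae (Filter.Eventually.of_forall fun y hy => ?_)
    rw [Set.uIoc_of_le zero_le_one] at hy
    rw [signHalf, if_pos (by linarith [hy.1]), abs_neg, abs_of_pos hy.1, one_mul]

lemma integral_cpow_mul_pow (j : ℕ) (hj : 0 < ν.re + j) :
    ∫ y in (0 : ℝ)..1, (y : ℂ) ^ (ν - 1) * (y : ℂ) ^ j = (ν + j)⁻¹ := by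
  have h : ∫ y in (0 : ℝ)..1, (y : ℂ) ^ (ν - 1) * (y : ℂ) ^ j =
      ∫ y in (0 : ℝ)..1, (y : ℂ) ^ (ν - 1 + j) := by
    refine intervalIntegral.integral_congr_ae (Filter.Eventually.of_forall fun y hy => ?_)
    rw [Set.uIoc_of_le zero_le_one] at hy
    have : (y : ℂ) ≠ 0 := by exact_mod_cast hy.1.ne'
    rw [Complex.cpow_add _ _ this, Complex.cpow_natCast]
  have hne : ν + j ≠ 0 := fun h => by
    have := congrArg Complex.re h
    simp at this
    linarith
  rw [h, integral_cpow (Or.inl (by simp; linarith))]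
  rw [show ν - 1 + j + 1 = ν + j by ring]
  simp [Complex.zero_cpow hne]

lemma integral_signHalf_pow (j : ℕ) (hj : 0 < ν.re + j) :
    IntervalIntegrable (fun y => signHalf ε y * ((|y| : ℝ) : ℂ) ^ (ν - 1) * (y : ℂ) ^ j)
      volume (-1) 1 ∧
    ∫ y in (-1 : ℝ)..1, signHalf ε y * ((|y| : ℝ) : ℂ) ^ (ν - 1) * (y : ℂ) ^ j =
      (((ε : ℤ) : ℂ) * Complex.I + (-1) ^ j) / (ν + j) := by
  have hi := intervalIntegrable_signHalf (ε := ε) (u := fun y : ℝ => (y : ℂ) ^ j) (k := j) (M := 1)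
    (by fun_prop) (fun y _ => by simp) hj
  refine ⟨hi, ?_⟩
  rw [integral_signHalf_mul hi, integral_cpow_mul_pow j hj]
  have : ∀ y : ℝ, (y : ℂ) ^ (ν - 1) * ((-y : ℝ) : ℂ) ^ j =
      (-1) ^ j * ((y : ℂ) ^ (ν - 1) * (y : ℂ) ^ j) := fun y => by
    rw [Complex.ofReal_neg, neg_pow]
    ring
  simp only [this, intervalIntegral.integral_const_mul, integral_cpow_mul_pow j hj]
  ring

lemma measurable_taylorRem {h : ℝ → ℂ} (hh : ContDiff ℝ ∞ h) (k : ℕ) :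
    Measurable (taylorRem k h) :=
  Measurable.sub hh.continuous.measurable (by fun_prop)

lemma taylorRem_succ (k : ℕ) (h : ℝ → ℂ) (y : ℝ) : taylorRem k h y =
    taylorRem (k + 1) h y + iteratedDeriv k h 0 / (k.factorial : ℂ) * (y : ℂ) ^ k := by
  rw [taylorRem, taylorRem, Finset.sum_range_succ]
  ring

/-- The integral against the weight of the functional `oneLin`, regularized to order `k`. -/
noncomputable def regIntegral (ε : ℤˣ) (ν : ℂ) (k : ℕ) (h : ℝ → ℂ) : ℂ :=
  ∫ y in (-1 : ℝ)..1, signHalf ε y * ((|y| : ℝ) : ℂ) ^ (ν - 1) * taylorRem k h y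

lemma exists_iteratedDeriv_bound {h : ℝ → ℂ} (hh : ContDiff ℝ ∞ h) (k : ℕ) :
    ∃ M : ℝ, ∀ y ∈ Set.Icc (-1 : ℝ) 1, ‖iteratedDeriv k h y‖ ≤ M := by
  obtain ⟨M, hM⟩ := (isCompact_Icc (a := (-1 : ℝ)) (b := 1)).bddAbove_image
    (hh.continuous_iteratedDeriv k (by exact_mod_cast le_top)).norm.continuousOn
  exact ⟨M, fun y hy => hM ⟨y, hy, rfl⟩⟩

lemma intervalIntegrable_taylorRem {h : ℝ → ℂ} (hh : ContDiff ℝ ∞ h) {k : ℕ}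
    (hk : 0 < ν.re + k) : IntervalIntegrable
      (fun y => signHalf ε y * ((|y| : ℝ) : ℂ) ^ (ν - 1) * taylorRem k h y) volume (-1) 1 := by
  obtain ⟨M, hM⟩ := exists_iteratedDeriv_bound hh k
  exact intervalIntegrable_signHalf (measurable_taylorRem hh k)
    (taylorRem_bound k h M hh hM) hk

/-- Moving one more Taylor term out of the integral leaves its explicit moment, which is where the
denominator ν + k comes from. -/
lemma regIntegral_succ {h : ℝ → ℂ} (hh : ContDiff ℝ ∞ h) {k : ℕ} (hk : 0 < ν.re + k) :
    regIntegral ε ν k h = regIntegral ε ν (k + 1) h + iteratedDeriv k h 0 / (k.factorial : ℂ) *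
      ((((ε : ℤ) : ℂ) * Complex.I + (-1) ^ k) / (ν + k)) := by
  obtain ⟨h1, h2⟩ := integral_signHalf_pow (ε := ε) k hk
  have h3 := intervalIntegrable_taylorRem (ε := ε) (ν := ν) hh (k := k + 1)
    (by push_cast; linarith)
  rw [regIntegral, regIntegral, ← h2, ← intervalIntegral.integral_const_mul,
    ← intervalIntegral.integral_add h3 (h1.const_mul _)]
  refine intervalIntegral.integral_congr fun y _ => ?_
  rw [taylorRem_succ]
  ring

/-- The part of the expansion at frequency zero, for coefficients `a` and `b j = a / (ν + j)`. -/
noncomputable def zeroTerm (ε : ℤˣ) (ν a : ℂ) (b : ℕ → ℂ) (k : ℕ) (φ : SmoothPS (-ε) (-ν)) : ℂ :=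
  a * ((∫ x : ℝ in (-1)..1, slice φ 1 x) + regIntegral ε ν k (slice φ sElt⁻¹)) +
    ∑ j ∈ Finset.range k, iteratedDeriv j (slice φ sElt⁻¹) 0 / (j.factorial : ℂ) *
      ((((ε : ℤ) : ℂ) * Complex.I + (-1) ^ j) * b j)

lemma add_natCast_ne_zero {k : ℕ} (hk : 0 < ν.re + k) : ν + k ≠ 0 := fun h => by
  have := congrArg Complex.re h
  simp at this
  linarith

/-- The relation (ν + j) b j = a is used instead of a quotient so that the regularization stays
independent of its order at ν = -j, where a vanishes and b j is prescribed separately. -/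
lemma zeroTerm_succ {a : ℂ} {b : ℕ → ℂ} (hb : ∀ j, (ν + j) * b j = a) {k : ℕ}
    (hk : 0 < ν.re + k) (φ : SmoothPS (-ε) (-ν)) :
    zeroTerm ε ν a b (k + 1) φ = zeroTerm ε ν a b k φ := by
  rw [zeroTerm, zeroTerm, Finset.sum_range_succ, regIntegral_succ (slice_smooth φ _) hk, ← hb k]
  have := add_natCast_ne_zero hk
  field_simp
  ring

lemma zeroTerm_eq {a : ℂ} {b : ℕ → ℂ} (hb : ∀ j, (ν + j) * b j = a) {k l : ℕ}
    (hk : 0 < ν.re + k) (hl : 0 < ν.re + l) (φ : SmoothPS (-ε) (-ν)) :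
    zeroTerm ε ν a b k φ = zeroTerm ε ν a b l φ := by
  wlog h : k ≤ l generalizing k l
  · exact (this hl hk (not_le.1 h).le).symm
  obtain ⟨m, rfl⟩ := Nat.exists_eq_add_of_le h
  clear h hl
  induction m with
  | zero => rfl
  | succ m ih =>
    rw [← add_assoc, zeroTerm_succ hb _ φ, ih]
    push_cast
    have : (0 : ℝ) ≤ m := Nat.cast_nonneg m
    linarith

/-- The `j`-th derivative at the point at infinity. -/
noncomputable def jetLin (ε : ℤˣ) (ν : ℂ) (j : ℕ) : SmoothPS (-ε) (-ν) →ₗ[ℂ] ℂ where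
  toFun φ := iteratedDeriv j (slice φ sElt⁻¹) 0
  map_add' φ ψ := iteratedDeriv_slice_add j _ φ ψ 0
  map_smul' c φ := iteratedDeriv_slice_smul j _ c φ 0

/-- The continuous functional `jetLin`. -/
noncomputable def jetDist (ε : ℤˣ) (ν : ℂ) (j : ℕ) : DistPS ε ν where
  toLinearMap := jetLin ε ν j
  cont := continuous_of_bound (jetLin ε ν j) 1 j fun φ => by
    rw [one_mul]
    exact le_qnorm_s le_rfl φ (by simp)

lemma jetDist_apply (j : ℕ) (φ : SmoothPS (-ε) (-ν)) :
    jetDist ε ν j φ = iteratedDeriv j (slice φ sElt⁻¹) 0 := rfl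

/-- `zeroTerm` as a distribution. -/
noncomputable def zeroDist (ε : ℤˣ) (ν a : ℂ) (b : ℕ → ℂ) : DistPS ε ν :=
  a • oneDist ε ν + ∑ j ∈ Finset.range (regOrder ν),
    ((b j - a / (ν + j)) * (((ε : ℤ) : ℂ) * Complex.I + (-1) ^ j) / (j.factorial : ℂ)) •
      jetDist ε ν j

lemma oneDist_apply (φ : SmoothPS (-ε) (-ν)) : oneDist ε ν φ =
    (∫ x : ℝ in (-1)..1, slice φ 1 x) + regIntegral ε ν (regOrder ν) (slice φ sElt⁻¹) +
    ∑ j ∈ Finset.range (regOrder ν), iteratedDeriv j (slice φ sElt⁻¹) 0 / (j.factorial : ℂ) *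
      ((((ε : ℤ) : ℂ) * Complex.I + (-1) ^ j) / (ν + j)) := rfl

/-- The added jets replace the coefficients a/(ν + j) in a · 𝟙 by b j. At ν = -j the quotient has
the value 0 by convention, and the correction supplies all of b j. -/
lemma zeroDist_apply (a : ℂ) (b : ℕ → ℂ) (φ : SmoothPS (-ε) (-ν)) :
    zeroDist ε ν a b φ = zeroTerm ε ν a b (regOrder ν) φ := by
  rw [zeroDist, add_apply, sum_apply, smul_apply, oneDist_apply, zeroTerm,
    smul_eq_mul, mul_add, add_assoc, Finset.mul_sum, ← Finset.sum_add_distrib]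
  congr 1
  refine Finset.sum_congr rfl fun j _ => ?_
  rw [smul_apply, jetDist_apply, smul_eq_mul]
  ring

lemma regOrder_pos_add (ν : ℂ) : 0 < ν.re + regOrder ν := by
  have := regOrder_spec ν
  linarith

lemma zeroDist_apply_eq {a : ℂ} {b : ℕ → ℂ} (hb : ∀ j, (ν + j) * b j = a) {k : ℕ}
    (hk : 0 < ν.re + k) (φ : SmoothPS (-ε) (-ν)) :
    zeroDist ε ν a b φ = zeroTerm ε ν a b k φ := by
  rw [zeroDist_apply, zeroTerm_eq hb (regOrder_pos_add ν) hk]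

/-- Where no denominator vanishes, b j is the quotient and every correction is zero. -/
lemma zeroDist_eq_smul {a : ℂ} {b : ℕ → ℂ} (hb : ∀ j, (ν + j) * b j = a)
    (hν : ∀ m : ℕ, ν ≠ -m) : zeroDist ε ν a b = a • oneDist ε ν := by
  rw [zeroDist, add_eq_left]
  refine Finset.sum_eq_zero fun j _ => ?_
  have : ν + j ≠ 0 := fun h => hν j (eq_neg_of_add_eq_zero_left h)
  rw [← hb j, mul_div_cancel_left₀ _ this, sub_self, zero_mul, zero_div]
  ext φ
  rw [smul_apply, smul_eq_mul, zero_mul, zero_apply]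

lemma integral_Ioi_one_eq (f : ℝ → ℂ) :
    ∫ x in Set.Ioi (1 : ℝ), f x = ∫ y in (0 : ℝ)..1, ((y : ℂ) ^ 2)⁻¹ * f y⁻¹ := by
  have himg : (fun y : ℝ => y⁻¹) '' Set.Ioo 0 1 = Set.Ioi 1 := by
    ext x
    constructor
    · rintro ⟨y, hy, rfl⟩
      exact (one_lt_inv₀ hy.1).2 hy.2
    · intro hx
      have hx' : (1 : ℝ) < x := hx
      exact ⟨x⁻¹, ⟨by positivity, inv_lt_one_of_one_lt₀ hx'⟩, inv_inv x⟩
  rw [← himg, integral_image_eq_integral_abs_deriv_smul (f' := fun y => -(y ^ 2)⁻¹)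
    measurableSet_Ioo (fun y hy => (hasDerivAt_inv hy.1.ne').hasDerivWithinAt)
    (inv_injective.injOn), intervalIntegral.integral_of_le zero_le_one,
    integral_Ioc_eq_integral_Ioo]
  refine setIntegral_congr_fun measurableSet_Ioo fun y hy => ?_
  have : 0 ≤ (y ^ 2)⁻¹ := by positivity
  simp only [abs_neg, abs_of_nonneg this, Complex.real_smul]
  push_cast
  rfl

lemma inv_sq_mul_exp_log {y : ℝ} (hy : 0 < y) (ν : ℂ) :
    ((y : ℂ) ^ 2)⁻¹ * Complex.exp ((-ν - 1) * Real.log y⁻¹) = (y : ℂ) ^ (ν - 1) := by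
  have h0 : (y : ℂ) ≠ 0 := by exact_mod_cast hy.ne'
  have h1 : Complex.exp ((-ν - 1) * Real.log y⁻¹) = (y : ℂ) ^ (ν + 1) := by
    rw [Complex.cpow_def_of_ne_zero h0, Real.log_inv, ← Complex.ofReal_log hy.le]
    congr 1
    push_cast
    ring
  rw [h1, show ν + 1 = (ν - 1) + (2 : ℕ) by push_cast; ring, Complex.cpow_add _ _ h0,
    Complex.cpow_natCast]
  field_simp

/-- Where the integral converges, `𝟙_{ε,ν}` is the integral over the chart `x ↦ ñ_x`. -/
theorem oneDist_eq_integral (hν : 1 < ν.re) (φ : SmoothPS (-ε) (-ν)) :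
    oneDist ε ν φ = ∫ x, slice φ 1 x := by
  have hint : Integrable (slice φ 1) := by
    have := integrable_iteratedDeriv_slice (k := 0) (by simp; linarith) φ
    simpa using this
  have hs : ∀ g : Mp, ContDiff ℝ ∞ (slice φ g) := slice_smooth φ
  have hε : -(((-ε : ℤˣ) : ℤ) : ℂ) = ((ε : ℤ) : ℂ) := by
    rw [Units.val_neg]
    push_cast
    ring
  -- The two tails |x| > 1 go over to the chart at infinity by x = 1/y; the factor y^{-2} and the
  -- transition factor combine to y^{ν-1}, and the constants 1 and εi are those of the sign factor
  -- in 𝟙.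
  have hpos : ∫ x in Set.Ioi (1 : ℝ), slice φ 1 x =
      ∫ y in (0 : ℝ)..1, (y : ℂ) ^ (ν - 1) * slice φ sElt⁻¹ (-y) := by
    rw [integral_Ioi_one_eq]
    refine intervalIntegral.integral_congr_ae (Filter.Eventually.of_forall fun y hy => ?_)
    rw [Set.uIoc_of_le zero_le_one] at hy
    rw [slice, one_mul, apply_nElt_pos φ (inv_pos.2 hy.1), inv_inv, ← mul_assoc,
      inv_sq_mul_exp_log hy.1, slice]
  have hneg : ∫ x in Set.Iic (-1 : ℝ), slice φ 1 x =
      ((ε : ℤ) : ℂ) * Complex.I * ∫ y in (0 : ℝ)..1, (y : ℂ) ^ (ν - 1) * slice φ sElt⁻¹ y := by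
    rw [← integral_comp_neg_Ioi, integral_Ioi_one_eq, ← intervalIntegral.integral_const_mul]
    refine intervalIntegral.integral_congr_ae (Filter.Eventually.of_forall fun y hy => ?_)
    rw [Set.uIoc_of_le zero_le_one] at hy
    rw [slice, one_mul, apply_nElt_neg φ (inv_pos.2 hy.1), inv_inv, hε,
      ← inv_sq_mul_exp_log hy.1, slice]
    ring
  have hreg : regIntegral ε ν 0 (slice φ sElt⁻¹) =
      ((ε : ℤ) : ℂ) * Complex.I * (∫ y in (0 : ℝ)..1, (y : ℂ) ^ (ν - 1) * slice φ sElt⁻¹ y) +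
      ∫ y in (0 : ℝ)..1, (y : ℂ) ^ (ν - 1) * slice φ sElt⁻¹ (-y) := by
    have h0 : taylorRem 0 (slice φ sElt⁻¹) = slice φ sElt⁻¹ := by
      ext y
      simp [taylorRem]
    have h1 := intervalIntegrable_taylorRem (ε := ε) (ν := ν) (hs sElt⁻¹) (k := 0)
      (by simp; linarith)
    rw [regIntegral]
    rw [h0] at h1 ⊢
    exact integral_signHalf_mul h1
  have h2 : ∀ j : ℕ, (ν + j) * (1 / (ν + j)) = 1 := fun j => by
    have : ν + j ≠ 0 := add_natCast_ne_zero (by have : (0 : ℝ) ≤ j := Nat.cast_nonneg j; linarith)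
    field_simp
  have h3 := zeroDist_apply_eq h2 (k := 0) (by simp; linarith) φ
  have h4 := zeroDist_eq_smul (ε := ε) h2 fun m hm => by
    rw [hm] at hν
    simp at hν
    have : (0 : ℝ) ≤ m := Nat.cast_nonneg m
    linarith
  rw [h4, one_smul, zeroTerm, hreg, Finset.range_zero, Finset.sum_empty, ← hpos, ← hneg] at h3
  rw [h3, ← intervalIntegral.integral_Iic_add_Ioi (b := -1) hint.integrableOn hint.integrableOn,
    ← intervalIntegral.integral_interval_add_Ioi (a := -1) (b := 1) hint.integrableOn
      hint.integrableOn]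
  ring

/-- Where the integral converges, `𝕖_{ε,ν,n}` is the integral against `e(nx)`. -/
theorem fourierDist_eq_integral_of_one_lt (hν : 1 < ν.re) (n : ℤ) (φ : SmoothPS (-ε) (-ν)) :
    fourierDist ε ν n φ = ∫ x, eExp (n * x) * slice φ 1 x := by
  rcases eq_or_ne n 0 with rfl | hn
  · rw [fourierDist, if_pos rfl, oneDist_eq_integral hν]
    simp [eExp]
  · rw [fourierDist_eq hn φ (k := 0) (by simp; linarith)]
    simp

/-! ### Flat sections and holomorphic dependence on the parameter. -/

/-- Half the logarithm of `1 + x²`. -/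
noncomputable def halfLog (x : ℝ) : ℝ := Real.log (1 + x ^ 2) / 2

lemma contDiff_halfLog : ContDiff ℝ ∞ fun x => (halfLog x : ℂ) := by
  refine Complex.ofRealCLM.contDiff.comp ?_
  refine ContDiff.div_const (ContDiff.log (by fun_prop) fun x => ?_) _
  positivity

lemma isCompactElt_mul {g h : Mp} (hg : IsCompactElt g) (hh : IsCompactElt h) :
    IsCompactElt (g * h) := by
  unfold IsCompactElt at *
  rw [mul_mat, Matrix.SpecialLinearGroup.coe_mul, Matrix.transpose_mul, Matrix.mul_assoc,
    ← Matrix.mul_assoc (h.mat : Matrix (Fin 2) (Fin 2) ℝ), hh, Matrix.one_mul, hg]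

lemma isCompactElt_one : IsCompactElt 1 := by simp [IsCompactElt]

lemma isCompactElt_of {g : Mp} {a b c d : ℝ}
    (hg : (g.mat : Matrix (Fin 2) (Fin 2) ℝ) = !![a, b; c, d]) (h1 : a ^ 2 + b ^ 2 = 1)
    (h2 : a * c + b * d = 0) (h3 : c ^ 2 + d ^ 2 = 1) : IsCompactElt g := by
  rw [IsCompactElt, hg]
  ext i j
  fin_cases i <;> fin_cases j <;>
    simp [Matrix.mul_apply, Fin.sum_univ_two, Matrix.transpose_apply] <;> linarith

lemma isCompactElt_s : IsCompactElt sElt :=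
  isCompactElt_of coe_s (by norm_num) (by norm_num) (by norm_num)

lemma isCompactElt_s_inv : IsCompactElt sElt⁻¹ :=
  isCompactElt_of inv_sElt.1 (by norm_num) (by norm_num) (by norm_num)

lemma exp_halfLog_sq (x : ℝ) : Real.exp (halfLog x) ^ 2 = 1 + x ^ 2 := by
  rw [← Real.exp_nat_mul, halfLog]
  push_cast
  rw [mul_div_cancel₀ _ two_ne_zero, Real.exp_log (by positivity)]

/-- The Iwasawa decomposition of `ñ_x`. -/
lemma exists_isCompactElt_mul (x : ℝ) : ∃ κ : Mp, IsCompactElt κ ∧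
    nElt x = κ * (mElt 1 1 * aElt (-halfLog x) * nbarElt (x / (1 + x ^ 2))) := by
  set b : Mp := mElt 1 1 * aElt (-halfLog x) * nbarElt (x / (1 + x ^ 2)) with hb
  refine ⟨nElt x * b⁻¹, ?_, by rw [inv_mul_cancel_right]⟩
  set r := Real.exp (halfLog x) with hr
  have hr0 : 0 < r := Real.exp_pos _
  have hr2 : r ^ 2 = 1 + x ^ 2 := exp_halfLog_sq x
  have e1 := (mul_sgn_of (coe_m 1 1) (coe_a (-halfLog x))).1
  have e2 := (mul_sgn_of e1 (coe_nbar (x / (1 + x ^ 2)))).1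
  rw [← hb, neg_neg, Real.exp_neg, ← hr, ← hr2] at e2
  have e3 : ((b⁻¹).mat : Matrix (Fin 2) (Fin 2) ℝ) = !![r, 0; -(x / r), r⁻¹] := by
    rw [inv_mat, Matrix.SpecialLinearGroup.coe_inv, Matrix.adjugate_fin_two, e2]
    ext i j
    fin_cases i <;> fin_cases j <;> simp
    field_simp
  have e4 := (mul_sgn_of (coe_n x) e3).1
  refine isCompactElt_of e4 ?_ ?_ ?_ <;> field_simp <;> rw [hr2] <;> ring

/-- By the Iwasawa decomposition a flat section depends on ν only through (1 + x²)^{(ν-1)/2}, so its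
regularity in (ν, x) reduces to smoothness of its member at ν = 1. -/
lemma flat_apply (Φ : FlatSection ε) {g : Mp} (hg : IsCompactElt g) (ν : ℂ) (x : ℝ) :
    slice (Φ.1 ν) g x = Complex.exp ((ν - 1) * halfLog x) * slice (Φ.1 1) g x := by
  obtain ⟨κ, hκ, h⟩ := exists_isCompactElt_mul x
  have key : ∀ ν, slice (Φ.1 ν) g x = Complex.exp ((ν - 1) * halfLog x) * Φ.1 ν (g * κ) := by
    intro ν
    rw [slice, h, ← mul_assoc, (Φ.1 ν).2.2, omega, sigma]
    simp only [Units.val_one, Int.cast_one, if_true, mul_one, one_mul]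
    rw [← Complex.exp_neg]
    congr 2
    push_cast
    ring
  rw [key ν, key 1, Φ.2 _ (isCompactElt_mul hg hκ) ν 1, sub_self, zero_mul, Complex.exp_zero,
    one_mul]

/-- Derivatives of exp(νL) h are exp(νL) times polynomials in ν with smooth coefficients, so they
are entire in ν and jointly continuous. -/
lemma exists_iteratedDeriv_exp_mul {L h : ℝ → ℂ} (hL : ContDiff ℝ ∞ L) (hh : ContDiff ℝ ∞ h)
    (k : ℕ) : ∃ P : ℕ → ℝ → ℂ, (∀ i, ContDiff ℝ ∞ (P i)) ∧ ∀ (ν : ℂ) (x : ℝ),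
      iteratedDeriv k (fun x => Complex.exp (ν * L x) * h x) x =
        Complex.exp (ν * L x) * ∑ i ∈ Finset.range (k + 1), ν ^ i * P i x := by
  induction k with
  | zero => exact ⟨fun _ => h, fun _ => hh, fun ν x => by simp⟩
  | succ k ih =>
    obtain ⟨P, hP, h1⟩ := ih
    have hd : ∀ {f : ℝ → ℂ}, ContDiff ℝ ∞ f → ∀ x, HasDerivAt f (deriv f x) x := fun hf x =>
      (hf.differentiable (by simp) x).hasDerivAt
    have hd' : ∀ {f : ℝ → ℂ}, ContDiff ℝ ∞ f → ContDiff ℝ ∞ (deriv f) := fun hf =>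
      (contDiff_infty_iff_deriv.1 hf).2
    refine ⟨fun i => (if i < k + 1 then deriv (P i) else 0) +
      if i = 0 then 0 else deriv L * P (i - 1), fun i => ?_, fun ν x => ?_⟩
    · refine ContDiff.add ?_ ?_
      · split_ifs
        · exact hd' (hP i)
        · exact contDiff_const
      · split_ifs
        · exact contDiff_const
        · exact (hd' hL).mul (hP _)
    · have h2 : HasDerivAt (iteratedDeriv k fun x => Complex.exp (ν * L x) * h x)
          (Complex.exp (ν * L x) * (ν * deriv L x) * (∑ i ∈ Finset.range (k + 1), ν ^ i * P i x) +
            Complex.exp (ν * L x) * ∑ i ∈ Finset.range (k + 1), ν ^ i * deriv (P i) x) x := by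
        rw [funext (h1 ν)]
        exact ((hd hL x).const_mul ν).cexp.mul
          (HasDerivAt.fun_sum fun i _ => (hd (hP i) x).const_mul (ν ^ i))
      rw [iteratedDeriv_succ, h2.deriv, mul_assoc, ← mul_add]
      congr 1
      simp only [Pi.add_apply, mul_add, Finset.sum_add_distrib]
      rw [add_comm]
      congr 1
      · rw [Finset.sum_range_succ _ (k + 1)]
        simp only [lt_irrefl, if_false, Pi.zero_apply, mul_zero, add_zero]
        refine Finset.sum_congr rfl fun i hi => ?_
        rw [if_pos (Finset.mem_range.1 hi)]
      · rw [Finset.sum_range_succ' _ (k + 1), Finset.mul_sum]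
        simp only [if_true, Pi.zero_apply, mul_zero, add_zero]
        refine Finset.sum_congr rfl fun i _ => ?_
        rw [if_neg (Nat.succ_ne_zero i), Nat.add_sub_cancel, Pi.mul_apply]
        ring

lemma flat_iteratedDeriv (Φ : FlatSection ε) {g : Mp} (hg : IsCompactElt g) (k : ℕ) :
    Continuous (fun p : ℂ × ℝ => iteratedDeriv k (slice (Φ.1 p.1) g) p.2) ∧
    ∀ x, Differentiable ℂ fun ν => iteratedDeriv k (slice (Φ.1 ν) g) x := by
  obtain ⟨P, hP, h⟩ := exists_iteratedDeriv_exp_mul contDiff_halfLog (slice_smooth (Φ.1 1) g) k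
  have e : ∀ (ν : ℂ) (x : ℝ), iteratedDeriv k (slice (Φ.1 ν) g) x =
      Complex.exp ((ν - 1) * halfLog x) * ∑ i ∈ Finset.range (k + 1), (ν - 1) ^ i * P i x := by
    intro ν x
    rw [← h (ν - 1) x, ← funext (flat_apply Φ hg ν)]
  simp only [e]
  refine ⟨?_, fun x => ?_⟩
  · have h1 : Continuous fun x => (halfLog x : ℂ) := contDiff_halfLog.continuous
    have h2 : ∀ i, Continuous (P i) := fun i => (hP i).continuous
    refine Continuous.mul (Complex.continuous_exp.comp ?_) (continuous_finsetSum _ fun i _ => ?_)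
    · exact (continuous_fst.sub continuous_const).mul (h1.comp continuous_snd)
    · exact ((continuous_fst.sub continuous_const).pow i).mul ((h2 i).comp continuous_snd)
  · fun_prop

lemma exists_flat_snorm_le (Φ : FlatSection ε) {g : Mp} (hg : IsCompactElt g) (k : ℕ) (R : ℝ) :
    ∃ M : ℝ, ∀ ν : ℂ, ‖ν‖ ≤ R → snorm g k (Φ.1 ν) ≤ M := by
  obtain ⟨M, hM⟩ := ((isCompact_closedBall (0 : ℂ) R).prod
    (isCompact_Icc (a := (-1 : ℝ)) (b := 1))).bddAbove_image
    (flat_iteratedDeriv Φ hg k).1.norm.continuousOn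
  refine ⟨M, fun ν hν => ?_⟩
  have h : ∀ x ∈ Set.Icc (-1 : ℝ) 1, ‖iteratedDeriv k (slice (Φ.1 ν) g) x‖ ≤ M := fun x hx =>
    hM ⟨(ν, x), ⟨by simpa using hν, hx⟩, rfl⟩
  exact (ContinuousMap.norm_le _ ((norm_nonneg _).trans (h 0 (by simp)))).2 fun x => h x x.2

lemma exists_flat_qnorm_le (Φ : FlatSection ε) (k : ℕ) (R : ℝ) :
    ∃ M : ℝ, ∀ ν : ℂ, ‖ν‖ ≤ R → qnorm k (Φ.1 ν) ≤ M := by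
  choose M₁ h₁ using fun j => exists_flat_snorm_le Φ isCompactElt_one j R
  choose M₂ h₂ using fun j => exists_flat_snorm_le Φ isCompactElt_s_inv j R
  exact ⟨∑ j ∈ Finset.range (k + 1), (M₁ j + M₂ j), fun ν hν =>
    Finset.sum_le_sum fun j _ => add_le_add (h₁ j ν hν) (h₂ j ν hν)⟩

lemma differentiable_of_ball {f : ℂ → ℂ}
    (h : ∀ R : ℝ, DifferentiableOn ℂ f (Metric.ball 0 R)) : Differentiable ℂ f := fun z =>
  (h (‖z‖ + 1)).differentiableAt (Metric.isOpen_ball.mem_nhds (by simp))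

/-- A single order of regularization serves a whole disc of parameters. The order `regOrder ν` jumps
with ν and would not show holomorphy. -/
lemma one_le_re_add {R : ℝ} {ν : ℂ} (hν : ‖ν‖ ≤ R) : 1 ≤ ν.re + (⌈R⌉₊ + 1 : ℕ) := by
  have h1 := Nat.le_ceil R
  have h2 := neg_le_of_abs_le ((Complex.abs_re_le_norm ν).trans hν)
  push_cast
  linarith

lemma differentiable_pairFlat_fourierDist {n : ℤ} (hn : n ≠ 0) (Φ : FlatSection (-ε)) :
    Differentiable ℂ (pairFlat (fun ν => fourierDist ε ν n) Φ) := by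
  refine differentiable_of_ball fun R => ?_
  set k := ⌈R⌉₊ + 1 with hk
  obtain ⟨C, hC0, hC⟩ := tail_bound_uniform k R
  obtain ⟨M, hM⟩ := exists_flat_qnorm_le Φ k R
  have hball : ∀ {ν : ℂ}, ν ∈ Metric.ball (0 : ℂ) R → ‖ν‖ ≤ R := fun hν =>
    (mem_ball_zero_iff.1 hν).le
  have h1 : DifferentiableOn ℂ (fun ν => ∫ x : ℝ, eExp (n * x) *
      iteratedDeriv k (slice (Φ.1 (-ν)) 1) x) (Metric.ball 0 R) := by
    refine differentiableOn_integral_of_dominated Metric.isOpen_ball (fun ν hν => ?_) ?_ ?_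
    · exact (fourier_integrable k (by rw [Complex.neg_re, neg_neg]; exact one_le_re_add (hball hν)) n _).aestronglyMeasurable
    · refine Filter.Eventually.of_forall fun x => Differentiable.differentiableOn ?_
      exact (((flat_iteratedDeriv Φ isCompactElt_one k).2 x).comp differentiable_neg).const_mul _
    · refine fun ν hν => ⟨_, Metric.isOpen_ball.mem_nhds hν, fun x => C * M * (1 + x ^ 2)⁻¹,
        integrable_inv_one_add_sq.const_mul _, Filter.Eventually.of_forall fun x w hw => ?_⟩
      have hw' := hball hw
      refine (norm_fourier_integrand n x (hC (-ε) (-w) (by rwa [norm_neg])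
        (by rw [Complex.neg_re, neg_neg]; exact one_le_re_add hw') _ x)).trans ?_
      have := hM (-w) (by rwa [norm_neg])
      exact mul_le_mul_of_nonneg_right (mul_le_mul_of_nonneg_left this hC0) (by positivity)
  refine (h1.const_mul ((-1 / (2 * Real.pi * Complex.I * n)) ^ k)).congr fun ν hν => ?_
  exact fourierDist_eq hn _ (one_le_re_add (hball hν))

/-- The Fourier series with coefficients of moderate growth. -/
theorem exists_fourierSeries {β : ℤ → ℂ → ℂ} (hβ : ∀ n, n ≠ 0 → Differentiable ℂ (β n))
    (hb : ∀ R : ℝ, ∃ (C : ℝ) (A : ℕ), ∀ n : ℤ, n ≠ 0 → ∀ ν : ℂ, ‖ν‖ ≤ R →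
      ‖β n ν‖ ≤ C * (n.natAbs : ℝ) ^ A) (ε : ℤˣ) :
    ∃ S : ∀ ν : ℂ, DistPS ε ν,
      (∀ ν, HasSum (fun n : ℤ => if n = 0 then 0 else β n ν • fourierDist ε ν n) (S ν)) ∧
      (∀ ν φ, HasSum (fun n : ℤ => if n = 0 then 0 else β n ν * fourierDist ε ν n φ) (S ν φ)) ∧
      ∀ Φ : FlatSection (-ε), Differentiable ℂ (pairFlat S Φ) := by
  have key : ∀ R : ℝ, ∃ (C : ℝ) (k : ℕ), 0 ≤ C ∧ ∀ ν : ℂ, ‖ν‖ ≤ R → ∀ (n : ℤ), n ≠ 0 →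
      ∀ φ : SmoothPS (-ε) (-ν),
      ‖β n ν * fourierDist ε ν n φ‖ ≤ C * (1 / (n : ℝ) ^ 2) * qnorm k φ := by
    intro R
    obtain ⟨C, A, hC⟩ := hb R
    -- The order is ⌈R⌉ + 1 for convergence of the integrals on the disc, plus A to absorb the
    -- growth of the coefficients, plus 2 for summability over n.
    obtain ⟨C', hC'0, hC'⟩ := norm_fourierDist_le (⌈R⌉₊ + 1 + (A + 2)) R
    refine ⟨|C| * C', ⌈R⌉₊ + 1 + (A + 2), by positivity, fun ν hν n hn φ => ?_⟩
    have hn1 : (1 : ℝ) ≤ n.natAbs := by exact_mod_cast Int.natAbs_pos.2 hn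
    have hre : 1 ≤ ν.re + (⌈R⌉₊ + 1 + (A + 2) : ℕ) := by
      have := one_le_re_add hν
      push_cast at this ⊢
      have : (0 : ℝ) ≤ A := Nat.cast_nonneg A
      linarith
    have h1 := hC n hn ν hν
    have h2 := hC' ε ν hν hre n hn φ
    have h3 : (n : ℝ) ^ 2 = (n.natAbs : ℝ) ^ 2 := by
      rw [Nat.cast_natAbs, Int.cast_abs, sq_abs]
    rw [norm_mul]
    calc _ ≤ (|C| * (n.natAbs : ℝ) ^ A) *
          (C' * ((n.natAbs : ℝ) ^ (⌈R⌉₊ + 1 + (A + 2)))⁻¹ * qnorm (⌈R⌉₊ + 1 + (A + 2)) φ) := by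
          refine mul_le_mul (h1.trans ?_) h2 (norm_nonneg _) (by positivity)
          exact mul_le_mul_of_nonneg_right (le_abs_self C) (by positivity)
      _ ≤ (|C| * (n.natAbs : ℝ) ^ A) *
          (C' * ((n.natAbs : ℝ) ^ (A + 2))⁻¹ * qnorm (⌈R⌉₊ + 1 + (A + 2)) φ) := by
          have := qnorm_nonneg (⌈R⌉₊ + 1 + (A + 2)) φ
          have h4 : ((n.natAbs : ℝ) ^ (⌈R⌉₊ + 1 + (A + 2)))⁻¹ ≤ ((n.natAbs : ℝ) ^ (A + 2))⁻¹ :=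
            inv_anti₀ (by positivity) (pow_le_pow_right₀ hn1 (by omega))
          exact mul_le_mul_of_nonneg_left (mul_le_mul_of_nonneg_right
            (mul_le_mul_of_nonneg_left h4 hC'0) this) (by positivity)
      _ = _ := by
          rw [h3, pow_add]
          field_simp
  have hsum : Summable fun n : ℤ => 1 / (n : ℝ) ^ 2 :=
    Real.summable_one_div_int_pow.2 one_lt_two
  have hS : ∀ ν : ℂ, ∃ G : DistPS ε ν,
      HasSum (fun n : ℤ => if n = 0 then 0 else β n ν • fourierDist ε ν n) G ∧
      ∀ φ, HasSum (fun n : ℤ => (if n = 0 then 0 else β n ν • fourierDist ε ν n : DistPS ε ν) φ)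
        (G φ) := by
    intro ν
    obtain ⟨C, k, hC0, hC⟩ := key ‖ν‖
    refine hasSum_of_le_qnorm _ (fun n : ℤ => C * (1 / (n : ℝ) ^ 2)) k (fun n φ => ?_)
      (hsum.mul_left C)
    split_ifs with hn
    · rw [zero_apply, norm_zero]
      have := qnorm_nonneg k φ
      positivity
    · rw [smul_apply, smul_eq_mul]
      exact hC ν le_rfl n hn φ
  choose S hS1 hS2 using hS
  have hS3 : ∀ ν φ, HasSum (fun n : ℤ => if n = 0 then 0 else β n ν * fourierDist ε ν n φ)
      (S ν φ) := by
    intro ν φ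
    convert hS2 ν φ using 2 with n
    split_ifs
    · rw [zero_apply]
    · rw [smul_apply, smul_eq_mul]
  refine ⟨S, hS1, hS3, fun Φ => differentiable_of_ball fun R => ?_⟩
  obtain ⟨C, k, hC0, hC⟩ := key R
  obtain ⟨M, hM⟩ := exists_flat_qnorm_le Φ k R
  have h1 : pairFlat S Φ = fun ν => ∑' n : ℤ,
      if n = 0 then 0 else β n ν * pairFlat (fun ν => fourierDist ε ν n) Φ ν :=
    funext fun ν => (hS3 ν (Φ.1 (-ν))).tsum_eq.symm
  rw [h1]
  refine Complex.differentiableOn_tsum_of_summable_norm (u := fun n : ℤ => C * (1 / (n : ℝ) ^ 2) * M)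
    ((hsum.mul_left C).mul_right M) (fun n => ?_) Metric.isOpen_ball fun n ν hν => ?_
  · split_ifs with hn
    · exact differentiableOn_const _
    · exact ((hβ n hn).mul (differentiable_pairFlat_fourierDist hn Φ)).differentiableOn
  · have hν' : ‖ν‖ ≤ R := (mem_ball_zero_iff.1 hν).le
    have hq := hM (-ν) (by rwa [norm_neg])
    split_ifs with hn
    · rw [norm_zero]
      have := (qnorm_nonneg k _).trans hq
      positivity
    · exact (hC ν hν' n hn _).trans (mul_le_mul_of_nonneg_left hq (by positivity))

lemma differentiable_flat_taylorRem (Φ : FlatSection ε) {g : Mp} (hg : IsCompactElt g) (k : ℕ)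
    (y : ℝ) : Differentiable ℂ fun ν => taylorRem k (slice (Φ.1 (-ν)) g) y := by
  have h : ∀ j x, Differentiable ℂ fun ν => iteratedDeriv j (slice (Φ.1 (-ν)) g) x := fun j x =>
    ((flat_iteratedDeriv Φ hg j).2 x).comp differentiable_neg
  have h0 := h 0 y
  simp only [iteratedDeriv_zero] at h0
  exact h0.sub (Differentiable.fun_sum fun j _ => ((h j 0).mul_const _).div_const _)

lemma differentiableOn_regIntegral (Φ : FlatSection (-ε)) (R : ℝ) :
    DifferentiableOn ℂ (fun ν => regIntegral ε ν (⌈R⌉₊ + 1) (slice (Φ.1 (-ν)) sElt⁻¹))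
      (Metric.ball 0 R) := by
  have hball : ∀ {ν : ℂ}, ν ∈ Metric.ball (0 : ℂ) R → ‖ν‖ ≤ R := fun hν =>
    (mem_ball_zero_iff.1 hν).le
  obtain ⟨M, hM⟩ := exists_flat_snorm_le Φ isCompactElt_s_inv (⌈R⌉₊ + 1) R
  simp only [regIntegral, intervalIntegral.integral_of_le (neg_le_self zero_le_one)]
  have h0 : ∀ᵐ y : ℝ ∂volume.restrict (Set.Ioc (-1 : ℝ) 1), y ≠ 0 :=
    ae_restrict_of_ae (by simp [ae_iff])
  refine differentiableOn_integral_of_dominated Metric.isOpen_ball (fun ν _ => ?_) ?_ ?_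
  · refine Measurable.aestronglyMeasurable (Measurable.mul (Measurable.mul ?_ ?_)
      (measurable_taylorRem (slice_smooth _ _) _))
    · exact Measurable.ite measurableSet_Iio measurable_const measurable_const
    · fun_prop
  · filter_upwards [h0] with y hy
    have hy' : ((|y| : ℝ) : ℂ) ≠ 0 := by exact_mod_cast abs_ne_zero.2 hy
    refine Differentiable.differentiableOn (Differentiable.mul (Differentiable.const_mul ?_ _)
      (differentiable_flat_taylorRem Φ isCompactElt_s_inv _ y))
    exact Differentiable.const_cpow (by fun_prop) (Or.inl hy')
  · refine fun ν hν => ⟨_, Metric.isOpen_ball.mem_nhds hν, fun _ => M, integrable_const M, ?_⟩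
    filter_upwards [h0, ae_restrict_mem measurableSet_Ioc] with y hy hy1 w hw
    have hw' := hball hw
    have hy2 := Set.Ioc_subset_Icc_self hy1
    have hp : 0 < |y| := abs_pos.2 hy
    have hb := taylorRem_bound (⌈R⌉₊ + 1) _ M (slice_smooth (Φ.1 (-w)) sElt⁻¹)
      (fun y hy => (le_snorm _ _ _ hy).trans (hM (-w) (by rwa [norm_neg]))) y hy2
    have hM0 : 0 ≤ M := (snorm_nonneg _ _ _).trans (hM (-w) (by rwa [norm_neg]))
    rw [norm_mul, norm_mul, norm_signHalf, one_mul, Complex.norm_cpow_eq_rpow_re_of_pos hp]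
    calc _ ≤ |y| ^ (w - 1).re * (M * |y| ^ (⌈R⌉₊ + 1)) := by gcongr
      _ = |y| ^ ((w - 1).re + (⌈R⌉₊ + 1 : ℕ)) * M := by
        rw [Real.rpow_add hp, Real.rpow_natCast]
        ring
      _ ≤ 1 * M := by
        refine mul_le_mul_of_nonneg_right ?_ hM0
        refine Real.rpow_le_one hp.le (abs_le.2 hy2) ?_
        have := one_le_re_add hw'
        rw [Complex.sub_re, Complex.one_re]
        linarith
      _ = M := one_mul M

lemma differentiable_flat_integral (Φ : FlatSection ε) {g : Mp} (hg : IsCompactElt g) :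
    Differentiable ℂ fun ν => ∫ x in (-1 : ℝ)..1, slice (Φ.1 (-ν)) g x := by
  refine differentiable_of_ball fun R => ?_
  obtain ⟨M, hM⟩ := exists_flat_snorm_le Φ hg 0 R
  simp only [intervalIntegral.integral_of_le (neg_le_self (zero_le_one (α := ℝ)))]
  refine differentiableOn_integral_of_dominated Metric.isOpen_ball (fun ν _ => ?_) ?_ ?_
  · exact (slice_smooth _ _).continuous.aestronglyMeasurable
  · refine Filter.Eventually.of_forall fun y => Differentiable.differentiableOn ?_
    have := ((flat_iteratedDeriv Φ hg 0).2 y).comp differentiable_neg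
    simpa [Function.comp_def] using this
  · refine fun ν hν => ⟨_, Metric.isOpen_ball.mem_nhds hν, fun _ => M, integrable_const M, ?_⟩
    filter_upwards [ae_restrict_mem measurableSet_Ioc] with y hy w hw
    have hw' : ‖-w‖ ≤ R := by
      rw [norm_neg]
      exact (mem_ball_zero_iff.1 hw).le
    simpa using (le_snorm g 0 (Φ.1 (-w)) (Set.Ioc_subset_Icc_self hy)).trans (hM (-w) hw')

/-- The term of frequency zero is holomorphic where its coefficients are. -/
theorem holomorphicFamily_zeroDist {a : ℂ → ℂ} {b : ℕ → ℂ → ℂ} {U : Set ℂ}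
    (ha : DifferentiableOn ℂ a U) (hb : ∀ j, DifferentiableOn ℂ (b j) U)
    (hab : ∀ ν ∈ U, ∀ j, (ν + j) * b j ν = a ν) :
    HolomorphicFamily (fun ν => zeroDist ε ν (a ν) fun j => b j ν) U := by
  intro Φ z hz
  set R := ‖z‖ + 1 with hR
  have hz' : z ∈ Metric.ball (0 : ℂ) R := by simp [hR]
  have hj : ∀ j, Differentiable ℂ fun ν => iteratedDeriv j (slice (Φ.1 (-ν)) sElt⁻¹) 0 := fun j =>
    ((flat_iteratedDeriv Φ isCompactElt_s_inv j).2 0).comp differentiable_neg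
  have h1 : DifferentiableOn ℂ (fun ν => zeroTerm ε ν (a ν) (fun j => b j ν) (⌈R⌉₊ + 1) (Φ.1 (-ν)))
      (U ∩ Metric.ball 0 R) := by
    refine DifferentiableOn.add (DifferentiableOn.mul (ha.mono Set.inter_subset_left)
      (DifferentiableOn.add ?_ ?_)) (DifferentiableOn.fun_sum fun j _ => DifferentiableOn.mul ?_ ?_)
    · exact (differentiable_flat_integral Φ isCompactElt_one).differentiableOn
    · exact (differentiableOn_regIntegral Φ R).mono Set.inter_subset_right
    · exact ((hj j).div_const _).differentiableOn
    · exact ((hb j).mono Set.inter_subset_left).const_mul _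
  have h2 : DifferentiableOn ℂ (pairFlat (fun ν => zeroDist ε ν (a ν) fun j => b j ν) Φ)
      (U ∩ Metric.ball 0 R) := h1.congr fun ν hν => by
    have := one_le_re_add (mem_ball_zero_iff.1 hν.2).le
    exact zeroDist_apply_eq (hab ν hν.1) (by linarith) _
  exact (differentiableWithinAt_inter (Metric.isOpen_ball.mem_nhds hz')).1 (h2 z ⟨hz, hz'⟩)

lemma deltaInf_apply (φ : SmoothPS (-ε) (-ν)) : deltaInf ε ν φ = φ sElt := by
  change φ (sElt⁻¹⁻¹ * 1) = φ sElt
  rw [inv_inv, mul_one]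

/-- The point s̃ lies in K̃, so the pairing of δ_∞ with a flat section is constant in ν. -/
lemma pairFlat_deltaInf (Φ : FlatSection (-ε)) (ν : ℂ) :
    pairFlat (deltaInf ε) Φ ν = Φ.1 0 sElt := by
  rw [pairFlat, deltaInf_apply, Φ.2 _ isCompactElt_s (-ν) 0]

end

/-! ### The continued family and its poles at 0 and 1/2. -/

section

variable {ε : ℤˣ} {ν : ℂ}

/-- The constant Fourier coefficient of the Eisenstein distribution. -/
noncomputable def zeroCoeff (ε : ℤˣ) (ν : ℂ) : ℂ :=
  (1 + ((ε : ℤ) : ℂ) * Complex.I) * (2 ^ (-(2 * ν) - 2) * riemannZeta (2 * ν))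

/-- The quotient `zeroCoeff ε ν / (ν + j)`, with the removable singularity removed. -/
noncomputable def zeroCoeffDiv (ε : ℤˣ) (j : ℕ) (ν : ℂ) : ℂ :=
  if j = 0 then zeroCoeff ε ν / ν else dslope (zeroCoeff ε) (-j) ν

lemma differentiable_two_cpow {f : ℂ → ℂ} (hf : Differentiable ℂ f) :
    Differentiable ℂ fun ν => (2 : ℂ) ^ f ν :=
  fun z => (hf z).const_cpow (Or.inl two_ne_zero)

lemma differentiableAt_zeroCoeff (hν : ν ≠ 1 / 2) : DifferentiableAt ℂ (zeroCoeff ε) ν := by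
  refine DifferentiableAt.const_mul (DifferentiableAt.mul
    (differentiable_two_cpow (by fun_prop) _) ?_) _
  have h : 2 * ν ≠ 1 := fun h => hν (by linear_combination h / 2)
  exact (differentiableAt_riemannZeta h).comp ν (by fun_prop)

lemma differentiableOn_zeroCoeff : DifferentiableOn ℂ (zeroCoeff ε) {1 / 2}ᶜ := fun _ hν =>
  (differentiableAt_zeroCoeff hν).differentiableWithinAt

/-- The trivial zeros of ζ(2ν), which cancel the poles of 𝟙 at the negative integers. -/
lemma zeroCoeff_neg {j : ℕ} (hj : j ≠ 0) : zeroCoeff ε (-j) = 0 := by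
  obtain ⟨m, rfl⟩ := Nat.exists_eq_succ_of_ne_zero hj
  have := riemannZeta_neg_two_mul_nat_add_one m
  rw [zeroCoeff, show 2 * (-((m.succ : ℕ) : ℂ)) = -2 * (m + 1) by push_cast; ring, this]
  ring

lemma add_mul_zeroCoeffDiv (hν : ν ≠ 0) (j : ℕ) : (ν + j) * zeroCoeffDiv ε j ν = zeroCoeff ε ν := by
  rw [zeroCoeffDiv]
  split_ifs with hj
  · rw [hj, Nat.cast_zero, add_zero, mul_div_cancel₀ _ hν]
  · have := sub_smul_dslope (zeroCoeff ε) (-j : ℂ) ν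
    rwa [zeroCoeff_neg hj, sub_zero, sub_neg_eq_add, smul_eq_mul] at this

lemma neg_natCast_ne_half (j : ℕ) : (-j : ℂ) ≠ 1 / 2 := fun h => by
  have := congrArg Complex.re h
  have h2 : (0 : ℝ) ≤ j := Nat.cast_nonneg j
  simp at this
  linarith

lemma differentiableOn_dslope_zeroCoeff (j : ℕ) :
    DifferentiableOn ℂ (dslope (zeroCoeff ε) (-j)) {1 / 2}ᶜ :=
  (Complex.differentiableOn_dslope (isOpen_compl_singleton.mem_nhds (neg_natCast_ne_half j))).2
    differentiableOn_zeroCoeff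

lemma differentiableOn_zeroCoeffDiv (j : ℕ) :
    DifferentiableOn ℂ (zeroCoeffDiv ε j) {0, 1 / 2}ᶜ := by
  have hsub : ({0, 1 / 2} : Set ℂ)ᶜ ⊆ {1 / 2}ᶜ :=
    Set.compl_subset_compl.2 (Set.subset_insert _ _)
  unfold zeroCoeffDiv
  split_ifs with hj
  · exact (differentiableOn_zeroCoeff.mono hsub).div differentiableOn_id
      fun ν hν h => hν (Or.inl h)
  · exact (differentiableOn_dslope_zeroCoeff j).mono hsub

/-- The term of frequency zero in the Fourier expansion. -/
noncomputable def zeroFamily (ε : ℤˣ) (ν : ℂ) : DistPS ε ν :=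
  zeroDist ε ν (zeroCoeff ε ν) fun j => zeroCoeffDiv ε j ν

lemma holomorphicFamily_zeroFamily : HolomorphicFamily (zeroFamily ε) {0, 1 / 2}ᶜ :=
  holomorphicFamily_zeroDist
    (differentiableOn_zeroCoeff.mono (Set.compl_subset_compl.2 (Set.subset_insert _ _)))
    differentiableOn_zeroCoeffDiv
    fun _ hν j => add_mul_zeroCoeffDiv (fun h => hν (Or.inl h)) j

lemma zeroFamily_eq (hν : ∀ m : ℕ, ν ≠ -m) :
    zeroFamily ε ν = zeroCoeff ε ν • fourierDist ε ν 0 := by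
  rw [zeroFamily, fourierDist, if_pos rfl]
  refine zeroDist_eq_smul (fun j => add_mul_zeroCoeffDiv ?_ j) hν
  simpa using hν 0

lemma zeroDist_smul (c a : ℂ) (b : ℕ → ℂ) (φ : SmoothPS (-ε) (-ν)) :
    c * zeroDist ε ν a b φ = zeroDist ε ν (c * a) (fun j => c * b j) φ := by
  rw [zeroDist_apply, zeroDist_apply, zeroTerm, zeroTerm, mul_add, Finset.mul_sum]
  congr 1
  · ring
  · exact Finset.sum_congr rfl fun j _ => by ring

/-- `(ν - 1/2) zeroCoeff ε ν`, continued to `ν = 1/2`. -/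
lemma exists_zeroCoeff_mul : ∃ α : ℂ → ℂ, Differentiable ℂ α ∧
    (∀ ν, ν ≠ 1 / 2 → α ν = (ν - 1 / 2) * zeroCoeff ε ν) ∧
    α (1 / 2) = (1 + ((ε : ℤ) : ℂ) * Complex.I) / 16 := by
  obtain ⟨ξ, hξ, h, hξ1⟩ := exists_entire_sub_one_mul_zeta
  refine ⟨fun ν => (1 + ((ε : ℤ) : ℂ) * Complex.I) * (2 ^ (-(2 * ν) - 2) * (ξ (2 * ν) / 2)),
    ?_, fun ν hν => ?_, ?_⟩
  · refine ((differentiable_two_cpow (by fun_prop)).mul ?_).const_mul _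
    exact (hξ.comp (by fun_prop)).div_const _
  · have h2 : 2 * ν ≠ 1 := fun h => hν (by linear_combination h / 2)
    simp only [zeroCoeff]
    rw [h _ h2]
    ring
  · have : (2 : ℂ) ^ (-(2 * (1 / 2 : ℂ)) - 2) = 1 / 8 := by
      rw [show (-(2 * (1 / 2 : ℂ)) - 2) = -((3 : ℕ) : ℂ) by push_cast; ring, Complex.cpow_neg,
        Complex.cpow_natCast]
      norm_num
    simp only [this]
    rw [mul_one_div_cancel two_ne_zero, hξ1]
    ring

lemma exists_zeta2_mul : ∃ ζ₂ : ℂ → ℂ, Differentiable ℂ ζ₂ ∧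
    (∀ ν, ν ≠ 0 → ζ₂ ν = ν * zeta2 (2 * ν + 1)) := by
  obtain ⟨ξ, hξ, h, hξ1⟩ := exists_entire_sub_one_mul_zeta
  refine ⟨fun ν => (1 - 2 ^ (-(2 * ν + 1))) * (ξ (2 * ν + 1) / 2), ?_, fun ν hν => ?_⟩
  · refine ((differentiable_two_cpow (by fun_prop)).const_sub 1).mul ?_
    exact (hξ.comp (by fun_prop)).div_const _
  · have h2 : 2 * ν + 1 ≠ 1 := fun h => hν (by linear_combination h / 2)
    simp only [zeta2]
    rw [h _ h2]
    ring

lemma differentiableOn_zeta2 : DifferentiableOn ℂ (fun ν => zeta2 (2 * ν + 1)) {0, 1 / 2}ᶜ := by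
  obtain ⟨z, hz, h⟩ := exists_zeta2_mul
  have h0 : ∀ ν ∈ ({0, 1 / 2} : Set ℂ)ᶜ, ν ≠ 0 := fun ν hν h => hν (Or.inl h)
  refine (hz.differentiableOn.div (c := z) (d := fun ν => ν) differentiableOn_id h0).congr fun ν hν => ?_
  rw [Pi.div_apply, h ν (h0 ν hν), mul_div_cancel_left₀ _ (h0 ν hν)]

/-- The continuation of the Eisenstein distribution, in terms of the sum `S` of the terms with
non-zero frequency. -/
noncomputable def contFamily (ε : ℤˣ) (S : ∀ ν : ℂ, DistPS ε ν) (ν : ℂ) : DistPS ε ν :=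
  (ν - 1 / 2)⁻¹ • S ν + zeroFamily ε ν + zeta2 (2 * ν + 1) • deltaInf ε ν

lemma pairFlat_contFamily (S : ∀ ν : ℂ, DistPS ε ν) (Φ : FlatSection (-ε)) (ν : ℂ) :
    pairFlat (contFamily ε S) Φ ν = (ν - 1 / 2)⁻¹ * pairFlat S Φ ν +
      pairFlat (zeroFamily ε) Φ ν + zeta2 (2 * ν + 1) * Φ.1 0 sElt := by
  rw [← pairFlat_deltaInf Φ ν]
  rfl

lemma holomorphicFamily_contFamily {S : ∀ ν : ℂ, DistPS ε ν}
    (hS : ∀ Φ : FlatSection (-ε), Differentiable ℂ (pairFlat S Φ)) :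
    HolomorphicFamily (contFamily ε S) {0, 1 / 2}ᶜ := by
  intro Φ
  rw [funext (pairFlat_contFamily S Φ)]
  refine (DifferentiableOn.add (DifferentiableOn.mul ?_ (hS Φ).differentiableOn)
    (holomorphicFamily_zeroFamily Φ)).add (differentiableOn_zeta2.mul_const _)
  refine DifferentiableOn.inv (by fun_prop) fun ν hν h => hν (Or.inr ?_)
  exact sub_eq_zero.1 h

/-- The pole at `0`. -/
lemma hasSimpleResidue_zero {S : ∀ ν : ℂ, DistPS ε ν}
    (hS : ∀ Φ : FlatSection (-ε), Differentiable ℂ (pairFlat S Φ)) :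
    ∃ R : DistPS ε 0, HasSimpleResidue (contFamily ε S) 0 R := by
  obtain ⟨z, hz, h⟩ := exists_zeta2_mul
  -- These are ν times the quotients of the zero term, with the pole at ν = 0 removed. At ν = 0 only
  -- j = 0 survives, so the residue is a combination of the 0-th jet at infinity and δ_∞.
  set b : ℕ → ℂ → ℂ := fun j ν =>
    if j = 0 then zeroCoeff ε ν else ν * dslope (zeroCoeff ε) (-j) ν with hb
  refine ⟨zeroDist ε 0 0 (fun j => b j 0) + z 0 • deltaInf ε 0, fun Φ => ?_⟩
  have hU : IsOpen ({1 / 2}ᶜ : Set ℂ) := isOpen_compl_singleton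
  have h0U : (0 : ℂ) ∈ ({1 / 2}ᶜ : Set ℂ) := by simp
  have hT : HolomorphicFamily (fun ν => zeroDist ε ν (ν * zeroCoeff ε ν) fun j => b j ν)
      {1 / 2}ᶜ := by
    refine holomorphicFamily_zeroDist (differentiableOn_id.mul differentiableOn_zeroCoeff)
      (fun j => ?_) fun ν hν j => ?_
    · simp only [hb]
      split_ifs with hj
      · exact differentiableOn_zeroCoeff
      · exact differentiableOn_id.mul (differentiableOn_dslope_zeroCoeff j)
    · simp only [hb]
      split_ifs with hj
      · rw [hj, Nat.cast_zero, add_zero]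
      · have := sub_smul_dslope (zeroCoeff ε) (-j : ℂ) ν
        rw [zeroCoeff_neg hj, sub_zero, sub_neg_eq_add, smul_eq_mul] at this
        linear_combination ν * this
  have hc : ContinuousAt (fun ν => ν * ((ν - 1 / 2)⁻¹ * pairFlat S Φ ν) +
      pairFlat (fun ν => zeroDist ε ν (ν * zeroCoeff ε ν) fun j => b j ν) Φ ν +
      z ν * Φ.1 0 sElt) 0 := by
    refine ContinuousAt.add (ContinuousAt.add (continuousAt_id.mul (ContinuousAt.mul ?_
      (hS Φ).continuous.continuousAt)) ?_) (hz.continuous.continuousAt.mul continuousAt_const)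
    · exact ContinuousAt.inv₀ (by fun_prop) (by norm_num)
    · exact ((hT Φ).differentiableAt (hU.mem_nhds h0U)).continuousAt
  have hv : (zeroDist ε 0 0 (fun j => b j 0) + z 0 • deltaInf ε 0) (Φ.1 (-0)) =
      0 * ((0 - 1 / 2)⁻¹ * pairFlat S Φ 0) +
      pairFlat (fun ν => zeroDist ε ν (ν * zeroCoeff ε ν) fun j => b j ν) Φ 0 +
      z 0 * Φ.1 0 sElt := by
    rw [← pairFlat_deltaInf Φ 0, zero_mul, zero_add]
    simp only [pairFlat, zero_mul]
    rfl
  rw [hv]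
  refine (hc.tendsto.mono_left nhdsWithin_le_nhds).congr' ?_
  filter_upwards [self_mem_nhdsWithin] with ν hν
  have hν0 : ν ≠ 0 := hν
  have hbz : (fun j => b j ν) = fun j => ν * zeroCoeffDiv ε j ν := by
    funext j
    simp only [hb, zeroCoeffDiv]
    split_ifs
    · field_simp
    · rfl
  have ht : pairFlat (fun ν => zeroDist ε ν (ν * zeroCoeff ε ν) fun j => b j ν) Φ ν =
      ν * pairFlat (zeroFamily ε) Φ ν := by
    change zeroDist ε ν (ν * zeroCoeff ε ν) (fun j => b j ν) _ = ν * zeroDist ε ν _ _ _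
    rw [hbz, zeroDist_smul]
  rw [pairFlat_contFamily, sub_zero, h ν hν0, mul_add, mul_add, ht]
  ring

/-- The pole at `1/2`. -/
lemma hasSimpleResidue_half {S : ∀ ν : ℂ, DistPS ε ν}
    (hS : ∀ Φ : FlatSection (-ε), Differentiable ℂ (pairFlat S Φ)) :
    HasSimpleResidue (contFamily ε S) (1 / 2)
      (S (1 / 2) + ((1 + ((ε : ℤ) : ℂ) * Complex.I) / 16) • oneDist ε (1 / 2)) := by
  intro Φ
  obtain ⟨α, hα, hα1, hα2⟩ := exists_zeroCoeff_mul (ε := ε)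
  -- On Re ν > 0 no denominator ν + j vanishes, so α/(ν + j) is holomorphic near 1/2 and no trivial
  -- zeros are involved.
  have hU : IsOpen {ν : ℂ | 0 < ν.re} := isOpen_re_gt 0
  have hhalf : (1 / 2 : ℂ) ∈ {ν : ℂ | 0 < ν.re} := by
    rw [Set.mem_ofPred_eq]
    norm_num
  have hne : ∀ ν : ℂ, 0 < ν.re → ∀ j : ℕ, ν + j ≠ 0 := fun ν hν j =>
    add_natCast_ne_zero (by have : (0 : ℝ) ≤ j := Nat.cast_nonneg j; linarith)
  have hab : ∀ ν ∈ {ν : ℂ | 0 < ν.re}, ∀ j : ℕ, (ν + j) * (α ν / (ν + j)) = α ν := fun ν hν j =>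
    mul_div_cancel₀ _ (hne ν hν j)
  have hT : HolomorphicFamily (fun ν => zeroDist ε ν (α ν) fun j => α ν / (ν + j))
      {ν : ℂ | 0 < ν.re} :=
    holomorphicFamily_zeroDist hα.differentiableOn
      (fun j => hα.differentiableOn.div (by fun_prop) fun ν hν => hne ν hν j) hab
  have hc : ContinuousAt (fun ν => pairFlat S Φ ν +
      pairFlat (fun ν => zeroDist ε ν (α ν) fun j => α ν / (ν + j)) Φ ν +
      (ν - 1 / 2) * (zeta2 (2 * ν + 1) * Φ.1 0 sElt)) (1 / 2) := by
    refine ContinuousAt.add (ContinuousAt.add (hS Φ).continuous.continuousAt ?_)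
      (ContinuousAt.mul (by fun_prop) (ContinuousAt.mul ?_ continuousAt_const))
    · exact ((hT Φ).differentiableAt (hU.mem_nhds hhalf)).continuousAt
    · obtain ⟨z, hz, h⟩ := exists_zeta2_mul
      refine ContinuousAt.congr (f := fun ν => z ν / ν)
        (hz.continuous.continuousAt.div continuousAt_id (by norm_num)) ?_
      filter_upwards [isOpen_ne.mem_nhds (show (1 / 2 : ℂ) ≠ 0 by norm_num)] with ν hν
      rw [h ν hν, mul_div_cancel_left₀ _ hν]
  have hv : (S (1 / 2) + ((1 + ((ε : ℤ) : ℂ) * Complex.I) / 16) • oneDist ε (1 / 2))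
      (Φ.1 (-(1 / 2))) = pairFlat S Φ (1 / 2) +
      pairFlat (fun ν => zeroDist ε ν (α ν) fun j => α ν / (ν + j)) Φ (1 / 2) +
      (1 / 2 - 1 / 2) * (zeta2 (2 * (1 / 2) + 1) * Φ.1 0 sElt) := by
    have hz : zeroDist ε (1 / 2) (α (1 / 2)) (fun j => α (1 / 2) / (1 / 2 + j)) =
        α (1 / 2) • oneDist ε (1 / 2) :=
      zeroDist_eq_smul (hab _ hhalf) fun m h => neg_natCast_ne_half m h.symm
    rw [sub_self, zero_mul, add_zero, ← hα2, ← hz]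
    rfl
  rw [hv]
  refine (hc.tendsto.mono_left nhdsWithin_le_nhds).congr' ?_
  have hmem : {ν : ℂ | 0 < ν.re} ∈ 𝓝[≠] (1 / 2 : ℂ) :=
    nhdsWithin_le_nhds (hU.mem_nhds hhalf)
  filter_upwards [self_mem_nhdsWithin, hmem] with ν hν hν0
  have hν1 : ν ≠ 1 / 2 := hν
  have hν2 : ν - 1 / 2 ≠ 0 := sub_ne_zero.2 hν1
  have hν3 : ν ≠ 0 := by simpa using hne ν hν0 0
  have hbz : (fun j : ℕ => α ν / (ν + j)) = fun j => (ν - 1 / 2) * zeroCoeffDiv ε j ν := by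
    funext j
    rw [hα1 ν hν1, ← add_mul_zeroCoeffDiv hν3 j, mul_left_comm, mul_div_cancel_left₀ _ (hne ν hν0 j)]
  have ht : pairFlat (fun ν => zeroDist ε ν (α ν) fun j => α ν / (ν + j)) Φ ν =
      (ν - 1 / 2) * pairFlat (zeroFamily ε) Φ ν := by
    change zeroDist ε ν (α ν) (fun j : ℕ => α ν / (ν + j)) _ = (ν - 1 / 2) * zeroDist ε ν _ _ _
    rw [hbz, hα1 ν hν1, zeroDist_smul]
  rw [pairFlat_contFamily, mul_add, mul_add, mul_inv_cancel_left₀ hν2, ht]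

end

/-! ### Values of the terms of the Eisenstein series. -/

section

variable {ε : ℤˣ} {ν : ℂ}
open scoped NumberTheorySymbols

lemma omega_one (ε : ℤˣ) (ν : ℂ) (e : ℤˣ) (t : ℝ) :
    (omega ε ν 1 e t)⁻¹ = ((e : ℤ) : ℂ) * Complex.exp ((1 - ν) * t) := by
  rw [omega, sigma, if_pos rfl, mul_one, mul_inv, ← Complex.exp_neg]
  congr 1
  · rcases Int.units_eq_one_or e with rfl | rfl <;> simp
  · congr 1
    ring

lemma omega_neg_one (ε : ℤˣ) (ν : ℂ) (e : ℤˣ) (t : ℝ) :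
    (omega ε ν (-1) e t)⁻¹ = ((e : ℤ) : ℂ) * (((ε : ℤ) : ℂ) * Complex.I) *
      Complex.exp ((1 - ν) * t) := by
  rw [omega, sigma, mul_inv, ← Complex.exp_neg]
  congr 1
  · rcases Int.units_eq_one_or e with rfl | rfl <;> rcases Int.units_eq_one_or ε with rfl | rfl <;>
      simp
  · congr 1
    ring

/-- Moved past s̃, an upper unipotent becomes a lower unipotent, on which the quasi-character is
trivial. This gives the invariance of δ_∞ under Γ̃_∞. -/
lemma nElt_mul_s (x : ℝ) : nElt x * sElt = sElt * (mElt 1 1 * aElt 0 * nbarElt (-x)) := by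
  obtain ⟨e1, s1⟩ := mul_sgn_of (coe_n x) coe_s
  obtain ⟨e2, s2⟩ := mul_sgn_of (coe_m 1 1) (coe_a 0)
  obtain ⟨e3, s3⟩ := mul_sgn_of e2 (coe_nbar (-x))
  obtain ⟨e4, s4⟩ := mul_sgn_of coe_s e3
  ext1
  · refine Subtype.ext ?_
    rw [e1, e4]
    ext i j
    fin_cases i <;> fin_cases j <;> simp
  · rw [s1, s4, s3, s2]
    simp [nElt, mElt, aElt, nbarElt, sElt, hilb, (zero_lt_one (α := ℝ)).not_gt]
    rcases eq_or_ne x 0 with rfl | hx <;> simp [*]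

lemma apply_mul_nElt_s (φ : SmoothPS ε ν) (γ : Mp) (x : ℝ) :
    φ (γ * nElt x * sElt) = φ (γ * sElt) := by
  rw [mul_assoc, nElt_mul_s, ← mul_assoc, φ.2.2, omega_one]
  simp

lemma s_mul_s : sElt = sElt⁻¹ * (mElt (-1) (-1) * aElt 0 * nbarElt 0) := by
  rw [aElt_zero, nbarElt_zero, mul_one, mul_one, eq_inv_mul_iff_mul_eq]
  obtain ⟨e1, s1⟩ := mul_sgn_of coe_s coe_s
  ext1
  · refine Subtype.ext ?_
    rw [e1, coe_m]
    ext i j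
    fin_cases i <;> fin_cases j <;> simp
  · rw [s1]
    simp [mElt, sElt, hilb]

lemma apply_s (φ : SmoothPS ε ν) :
    φ sElt = -(((ε : ℤ) : ℂ) * Complex.I) * slice φ sElt⁻¹ 0 := by
  conv_lhs => rw [s_mul_s]
  rw [φ.2.2, omega_neg_one, slice, nElt_zero, mul_one]
  simp

/-- By that invariance the representative chosen by `Quotient.out` may be replaced by any other. -/
lemma eisTerm_apply {q : EisCosets} {γ : Mp} (h : QuotientGroup.mk γ = q.1)
    (φ : SmoothPS (-ε) (-ν)) : eisTerm ε ν q φ = φ (γ * sElt) := by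
  have h1 : eisTerm ε ν q φ = φ (q.1.out * sElt) := by
    have : eisTerm ε ν q φ = deltaInf ε ν (piSmooth (-ε) (-ν) (q.1.out)⁻¹ φ) := rfl
    rw [this, deltaInf_apply]
    change φ ((q.1.out)⁻¹⁻¹ * sElt) = _
    rw [inv_inv]
  have h2 : (QuotientGroup.mk γ : Mp ⧸ gammaInf) = QuotientGroup.mk q.1.out := by
    rw [h, QuotientGroup.out_eq']
  obtain ⟨m, hm⟩ := QuotientGroup.eq.1 h2
  rw [h1, ← apply_mul_nElt_s φ γ m, ← hm, mul_inv_cancel_left]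

/-- The value of `φ(γ s̃)` when the lower left entry of `γ` is positive. -/
lemma apply_mul_s_pos {γ : Mp} {a b c d : ℝ}
    (hγ : (γ.mat : Matrix (Fin 2) (Fin 2) ℝ) = !![a, b; c, d]) (hc : 0 < c) (hd : d ≠ 0)
    (φ : SmoothPS (-ε) (-ν)) : φ (γ * sElt) = ((ε : ℤ) : ℂ) * Complex.I * ((γ.sgn : ℤ) : ℂ) *
      ((c : ℂ) ^ (-(ν + 1)) * φ (nElt (a / c))) := by
  have hdet : a * d - b * c = 1 := by
    have := γ.mat.det_coe
    rwa [hγ, Matrix.det_fin_two_of] at this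
  -- The lower row of γ s̃ is (d, -c). For c > 0 its lower right entry is negative, so the factor in
  -- M̃ lies over -I, and the character contributes εi.
  have key : γ * sElt =
      nElt (a / c) * (mElt (-1) (-γ.sgn) * aElt (-Real.log c) * nbarElt (-d / c)) := by
    obtain ⟨e1, s1⟩ := mul_sgn_of hγ coe_s
    obtain ⟨e2, s2⟩ := mul_sgn_of (coe_m (-1) (-γ.sgn)) (coe_a (-Real.log c))
    obtain ⟨e3, s3⟩ := mul_sgn_of e2 (coe_nbar (-d / c))
    obtain ⟨e4, s4⟩ := mul_sgn_of (coe_n (a / c)) e3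
    ext1
    · refine Subtype.ext ?_
      rw [e1, e4, neg_neg, Real.exp_neg, Real.exp_log hc]
      ext i j
      fin_cases i <;> fin_cases j <;> simp <;> field_simp
      linarith
    · rw [s1, s4, s3, s2, neg_neg, Real.exp_neg, Real.exp_log hc]
      have hcc : -c * (-d / c) = d := by field_simp
      simp [nElt, mElt, aElt, nbarElt, sElt, hilb, hc.ne', hd, hcc]
      have h1 : d / (-d / c) = -c := by field_simp
      have h2 : ¬ (1 : ℝ) < 0 := by norm_num
      rcases lt_or_gt_of_ne hd with h | h
      · have h3 : d / c < 0 := div_neg_of_neg_of_pos h hc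
        have h4 : ¬ d / -c < 0 := by rw [div_neg]; linarith
        simp [h1, h2, h, h3, h4, hc.not_gt]
      · have h3 : d / -c < 0 := div_neg_of_pos_of_neg h (by linarith)
        simp [h1, h2, h.not_gt, h3, hc, hc.not_gt]
  have hcc : (c : ℂ) ≠ 0 := by exact_mod_cast hc.ne'
  rw [key, φ.2.2, omega_neg_one, Complex.cpow_def_of_ne_zero hcc, ← Complex.ofReal_log hc.le]
  have e1 : (1 - -ν) * ((-Real.log c : ℝ) : ℂ) = Real.log c * (-(ν + 1)) := by
    push_cast
    ring
  rw [e1, Units.val_neg, Units.val_neg]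
  push_cast
  ring

/-- The value of `φ(γ s̃)` when the lower left entry of `γ` is negative. -/
lemma apply_mul_s_neg {γ : Mp} {a b c d : ℝ}
    (hγ : (γ.mat : Matrix (Fin 2) (Fin 2) ℝ) = !![a, b; c, d]) (hc : c < 0) (hd : d ≠ 0)
    (φ : SmoothPS (-ε) (-ν)) : φ (γ * sElt) = ((γ.sgn : ℤ) : ℂ) *
      (((-c : ℝ) : ℂ) ^ (-(ν + 1)) * φ (nElt (a / c))) := by
  have hdet : a * d - b * c = 1 := by
    have := γ.mat.det_coe
    rwa [hγ, Matrix.det_fin_two_of] at this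
  have hc' : 0 < -c := by linarith
  -- Now -c > 0 and the factor in M̃ lies over I, so only the sign of γ remains.
  have key : γ * sElt =
      nElt (a / c) * (mElt 1 γ.sgn * aElt (-Real.log (-c)) * nbarElt (-d / c)) := by
    obtain ⟨e1, s1⟩ := mul_sgn_of hγ coe_s
    obtain ⟨e2, s2⟩ := mul_sgn_of (coe_m 1 γ.sgn) (coe_a (-Real.log (-c)))
    obtain ⟨e3, s3⟩ := mul_sgn_of e2 (coe_nbar (-d / c))
    obtain ⟨e4, s4⟩ := mul_sgn_of (coe_n (a / c)) e3
    ext1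
    · refine Subtype.ext ?_
      rw [e1, e4, neg_neg, Real.exp_neg, Real.exp_log hc']
      ext i j
      fin_cases i <;> fin_cases j <;> simp [mul_div_assoc', neg_div, hc.ne]
      field_simp
      rw [eq_div_iff hc.ne]
      linarith
    · rw [s1, s4, s3, s2, neg_neg, Real.exp_neg, Real.exp_log hc']
      have hcc : -(c * (-d / c)) = d := by rw [mul_div_cancel₀ _ hc.ne, neg_neg]
      simp [nElt, mElt, aElt, nbarElt, sElt, hilb, hc.ne, hd, hcc]
      have h1 : d / (-d / c) = -c := by field_simp
      have h2 : ¬ (1 : ℝ) < 0 := by norm_num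
      have h5 : ¬ 0 < c := hc.not_gt
      rcases lt_or_gt_of_ne hd with h | h
      · have h3 : ¬ d / c < 0 := (div_pos_of_neg_of_neg h hc).not_gt
        simp [h1, h2, h, h3, h5]
      · simp [h1, h2, h.not_gt, h5]
  have hcc : ((-c : ℝ) : ℂ) ≠ 0 := by exact_mod_cast hc'.ne'
  rw [key, φ.2.2, omega_one, Complex.cpow_def_of_ne_zero hcc, ← Complex.ofReal_log hc'.le]
  have e1 : (1 - -ν) * ((-Real.log (-c) : ℝ) : ℂ) = Real.log (-c) * (-(ν + 1)) := by
    push_cast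
    ring
  rw [e1]
  ring

end

/-! ### Cosets and first columns. -/

section

variable {ε : ℤˣ} {ν : ℂ}
open scoped NumberTheorySymbols
open ZMod (χ₈)

lemma kron_mul {v c' : ℕ} {a d : ℤ} (ha : a % 4 = 1) (hd : d % 4 = 1) :
    kron v c' (a * d) = kron v c' a * kron v c' d := by
  have h : a * d % 4 = 1 := by rw [Int.mul_emod, ha, hd]; rfl
  rw [kron, kron, kron, if_pos ha, if_pos hd, if_pos h, jacobiSym.mul_left, Int.cast_mul, map_mul]
  ring

lemma kron_one (v c' : ℕ) : kron v c' 1 = 1 := by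
  rw [kron, if_pos (by norm_num), jacobiSym.one_left]
  simp

/-- Modulo c the entries a and d are inverse to each other, so their symbols are equal signs; this
transfers the sign (c/d) of a group element to its first column. -/
lemma kron_mul_kron {v c' : ℕ} (hv : 2 ≤ v) {a d k : ℤ} (ha : a % 4 = 1) (hd : d % 4 = 1)
    (h : a * d = 1 + (2 ^ v * c' : ℕ) * k) : kron v c' a * kron v c' d = 1 := by
  rw [← kron_mul ha hd, h, kron_add_mul hv, kron_one]

/-- The symbol vanishes on columns that do not occur in Γ̃₁(4), so a can later run over all
integers. -/
lemma isCoprime_of_kron_ne_zero {v c' : ℕ} {a : ℤ} (h : kron v c' a ≠ 0) (hc' : c' ≠ 0) :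
    a % 4 = 1 ∧ IsCoprime a ((2 ^ v * c' : ℕ) : ℤ) := by
  rw [kron] at h
  split_ifs at h with ha
  · have hJ : J(a | c') ≠ 0 := right_ne_zero_of_mul h
    have h1 : a.gcd c' = 1 := by
      by_contra h2
      exact hJ (jacobiSym.eq_zero_iff.2 ⟨hc', h2⟩)
    refine ⟨ha, ?_⟩
    rw [Nat.cast_mul, Nat.cast_pow]
    refine IsCoprime.mul_right (IsCoprime.pow_right ⟨1, -(a / 2), ?_⟩) (Int.isCoprime_iff_gcd_eq_one.2 h1)
    push_cast
    omega
  · exact absurd rfl h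

/-- The positive multiples of `4`, as `2^v c'` with `v ≥ 2` and `c'` odd. -/
def fourMultiple (p : ℕ × ℕ) : ℕ := 2 ^ (p.1 + 2) * (2 * p.2 + 1)

lemma fourMultiple_pos (p : ℕ × ℕ) : 0 < fourMultiple p := by
  unfold fourMultiple
  positivity

lemma four_dvd_fourMultiple (p : ℕ × ℕ) : 4 ∣ fourMultiple p :=
  ⟨2 ^ p.1 * (2 * p.2 + 1), by rw [fourMultiple]; ring⟩

lemma fourMultiple_injective : Function.Injective fourMultiple := by
  rintro ⟨u, m⟩ ⟨u', m'⟩ h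
  have key : ∀ p : ℕ × ℕ, padicValNat 2 (fourMultiple p) = p.1 + 2 := fun p => by
    rw [fourMultiple, padicValNat.mul (by positivity) (by positivity), padicValNat.prime_pow,
      padicValNat.eq_zero_of_not_dvd (by omega), add_zero]
  have h1 := key (u, m)
  rw [h, key] at h1
  have hu : u = u' := by simpa using h1.symm
  subst hu
  have h2 := Nat.eq_of_mul_eq_mul_left (by positivity) h
  simp only at h2
  rw [show m = m' by omega]

lemma exists_fourMultiple {n : ℕ} (h0 : n ≠ 0) (h4 : 4 ∣ n) : ∃ p, fourMultiple p = n := by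
  obtain ⟨n, rfl⟩ := h4
  obtain ⟨v, m, hm, rfl⟩ := Nat.exists_eq_two_pow_mul_odd (n := n) (by omega)
  obtain ⟨k, rfl⟩ := hm
  exact ⟨(v, k), by rw [fourMultiple]; ring⟩

/-- The indices of the first columns of the elements of `Γ̃₁(4)`: `none` for `(1, 0)`,
and `(s, p, a)` for `(a, s c)` with `c = fourMultiple p`. -/
abbrev ColIndex : Type := Option (ℤˣ × (ℕ × ℕ) × ℤ)

/-- The upper entry of a column. -/
def colA (j : ColIndex) : ℤ := j.elim 1 fun j => j.2.2

/-- The lower entry of a column. -/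
def colC (j : ColIndex) : ℤ := j.elim 0 fun j => (j.1 : ℤ) * fourMultiple j.2.1

lemma col_injective {i j : ColIndex} (ha : colA i = colA j) (hc : colC i = colC j) : i = j := by
  have hp : ∀ p, (fourMultiple p : ℤ) ≠ 0 := fun p => by exact_mod_cast (fourMultiple_pos p).ne'
  obtain _ | ⟨s, p, a⟩ := i <;> obtain _ | ⟨s', p', a'⟩ := j
  · rfl
  · exact absurd hc.symm (mul_ne_zero (Units.ne_zero _) (hp _))
  · exact absurd hc (mul_ne_zero (Units.ne_zero _) (hp _))
  · obtain rfl : a = a' := ha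
    have hc : (s : ℤ) * fourMultiple p = s' * fourMultiple p' := hc
    have h1 := congrArg Int.natAbs hc
    simp only [Int.natAbs_mul, Int.natAbs_natCast, Int.units_natAbs, one_mul] at h1
    obtain rfl := fourMultiple_injective h1
    have := Units.ext (mul_right_cancel₀ (hp _) hc)
    rw [this]

/-- `γ ∈ Γ̃₁(4)` has the first column with index `j`. -/
def HasCol (γ : Mp) (j : ColIndex) : Prop :=
  ∃ b d : ℤ, (γ.mat : Matrix (Fin 2) (Fin 2) ℝ) =
      !![(colA j : ℝ), (b : ℝ); (colC j : ℝ), (d : ℝ)] ∧ colA j % 4 = 1 ∧ d % 4 = 1 ∧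
    colA j * d = 1 + colC j * b ∧ (γ.sgn : ℤ) = kronecker (colC j) d

lemma four_dvd_colC (j : ColIndex) : 4 ∣ colC j := by
  obtain _ | ⟨s, p, a⟩ := j
  · exact dvd_zero _
  · exact Dvd.dvd.mul_left (by exact_mod_cast four_dvd_fourMultiple p) _

lemma HasCol.mem {γ : Mp} {j : ColIndex} (h : HasCol γ j) : γ ∈ gamma1Four := by
  obtain ⟨b, d, h1, h2, h3, -, h4⟩ := h
  refine ⟨_, b, _, d, h1, ?_, ?_, ?_, h4⟩
  · exact h2
  · exact h3
  · exact Int.modEq_zero_iff_dvd.2 (four_dvd_colC j)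

lemma entries_eq {a b c d a' b' c' d' : ℝ} (h : !![a, b; c, d] = !![a', b'; c', d']) :
    a = a' ∧ b = b' ∧ c = c' ∧ d = d' :=
  ⟨congrFun (congrFun h 0) 0, congrFun (congrFun h 0) 1, congrFun (congrFun h 1) 0,
    congrFun (congrFun h 1) 1⟩

lemma det_int {γ : Mp} {a b c d : ℤ}
    (h : (γ.mat : Matrix (Fin 2) (Fin 2) ℝ) = !![(a : ℝ), (b : ℝ); (c : ℝ), (d : ℝ)]) :
    a * d = 1 + c * b := by
  have := γ.mat.det_coe
  rw [h, Matrix.det_fin_two_of] at this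
  have h2 : (a * d : ℝ) = 1 + c * b := by linarith
  exact_mod_cast h2

lemma exists_hasCol {γ : Mp} (hγ : γ ∈ gamma1Four) : ∃ j, HasCol γ j := by
  obtain ⟨a, b, c, d, h1, ha, hd, hc, hs⟩ := hγ
  have hdet := det_int h1
  have ha : a % 4 = 1 := ha
  have hd : d % 4 = 1 := hd
  suffices h : ∃ j, colA j = a ∧ colC j = c by
    obtain ⟨j, rfl, rfl⟩ := h
    exact ⟨j, b, d, h1, ha, hd, hdet, hs⟩
  rcases eq_or_ne c 0 with rfl | hc0
  · refine ⟨none, ?_, rfl⟩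
    rw [zero_mul, add_zero] at hdet
    rcases Int.mul_eq_one_iff_eq_one_or_neg_one.1 hdet with ⟨h, -⟩ | ⟨h, -⟩
    · rw [h]; rfl
    · omega
  · obtain ⟨p, hp⟩ := exists_fourMultiple (Int.natAbs_ne_zero.2 hc0)
      (Int.natCast_dvd.1 (Int.modEq_zero_iff_dvd.1 hc))
    rcases lt_or_gt_of_ne hc0 with h | h
    · exact ⟨some (-1, p, a), rfl, by simp only [colC, Option.elim, hp, Units.val_neg, Units.val_one]; omega⟩
    · exact ⟨some (1, p, a), rfl, by simp only [colC, Option.elim, hp, Units.val_one]; omega⟩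

lemma kronecker_colC (s : ℤˣ) (p : ℕ × ℕ) (a : ℤ) {d : ℤ} (hd : d % 4 = 1) :
    kronecker (colC (some (s, p, a))) d = kron (p.1 + 2) (2 * p.2 + 1) d := by
  refine kronecker_eq_kron (odd_two_mul_add_one _) ?_ hd
  rw [colC, Option.elim, Int.natAbs_mul, Int.units_natAbs, one_mul, Int.natAbs_natCast, fourMultiple]

lemma kron_col {s : ℤˣ} {p : ℕ × ℕ} {a b d : ℤ} (ha : a % 4 = 1) (hd : d % 4 = 1)
    (h : a * d = 1 + colC (some (s, p, a)) * b) :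
    kron (p.1 + 2) (2 * p.2 + 1) a * kron (p.1 + 2) (2 * p.2 + 1) d = 1 := by
  refine kron_mul_kron (k := s * b) (by omega) ha hd ?_
  rw [h, colC, Option.elim, fourMultiple]
  ring

/-- Right multiplication by ñ_m adds cm to d. The cocycle is trivial there, and the symbol has
period |c| when c ≠ 0. -/
lemma HasCol.mul_nElt {γ : Mp} {j : ColIndex} (h : HasCol γ j) (m : ℤ) :
    HasCol (γ * nElt m) j := by
  obtain ⟨b, d, h1, ha, hd, hdet, hs⟩ := h
  obtain ⟨e, es⟩ := mul_sgn_of h1 (coe_n m)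
  have hd' : (colC j * m + d) % 4 = 1 := by
    obtain ⟨k, hk⟩ := four_dvd_colC j
    rw [hk, mul_assoc]
    omega
  refine ⟨colA j * m + b, colC j * m + d, ?_, ha, hd', by linear_combination hdet, ?_⟩
  · rw [e]
    ext i j
    fin_cases i <;> fin_cases j <;> simp
  · have h2 : (γ * nElt m).sgn = γ.sgn := by
      rw [es]
      by_cases hc : colC j = 0
      · have hd1 : (d : ℝ) ≠ 0 := by
          have : d ≠ 0 := by rintro rfl; simp at hd
          exact_mod_cast this
        simp [hc, nElt, hilb, hd1, (zero_lt_one (α := ℝ)).not_gt]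
      · have hc1 : (colC j : ℝ) ≠ 0 := by exact_mod_cast hc
        simp [hc1, nElt, hilb, (zero_lt_one (α := ℝ)).not_gt]
    rw [h2, hs]
    obtain _ | ⟨s, p, a⟩ := j
    · simp [colC]
    · rw [kronecker_colC s p a hd, kronecker_colC s p a hd',
        ← kron_add_mul (a := d) (k := s * m) (by omega)]
      congr 1
      rw [colC, Option.elim, fourMultiple]
      ring

lemma HasCol.eq_mul_nElt {γ γ' : Mp} {j : ColIndex} (h : HasCol γ j) (h' : HasCol γ' j) :
    ∃ m : ℤ, γ' = γ * nElt m := by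
  obtain ⟨b, d, h1, ha, hd, hdet, hs⟩ := id h
  obtain ⟨b', d', h1', -, hd', hdet', hs'⟩ := h'
  -- This is the upper right entry of γ⁻¹γ'. The metaplectic signs agree because both are the symbol
  -- of the same lower row.
  refine ⟨d * b' - b * d', ?_⟩
  have hb : colA j * (d * b' - b * d') + b = b' := by
    linear_combination b' * hdet - b * hdet'
  have hd2 : colC j * (d * b' - b * d') + d = d' := by
    linear_combination d' * hdet - d * hdet'
  obtain ⟨b₂, d₂, h₁, -, hd₂, -, hs₂⟩ := h.mul_nElt (d * b' - b * d')
  have e := (mul_sgn_of h1 (coe_n ((d * b' - b * d' : ℤ) : ℝ))).1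
  rw [h₁] at e
  obtain ⟨-, eb, -, ed⟩ := entries_eq e
  have eb : (b₂ : ℝ) = b' := by
    rw [eb, mul_one]
    exact_mod_cast hb
  have ed : (d₂ : ℝ) = d' := by
    rw [ed, mul_one]
    exact_mod_cast hd2
  have ed' : d₂ = d' := by exact_mod_cast ed
  ext1
  · exact Subtype.ext (by rw [h₁, h1', eb, ed])
  · exact Units.ext (by rw [hs', hs₂, ed'])

/-- The value at `φ` of the term of the Eisenstein series with index `j`. -/
noncomputable def eisVal (φ : SmoothPS (-ε) (-ν)) (j : ColIndex) : ℂ :=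
  j.elim (φ sElt) fun j => (if j.1 = 1 then ((ε : ℤ) : ℂ) * Complex.I else 1) *
    ((kron (j.2.1.1 + 2) (2 * j.2.1.2 + 1) j.2.2 : ℂ) * ((fourMultiple j.2.1 : ℂ) ^ (-(ν + 1)) *
      φ (nElt (j.2.2 / ((j.1 : ℤ) * fourMultiple j.2.1)))))

/-- The explicit values `apply_mul_s_pos` and `apply_mul_s_neg` involve γ only through its first
column and its sign, and `kron_col` expresses the sign by a. -/
lemma HasCol.apply {γ : Mp} {j : ColIndex} (h : HasCol γ j) (φ : SmoothPS (-ε) (-ν)) :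
    φ (γ * sElt) = eisVal φ j := by
  obtain _ | ⟨s, p, a⟩ := j
  · have h1 : HasCol (1 : Mp) none := by
      refine ⟨0, 1, ?_, rfl, rfl, rfl, ?_⟩
      · ext i j
        fin_cases i <;> fin_cases j <;> simp [colA, colC]
      · simp [kronecker, colC]
    obtain ⟨m, rfl⟩ := h1.eq_mul_nElt h
    rw [apply_mul_nElt_s, one_mul]
    rfl
  · obtain ⟨b, d, h1, ha, hd, hdet, hs⟩ := h
    have hd0 : (d : ℝ) ≠ 0 := by
      have : d ≠ 0 := by rintro rfl; simp at hd
      exact_mod_cast this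
    have ha : a % 4 = 1 := ha
    rw [kronecker_colC s p a hd] at hs
    have hk := kron_col ha hd hdet
    have hs : (γ.sgn : ℤ) = kron (p.1 + 2) (2 * p.2 + 1) a := by
      rcases Int.mul_eq_one_iff_eq_one_or_neg_one.1 hk with ⟨h2, h3⟩ | ⟨h2, h3⟩ <;>
        rw [hs, h2, h3]
    have hN : (0 : ℝ) < fourMultiple p := by exact_mod_cast fourMultiple_pos p
    rcases Int.units_eq_one_or s with rfl | rfl
    · have hc : ((colC (some (1, p, a)) : ℤ) : ℝ) = fourMultiple p := by simp [colC]
      rw [hc] at h1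
      rw [apply_mul_s_pos h1 hN hd0, hs]
      simp [eisVal, colA]
      ring
    · have hc : ((colC (some (-1, p, a)) : ℤ) : ℝ) = -fourMultiple p := by simp [colC]
      rw [hc] at h1
      rw [apply_mul_s_neg h1 (by linarith) hd0, hs]
      simp [eisVal, colA]

/-- A nonzero symbol means that a ≡ 1 (4) is prime to c. Bézout then completes the column to a
matrix, and d ≡ 1 (4) is automatic from ad ≡ 1 (4). -/
lemma exists_hasCol_of_eisVal_ne_zero {φ : SmoothPS (-ε) (-ν)} {j : ColIndex}
    (h : eisVal φ j ≠ 0) : ∃ γ, HasCol γ j := by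
  suffices h2 : ∃ b d e : ℤ, colA j % 4 = 1 ∧ d % 4 = 1 ∧ colA j * d = 1 + colC j * b ∧
      kronecker (colC j) d * e = 1 by
    obtain ⟨b, d, e, ha, hd, hdet, he⟩ := h2
    have hdet' : (colA j : ℝ) * d = 1 + colC j * b := by exact_mod_cast hdet
    exact ⟨⟨⟨!![(colA j : ℝ), b; (colC j : ℝ), d], by
      rw [Matrix.det_fin_two_of]; linarith⟩, Units.mkOfMulEqOne _ _ he⟩, b, d, rfl, ha, hd, hdet, rfl⟩
  obtain _ | ⟨s, p, a⟩ := j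
  · exact ⟨0, 1, 1, rfl, rfl, rfl, by simp [kronecker, colC]⟩
  · have hk : kron (p.1 + 2) (2 * p.2 + 1) a ≠ 0 := by
      intro h0
      exact h (by simp [eisVal, h0])
    obtain ⟨ha, u, w, huw⟩ := isCoprime_of_kron_ne_zero hk (by omega)
    have hdet : a * u = 1 + colC (some (s, p, a)) * (-(s * w)) := by
      have hss : (s : ℤ) * s = 1 := Int.units_coe_mul_self s
      rw [colC, Option.elim]
      have : ((2 ^ (p.1 + 2) * (2 * p.2 + 1) : ℕ) : ℤ) = fourMultiple p := rfl
      rw [this] at huw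
      linear_combination huw + w * fourMultiple p * hss
    have hu : u % 4 = 1 := by
      obtain ⟨k, hk⟩ := four_dvd_colC (some (s, p, a))
      rw [hk, mul_assoc] at hdet
      have h3 : a * u % 4 = 1 := by omega
      have h4 : a * u % 4 = u % 4 := by rw [Int.mul_emod, ha, one_mul, Int.emod_emod]
      omega
    refine ⟨_, u, kron (p.1 + 2) (2 * p.2 + 1) a, ha, hu, hdet, ?_⟩
    rw [kronecker_colC s p a hu, mul_comm]
    exact kron_col ha hu hdet

/-- The index of the first column of a coset. -/
lemma exists_colIndex : ∃ g : EisCosets → ColIndex, Function.Injective g ∧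
    (∀ q (ε : ℤˣ) (ν : ℂ) (φ : SmoothPS (-ε) (-ν)), eisTerm ε ν q φ = eisVal φ (g q)) ∧
    ∀ (ε : ℤˣ) (ν : ℂ) (φ : SmoothPS (-ε) (-ν)) j, j ∉ Set.range g → eisVal φ j = 0 := by
  have h : ∀ q : EisCosets, ∃ j γ, HasCol γ j ∧ QuotientGroup.mk γ = q.1 := fun q => by
    obtain ⟨γ, hγ, hq⟩ := q.2
    obtain ⟨j, hj⟩ := exists_hasCol hγ
    exact ⟨j, γ, hj, hq⟩
  choose g γ hg hγ using h
  have hmk : ∀ (γ : Mp) (m : ℤ), (QuotientGroup.mk (γ * nElt m) : Mp ⧸ gammaInf) =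
      QuotientGroup.mk γ := fun γ m => by
    refine (QuotientGroup.eq.2 ?_).symm
    rw [inv_mul_cancel_left]
    exact ⟨m, rfl⟩
  refine ⟨g, fun q q' h => ?_, fun q ε ν φ => ?_, fun ε ν φ j hj => ?_⟩
  · have h1 := hg q
    rw [h] at h1
    obtain ⟨m, hm⟩ := h1.eq_mul_nElt (hg q')
    refine Subtype.ext ?_
    rw [← hγ, ← hγ, hm, hmk]
  · rw [eisTerm_apply (hγ q), (hg q).apply]
  · by_contra hne
    obtain ⟨γ', h'⟩ := exists_hasCol_of_eisVal_ne_zero hne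
    refine hj ⟨⟨QuotientGroup.mk γ', γ', h'.mem, rfl⟩, ?_⟩
    obtain ⟨m, hm⟩ := QuotientGroup.eq.1 (hγ ⟨QuotientGroup.mk γ', γ', h'.mem, rfl⟩)
    have h2 := (hg ⟨QuotientGroup.mk γ', γ', h'.mem, rfl⟩).mul_nElt m
    have h3 : γ' = γ ⟨QuotientGroup.mk γ', γ', h'.mem, rfl⟩ * nElt m := by
      rw [← hm, mul_inv_cancel_left]
    rw [← h3] at h2
    obtain ⟨b, d, e1, _⟩ := h2
    obtain ⟨b', d', e2, _⟩ := h'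
    rw [e1] at e2
    obtain ⟨ea, -, ec, -⟩ := entries_eq e2
    exact col_injective (by exact_mod_cast ea) (by exact_mod_cast ec)

end

/-! ### Convergence of the Eisenstein series and Poisson summation. -/

section

variable {ε : ℤˣ} {ν : ℂ}
open scoped FourierTransform

lemma hasSum_option {α : Type*} {f : Option α → ℂ} {S : ℂ} (h : HasSum (fun i => f (some i)) S) :
    HasSum f (f none + S) := by
  have h1 : HasSum (fun j : Option α => if j = none then f none else 0) (f none) :=
    hasSum_ite_eq none (f none)
  have h2 : HasSum (fun j : Option α => if j = none then 0 else f j) S := by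
    refine ((Option.some_injective α).hasSum_iff fun j hj => ?_).1 h
    obtain _ | j := j
    · rfl
    · exact absurd ⟨j, rfl⟩ hj
  refine (h1.add h2).congr_fun fun j => ?_
  by_cases h : j = none
  · simp [h]
  · simp [h]

lemma rpow_le_one_add_sq {τ x : ℝ} (h0 : 0 ≤ τ) (h2 : τ ≤ 2) (hx : 0 ≤ x) :
    x ^ τ ≤ 1 + x ^ 2 := by
  rcases le_total x 1 with h | h
  · have := Real.rpow_le_one hx h h0
    nlinarith [sq_nonneg x]
  · have := Real.rpow_le_rpow_of_exponent_le h h2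
    rw [Real.rpow_two] at this
    linarith

/-- A bound for the terms of the sum of `φ` over the rationals with a fixed denominator. -/
lemma norm_kron_mul_apply_le (ν : ℂ) (hν : 1 ≤ ν.re) {τ : ℝ} (h0 : 0 < τ) (h2 : τ ≤ 2) :
    ∃ C : ℝ, 0 ≤ C ∧ ∀ (ε s : ℤˣ) (φ : SmoothPS (-ε) (-ν)) (p : ℕ × ℕ) (a : ℤ),
      ‖(kron (p.1 + 2) (2 * p.2 + 1) a : ℂ) * φ (nElt (a / ((s : ℤ) * fourMultiple p)))‖ ≤
        C * ((fourMultiple p : ℝ) ^ τ * |(a : ℝ)| ^ (-τ)) * qnorm 0 φ := by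
  obtain ⟨C, hC0, hC⟩ := tail_bound_uniform 0 ‖ν‖
  refine ⟨C, hC0, fun ε s φ p a => ?_⟩
  rcases eq_or_ne a 0 with rfl | ha
  · have : kron (p.1 + 2) (2 * p.2 + 1) 0 = 0 := by simp [kron]
    rw [this, Int.cast_zero, zero_mul, norm_zero]
    have := qnorm_nonneg 0 φ
    positivity
  have hN : (0 : ℝ) < fourMultiple p := by exact_mod_cast fourMultiple_pos p
  have ha' : 0 < |(a : ℝ)| := abs_pos.2 (by exact_mod_cast ha)
  have h3 := hC (-ε) (-ν) (by simp) (by simpa using hν) φ (a / ((s : ℤ) * fourMultiple p))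
  rw [iteratedDeriv_zero, slice, one_mul] at h3
  have h4 : (a / ((s : ℤ) * fourMultiple p : ℝ)) ^ 2 = (|(a : ℝ)| / fourMultiple p) ^ 2 := by
    rcases Int.units_eq_one_or s with rfl | rfl <;> simp [div_pow]
  rw [h4] at h3
  have h5 : (1 + (|(a : ℝ)| / fourMultiple p) ^ 2)⁻¹ ≤ (fourMultiple p : ℝ) ^ τ * |(a : ℝ)| ^ (-τ) := by
    rw [Real.rpow_neg ha'.le, ← div_eq_mul_inv, ← Real.div_rpow hN.le ha'.le, ← inv_div |(a : ℝ)|,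
      Real.inv_rpow (by positivity)]
    exact inv_anti₀ (by positivity) (rpow_le_one_add_sq h0.le h2 (by positivity))
  rw [norm_mul]
  calc _ ≤ 1 * (C * qnorm 0 φ * (1 + (|(a : ℝ)| / fourMultiple p) ^ 2)⁻¹) :=
        mul_le_mul (norm_intCast_le_one (abs_kron_le _ _ _)) h3 (norm_nonneg _) zero_le_one
    _ ≤ C * qnorm 0 φ * ((fourMultiple p : ℝ) ^ τ * |(a : ℝ)| ^ (-τ)) := by
        rw [one_mul]
        exact mul_le_mul_of_nonneg_left h5 (mul_nonneg hC0 (qnorm_nonneg _ _))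
    _ = _ := by ring

lemma summable_fourMultiple_rpow {s : ℝ} (hs : 1 < s) :
    Summable fun p : ℕ × ℕ => (fourMultiple p : ℝ) ^ (-s) :=
  (Real.summable_nat_rpow.2 (by linarith : -s < -1)).comp_injective fourMultiple_injective

lemma norm_fourMultiple_cpow (p : ℕ × ℕ) (s : ℂ) : ‖(fourMultiple p : ℂ) ^ s‖ = (fourMultiple p : ℝ) ^ s.re :=
  Complex.norm_natCast_cpow_of_pos (fourMultiple_pos p) s

/-- The terms of the Eisenstein series are dominated by a continuous seminorm. -/
theorem exists_eisVal_bound (hν : 1 < ν.re) : ∃ B : ColIndex → ℝ, Summable B ∧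
    ∀ (ε : ℤˣ) (φ : SmoothPS (-ε) (-ν)) j, ‖eisVal φ j‖ ≤ B j * qnorm 0 φ := by
  -- Interpolating the decay of φ between |x|^0 and |x|^{-2}: τ > 1 gives summability over a, τ < Re
  -- ν gives c^{-(Re ν + 1 - τ)} an exponent below -1, and τ ≤ 2 is what the decay allows.
  obtain ⟨τ, hτ1, hτ2⟩ := exists_between (lt_min hν one_lt_two)
  obtain ⟨hτ3, hτ4⟩ := lt_min_iff.1 hτ2
  obtain ⟨C, hC0, hC⟩ := norm_kron_mul_apply_le ν hν.le (by linarith : 0 < τ) hτ4.le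
  refine ⟨fun j => j.elim 1 fun j => 1 * (C * ((fourMultiple j.2.1 : ℝ) ^ (-(ν.re + 1 - τ)) *
    |(j.2.2 : ℝ)| ^ (-τ))), ?_, fun ε φ j => ?_⟩
  · have h1 : Summable fun x : (ℕ × ℕ) × ℤ => C * ((fourMultiple x.1 : ℝ) ^ (-(ν.re + 1 - τ)) *
        |(x.2 : ℝ)| ^ (-τ)) :=
      ((summable_fourMultiple_rpow (by linarith)).mul_of_nonneg (Real.summable_abs_int_rpow hτ1)
        (fun p => by positivity) (fun a => by positivity)).mul_left C
    have h2 : Summable fun j : ℤˣ × (ℕ × ℕ) × ℤ => (1 : ℝ) * (C *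
        ((fourMultiple j.2.1 : ℝ) ^ (-(ν.re + 1 - τ)) * |(j.2.2 : ℝ)| ^ (-τ))) :=
      Summable.mul_of_nonneg (f := fun _ : ℤˣ => (1 : ℝ)) (Summable.of_finite) h1
        (fun _ => zero_le_one) (fun x => by positivity)
    have h3 := (hasSum_option (f := fun j : ColIndex => ((j.elim 1 fun j => 1 * (C *
      ((fourMultiple j.2.1 : ℝ) ^ (-(ν.re + 1 - τ)) * |(j.2.2 : ℝ)| ^ (-τ))) : ℝ) : ℂ))
      (Complex.hasSum_ofReal.2 h2.hasSum)).summable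
    exact Complex.summable_ofReal.1 h3
  · obtain _ | ⟨s, p, a⟩ := j
    · change ‖φ sElt‖ ≤ 1 * qnorm 0 φ
      rw [apply_s, norm_mul, norm_neg, norm_units_mul_I]
      exact mul_le_mul_of_nonneg_left
        (le_qnorm_s (j := 0) (x := 0) le_rfl φ ⟨by norm_num, zero_le_one⟩) zero_le_one
    · have hw : ‖(if s = 1 then ((ε : ℤ) : ℂ) * Complex.I else 1)‖ = 1 := by
        split_ifs
        · exact norm_units_mul_I ε
        · exact norm_one
      have hN : (0 : ℝ) < fourMultiple p := by exact_mod_cast fourMultiple_pos p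
      have e : eisVal φ (some (s, p, a)) = (if s = 1 then ((ε : ℤ) : ℂ) * Complex.I else 1) *
          ((fourMultiple p : ℂ) ^ (-(ν + 1)) * ((kron (p.1 + 2) (2 * p.2 + 1) a : ℂ) *
            φ (nElt (a / ((s : ℤ) * fourMultiple p))))) := by
        simp only [eisVal, Option.elim]
        ring
      have h1 : (fourMultiple p : ℝ) ^ (-(ν.re + 1 - τ)) =
          (fourMultiple p : ℝ) ^ (-(ν + 1)).re * (fourMultiple p : ℝ) ^ τ := by
        rw [← Real.rpow_add hN]
        congr 1
        simp
        ring
      rw [e, norm_mul, hw, one_mul, norm_mul, norm_fourMultiple_cpow]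
      refine (mul_le_mul_of_nonneg_left (hC ε s φ p a) (by positivity)).trans (le_of_eq ?_)
      simp only [Option.elim, h1]
      ring

/-- Domination by one continuous seminorm gives strong convergence. The sum over cosets extends to
all column indices since the additional terms vanish. -/
theorem summable_eisTerm (ε : ℤˣ) (hν : 1 < ν.re) : Summable (eisTerm ε ν) ∧
    ∀ φ : SmoothPS (-ε) (-ν), (∑' q, eisTerm ε ν q) φ = ∑' j, eisVal φ j := by
  obtain ⟨g, hg, hgv, hg0⟩ := exists_colIndex
  obtain ⟨B, hB, hBφ⟩ := exists_eisVal_bound hν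
  obtain ⟨G, hG, hGφ⟩ := hasSum_of_le_qnorm (eisTerm ε ν) (fun q => B (g q)) 0
    (fun q φ => by rw [hgv]; exact hBφ ε φ (g q)) (hB.comp_injective hg)
  refine ⟨hG.summable, fun φ => ?_⟩
  rw [hG.tsum_eq]
  have h : HasSum (fun q => eisVal φ (g q)) (G φ) :=
    (hGφ φ).congr_fun fun q => (hgv q ε ν φ).symm
  exact ((hg.hasSum_iff fun j hj => hg0 ε ν φ j hj).1 h).tsum_eq.symm

lemma summable_fourierDist_apply (hν : 1 < ν.re) (φ : SmoothPS (-ε) (-ν)) :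
    Summable fun n : ℤ => ‖fourierDist ε ν n φ‖ := by
  obtain ⟨C, hC0, hC⟩ := norm_fourierDist_le 2 ‖ν‖
  refine Summable.of_norm_bounded_eventually
    ((Real.summable_abs_int_rpow one_lt_two).mul_left (C * qnorm 2 φ)) ?_
  refine (Set.finite_singleton (0 : ℤ)).subset fun n hn => ?_
  by_contra h0
  refine hn ?_
  change ‖‖fourierDist ε ν n φ‖‖ ≤ _
  rw [norm_norm]
  refine (hC ε ν le_rfl (by push_cast; linarith) n h0 φ).trans (le_of_eq ?_)
  rw [Real.rpow_neg (abs_nonneg _), Real.rpow_two, Nat.cast_natAbs, Int.cast_abs]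
  ring

/-- Poisson summation. -/
lemma tsum_slice_add (hν : 1 < ν.re) (φ : SmoothPS (-ε) (-ν)) (x : ℝ) :
    ∑' k : ℤ, slice φ 1 (x + k) = ∑' n : ℤ, fourierDist ε ν n φ * eExp (-n * x) := by
  have hF : ∀ n : ℤ, 𝓕 (slice φ 1) (n : ℝ) = fourierDist ε ν (-n) φ := fun n => by
    rw [fourierDist_eq_integral_of_one_lt hν, Real.fourier_real_eq_integral_exp_smul]
    refine MeasureTheory.integral_congr_ae (Filter.Eventually.of_forall fun v => ?_)
    simp only [eExp, smul_eq_mul]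
    congr 2
    push_cast
    ring
  have hs := summable_fourierDist_apply hν φ
  have hO : slice φ 1 =O[Filter.cocompact ℝ] fun x : ℝ => |x| ^ (-2 : ℝ) := by
    obtain ⟨C, hC0, hC⟩ := tail_bound_uniform 0 ‖ν‖
    refine Asymptotics.IsBigO.of_bound (C * qnorm 0 φ) ?_
    filter_upwards [Filter.mem_cocompact.2 ⟨{0}, isCompact_singleton, subset_rfl⟩] with x hx
    have hx0 : 0 < |x| := abs_pos.2 hx
    have h := hC (-ε) (-ν) (by simp) (by simp; linarith) φ x
    rw [iteratedDeriv_zero] at h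
    refine h.trans (mul_le_mul_of_nonneg_left ?_ (mul_nonneg hC0 (qnorm_nonneg _ _)))
    rw [Real.norm_of_nonneg (by positivity), Real.rpow_neg hx0.le, Real.rpow_two, sq_abs]
    exact inv_anti₀ (sq_pos_of_ne_zero hx) (by linarith)
  have h := Real.tsum_eq_tsum_fourier_of_rpow_decay_of_summable (slice_smooth φ 1).continuous
    one_lt_two hO (by
      simp only [hF]
      exact ((Equiv.neg ℤ).summable_iff (f := fun n : ℤ => fourierDist ε ν n φ)).2 hs.of_norm) x
  rw [h, ← (Equiv.neg ℤ).tsum_eq]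
  refine tsum_congr fun n => ?_
  rw [hF, Equiv.neg_apply, neg_neg, fourier_coe_apply, eExp]
  congr 2
  push_cast
  ring

end

/-! ### Fourier expansion of the Eisenstein series. -/

section

variable {ε : ℤˣ} {ν : ℂ}

/-- The sum of `φ` over the rationals with denominator `fourMultiple p`, weighted with the Kronecker
symbol. -/
lemma tsum_kron_mul_apply (hν : 1 < ν.re) (φ : SmoothPS (-ε) (-ν)) (s : ℤˣ) (p : ℕ × ℕ) :
    ∑' a : ℤ, (kron (p.1 + 2) (2 * p.2 + 1) a : ℂ) * φ (nElt (a / ((s : ℤ) * fourMultiple p))) =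
      ∑' n : ℤ, fourierDist ε ν n φ * kronGauss (p.1 + 2) (2 * p.2 + 1) (s * n) := by
  have hN : (fourMultiple p : ℝ) ≠ 0 := by exact_mod_cast (fourMultiple_pos p).ne'
  have : NeZero (fourMultiple p) := ⟨(fourMultiple_pos p).ne'⟩
  obtain ⟨C, hC0, hC⟩ := norm_kron_mul_apply_le ν hν.le two_pos le_rfl
  have hsum : Summable fun a : ℤ =>
      (kron (p.1 + 2) (2 * p.2 + 1) a : ℂ) * φ (nElt (a / ((s : ℤ) * fourMultiple p))) :=
    Summable.of_norm_bounded (((Real.summable_abs_int_rpow one_lt_two).mul_left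
      (C * (fourMultiple p : ℝ) ^ (2 : ℝ) * qnorm 0 φ))) fun a =>
        (hC ε s φ p a).trans (le_of_eq (by ring))
  rw [tsum_int_residue hsum (fourMultiple p)]
  -- Write a = kN + r, where the symbol depends only on r. Poisson summation in k applies at the
  -- point r/(sN), after the sign s has been absorbed by k ↦ sk.
  have h1 : ∀ r : ℕ, ∑' k : ℤ, (kron (p.1 + 2) (2 * p.2 + 1) (k * fourMultiple p + r) : ℂ) *
      φ (nElt ((k * fourMultiple p + r : ℤ) / ((s : ℤ) * fourMultiple p))) =
      ∑' n : ℤ, (kron (p.1 + 2) (2 * p.2 + 1) r : ℂ) *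
        (fourierDist ε ν n φ * eExp (-n * (r / ((s : ℤ) * fourMultiple p)))) := fun r => by
    rw [tsum_mul_left, ← tsum_slice_add hν, 
      ← (Units.mulLeft s).tsum_eq
        (fun k : ℤ => slice φ 1 (r / ((s : ℤ) * fourMultiple p) + k)), ← tsum_mul_left]
    refine tsum_congr fun k => ?_
    have e1 : kron (p.1 + 2) (2 * p.2 + 1) (k * fourMultiple p + r) =
        kron (p.1 + 2) (2 * p.2 + 1) r := by
      rw [← kron_add_mul (a := r) (k := k) (by omega), fourMultiple]
      congr 1
      ring
    have e2 : ((k * fourMultiple p + r : ℤ) / ((s : ℤ) * fourMultiple p) : ℝ) =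
        r / ((s : ℤ) * fourMultiple p) + ((s : ℤ) * k : ℤ) := by
      push_cast
      rcases Int.units_eq_one_or s with rfl | rfl <;> simp <;> field_simp <;> ring
    rw [slice, one_mul, Units.mulLeft_apply, e1, ← e2]
  simp only [h1]
  rw [← Summable.tsum_finsetSum]
  · refine tsum_congr fun n => ?_
    rw [kronGauss, Finset.mul_sum]
    refine Finset.sum_congr rfl fun r _ => ?_
    have e2 : eExp (-n * (r / ((s : ℤ) * fourMultiple p))) =
        eDiv (2 ^ (p.1 + 2) * (2 * p.2 + 1)) (-(s * n) * r) := by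
      rw [eDiv]
      congr 1
      change _ = ((-(s * n) * r : ℤ) : ℝ) / fourMultiple p
      rcases Int.units_eq_one_or s with rfl | rfl <;> simp <;> field_simp
    rw [e2]
    ring
  · refine fun r _ => Summable.mul_left _ (Summable.of_norm ?_)
    refine (summable_fourierDist_apply hν φ).congr fun n => ?_
    rw [norm_mul, norm_eExp, mul_one]

lemma summable_fourierDist_mul_kronGauss (hν : 1 < ν.re) (φ : SmoothPS (-ε) (-ν)) (s : ℤˣ) :
    Summable fun x : (ℕ × ℕ) × ℤ => (fourMultiple x.1 : ℂ) ^ (-(ν + 1)) *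
      (fourierDist ε ν x.2 φ * kronGauss (x.1.1 + 2) (2 * x.1.2 + 1) (s * x.2)) := by
  refine Summable.of_norm_bounded ((summable_fourMultiple_rpow hν).mul_of_nonneg
    (summable_fourierDist_apply hν φ) (fun p => by positivity) (fun n => norm_nonneg _))
    fun x => ?_
  have hN : (0 : ℝ) < fourMultiple x.1 := by exact_mod_cast fourMultiple_pos x.1
  have h1 : (fourMultiple x.1 : ℝ) ^ (-ν.re) =
      (fourMultiple x.1 : ℝ) ^ (-(ν + 1)).re * fourMultiple x.1 := by
    rw [← Real.rpow_add_one hN.ne']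
    congr 1
    simp
  rw [norm_mul, norm_mul, norm_fourMultiple_cpow, h1, mul_assoc, mul_comm ‖fourierDist _ _ _ _‖]
  exact mul_le_mul_of_nonneg_left (mul_le_mul_of_nonneg_right (norm_kronGauss_le _ _ _)
    (norm_nonneg _)) (by positivity)

/-- The part of the Eisenstein series with a fixed sign of the lower left entry. -/
lemma tsum_eisVal_sign (hν : 1 < ν.re) (φ : SmoothPS (-ε) (-ν)) (s : ℤˣ) :
    ∑' p : ℕ × ℕ, ∑' a : ℤ, (fourMultiple p : ℂ) ^ (-(ν + 1)) *
      ((kron (p.1 + 2) (2 * p.2 + 1) a : ℂ) * φ (nElt (a / ((s : ℤ) * fourMultiple p)))) =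
      ∑' n : ℤ, fourierDist ε ν n φ * kronSeries (s * n) ν := by
  have h := summable_fourierDist_mul_kronGauss hν φ s
  simp only [tsum_mul_left, tsum_kron_mul_apply hν φ s]
  simp only [← tsum_mul_left]
  rw [← Summable.tsum_comm (f := fun (p : ℕ × ℕ) (n : ℤ) => (fourMultiple p : ℂ) ^ (-(ν + 1)) *
    (fourierDist ε ν n φ * kronGauss (p.1 + 2) (2 * p.2 + 1) (s * n))) h]
  refine tsum_congr fun n => ?_
  rw [kronSeries, ← tsum_mul_left]
  refine tsum_congr fun p => ?_
  rw [fourMultiple]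
  ring

lemma summable_fourierDist_mul_kronSeries (hν : 1 < ν.re) (φ : SmoothPS (-ε) (-ν)) (s : ℤˣ) :
    Summable fun n : ℤ => fourierDist ε ν n φ * kronSeries (s * n) ν := by
  refine (((summable_fourierDist_mul_kronGauss hν φ s).prod_symm).prod).congr fun n => ?_
  rw [kronSeries, ← tsum_mul_left]
  refine tsum_congr fun p => ?_
  simp only [Prod.swap, fourMultiple]
  ring

/-- The Fourier expansion of the Eisenstein series, without the factor `ζ₂(2ν+1)`. -/
theorem tsum_eisVal (hν : 1 < ν.re) (φ : SmoothPS (-ε) (-ν)) :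
    ∑' j, eisVal φ j = φ sElt + ∑' n : ℤ, fourierDist ε ν n φ *
      (((ε : ℤ) : ℂ) * Complex.I * kronSeries n ν + kronSeries (-n) ν) := by
  obtain ⟨B, hB, hBφ⟩ := exists_eisVal_bound hν
  have hs : Summable (eisVal φ) :=
    Summable.of_norm_bounded (hB.mul_right (qnorm 0 φ)) (hBφ ε φ)
  have hs' : Summable fun i => eisVal φ (some i) := hs.comp_injective (Option.some_injective _)
  rw [(hasSum_option hs'.hasSum).tsum_eq]
  congr 1
  have h1 : ∀ s : ℤˣ, ∑' x : (ℕ × ℕ) × ℤ, eisVal φ (some (s, x)) =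
      (if s = 1 then ((ε : ℤ) : ℂ) * Complex.I else 1) *
        ∑' n : ℤ, fourierDist ε ν n φ * kronSeries (s * n) ν := fun s => by
    have h2 : Summable fun x : (ℕ × ℕ) × ℤ => eisVal φ (some (s, x)) :=
      hs'.comp_injective (i := fun x : (ℕ × ℕ) × ℤ => (s, x)) (Prod.mk_right_injective s)
    rw [h2.tsum_prod, ← tsum_eisVal_sign hν φ s, ← tsum_mul_left]
    refine tsum_congr fun p => ?_
    rw [← tsum_mul_left]
    refine tsum_congr fun a => ?_
    simp only [eisVal, Option.elim]
    ring
  have e1 := summable_fourierDist_mul_kronSeries hν φ 1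
  have e2 := summable_fourierDist_mul_kronSeries hν φ (-1)
  rw [hs'.tsum_prod, tsum_fintype, UnitsInt.univ, Finset.sum_pair (by decide), h1, h1,
    if_pos rfl, if_neg (by decide), one_mul, ← tsum_mul_left, ← (e1.mul_left _).tsum_add e2]
  refine tsum_congr fun n => ?_
  simp only [Units.val_one, Units.val_neg, one_mul, neg_mul]
  ring

/-- The continuation of the Eisenstein distribution. -/
theorem exists_contFamily (ε : ℤˣ) : ∃ (b : ℤ → ℂ → ℂ) (S : ∀ ν : ℂ, DistPS ε ν),
    (∀ n, n ≠ 0 → Differentiable ℂ (b n)) ∧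
    (∀ ν, HasSum (fun n => if n = 0 then 0 else b n ν • fourierDist ε ν n) (S ν)) ∧
    (∀ ν (φ : SmoothPS (-ε) (-ν)),
      HasSum (fun n => if n = 0 then 0 else b n ν * fourierDist ε ν n φ) (S ν φ)) ∧
    (∀ Φ, Differentiable ℂ (pairFlat S Φ)) ∧
    ∀ ν : ℂ, 1 < ν.re → contFamily ε S ν = eisensteinInf ε ν := by
  obtain ⟨β, hβ, hb⟩ := exists_entire_kronSeries
  -- The terms with c > 0 carry the factor εi and frequency n, those with c < 0 the factor 1 and
  -- frequency -n.
  set b : ℤ → ℂ → ℂ := fun n ν => ((ε : ℤ) : ℂ) * Complex.I * β n ν + β (-n) ν with hbdef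
  have hb1 : ∀ n, n ≠ 0 → Differentiable ℂ (b n) := fun n hn =>
    ((hβ n hn).1.const_mul _).add (hβ (-n) (neg_ne_zero.2 hn)).1
  have hb2 : ∀ R : ℝ, ∃ (C : ℝ) (A : ℕ), ∀ n : ℤ, n ≠ 0 → ∀ ν : ℂ, ‖ν‖ ≤ R →
      ‖b n ν‖ ≤ C * (n.natAbs : ℝ) ^ A := fun R => by
    obtain ⟨C, A, h⟩ := hb R
    refine ⟨2 * C, A, fun n hn ν hν => ?_⟩
    have h1 := h n hn ν hν
    have h2 := h (-n) (neg_ne_zero.2 hn) ν hν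
    rw [Int.natAbs_neg] at h2
    refine (norm_add_le _ _).trans ?_
    rw [norm_mul, norm_units_mul_I]
    linarith
  obtain ⟨S, hS1, hS2, hS3⟩ := exists_fourierSeries hb1 hb2 ε
  refine ⟨b, S, hb1, hS1, hS2, hS3, fun ν hν => ?_⟩
  have hν0 : ν - 1 / 2 ≠ 0 := by
    intro h
    have h2 : ν = 1 / 2 := sub_eq_zero.1 h
    rw [h2] at hν
    norm_num at hν
  have hm : ∀ m : ℕ, ν ≠ -m := fun m h => by
    rw [h] at hν
    simp at hν
    have : (0 : ℝ) ≤ m := m.cast_nonneg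
    linarith
  refine ContinuousLinearMap.ext fun φ => ?_
  have e1 : contFamily ε S ν φ = (ν - 1 / 2)⁻¹ * S ν φ +
      zeroCoeff ε ν * fourierDist ε ν 0 φ + zeta2 (2 * ν + 1) * φ sElt := by
    rw [contFamily, zeroFamily_eq hm, ← deltaInf_apply]
    rfl
  have e2 : eisensteinInf ε ν φ = zeta2 (2 * ν + 1) * (∑' q, eisTerm ε ν q) φ := rfl
  rw [e1, e2, (summable_eisTerm ε hν).2, tsum_eisVal hν, mul_add, add_comm]
  congr 1
  rw [← tsum_mul_left]
  have h0 : HasSum (fun n : ℤ => if n = 0 then zeroCoeff ε ν * fourierDist ε ν 0 φ else 0)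
      (zeroCoeff ε ν * fourierDist ε ν 0 φ) := hasSum_ite_eq 0 _
  refine (HasSum.tsum_eq ((((hS2 ν φ).mul_left (ν - 1 / 2)⁻¹).add h0).congr_fun
    fun n => ?_)).symm
  rcases eq_or_ne n 0 with rfl | hn
  · have := zeta2_mul_kronSeries_zero hν
    simp only [if_true, mul_zero, zero_add, neg_zero, zeroCoeff]
    linear_combination (1 + ((ε : ℤ) : ℂ) * Complex.I) * fourierDist ε ν 0 φ * this
  · simp only [if_neg hn, add_zero, hbdef, (hβ n hn).2 ν hν, (hβ (-n) (neg_ne_zero.2 hn)).2 ν hν]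
    linear_combination -(zeta2 (2 * ν + 1) * fourierDist ε ν n φ *
      (((ε : ℤ) : ℂ) * Complex.I * kronSeries n ν + kronSeries (-n) ν)) * inv_mul_cancel₀ hν0

/-! ### Extending test functions from the chart to the principal series. -/

/-- The factor of a function in the principal series that depends on the component of the
big cell, for an element with lower row `(c, d)`. -/
noncomputable def cellSign (ε : ℤˣ) (c d : ℝ) : ℂ :=
  if 0 < d then 1 else (if 0 < c then -1 else 1) * (((ε : ℤ) : ℂ) * Complex.I)

/-- The function on the group with the transformation law of `V^∞_{ε,ν}` that restricts to `χ` on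
the upper triangular unipotent subgroup and is supported in the big cell. -/
noncomputable def cellFun (ε : ℤˣ) (ν : ℂ) (χ : ℝ → ℂ) (g : Mp) : ℂ :=
  if g.mat 1 1 = 0 then 0 else ((g.sgn : ℤ) : ℂ) * cellSign ε (g.mat 1 0) (g.mat 1 1) *
    Complex.exp ((1 - ν) * (-Real.log |g.mat 1 1| : ℝ)) * χ (g.mat 0 1 / g.mat 1 1)

lemma cellFun_apply {χ : ℝ → ℂ} {g : Mp} {a b c d : ℝ}
    (hg : (g.mat : Matrix (Fin 2) (Fin 2) ℝ) = !![a, b; c, d]) :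
    cellFun ε ν χ g = if d = 0 then 0 else ((g.sgn : ℤ) : ℂ) * cellSign ε c d *
      Complex.exp ((1 - ν) * (-Real.log |d| : ℝ)) * χ (b / d) := by
  have h11 : g.mat 1 1 = d := congrFun (congrFun hg 1) 1
  have h10 : g.mat 1 0 = c := congrFun (congrFun hg 1) 0
  have h01 : g.mat 0 1 = b := congrFun (congrFun hg 0) 1
  rw [cellFun, h11, h10, h01]

lemma cellFun_nElt (χ : ℝ → ℂ) (x : ℝ) : cellFun ε ν χ (nElt x) = χ x := by
  rw [cellFun_apply (coe_n x), if_neg one_ne_zero]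
  simp [nElt, cellSign]

lemma exists_entries (g : Mp) : ∃ a b c d : ℝ,
    (g.mat : Matrix (Fin 2) (Fin 2) ℝ) = !![a, b; c, d] ∧ a * d - b * c = 1 := by
  refine ⟨_, _, _, _, Matrix.eta_fin_two _, ?_⟩
  have := g.mat.det_coe
  rwa [Matrix.det_fin_two] at this

lemma sgn_mul_nElt (g : Mp) (x : ℝ) : (g * nElt x).sgn = g.sgn := by
  obtain ⟨a, b, c, d, hg, hdet⟩ := exists_entries g
  rw [(mul_sgn_of hg (coe_n x)).2]
  have h1 : ¬ (1 : ℝ) < 0 := by norm_num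
  by_cases hc : c = 0
  · have hd : d ≠ 0 := by rintro rfl; simp [hc] at hdet
    simp [hc, hd, nElt, hilb, h1]
  · simp [hc, nElt, hilb, h1]

lemma sign_cases (x : ℝ) : (x < 0 ∧ ¬ 0 < x ∧ ¬ x = 0) ∨ (¬ x < 0 ∧ ¬ 0 < x ∧ x = 0) ∨
    (¬ x < 0 ∧ 0 < x ∧ ¬ x = 0) := by
  rcases lt_trichotomy x 0 with h | h | h
  · exact Or.inl ⟨h, h.not_gt, h.ne⟩
  · exact Or.inr (Or.inl ⟨h.not_lt, h.not_gt, h⟩)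
  · exact Or.inr (Or.inr ⟨h.not_gt, h, h.ne'⟩)

/-- Right multiplication by ñ_{-,y} can change the sign of the lower left entry, and the cocycle
compensates for it. The proof is a finite check of signs; the only arithmetic used is how the sign
of dy orders c and c + dy. -/
lemma cellSign_nbar {c d y : ℝ} (hd : d ≠ 0) (hy : y ≠ 0) :
    ((hilb ((if c + d * y = 0 then d else c + d * y) / if c = 0 then d else c)
      ((if c + d * y = 0 then d else c + d * y) / y) : ℤ) : ℂ) * cellSign ε (c + d * y) d =
      cellSign ε c d := by
  obtain ⟨c', hc'⟩ : ∃ c', c' = c + d * y := ⟨_, rfl⟩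
  have h5 : (d < 0 ∧ y < 0 → c < c') ∧ (d < 0 ∧ 0 < y → c' < c) ∧ (0 < d ∧ y < 0 → c' < c) ∧
      (0 < d ∧ 0 < y → c < c') :=
    ⟨fun h => by linarith [mul_pos_of_neg_of_neg h.1 h.2],
      fun h => by linarith [mul_neg_of_neg_of_pos h.1 h.2],
      fun h => by linarith [mul_neg_of_pos_of_neg h.1 h.2], fun h => by linarith [mul_pos h.1 h.2]⟩
  rw [← hc']
  clear hc'
  unfold hilb cellSign
  simp only [div_neg_iff_mul]
  rcases sign_cases d with ⟨h1, h2, h3⟩ | ⟨h1, h2, h3⟩ | ⟨h1, h2, h3⟩ <;>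
  rcases sign_cases y with ⟨i1, i2, i3⟩ | ⟨i1, i2, i3⟩ | ⟨i1, i2, i3⟩ <;>
  rcases sign_cases c with ⟨j1, j2, j3⟩ | ⟨j1, j2, j3⟩ | ⟨j1, j2, j3⟩ <;>
  rcases sign_cases c' with ⟨k1, k2, k3⟩ | ⟨k1, k2, k3⟩ | ⟨k1, k2, k3⟩ <;>
  simp only [h1, h2, h3, i1, i2, i3, not_true_eq_false, ne_eq, true_and, and_self, false_and,
    and_false, true_imp_iff, false_imp_iff, and_true, not_false_eq_true] at h5 hd hy <;>
  first
  | (exfalso; linarith)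
  | simp [mul_neg_iff, h1, h2, i1, i2, j1, j2, j3, k1, k2, k3]

/-- The analogous check for -I. The constant εi appears on crossing from d > 0 to d < 0, and (εi)² =
-1 accounts for the way back. -/
lemma cellSign_neg {c d : ℝ} (hd : d ≠ 0) :
    ((hilb ((if c * -1 = 0 then d * -1 else c * -1) / if c = 0 then d else c)
      ((if c * -1 = 0 then d * -1 else c * -1) / -1) : ℤ) : ℂ) * cellSign ε (c * -1) (d * -1) =
      ((ε : ℤ) : ℂ) * Complex.I * cellSign ε c d := by
  have hII : ((ε : ℤ) : ℂ) * Complex.I * (((ε : ℤ) : ℂ) * Complex.I) = -1 := by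
    rcases Int.units_eq_one_or ε with rfl | rfl <;> simp
  unfold hilb cellSign
  simp only [div_neg_iff_mul]
  rcases sign_cases d with ⟨h1, h2, h3⟩ | ⟨h1, h2, h3⟩ | ⟨h1, h2, h3⟩ <;>
  rcases sign_cases c with ⟨j1, j2, j3⟩ | ⟨j1, j2, j3⟩ | ⟨j1, j2, j3⟩ <;>
  first
  | exact absurd h3 hd
  | simp [h1, h2, h3, j1, j2, j3, hII]

lemma cellFun_mul_nbarElt (χ : ℝ → ℂ) (g : Mp) (y : ℝ) :
    cellFun ε ν χ (g * nbarElt y) = cellFun ε ν χ g := by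
  obtain ⟨a, b, c, d, hg, hdet⟩ := exists_entries g
  obtain ⟨e, s⟩ := mul_sgn_of hg (coe_nbar y)
  rw [cellFun_apply e, cellFun_apply hg, s]
  simp only [mul_one, mul_zero, zero_add]
  by_cases hd : d = 0
  · simp [hd]
  rw [if_neg hd, if_neg hd]
  congr 2
  have hs : (nbarElt y).sgn = 1 := rfl
  have h1 : ¬ (1 : ℝ) < 0 := by norm_num
  rw [hs, mul_one]
  rcases eq_or_ne y 0 with rfl | hy
  · by_cases hc : c = 0
    · simp [hc, hd, hilb, h1]
    · simp [hc, hilb, h1]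
  rw [if_neg hy, ← cellSign_nbar (ε := ε) (c := c) hd hy, Units.val_mul, Int.cast_mul]
  ring

lemma cellFun_mul_aElt (χ : ℝ → ℂ) (g : Mp) (t : ℝ) :
    cellFun ε ν χ (g * aElt t) = Complex.exp ((1 - ν) * t) * cellFun ε ν χ g := by
  obtain ⟨a, b, c, d, hg, hdet⟩ := exists_entries g
  obtain ⟨e, s⟩ := mul_sgn_of hg (coe_a t)
  have hs : (aElt t).sgn = 1 := rfl
  have ht := Real.exp_pos t
  have ht' := Real.exp_pos (-t)
  have h2 : (g * aElt t).sgn = g.sgn := by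
    rw [s, hs, mul_one, hilb, if_neg, one_mul]
    rintro ⟨h1, -⟩
    refine h1.not_ge ?_
    by_cases hc : c = 0
    · have hd : d ≠ 0 := by rintro rfl; simp [hc] at hdet
      simp [hc, hd, ht'.le]
    · simp [hc, ht.ne', ht.le]
  rw [cellFun_apply e, cellFun_apply hg, h2]
  simp only [mul_zero, zero_add, add_zero]
  by_cases hd : d = 0
  · simp [hd]
  have hd' : d * Real.exp (-t) ≠ 0 := mul_ne_zero hd ht'.ne'
  have e1 : cellSign ε (c * Real.exp t) (d * Real.exp (-t)) = cellSign ε c d := by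
    simp [cellSign, mul_pos_iff_of_pos_right, ht, ht']
  have e2 : -Real.log |d * Real.exp (-t)| = t + -Real.log |d| := by
    rw [abs_mul, Real.log_mul (abs_ne_zero.2 hd) (abs_ne_zero.2 ht'.ne'), abs_of_pos ht',
      Real.log_exp]
    ring
  rw [if_neg hd, if_neg hd', e1, e2, mul_div_mul_right _ _ ht'.ne', Complex.ofReal_add, mul_add,
    Complex.exp_add]
  ring

lemma cellFun_mul_mElt (χ : ℝ → ℂ) (g : Mp) (e₁ e₂ : ℤˣ) :
    cellFun ε ν χ (g * mElt e₁ e₂) = (omega ε ν e₁ e₂ 0)⁻¹ * cellFun ε ν χ g := by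
  obtain ⟨a, b, c, d, hg, hdet⟩ := exists_entries g
  obtain ⟨e, s⟩ := mul_sgn_of hg (coe_m e₁ e₂)
  have hs : (mElt e₁ e₂).sgn = e₂ := rfl
  rw [cellFun_apply e, cellFun_apply hg, s, hs]
  simp only [mul_zero, zero_add, add_zero]
  by_cases hd : d = 0
  · simp [hd]
  rcases Int.units_eq_one_or e₁ with rfl | rfl
  · have h1 : ¬ (1 : ℝ) < 0 := by norm_num
    rw [omega_one]
    by_cases hc : c = 0
    · simp [hc, hd, hilb, h1]
      ring
    · simp [hc, hd, hilb, h1]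
      ring
  · rw [omega_neg_one]
    have e0 : (((-1 : ℤˣ) : ℤ) : ℝ) = -1 := by simp
    have h := cellSign_neg (ε := ε) (c := c) hd
    rw [e0, if_pos trivial, if_neg (by simpa using hd), if_neg hd, mul_div_mul_right _ _ (by norm_num),
      abs_mul, abs_neg, abs_one, mul_one, Units.val_mul, Units.val_mul, Complex.ofReal_zero,
      mul_zero, Complex.exp_zero, Int.cast_mul, Int.cast_mul]
    linear_combination ((g.sgn : ℤ) : ℂ) * ((e₂ : ℤ) : ℂ) *
      Complex.exp ((1 - ν) * (-Real.log |d| : ℝ)) * χ (b / d) * h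

lemma cellFun_mul (χ : ℝ → ℂ) (g : Mp) (e₁ e₂ : ℤˣ) (t y : ℝ) :
    cellFun ε ν χ (g * (mElt e₁ e₂ * aElt t * nbarElt y)) =
      (omega ε ν e₁ e₂ t)⁻¹ * cellFun ε ν χ g := by
  rw [← mul_assoc, ← mul_assoc, cellFun_mul_nbarElt, cellFun_mul_aElt, cellFun_mul_mElt]
  rcases Int.units_eq_one_or e₁ with rfl | rfl
  · rw [omega_one, omega_one]
    simp
    ring
  · rw [omega_neg_one, omega_neg_one]
    simp
    ring

/-- Near a zero of cx + d the quotient (ax + b)/(cx + d) leaves every compact set, since the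
determinant keeps ax + b away from 0; so χ vanishes there. Elsewhere the sign of cx + d is locally
constant and all factors are smooth. -/
lemma contDiff_cellFun_nElt {χ : ℝ → ℂ} (hχ : ContDiff ℝ ∞ χ) (hc : HasCompactSupport χ) (g : Mp) :
    ContDiff ℝ ∞ fun x : ℝ => cellFun ε ν χ (g * nElt x) := by
  obtain ⟨a, b, c, d, hg, hdet⟩ := exists_entries g
  have he : ∀ x : ℝ, cellFun ε ν χ (g * nElt x) = if c * x + d = 0 then 0 else
      ((g.sgn : ℤ) : ℂ) * cellSign ε c (c * x + d) *
        Complex.exp ((1 - ν) * (-Real.log |c * x + d| : ℝ)) * χ ((a * x + b) / (c * x + d)) :=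
    fun x => by
      rw [cellFun_apply (mul_sgn_of hg (coe_n x)).1, sgn_mul_nElt]
      simp only [mul_one, mul_zero, add_zero]
  rw [funext he]
  refine contDiff_iff_contDiffAt.2 fun x₀ => ?_
  have hcont : Continuous fun x : ℝ => c * x + d := by fun_prop
  by_cases h0 : c * x₀ + d = 0
  · obtain ⟨R, hR⟩ := hc.isCompact.isBounded.subset_closedBall 0
    have hb : 0 < |a * x₀ + b| := by
      refine abs_pos.2 fun hb => ?_
      have : a * (c * x₀ + d) - c * (a * x₀ + b) = 1 := by linear_combination hdet
      rw [h0, hb] at this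
      simp at this
    have hev : ∀ᶠ x in 𝓝 x₀, |R| * |c * x + d| < |a * x + b| := by
      refine Filter.Tendsto.eventually_lt (f := fun x : ℝ => |R| * |c * x + d|)
        (g := fun x : ℝ => |a * x + b|) (Continuous.tendsto (by fun_prop) x₀)
        (Continuous.tendsto (by fun_prop) x₀) ?_
      rw [h0]
      simpa using hb
    refine contDiffAt_const (c := (0 : ℂ)) |>.congr_of_eventuallyEq ?_
    filter_upwards [hev] with x hx
    split_ifs with h
    · rfl
    · have : χ ((a * x + b) / (c * x + d)) = 0 := by
        by_contra hne
        have h1 := hR (subset_tsupport _ hne)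
        rw [mem_closedBall_zero_iff, Real.norm_eq_abs, abs_div, div_le_iff₀ (abs_pos.2 h)] at h1
        have h2 := mul_le_mul_of_nonneg_right (le_abs_self R) (abs_nonneg (c * x + d))
        linarith
      rw [this, mul_zero]
  · have hs : ∀ᶠ x in 𝓝 x₀, c * x + d ≠ 0 ∧ cellSign ε c (c * x + d) = cellSign ε c (c * x₀ + d) := by
      rcases lt_or_gt_of_ne h0 with h | h
      · filter_upwards [hcont.continuousAt.eventually_lt continuousAt_const h] with x hx
        exact ⟨hx.ne, by rw [cellSign, cellSign, if_neg hx.not_gt, if_neg h.not_gt]⟩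
      · filter_upwards [continuousAt_const.eventually_lt hcont.continuousAt h] with x hx
        exact ⟨hx.ne', by rw [cellSign, cellSign, if_pos hx, if_pos h]⟩
    have hlog : ContDiffAt ℝ ∞ (fun x : ℝ => Real.log |c * x + d|) x₀ := by
      simp only [Real.log_abs]
      exact ContDiffAt.log (by fun_prop) h0
    have hdiv : ContDiffAt ℝ ∞ (fun x : ℝ => (a * x + b) / (c * x + d)) x₀ :=
      ContDiffAt.div (by fun_prop) (by fun_prop) h0
    have hlog' : ContDiffAt ℝ ∞ (fun x : ℝ => ((-Real.log |c * x + d| : ℝ) : ℂ)) x₀ :=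
      Complex.ofRealCLM.contDiff.contDiffAt.comp x₀ hlog.neg
    have h2 : ContDiffAt ℝ ∞ (fun x : ℝ => ((g.sgn : ℤ) : ℂ) * cellSign ε c (c * x₀ + d) *
        Complex.exp ((1 - ν) * (-Real.log |c * x + d| : ℝ)) *
          χ ((a * x + b) / (c * x + d))) x₀ :=
      (contDiffAt_const.mul (contDiffAt_const.mul hlog').cexp).mul
        (hχ.contDiffAt.comp x₀ hdiv)
    refine h2.congr_of_eventuallyEq ?_
    filter_upwards [hs] with x hx
    rw [if_neg hx.1, hx.2]

/-- Test functions on the upper triangular unipotent subgroup extend to the principal series. -/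
theorem exists_extension (ε : ℤˣ) (ν : ℂ) {χ : ℝ → ℂ} (hχ : ContDiff ℝ ∞ χ)
    (hc : HasCompactSupport χ) : ∃ φ : SmoothPS ε ν, ∀ x, φ (nElt x) = χ x := by
  refine ⟨⟨cellFun ε ν χ, fun g => ?_, cellFun_mul χ⟩, cellFun_nElt χ⟩
  have h : ∀ p : ℝ × ℝ × ℝ, cellFun ε ν χ (g * (nElt p.1 * aElt p.2.1 * nbarElt p.2.2)) =
      Complex.exp ((1 - ν) * p.2.1) * cellFun ε ν χ (g * nElt p.1) := fun p => by
    rw [← mul_assoc, ← mul_assoc, cellFun_mul_nbarElt, cellFun_mul_aElt]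
  rw [funext h]
  have h1 : ContDiff ℝ ∞ fun p : ℝ × ℝ × ℝ => ((p.2.1 : ℝ) : ℂ) :=
    Complex.ofRealCLM.contDiff.comp (by fun_prop)
  exact (contDiff_const.mul h1).cexp.mul ((contDiff_cellFun_nElt hχ hc g).comp contDiff_fst)

end

/-! ### Compactly supported test functions and the nonvanishing of the residue at 1/2. -/

section

variable {ε : ℤˣ} {ν : ℂ}
open MeasureTheory

/-- A smooth function with compact support whose integer translates sum to `1`. -/
noncomputable def unitBump (x : ℝ) : ℂ :=
  ((Real.smoothTransition (x + 1) - Real.smoothTransition x : ℝ) : ℂ)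

lemma contDiff_unitBump : ContDiff ℝ ∞ unitBump :=
  Complex.ofRealCLM.contDiff.comp
    ((Real.smoothTransition.contDiff.comp (contDiff_id.add contDiff_const)).sub
      Real.smoothTransition.contDiff)

lemma unitBump_eq_zero {x : ℝ} (hx : 1 ≤ |x|) : unitBump x = 0 := by
  rw [unitBump]
  rcases le_abs.1 hx with h | h
  · rw [Real.smoothTransition.one_of_one_le h, Real.smoothTransition.one_of_one_le (by linarith)]
    simp
  · rw [Real.smoothTransition.zero_of_nonpos (x := x) (by linarith),
      Real.smoothTransition.zero_of_nonpos (by linarith)]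
    simp

lemma hasCompactSupport_unitBump : HasCompactSupport unitBump :=
  HasCompactSupport.intro (isCompact_Icc (a := (-1 : ℝ)) (b := 1)) fun x hx =>
    unitBump_eq_zero (by
      by_contra h
      exact hx (abs_le.1 (not_le.1 h).le))

/-- The integer translates telescope. At a given x only the shifts -⌊x⌋ and -⌊x⌋ - 1 can contribute,
because the support lies in [-1, 1]. -/
lemma hasSum_unitBump (x : ℝ) : HasSum (fun k : ℤ => unitBump (x + k)) 1 := by
  have h0 := Int.fract_nonneg x
  have h1 := Int.fract_lt_one x
  have h2 := Int.self_sub_floor x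
  have h3 : ∑ k ∈ ({-⌊x⌋, -⌊x⌋ - 1} : Finset ℤ), unitBump (x + k) = 1 := by
    rw [Finset.sum_pair (by omega)]
    have e1 : x + ((-⌊x⌋ : ℤ) : ℝ) = Int.fract x := by push_cast; linarith
    have e2 : x + ((-⌊x⌋ - 1 : ℤ) : ℝ) = Int.fract x - 1 := by push_cast; linarith
    rw [e1, e2, unitBump, unitBump, sub_add_cancel,
      Real.smoothTransition.one_of_one_le (by linarith),
      Real.smoothTransition.zero_of_nonpos (x := Int.fract x - 1) (by linarith)]
    push_cast
    ring
  rw [← h3]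
  refine hasSum_sum_of_ne_finset_zero fun k hk => unitBump_eq_zero ?_
  simp only [Finset.mem_insert, Finset.mem_singleton, not_or] at hk
  by_contra h
  obtain ⟨h4, h5⟩ := abs_lt.1 (not_le.1 h)
  have h6 : (-2 : ℝ) < ((⌊x⌋ + k : ℤ) : ℝ) := by push_cast; linarith
  have h7 : ((⌊x⌋ + k : ℤ) : ℝ) < 1 := by push_cast; linarith
  have h6 : -2 < ⌊x⌋ + k := by exact_mod_cast h6
  have h7 : ⌊x⌋ + k < 1 := by exact_mod_cast h7
  omega

lemma integral_eExp_mul (m : ℤ) :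
    ∫ x in (0 : ℝ)..1, eExp (m * x) = if m = 0 then 1 else 0 := by
  split_ifs with hm
  · simp [hm, eExp]
  · have h := intervalIntegral.integral_eq_sub_of_hasDerivAt (a := 0) (b := 1)
      (fun x _ => hasDerivAt_eExp_mul m x)
      ((continuous_const.mul (continuous_eExp_mul m)).intervalIntegrable _ _)
    rw [intervalIntegral.integral_const_mul, mul_one, eExp_int, mul_zero] at h
    have h0 : eExp 0 = 1 := by simpa using eExp_int 0
    rw [h0, sub_self] at h
    refine (mul_eq_zero.1 h).resolve_left ?_
    have : (m : ℂ) ≠ 0 := by exact_mod_cast hm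
    simp [Real.pi_ne_zero, this]

lemma eExp_mul_add_int (m k : ℤ) (x : ℝ) : eExp (m * (x + k)) = eExp (m * x) := by
  have h : (m : ℝ) * (x + k) = m * x + ((m * k : ℤ) : ℝ) := by push_cast; ring
  rw [h, eExp_add, eExp_int, mul_one]

/-- The Fourier coefficients of a function whose integer translates sum to `1`. -/
lemma integral_eExp_mul_of_hasSum {χ : ℝ → ℂ} (hχ : Continuous χ) (hc : HasCompactSupport χ)
    (h : ∀ x : ℝ, HasSum (fun k : ℤ => χ (x + k)) 1) (m : ℤ) :
    ∫ x : ℝ, eExp (m * x) * χ x = if m = 0 then 1 else 0 := by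
  have hi : Integrable χ := hχ.integrable_of_hasCompactSupport hc
  have hfi : Integrable fun x : ℝ => eExp (m * x) * χ x :=
    ((continuous_eExp_mul m).mul hχ).integrable_of_hasCompactSupport hc.mul_left
  have h1 := hfi.hasSum_intervalIntegral_comp_add_int
  simp only [eExp_mul_add_int, intervalIntegral.integral_of_le zero_le_one] at h1
  have h2 : HasSum (fun k : ℤ => ∫ x in Set.Ioc (0 : ℝ) 1, eExp (m * x) * χ (x + k))
      (∫ x in Set.Ioc (0 : ℝ) 1, ∑' k : ℤ, eExp (m * x) * χ (x + k)) := by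
    refine hasSum_integral_of_summable_integral_norm (fun k => ?_) ?_
    · exact (((continuous_eExp_mul m).mul
        (hχ.comp (continuous_id.add continuous_const))).integrableOn_Icc (a := 0) (b := 1)).mono_set
        Set.Ioc_subset_Icc_self
    · have h3 := hi.norm.hasSum_intervalIntegral_comp_add_int.summable
      simp only [intervalIntegral.integral_of_le zero_le_one] at h3
      refine h3.congr fun k => ?_
      refine integral_congr_ae (Filter.Eventually.of_forall fun x => ?_)
      simp only [norm_mul, norm_eExp, one_mul]
  rw [h1.unique h2, ← integral_eExp_mul, intervalIntegral.integral_of_le zero_le_one]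
  refine integral_congr_ae (Filter.Eventually.of_forall fun x => ?_)
  simp only [tsum_mul_left, (h x).tsum_eq, mul_one]

/-- Elements of the principal series with compact support in the chart `x ↦ ñ_x` vanish near `s̃`. -/
lemma slice_s_eq_zero {φ : SmoothPS ε ν} {R : ℝ} (hR : 0 < R)
    (h : ∀ x, R ≤ |x| → slice φ 1 x = 0) {y : ℝ} (hy : |y| ≤ R⁻¹) : slice φ sElt⁻¹ y = 0 := by
  have key : ∀ y, |y| ≤ R⁻¹ → y ≠ 0 → slice φ sElt⁻¹ y = 0 := by
    intro y hy hy0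
    have hR' : R ≤ |y|⁻¹ := by
      rwa [le_inv_comm₀ hR (abs_pos.2 hy0)]
    rcases lt_or_gt_of_ne hy0 with h0 | h0
    · have h1 := apply_nElt_pos φ (x := (-y)⁻¹) (by simpa using h0)
      rw [inv_inv, neg_neg] at h1
      have h2 := h (-y)⁻¹ (by rwa [abs_inv, abs_neg])
      rw [slice, one_mul, h1] at h2
      exact (mul_eq_zero.1 h2).resolve_left (Complex.exp_ne_zero _)
    · have h1 := apply_nElt_neg φ (x := y⁻¹) (by simpa using h0)
      rw [inv_inv] at h1
      have h2 := h (-y⁻¹) (by rwa [abs_neg, abs_inv])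
      rw [slice, one_mul, h1] at h2
      refine (mul_eq_zero.1 h2).resolve_left (mul_ne_zero ?_ (Complex.exp_ne_zero _))
      rw [neg_mul, neg_ne_zero, ← norm_ne_zero_iff, norm_units_mul_I]
      exact one_ne_zero
  rcases eq_or_ne y 0 with rfl | hy0
  · have hcont : Filter.Tendsto (slice φ sElt⁻¹) (𝓝[≠] 0) (𝓝 (slice φ sElt⁻¹ 0)) :=
      ((slice_smooth φ sElt⁻¹).continuous.tendsto 0).mono_left nhdsWithin_le_nhds
    refine tendsto_nhds_unique hcont (tendsto_const_nhds.congr' ?_)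
    have hb : ∀ᶠ y : ℝ in 𝓝[≠] 0, |y| < R⁻¹ := by
      refine nhdsWithin_le_nhds ?_
      have : Filter.Tendsto (fun y : ℝ => |y|) (𝓝 0) (𝓝 0) := by
        simpa using continuous_abs.tendsto (0 : ℝ)
      exact this.eventually_lt_const (inv_pos.2 hR)
    filter_upwards [hb, self_mem_nhdsWithin] with y hy hy0
    exact (key y hy.le hy0).symm
  · exact key y hy hy0

lemma exists_bound_of_hasCompactSupport {χ : ℝ → ℂ} (hc : HasCompactSupport χ) :
    ∃ R : ℝ, 0 < R ∧ ∀ x, R ≤ |x| → χ x = 0 := by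
  obtain ⟨R, hR⟩ := hc.isCompact.isBounded.subset_closedBall 0
  refine ⟨|R| + 1, by positivity, fun x hx => ?_⟩
  by_contra h
  have h1 := hR (subset_tsupport _ h)
  rw [mem_closedBall_zero_iff, Real.norm_eq_abs] at h1
  linarith [le_abs_self R]

lemma apply_s_eq_zero {φ : SmoothPS ε ν} (hc : HasCompactSupport (slice φ 1)) : φ sElt = 0 := by
  obtain ⟨R, hR, h⟩ := exists_bound_of_hasCompactSupport hc
  rw [apply_s, slice_s_eq_zero hR h (by simpa using hR.le), mul_zero]

lemma fourierDist_eq_integral_of_hasCompactSupport {n : ℤ} (hn : n ≠ 0) {φ : SmoothPS (-ε) (-ν)}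
    (hc : HasCompactSupport (slice φ 1)) :
    fourierDist ε ν n φ = ∫ x : ℝ, eExp (n * x) * slice φ 1 x := by
  have hcj : ∀ j, HasCompactSupport (iteratedDeriv j (slice φ 1)) := fun j => by
    induction j with
    | zero => simpa using hc
    | succ j ih =>
      rw [iteratedDeriv_succ]
      exact ih.deriv
  rw [fourierDist_eq_integral hn φ (Nat.zero_le _) (k := 0) (fun j _ =>
    ((slice_smooth φ 1).continuous_iteratedDeriv j
      (by exact_mod_cast le_top)).integrable_of_hasCompactSupport (hcj j)) le_rfl]
  simp

/-- The residue at `1/2` is not zero. -/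
theorem residue_half_ne_zero {b : ℤ → ℂ} {S : DistPS ε (1 / 2)}
    (hS : ∀ φ : SmoothPS (-ε) (-(1 / 2)),
      HasSum (fun n => if n = 0 then 0 else b n * fourierDist ε (1 / 2) n φ) (S φ)) :
    S + ((1 + ((ε : ℤ) : ℂ) * Complex.I) / 16) • oneDist ε (1 / 2) ≠ 0 := by
  intro h0
  -- The integral of e(nx) against this function is the n-th Fourier coefficient of its
  -- periodization 1, so all nonzero frequencies vanish. Since φ also vanishes near infinity, 𝟙
  -- takes the value 1.
  obtain ⟨φ, hφ⟩ := exists_extension (-ε) (-(1 / 2)) contDiff_unitBump hasCompactSupport_unitBump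
  have hs : slice φ 1 = unitBump := funext fun x => by rw [slice, one_mul, hφ]
  have hc : HasCompactSupport (slice φ 1) := hs ▸ hasCompactSupport_unitBump
  have hint := integral_eExp_mul_of_hasSum contDiff_unitBump.continuous hasCompactSupport_unitBump
    hasSum_unitBump
  have h1 : S φ = 0 := by
    refine (hS φ).unique ?_
    convert! (hasSum_zero : HasSum (fun _ : ℤ => (0 : ℂ)) 0) using 2 with n
    split_ifs with hn
    · rfl
    · rw [fourierDist_eq_integral_of_hasCompactSupport hn hc, hs, hint, if_neg hn, mul_zero]
  have hz : ∀ y ∈ Set.Icc (-1 : ℝ) 1, slice φ sElt⁻¹ y = 0 := fun y hy =>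
    slice_s_eq_zero one_pos (fun x hx => by rw [hs, unitBump_eq_zero hx])
      (by rw [inv_one]; exact abs_le.2 hy)
  have hj : ∀ j, iteratedDeriv j (slice φ sElt⁻¹) 0 = 0 := fun j => by
    have : slice φ sElt⁻¹ =ᶠ[𝓝 0] fun _ => 0 := by
      filter_upwards [Icc_mem_nhds (show (-1 : ℝ) < 0 by norm_num) zero_lt_one] with y hy
      exact hz y hy
    rw [this.iteratedDeriv_eq]
    simp
  have h2 : oneDist ε (1 / 2) φ = 1 := by
    have hreg : regIntegral ε (1 / 2) (regOrder (1 / 2)) (slice φ sElt⁻¹) = 0 := by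
      rw [regIntegral]
      refine (intervalIntegral.integral_congr (g := fun _ => 0) fun y hy => ?_).trans (by simp)
      rw [Set.uIcc_of_le (by norm_num)] at hy
      simp only [taylorRem, hz y hy, hj, zero_div, zero_mul, Finset.sum_const_zero, sub_zero,
        mul_zero]
    have h3 : ∫ x : ℝ in (-1)..1, slice φ 1 x = 1 := by
      have h4 := hint 0
      simp only [Int.cast_zero, zero_mul, if_true] at h4
      rw [hs, intervalIntegral.integral_of_le (by norm_num), setIntegral_eq_integral_of_forall_compl_eq_zero, ← h4]
      · simp [eExp]
      · intro x hx
        refine unitBump_eq_zero ?_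
        by_contra h
        obtain ⟨h5, h6⟩ := abs_lt.1 (not_le.1 h)
        exact hx ⟨h5, h6.le⟩
    rw [oneDist_apply, hreg, h3]
    simp [hj]
  have h3 := congrArg (fun F : DistPS ε (1 / 2) => F φ) h0
  simp only [add_apply, smul_apply, zero_apply, h1, h2, zero_add, smul_eq_mul, mul_one] at h3
  -- The residue takes the value (1 ± i)/16, whose real part is not zero.
  rcases Int.units_eq_one_or ε with rfl | rfl
  · simpa using congrArg Complex.re h3
  · simpa using congrArg Complex.re h3

end

/-! ### Coefficients of the continued family and the final statement. -/

section

variable {ε : ℤˣ} {ν : ℂ}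

/-- The Fourier coefficients of the Eisenstein distribution. -/
noncomputable def eisCoeff (ε : ℤˣ) (b : ℤ → ℂ → ℂ) (n : ℤ) (ν : ℂ) : ℂ :=
  if n = 0 then zeroCoeff ε ν else (ν - 1 / 2)⁻¹ * b n ν

lemma hasSum_contFamily {b : ℤ → ℂ → ℂ} {S : ∀ ν : ℂ, DistPS ε ν}
    (hS : HasSum (fun n => if n = 0 then 0 else b n ν • fourierDist ε ν n) (S ν)) :
    HasSum (fun n : ℤ => if n = 0 then zeroFamily ε ν else eisCoeff ε b n ν • fourierDist ε ν n)
      (contFamily ε S ν - zeta2 (2 * ν + 1) • deltaInf ε ν) := by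
  have h0 : HasSum (fun n : ℤ => if n = 0 then zeroFamily ε ν else 0) (zeroFamily ε ν) :=
    hasSum_ite_eq 0 _
  rw [contFamily, add_sub_cancel_right]
  refine ((hS.const_smul (ν - 1 / 2)⁻¹).add h0).congr_fun fun n => ?_
  rcases eq_or_ne n 0 with rfl | hn
  · simp only [if_true, smul_zero, zero_add]
  · simp only [if_neg hn, add_zero, eisCoeff, mul_smul]

/-- Paired with χ(x) e(-nx), the distribution 𝕖_m gives the (m - n)-th Fourier coefficient of the
constant 1, so only m = n remains. The multiple of δ_∞ drops out because a function with compact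
support in the chart vanishes at s̃. -/
lemma isFourierCoeff_contFamily {b : ℤ → ℂ → ℂ} {S : ∀ ν : ℂ, DistPS ε ν} (hν : 1 < ν.re)
    (hS : ∀ φ : SmoothPS (-ε) (-ν),
      HasSum (fun n => if n = 0 then 0 else b n ν * fourierDist ε ν n φ) (S ν φ)) (n : ℤ) :
    IsFourierCoeff (contFamily ε S ν) n (eisCoeff ε b n ν) := by
  intro χ hχ hc hsum φ hφ
  have hm : ∀ m : ℕ, ν ≠ -m := fun m h => by
    rw [h, Complex.neg_re, Complex.natCast_re] at hν
    linarith [(m.cast_nonneg : (0 : ℝ) ≤ m)]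
  have hs : slice φ 1 = fun x => χ x * eExp (-n * x) := funext fun x => by
    rw [slice, one_mul, hφ]
  have hcs : HasCompactSupport (slice φ 1) := hs ▸ hc.mul_right
  have hF : ∀ m : ℤ, fourierDist ε ν m φ = if m = n then 1 else 0 := fun m => by
    rw [fourierDist_eq_integral_of_one_lt hν, hs]
    have h1 := integral_eExp_mul_of_hasSum hχ.continuous hc hsum (m - n)
    simp only [sub_eq_zero] at h1
    rw [← h1]
    congr 1
    funext x
    have h2 : ((m - n : ℤ) : ℝ) * x = m * x + -n * x := by push_cast; ring
    rw [h2, eExp_add]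
    ring
  have hS' : S ν φ = if n = 0 then 0 else b n ν := by
    refine (hS φ).unique ((hasSum_ite_eq n (if n = 0 then 0 else b n ν)).congr_fun fun m => ?_)
    rw [hF]
    rcases eq_or_ne m n with rfl | hmn
    · simp
    · simp [hmn]
  have e1 : contFamily ε S ν φ = (ν - 1 / 2)⁻¹ * S ν φ +
      zeroCoeff ε ν * fourierDist ε ν 0 φ + zeta2 (2 * ν + 1) * φ sElt := by
    rw [contFamily, zeroFamily_eq hm, ← deltaInf_apply]
    rfl
  rw [e1, apply_s_eq_zero hcs, hS', hF, eisCoeff]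
  rcases eq_or_ne n 0 with rfl | hn
  · simp
  · simp [hn, hn.symm]

lemma differentiableOn_eisCoeff {b : ℤ → ℂ → ℂ} (hb : ∀ n, n ≠ 0 → Differentiable ℂ (b n))
    (n : ℤ) : DifferentiableOn ℂ (eisCoeff ε b n) {1 / 2}ᶜ := by
  by_cases hn : n = 0
  · refine (differentiableOn_zeroCoeff (ε := ε)).congr fun ν _ => ?_
    rw [eisCoeff, if_pos hn]
  · have h : DifferentiableOn ℂ (fun ν : ℂ => (ν - 1 / 2)⁻¹ * b n ν) {1 / 2}ᶜ :=
      DifferentiableOn.mul (DifferentiableOn.inv (by fun_prop) fun ν hν => sub_ne_zero.2 hν)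
        (hb n hn).differentiableOn
    refine h.congr fun ν _ => ?_
    rw [eisCoeff, if_neg hn]

lemma meromorphicAt_eisCoeff {b : ℤ → ℂ → ℂ} (hb : ∀ n, n ≠ 0 → Differentiable ℂ (b n))
    (n : ℤ) : MeromorphicAt (eisCoeff ε b n) (1 / 2) := by
  have hsub : MeromorphicAt (fun ν : ℂ => (ν - 1 / 2)⁻¹) (1 / 2) :=
    ((MeromorphicAt.id _).sub (MeromorphicAt.const _ _)).inv
  by_cases hn : n = 0
  · obtain ⟨α, hα, h, -⟩ := exists_zeroCoeff_mul (ε := ε)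
    refine (hsub.mul (hα.analyticAt _).meromorphicAt).congr ?_
    filter_upwards [self_mem_nhdsWithin] with ν hν
    have hν0 : ν - 1 / 2 ≠ 0 := sub_ne_zero.2 hν
    rw [eisCoeff, if_pos hn, Pi.mul_apply, h ν hν, inv_mul_cancel_left₀ hν0]
  · refine (hsub.mul ((hb n hn).analyticAt _).meromorphicAt).congr
      (Filter.Eventually.of_forall fun ν => ?_)
    rw [eisCoeff, if_neg hn, Pi.mul_apply]

end

end Metaplectic

theorem mainTheorem4 (ε : ℤˣ) :
    ∃ (E : ∀ ν : ℂ, DistPS ε ν) (a : ℤ → ℂ → ℂ) (T : ∀ ν : ℂ, DistPS ε ν),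
      -- `E ν` is the Eisenstein distribution where the series defines it
      (∀ ν : ℂ, 1 < ν.re → Summable (eisTerm ε ν) ∧ E ν = eisensteinInf ε ν) ∧
      -- the continuation is holomorphic outside `{0, 1/2}`, with at most a simple pole at `0`
      -- and a simple pole at `1/2`
      HolomorphicFamily E {0, 1 / 2}ᶜ ∧
      (∃ R : DistPS ε 0, HasSimpleResidue E 0 R) ∧
      (∃ R : DistPS ε (1 / 2), R ≠ 0 ∧ HasSimpleResidue E (1 / 2) R) ∧
      -- `a n` is the meromorphic continuation of the `n`-th Fourier coefficient
      (∀ (ν : ℂ) (n : ℤ), 1 < ν.re → IsFourierCoeff (E ν) n (a n ν)) ∧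
      (∀ n : ℤ, DifferentiableOn ℂ (a n) {1 / 2}ᶜ ∧ MeromorphicAt (a n) (1 / 2)) ∧
      -- `T` is the term with `n = 0`, that is `a 0 ν • fourierDist ε ν 0`, extended to the
      -- negative integers by removing singularities
      HolomorphicFamily T {0, 1 / 2}ᶜ ∧
      (∀ ν : ℂ, ν ≠ 1 / 2 → (∀ m : ℕ, ν ≠ -m) → T ν = a 0 ν • fourierDist ε ν 0) ∧
      -- the Fourier expansion of the continuation
      (∀ ν : ℂ, ν ≠ 0 → ν ≠ 1 / 2 →
        HasSum (fun n : ℤ => if n = 0 then T ν else a n ν • fourierDist ε ν n)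
          (E ν - zeta2 (2 * ν + 1) • deltaInf ε ν)) := by
  obtain ⟨b, S, hb, hS, hSφ, hSΦ, hE⟩ := exists_contFamily ε
  refine ⟨contFamily ε S, eisCoeff ε b, zeroFamily ε,
    fun ν hν => ⟨(summable_eisTerm ε hν).1, hE ν hν⟩, holomorphicFamily_contFamily hSΦ,
    hasSimpleResidue_zero hSΦ,
    ⟨_, residue_half_ne_zero (hSφ (1 / 2)), hasSimpleResidue_half hSΦ⟩,
    fun ν n hν => isFourierCoeff_contFamily hν (hSφ ν) n,
    fun n => ⟨differentiableOn_eisCoeff hb n, meromorphicAt_eisCoeff hb n⟩,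
    holomorphicFamily_zeroFamily, fun ν _ hm => ?_, fun ν _ _ => hasSum_contFamily (hS ν)⟩
  rw [zeroFamily_eq hm, eisCoeff, if_pos rfl]
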